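/- Let $0<a_j<b_j$, $\mathbf c_j\in\mathbb R^3$ $(1\le j\le N)$ be such that the closed balls $B_{b_j}(\mathbf c_j)$ (the cloaks) are pairwise disjoint, and let $g_j\in C^2([0,b_j])$ satisfy $g_j(0)=a_j$, $g_j(b_j)=b_j$ and $g_j'>0$ on $[0,b_j]$. Put $\Omega_0=\mathbb R^3\setminus\{\mathbf c_1,\dots,\mathbf c_N\}$ and $\Omega=\mathbb R^3\setminus\bigcup_j B_{a_j}(\mathbf c_j)$, and let $\mathbf x(\mathbf y)=\mathbf c_j+g_j(|\mathbf y-\mathbf c_j|)\frac{\mathbf y-\mathbf c_j}{|\mathbf y-\mathbf c_j|}$ for $\mathbf y\in B_{b_j}(\mathbf c_j)\setminus\{\mathbf c_j\}$ and $\mathbf x(\mathbf y)=\mathbf y$ for $\mathbf y$ outside all these balls; this is a bijection from $\Omega_0$ onto $\Omega$. Let $\varepsilon_0,\mu_0$ be constant positive definite Hermitian $3\times3$ matrices (the permittivity and the permeability of the background), and let the cloaked medium in $\Omega$ be given, almost everywhere, by $$\varepsilon(\mathbf x)=\frac{\mathcal A\,\varepsilon_0\,\mathcal A^{T}}{\det\mathcal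 A},\qquad \mu(\mathbf x)=\frac{\mathcal A\,\mu_0\,\mathcal A^{T}}{\det\mathcal A},\qquad \mathcal A=\frac{\partial\mathbf x}{\partial\mathbf y}(\mathbf y(\mathbf x)).$$ Let $\mathcal H_\Omega$ be the Hilbert space of the measurable fields $(\mathbf E,\mathbf H):\Omega\to\mathbb C^3\times\mathbb C^3$ of finite energy, with the scalar product $$\big((\mathbf E,\mathbf H),(\mathbf E',\mathbf H')\big)=\int_\Omega(\varepsilon\mathbf E\cdot\overline{\mathbf E'}+\mu\mathbf H\cdot\overline{\mathbf H'})\,d\mathbf x,$$ and let $a_\Omega(\mathbf E,\mathbf H)=i(\varepsilon^{-1}\nabla\times\mathbf H,\,-\mu^{-1}\nabla\times\mathbf E)$ with domain $C^1_0(\Omega;\mathbb C^6)$. Then $a_\Omega$ has exactly one self-adjoint extension $A_\Omega$ in $\mathcal H_\Omega$. For real $\omega\ne0$, a solution with locally finite energy at frequency $\omega$ is a field $(\mathbf E,\mathbf H)$ that satisfies $$\nabla\times\mathbf E=i\omega\mu\mathbf H,\quad\nabla\times\mathbf H=-i\omega\varepsilon\mathbf E,\quad\nabla\cdot(\mu\mathbf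 H)=0,\quad\nabla\cdot(\varepsilon\mathbf E)=0$$ in $\Omega$ in the sense of distributions, has finite energy in every bounded subset of $\Omega$, and is such that $\phi\,(\mathbf E,\mathbf H)\in D(A_\Omega)$ for every continuously differentiable function $\phi$ on $\overline\Omega$ (the restriction of a $C^1$ function on $\mathbb R^3$) with bounded support. Let $(\mathbf E^{\rm in},\mathbf H^{\rm in})(\mathbf x)=(\mathbf e,\mathbf h)\,e^{i\mathbf k\cdot\mathbf x}$ be any incident plane wave of frequency $\omega\neq0$ in the background (the time factor $e^{-i\omega t}$ is suppressed), that is, $\mathbf k\in\mathbb R^3\setminus\{0\}$, $\mathbf e,\mathbf h\in\mathbb C^3$, $\mathbf k\times\mathbf e=\omega\mu_0\mathbf h$ and $\mathbf k\times\mathbf h=-\omega\varepsilon_0\mathbf e$. Then there is a solution $(\mathbf E,\mathbf H)$ with locally finite energy at frequency $\omega$ that coincides with $(\mathbf E^{\rm in},\mathbf H^{\rm in})$ outside all the cloaks, i.e. on $\mathbb R^3\setminus\bigcup_jB_{b_j}(\mathbf c_j)$. Moreover, up to equality almost everywhere in $\Omega$, it is the only solution with locally finite energy at frequency $\omega$ for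 which the scattered wave $(\mathbf E^{\rm sc},\mathbf H^{\rm sc})=(\mathbf E,\mathbf H)-(\mathbf E^{\rm in},\mathbf H^{\rm in})$ is outgoing. Hence the scattered wave is identically zero outside all the cloaks. Here a field is called outgoing if, for some square integrable $f:\mathbb R^3\to\mathbb C^6$ with compact support, it agrees almost everywhere outside some ball with a field $\lim_{\eta\downarrow0}(A_0-(\omega+i\eta))^{-1}f$, where $A_0(\mathbf E,\mathbf H)=i(\varepsilon_0^{-1}\nabla\times\mathbf H,-\mu_0^{-1}\nabla\times\mathbf E)$ in $L^2(\mathbb R^3;\mathbb C^6)$ (derivatives in the sense of distributions) and the limit exists in $L^2(B)$ for every bounded $B\subset\mathbb R^3$. If the background is isotropic, $\varepsilon_0=\varepsilon^0I$ and $\mu_0=\mu^0I$ with $\varepsilon^0,\mu^0>0$, the same uniqueness holds with "outgoing" replaced by the Silver–Müller radiation condition $$|\mathbf x|\Big(\sqrt{\mu^0}\,\mathbf H^{\rm sc}\times\frac{\mathbf x}{|\mathbf x|}-\sqrt{\varepsilon^0}\,\mathbf E^{\rm sc}\Big)\to0\quad\text{as }|\mathbf x|\to\infty,$$ uniformly in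 $\mathbf x/|\mathbf x|$. -/

import Mathlib

open MeasureTheory Filter Topology Matrix
open scoped ComplexOrder

noncomputable section

namespace Cloak

/-- Three-dimensional Euclidean space. -/
abbrev R3 := EuclideanSpace ℝ (Fin 3)

/-- Complex 3-vectors. -/
abbrev C3 := Fin 3 → ℂ

/-- An electromagnetic field `(E, H)`: the first component is the electric field, the second the
magnetic field (both as vectors of covariant components). -/
abbrev EMField := R3 → C3 × C3

/-! ### Vector calculus -/

/-- The partial derivative in the direction of the `j`-th Cartesian coordinate. -/
def pd (j : Fin 3) (φ : R3 → ℂ) (x : R3) : ℂ := fderiv ℝ φ x (EuclideanSpace.single j 1)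

/-- The gradient of a differentiable function. -/
def grad (φ : R3 → ℂ) (x : R3) : C3 := fun j => pd j φ x

/-- The curl of a differentiable vector field. -/
def curl (F : R3 → C3) (x : R3) : C3 :=
  ![pd 1 (fun z => F z 2) x - pd 2 (fun z => F z 1) x,
    pd 2 (fun z => F z 0) x - pd 0 (fun z => F z 2) x,
    pd 0 (fun z => F z 1) x - pd 1 (fun z => F z 0) x]

/-- `curl F = G` in the sense of distributions in the open set `O`. -/
def HasWeakCurl (O : Set R3) (F G : R3 → C3) : Prop :=
  LocallyIntegrableOn F O ∧ LocallyIntegrableOn G O ∧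
    ∀ φ : R3 → C3, ContDiff ℝ (⊤ : ℕ∞) φ → HasCompactSupport φ → tsupport φ ⊆ O →
      ∫ x in O, F x ⬝ᵥ curl φ x = ∫ x in O, G x ⬝ᵥ φ x

/-- `div F = 0` in the sense of distributions in the open set `O`. -/
def IsWeakDivFree (O : Set R3) (F : R3 → C3) : Prop :=
  LocallyIntegrableOn F O ∧
    ∀ ψ : R3 → ℂ, ContDiff ℝ (⊤ : ℕ∞) ψ → HasCompactSupport ψ → tsupport ψ ⊆ O →
      ∫ x in O, F x ⬝ᵥ grad ψ x = 0

/-! ### The cloaks and the transformation -/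

/-- `g` is a cloaking function on `[0, b]` with `g 0 = a`: it is twice continuously differentiable
on `[0, b]` with positive derivative, `g 0 = a` and `g b = b`. -/
structure IsCloakingFunction (a b : ℝ) (g : ℝ → ℝ) : Prop where
  contDiffOn : ContDiffOn ℝ 2 g (Set.Icc 0 b)
  map_zero : g 0 = a
  map_right : g b = b
  deriv_pos : ∀ ρ ∈ Set.Icc 0 b, 0 < derivWithin g (Set.Icc 0 b) ρ

/-- A finite family of spherical cloaks `closedBall (c j) (b j)`, with concealed regions
`closedBall (c j) (a j)` and cloaking functions `g j`. The cloaks are pairwise disjoint; as they are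
compact, this says that they are at a positive distance of each other. -/
structure CloakSystem (N : ℕ) where
  c : Fin N → R3
  a : Fin N → ℝ
  b : Fin N → ℝ
  g : Fin N → ℝ → ℝ
  a_pos : ∀ j, 0 < a j
  a_lt_b : ∀ j, a j < b j
  cloaking : ∀ j, IsCloakingFunction (a j) (b j) (g j)
  disjoint : ∀ j l, j ≠ l →
    Disjoint (Metric.closedBall (c j) (b j)) (Metric.closedBall (c l) (b l))

namespace CloakSystem

variable {N : ℕ} (S : CloakSystem N)

/-- The concealed region `K`, the union of the cloaked objects. -/
def K : Set R3 := ⋃ j, Metric.closedBall (S.c j) (S.a j)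

/-- The domain `Ω = ℝ³ \ K` in which the waves propagate. -/
def Omega : Set R3 := S.Kᶜ

/-- `Ω₀`, the space with the centres of the cloaks removed. -/
def Omega0 : Set R3 := (Set.range S.c)ᶜ

/-- The exterior of all the cloaks. -/
def exterior : Set R3 := (⋃ j, Metric.closedBall (S.c j) (S.b j))ᶜ

open Classical in
/-- The transformation `y ↦ x(y)`: it is `c j + g j (|y - c j|) (y - c j) / |y - c j|` on the
`j`-th ball (only one `j` is possible, the balls being disjoint) and the identity elsewhere. It is
a bijection from `Ω₀` onto `Ω`. -/
def map (y : R3) : R3 :=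
  if h : ∃ j, y ∈ Metric.closedBall (S.c j) (S.b j) then
    S.c h.choose +
      (S.g h.choose ‖y - S.c h.choose‖ / ‖y - S.c h.choose‖) • (y - S.c h.choose)
  else y

/-- The inverse transformation `x ↦ y(x)` from `Ω` onto `Ω₀`. -/
def invMap (x : R3) : R3 := Function.invFunOn S.map S.Omega0 x

/-- The Jacobian matrix `∂x^l / ∂y^m` of the transformation, as a complex matrix. (On the spheres
`|y - c j| = b j`, a null set, the transformation need not be differentiable.) -/
def jac (y : R3) : Matrix (Fin 3) (Fin 3) ℂ :=
  Matrix.of fun l m => ((fderiv ℝ S.map y (EuclideanSpace.single m 1) l : ℝ) : ℂ)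

/-- The contravariant permittivity or permeability `Δ⁻¹ A t₀ Aᵀ` (at `y = y(x)`) of the cloaked
medium, obtained from the constant one `t₀` of the background as a tensor density of weight one. -/
def medium (t₀ : Matrix (Fin 3) (Fin 3) ℂ) (x : R3) : Matrix (Fin 3) (Fin 3) ℂ :=
  (S.jac (S.invMap x)).det⁻¹ • (S.jac (S.invMap x) * t₀ * (S.jac (S.invMap x))ᵀ)

/-! ### Finite energy fields and the Maxwell operator in `Ω`

Throughout, `ε₀` and `μ₀` are the (contravariant) permittivity and permeability of the background.
Elements of the Hilbert space of finite energy fields are represented by functions; two functions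
represent the same element iff they agree almost everywhere in `Ω`. -/

variable (ε₀ μ₀ : Matrix (Fin 3) (Fin 3) ℂ)

/-- The density `ε^{lm} E_m conj(E'_l) + μ^{lm} H_m conj(H'_l)` of the energy scalar product of
`u = (E, H)` and `v = (E', H')`. -/
def energyDensity (u v : EMField) (x : R3) : ℂ :=
  (S.medium ε₀ x *ᵥ (u x).1) ⬝ᵥ star (v x).1 + (S.medium μ₀ x *ᵥ (u x).2) ⬝ᵥ star (v x).2

/-- The energy of the field `u` in the set `O` is finite. -/
def FiniteEnergyOn (O : Set R3) (u : EMField) : Prop :=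
  AEStronglyMeasurable u (volume.restrict O) ∧ IntegrableOn (S.energyDensity ε₀ μ₀ u u) O

/-- The energy scalar product of finite energy fields in `Ω`. -/
def energyInner (u v : EMField) : ℂ := ∫ x in S.Omega, S.energyDensity ε₀ μ₀ u v x

/-- The Maxwell operator `(E, H) ↦ i (ε⁻¹ curl H, -μ⁻¹ curl E)` of the cloaked medium on
differentiable fields. -/
def maxwell (u : EMField) : EMField := fun x =>
  (Complex.I • ((S.medium ε₀ x)⁻¹ *ᵥ curl (fun z => (u z).2) x),
    -(Complex.I • ((S.medium μ₀ x)⁻¹ *ᵥ curl (fun z => (u z).1) x)))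

/-- The graph of the Maxwell operator with domain the continuously differentiable fields with
compact support in `Ω`. -/
def maxwellGraph : Set (EMField × EMField) :=
  {p | ContDiff ℝ 1 p.1 ∧ HasCompactSupport p.1 ∧ tsupport p.1 ⊆ S.Omega ∧
    p.2 = S.maxwell ε₀ μ₀ p.1}

/-- The (graph of the) adjoint, in the Hilbert space of finite energy fields in `Ω`, of the operator
with graph `A`. -/
def adjointGraph (A : Set (EMField × EMField)) : Set (EMField × EMField) :=
  {p | S.FiniteEnergyOn ε₀ μ₀ S.Omega p.1 ∧ S.FiniteEnergyOn ε₀ μ₀ S.Omega p.2 ∧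
    ∀ q ∈ A, S.energyInner ε₀ μ₀ q.2 p.1 = S.energyInner ε₀ μ₀ q.1 p.2}

/-- `A` is (the graph of) a self-adjoint extension of the Maxwell operator of the cloaked medium with
domain `C¹₀(Ω)`. As this operator is densely defined, `A = A*` is the graph of an operator. -/
def IsSelfAdjointExtension (A : Set (EMField × EMField)) : Prop :=
  S.maxwellGraph ε₀ μ₀ ⊆ A ∧ A = S.adjointGraph ε₀ μ₀ A

/-- `u = (E, H)` solves the time-harmonic Maxwell equations `curl E = i ω μ H`, `curl H = -i ω ε E`,
`div (μ H) = 0`, `div (ε E) = 0` of the cloaked medium in `Ω` in the sense of distributions. -/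
def SolvesMaxwell (ω : ℝ) (u : EMField) : Prop :=
  HasWeakCurl S.Omega (fun x => (u x).1)
      (fun x => (Complex.I * ω) • (S.medium μ₀ x *ᵥ (u x).2)) ∧
    HasWeakCurl S.Omega (fun x => (u x).2)
      (fun x => (-(Complex.I * ω)) • (S.medium ε₀ x *ᵥ (u x).1)) ∧
    IsWeakDivFree S.Omega (fun x => S.medium μ₀ x *ᵥ (u x).2) ∧
    IsWeakDivFree S.Omega (fun x => S.medium ε₀ x *ᵥ (u x).1)

/-- `u` is a solution with locally finite energy in `Ω` at the frequency `ω`; here `A` is the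
self-adjoint extension of the Maxwell operator. The multipliers `φ` are the continuously
differentiable functions on the closure of `Ω` with bounded support, given as restrictions of
functions on the whole space; they need not vanish on the boundary of `Ω`. -/
structure IsLocallyFiniteEnergySolution (A : Set (EMField × EMField)) (ω : ℝ) (u : EMField) :
    Prop where
  solves : S.SolvesMaxwell ε₀ μ₀ ω u
  finite_energy : ∀ O : Set R3, O ⊆ S.Omega → Bornology.IsBounded O →
    S.FiniteEnergyOn ε₀ μ₀ O u
  mem_domain : ∀ φ : R3 → ℂ, ContDiff ℝ 1 φ → HasCompactSupport φ →
    ∃ w : EMField, ((fun x => φ x • u x), w) ∈ A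

end CloakSystem

/-! ### Plane waves and radiation conditions in the background -/

/-- `(e, h) exp (i (k · x - ω t))` is a plane wave of frequency `ω` in the background:
`k × e = ω μ₀ h` and `k × h = -ω ε₀ e`. -/
structure IsPlaneWave (ε₀ μ₀ : Matrix (Fin 3) (Fin 3) ℂ) (ω : ℝ) (k : R3) (e h : C3) : Prop where
  frequency_ne_zero : ω ≠ 0
  wavevector_ne_zero : k ≠ 0
  faraday : crossProduct (fun j => (k j : ℂ)) e = (ω : ℂ) • (μ₀ *ᵥ h)
  ampere : crossProduct (fun j => (k j : ℂ)) h = -((ω : ℂ) • (ε₀ *ᵥ e))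

/-- The plane wave with wave vector `k` and amplitudes `e`, `h`, without the factor
`exp (-i ω t)`. -/
def planeWave (k : R3) (e h : C3) : EMField := fun x =>
  (Complex.exp (Complex.I * (inner ℝ k x : ℝ)) • e,
    Complex.exp (Complex.I * (inner ℝ k x : ℝ)) • h)

/-- The square integrable field `v = (E, H)` solves `(A₀ - z) v = f` in the whole space, `A₀` being
the Maxwell operator `(E, H) ↦ i (ε₀⁻¹ curl H, -μ₀⁻¹ curl E)` of the background with derivatives in
the sense of distributions. -/
def SolvesResolvent (ε₀ μ₀ : Matrix (Fin 3) (Fin 3) ℂ) (z : ℂ) (f v : EMField) : Prop :=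
  MemLp v 2 volume ∧
    HasWeakCurl Set.univ (fun x => (v x).2)
      (fun x => (-Complex.I) • (ε₀ *ᵥ (z • (v x).1 + (f x).1))) ∧
    HasWeakCurl Set.univ (fun x => (v x).1)
      (fun x => Complex.I • (μ₀ *ᵥ (z • (v x).2 + (f x).2)))

/-- The outgoing radiation condition for a (possibly anisotropic) background, for the time factor
`exp (-i ω t)`: outside some ball, `u` agrees with the outgoing field
`(A₀ - (ω + i 0))⁻¹ f = lim_{η ↓ 0} (A₀ - (ω + i η))⁻¹ f` radiated by some square integrable source
`f` with compact support, the limit being taken in the mean square on every bounded set. -/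
def IsOutgoing (ε₀ μ₀ : Matrix (Fin 3) (Fin 3) ℂ) (ω : ℝ) (u : EMField) : Prop :=
  ∃ (f u₀ : EMField) (v : ℝ → EMField),
    MemLp f 2 volume ∧ HasCompactSupport f ∧ AEStronglyMeasurable u₀ volume ∧
    (∀ η : ℝ, 0 < η → SolvesResolvent ε₀ μ₀ (ω + Complex.I * η) f (v η)) ∧
    (∀ B : Set R3, Bornology.IsBounded B →
      Tendsto (fun η => eLpNorm (v η - u₀) 2 (volume.restrict B)) (𝓝[>] 0) (𝓝 0)) ∧
    ∃ R : ℝ, ∀ᵐ x : R3, R < ‖x‖ → u x = u₀ x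

/-- The outgoing Silver–Müller radiation condition in an isotropic background with permittivity `ε`
and permeability `μ`, for the time factor `exp (-i ω t)`:
`|x| (√μ H × x/|x| - √ε E) → 0` as `|x| → ∞`, uniformly in the direction `x/|x|`
(and disregarding null sets of `x`). -/
def SilverMuller (ε μ : ℝ) (u : EMField) : Prop :=
  Tendsto
    (fun x : R3 =>
      (Real.sqrt μ : ℂ) • crossProduct (u x).2 (fun j => (x j : ℂ)) -
        ((Real.sqrt ε * ‖x‖ : ℝ) : ℂ) • (u x).1)
    (cocompact R3 ⊓ ae volume) (𝓝 0)

end Cloak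

end

/-!
The transformation `y ↦ x(y)` turns the cloaked medium into the homogeneous background: if `J` is
its Jacobian matrix, then `(E, H) ↦ (Jᵀ E, Jᵀ H)` preserves the energy, and since curls transform
like densities of weight one it maps the fields in `Ω` with `curl E = i μ H'`, `curl H = -i ε E'`
(in the sense of distributions) to fields in `Ω₀` with the same equations for `ε₀`, `μ₀`
(`IsChange.hasWeakCurl`, `CloakSystem.IsFlattening.weakMaxwell_pull`). The transformation is only
Lipschitz across the outer spheres of the cloaks and its derivative blows up at the centres. The
first obstacle is met by testing with Lipschitz fields of the form `α ∇β`, which are reached by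
mollification (`HasWeakCurl.integral_cross_grad`). As to the second one, single points have no
capacity in three dimensions, so for locally square integrable fields the equations extend from
`Ω₀` to all of space (`HasWeakCurl.of_compl_finite`).

*The self-adjoint extension.* The adjoint of the Maxwell operator on `C¹₀(Ω)` is the weak Maxwell
operator (`mem_adjointGraph_iff`). Pulled back to the whole space it is the Maxwell operator of the
background, which is symmetric for the energy scalar product (`WeakMaxwell.integral_energyForm`).
An operator whose adjoint is symmetric is essentially self-adjoint.

*Existence.* The incident plane wave in `y`-space, transported to `Ω`, is a solution that agrees
with the incident wave outside the cloaks. If `φ` is a cut-off function, then `∇φ` is transported to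
a field of the size `1 / |y - c|` near a centre `c`; this is square integrable in three dimensions,
which puts `φ (E, H)` into the domain of the self-adjoint operator (`exists_smul_mem`).

*Uniqueness.* Let `d` be the transported difference of a solution and of the plane wave. It is locally
square integrable and solves the equations of the background in the whole space, and outside some
ball it is the scattered wave.

* If the scattered wave is outgoing, it agrees outside a ball with the limit `u₀` of resolvent fields
  `v_η = (A₀ - (ω + iη))⁻¹ f`, so that `p = d - u₀` has compact support. Then `v_η + p` is
  `-iη (A₀ - (ω + iη))⁻¹ p`, and as `A₀` is symmetric, its energy is at most that of `p`. It tends to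
  `d` as `η → 0`, whence `d` is square integrable (`memLp_two_of_isOutgoing`).
* A square integrable solution `d` vanishes. Indeed the Maxwell stress tensor, contracted with the
  position vector, gives a vector field whose divergence is minus one half of the energy density and
  whose length is at most of the order of `|x|` times the energy density; integrate it against the tent function
  `(1 - |x| / R)₊` and let `R → ∞` (`ae_eq_zero_of_memLp`). No unique continuation theorem is needed,
  and the background may be anisotropic.
* In an isotropic background the same vector field shows that the energy in the ball of radius `R`,
  divided by `R`, is nondecreasing in `R`. The Silver–Müller condition, together with the vanishing
  of the energy flux through large spheres, makes this quotient tend to zero, so again `d = 0`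
  (`ae_eq_zero_of_silverMuller`).
-/

noncomputable section

namespace Cloak

/-! ### Pointwise algebra and integrability of pairings -/

lemma norm_dotProduct_le (a b : C3) : ‖a ⬝ᵥ b‖ ≤ 3 * ‖a‖ * ‖b‖ := by
  have h : ∀ i, ‖a i * b i‖ ≤ ‖a‖ * ‖b‖ := fun i => by
    rw [norm_mul]
    exact mul_le_mul (norm_le_pi_norm a i) (norm_le_pi_norm b i) (norm_nonneg _) (norm_nonneg _)
  refine (norm_sum_le _ _).trans ?_
  refine (Finset.sum_le_sum fun i _ => h i).trans ?_
  simp [mul_assoc]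

lemma norm_crossProduct_le (a b : C3) : ‖crossProduct a b‖ ≤ 2 * ‖a‖ * ‖b‖ := by
  have h : ∀ i j, ‖a i * b j‖ ≤ ‖a‖ * ‖b‖ := fun i j => by
    rw [norm_mul]
    exact mul_le_mul (norm_le_pi_norm a i) (norm_le_pi_norm b j) (norm_nonneg _) (norm_nonneg _)
  have h2 : ∀ i j k l, ‖a i * b j - a k * b l‖ ≤ 2 * ‖a‖ * ‖b‖ := fun i j k l => by
    refine (norm_sub_le _ _).trans ?_
    linarith [h i j, h k l]
  refine (pi_norm_le_iff_of_nonneg (by positivity)).2 fun i => ?_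
  rw [cross_apply]
  fin_cases i <;> exact h2 _ _ _ _

/-- Measurability of a field with values in `ℂ³` from its components. -/
lemma aestronglyMeasurable_c3 {ν : Measure R3} {f : R3 → C3}
    (h : ∀ i, AEStronglyMeasurable (fun x => f x i) ν) : AEStronglyMeasurable f ν :=
  (aemeasurable_pi_lambda f fun i => (h i).aemeasurable).aestronglyMeasurable

lemma aestronglyMeasurable_comp {ν : Measure R3} {f : R3 → C3}
    (h : AEStronglyMeasurable f ν) (i : Fin 3) : AEStronglyMeasurable (fun x => f x i) ν :=
  (continuous_apply i).comp_aestronglyMeasurable h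

lemma aestronglyMeasurable_dot {ν : Measure R3} {f g : R3 → C3}
    (hf : AEStronglyMeasurable f ν) (hg : AEStronglyMeasurable g ν) :
    AEStronglyMeasurable (fun x => f x ⬝ᵥ g x) ν := by
  have : Continuous fun p : C3 × C3 => p.1 ⬝ᵥ p.2 := by fun_prop
  exact this.comp_aestronglyMeasurable (hf.prodMk hg)

lemma aestronglyMeasurable_cross {ν : Measure R3} {f g : R3 → C3}
    (hf : AEStronglyMeasurable f ν) (hg : AEStronglyMeasurable g ν) :
    AEStronglyMeasurable (fun x => crossProduct (f x) (g x)) ν := by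
  have h : ∀ i j, AEStronglyMeasurable (fun x => f x i * g x j) ν := fun i j =>
    (aestronglyMeasurable_comp hf i).mul (aestronglyMeasurable_comp hg j)
  refine aestronglyMeasurable_c3 fun i => ?_
  simp only [cross_apply]
  fin_cases i
  · exact (h 1 2).sub (h 2 1)
  · exact (h 2 0).sub (h 0 2)
  · exact (h 0 1).sub (h 1 0)

lemma tendsto_cross {f g : ℕ → C3} {a b : C3} (hf : Tendsto f atTop (𝓝 a))
    (hg : Tendsto g atTop (𝓝 b)) :
    Tendsto (fun n => crossProduct (f n) (g n)) atTop (𝓝 (crossProduct a b)) := by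
  have h : ∀ i j, Tendsto (fun n => f n i * g n j) atTop (𝓝 (a i * b j)) := fun i j =>
    (tendsto_pi_nhds.1 hf i).mul (tendsto_pi_nhds.1 hg j)
  refine tendsto_pi_nhds.2 fun i => ?_
  simp only [cross_apply]
  fin_cases i
  · exact (h 1 2).sub (h 2 1)
  · exact (h 2 0).sub (h 0 2)
  · exact (h 0 1).sub (h 1 0)

lemma measurable_pd (j : Fin 3) (φ : R3 → ℂ) : Measurable (pd j φ) :=
  (measurable_fderiv_apply_const ℝ φ _)

lemma aestronglyMeasurable_grad (φ : R3 → ℂ) (ν : Measure R3) :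
    AEStronglyMeasurable (grad φ) ν :=
  aestronglyMeasurable_c3 fun j => (measurable_pd j φ).aestronglyMeasurable

lemma aestronglyMeasurable_curl (F : R3 → C3) (ν : Measure R3) :
    AEStronglyMeasurable (curl F) ν := by
  refine aestronglyMeasurable_c3 fun j => ?_
  fin_cases j <;> simp only [curl] <;>
    exact ((measurable_pd _ _).sub (measurable_pd _ _)).aestronglyMeasurable

/-- A locally integrable field on `O` paired with a bounded field that vanishes off a compact
subset of `O` is integrable. -/
lemma integrable_dot {O K : Set R3} {F g : R3 → C3} (hF : LocallyIntegrableOn F O)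
    (hK : IsCompact K) (hKO : K ⊆ O) (hg : AEStronglyMeasurable g volume) {C : ℝ}
    (hC : ∀ x, ‖g x‖ ≤ C) (h0 : ∀ x ∉ K, g x = 0) : Integrable (fun x => F x ⬝ᵥ g x) := by
  have hs : Function.support (fun x => F x ⬝ᵥ g x) ⊆ K := fun x hx => by
    by_contra h
    exact hx (by simp [h0 x h])
  rw [← integrableOn_iff_integrable_of_support_subset hs]
  have hFi : IntegrableOn F K := hF.integrableOn_compact_subset hKO hK
  refine Integrable.mono' (hFi.norm.const_mul (3 * C)) (aestronglyMeasurable_dot hFi.1 hg.restrict) ?_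
  refine Eventually.of_forall fun x => (norm_dotProduct_le _ _).trans ?_
  have := mul_le_mul_of_nonneg_left (hC x) (norm_nonneg (F x))
  linarith

/-- Dominated convergence for the pairing of a locally integrable field with uniformly bounded
fields that are supported in a fixed compact set. -/
lemma tendsto_integral_dot {O K : Set R3} {F : R3 → C3} {g : ℕ → R3 → C3} {g' : R3 → C3}
    (hF : LocallyIntegrableOn F O)
    (hK : IsCompact K) (hKO : K ⊆ O) (hg : ∀ n, AEStronglyMeasurable (g n) volume) {C : ℝ}
    (hC : ∀ n x, ‖g n x‖ ≤ C) (h0 : ∀ n, ∀ x ∉ K, g n x = 0) (h0' : ∀ x ∉ K, g' x = 0)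
    (hlim : ∀ᵐ x, Tendsto (fun n => g n x) atTop (𝓝 (g' x))) :
    Tendsto (fun n => ∫ x in O, F x ⬝ᵥ g n x) atTop (𝓝 (∫ x in O, F x ⬝ᵥ g' x)) := by
  have hFi : IntegrableOn F K := hF.integrableOn_compact_subset hKO hK
  have e : ∀ f : R3 → C3, (∀ x ∉ K, f x = 0) →
      ∫ x in O, F x ⬝ᵥ f x = ∫ x, F x ⬝ᵥ f x := fun f hf =>
    setIntegral_eq_integral_of_forall_compl_eq_zero fun x hx => by
      simp [hf x fun h => hx (hKO h)]
  simp only [fun n => e (g n) (h0 n), e g' h0']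
  refine tendsto_integral_of_dominated_convergence
    (K.indicator fun x => 3 * C * ‖F x‖) (fun n => ?_) ?_ (fun n => ?_) ?_
  · exact (integrable_dot hF hK hKO (hg n) (hC n) (h0 n)).1
  · exact (integrable_indicator_iff hK.measurableSet).2 (hFi.norm.const_mul _)
  · refine Eventually.of_forall fun x => ?_
    by_cases hx : x ∈ K
    · rw [Set.indicator_of_mem hx]
      refine (norm_dotProduct_le _ _).trans ?_
      have := mul_le_mul_of_nonneg_left (hC n x) (norm_nonneg (F x))
      linarith
    · simp [hx, h0 n x hx]
  · filter_upwards [hlim] with x hx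
    have : Continuous fun p : C3 => F x ⬝ᵥ p := by fun_prop
    exact (this.tendsto _).comp hx

/-! ### Partial derivatives -/

lemma pd_mul {j : Fin 3} {f g : R3 → ℂ} {x : R3} (hf : DifferentiableAt ℝ f x)
    (hg : DifferentiableAt ℝ g x) :
    pd j (fun z => f z * g z) x = f x * pd j g x + g x * pd j f x := by
  simp only [pd]
  rw [fderiv_fun_mul hf hg]
  simp

lemma pd_add {j : Fin 3} {f g : R3 → ℂ} {x : R3} (hf : DifferentiableAt ℝ f x)
    (hg : DifferentiableAt ℝ g x) :
    pd j (fun z => f z + g z) x = pd j f x + pd j g x := by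
  simp only [pd]
  rw [fderiv_fun_add hf hg]
  simp

lemma pd_const_mul {j : Fin 3} (c : ℂ) {f : R3 → ℂ} {x : R3} (hf : DifferentiableAt ℝ f x) :
    pd j (fun z => c * f z) x = c * pd j f x := by
  simp only [pd]
  rw [fderiv_const_mul hf]
  simp

lemma pd_const (j : Fin 3) (c : ℂ) (x : R3) : pd j (fun _ => c) x = 0 := by
  simp [pd]

lemma pd_star {j : Fin 3} (f : R3 → ℂ) (x : R3) :
    pd j (fun z => star (f z)) x = star (pd j f x) := by
  simp only [pd]
  rw [fderiv_star]
  simp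

lemma pd_congr {j : Fin 3} {f g : R3 → ℂ} {x : R3} (h : f =ᶠ[𝓝 x] g) : pd j f x = pd j g x := by
  simp only [pd, h.fderiv_eq]

lemma pd_eq_zero_of_notMem_tsupport {j : Fin 3} {f : R3 → ℂ} {x : R3} (h : x ∉ tsupport f) :
    pd j f x = 0 := by
  rw [pd_congr (notMem_tsupport_iff_eventuallyEq.1 h)]
  simp [pd]

/-- The `i`-th Cartesian coordinate as a complex function. -/
def coord (i : Fin 3) (x : R3) : ℂ := (x i : ℂ)

lemma hasFDerivAt_coord (i : Fin 3) (x : R3) : HasFDerivAt (coord i)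
    (Complex.ofRealCLM.comp (EuclideanSpace.proj i : R3 →L[ℝ] ℝ)) x :=
  (Complex.ofRealCLM.comp (EuclideanSpace.proj i : R3 →L[ℝ] ℝ)).hasFDerivAt

lemma contDiff_coord (i : Fin 3) {n : WithTop ℕ∞} : ContDiff ℝ n (coord i) :=
  (Complex.ofRealCLM.comp (EuclideanSpace.proj i : R3 →L[ℝ] ℝ)).contDiff

lemma pd_coord (i j : Fin 3) (x : R3) : pd j (coord i) x = if i = j then 1 else 0 := by
  simp only [pd]
  rw [(hasFDerivAt_coord i x).fderiv]
  simp only [ContinuousLinearMap.comp_apply, Complex.ofRealCLM_apply, PiLp.proj_apply,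
    PiLp.single_apply]
  split_ifs <;> simp

lemma contDiff_pd {j : Fin 3} {f : R3 → ℂ} (hf : ContDiff ℝ (⊤ : ℕ∞) f) :
    ContDiff ℝ (⊤ : ℕ∞) (pd j f) :=
  (hf.fderiv_right (m := (⊤ : ℕ∞)) (by simp)).clm_apply contDiff_const

lemma pd_pd_comm {i j : Fin 3} {f : R3 → ℂ} (hf : ContDiff ℝ (⊤ : ℕ∞) f) (x : R3) :
    pd i (pd j f) x = pd j (pd i f) x := by
  have hs : IsSymmSndFDerivAt ℝ f x := hf.contDiffAt.isSymmSndFDerivAt (by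
    simpa using WithTop.coe_le_coe.2 (le_top : (2 : ℕ∞) ≤ ⊤))
  have hd : DifferentiableAt ℝ (fderiv ℝ f) x :=
    ((hf.fderiv_right (m := (⊤ : ℕ∞)) (by simp)).differentiable (by simp)) x
  have e : ∀ k l, pd k (pd l f) x =
      fderiv ℝ (fderiv ℝ f) x (EuclideanSpace.single k 1) (EuclideanSpace.single l 1) := by
    intro k l
    unfold pd
    rw [fderiv_clm_apply hd (differentiableAt_const _)]
    simp
  rw [e, e, hs.eq]

/-- `curl (α ∇β) = ∇α × ∇β`. -/
lemma curl_smul_grad {α β : R3 → ℂ} (hα : ContDiff ℝ (⊤ : ℕ∞) α) (hβ : ContDiff ℝ (⊤ : ℕ∞) β)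
    (x : R3) : curl (fun z => α z • grad β z) x = crossProduct (grad α x) (grad β x) := by
  have ha : DifferentiableAt ℝ α x := hα.differentiable (by simp) x
  have hb : ∀ j, DifferentiableAt ℝ (pd j β) x := fun j =>
    (contDiff_pd hβ).differentiable (by simp) x
  have e : ∀ i j, pd i (fun z => α z * pd j β z) x
      = α x * pd i (pd j β) x + pd j β x * pd i α x := fun i j => pd_mul ha (hb j)
  rw [cross_apply]
  simp only [curl, grad, Pi.smul_apply, smul_eq_mul, e]
  rw [pd_pd_comm hβ (i := 2) (j := 1), pd_pd_comm hβ (i := 0) (j := 2),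
    pd_pd_comm hβ (i := 1) (j := 0)]
  congr 1
  · ring
  · congr 1
    · ring
    · congr 1
      ring

/-- `curl F = ∑ₘ ∇Fₘ × eₘ`, for arbitrary fields. -/
lemma curl_eq_sum (F : R3 → C3) (x : R3) :
    curl F x = ∑ m, crossProduct (grad (fun z => F z m) x) (Pi.single m 1) := by
  ext i
  simp only [Fin.sum_univ_three, Pi.add_apply, cross_apply, curl, grad]
  fin_cases i <;> simp <;> ring

lemma curl_smul {χ : R3 → ℂ} {F : R3 → C3} {x : R3} (hχ : DifferentiableAt ℝ χ x)
    (hF : ∀ i, DifferentiableAt ℝ (fun z => F z i) x) :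
    curl (fun z => χ z • F z) x = χ x • curl F x + crossProduct (grad χ x) (F x) := by
  have e : ∀ i j, pd i (fun z => χ z * F z j) x
      = χ x * pd i (fun z => F z j) x + F x j * pd i χ x := fun i j => pd_mul hχ (hF j)
  ext i
  simp only [curl, Pi.smul_apply, smul_eq_mul, e, cross_apply, Pi.add_apply, grad]
  fin_cases i <;> simp <;> ring

lemma norm_pd_le_of_lipschitz {C : NNReal} {f : R3 → ℂ} (hf : LipschitzWith C f) (j : Fin 3)
    (x : R3) : ‖pd j f x‖ ≤ C := by
  refine ((fderiv ℝ f x).le_opNorm _).trans ?_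
  have := norm_fderiv_le_of_lipschitz ℝ hf (x₀ := x)
  simpa using this

lemma norm_grad_le_of_lipschitz {C : NNReal} {f : R3 → ℂ} (hf : LipschitzWith C f)
    (x : R3) : ‖grad f x‖ ≤ C :=
  (pi_norm_le_iff_of_nonneg C.2).2 fun j => norm_pd_le_of_lipschitz hf j x

lemma norm_curl_le_of_lipschitz {C : NNReal} {F : R3 → C3}
    (hF : ∀ i, LipschitzWith C (fun z => F z i)) (x : R3) : ‖curl F x‖ ≤ 2 * C := by
  refine (pi_norm_le_iff_of_nonneg (by positivity)).2 fun i => ?_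
  have h : ∀ i j k l, ‖pd i (fun z => F z j) x - pd k (fun z => F z l) x‖ ≤ 2 * C :=
    fun i j k l => by
      refine (norm_sub_le _ _).trans ?_
      linarith [norm_pd_le_of_lipschitz (hF j) i x, norm_pd_le_of_lipschitz (hF l) k x]
  fin_cases i <;> exact h _ _ _ _

/-- A locally Lipschitz function with compact support is Lipschitz. -/
lemma exists_lipschitzWith_of_hasCompactSupport {f : R3 → ℂ} (hf : LocallyLipschitz f)
    (hc : HasCompactSupport f) : ∃ C, LipschitzWith C f := by
  obtain ⟨R, hR⟩ := hc.isCompact.isBounded.subset_closedBall (0 : R3)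
  obtain ⟨C, hC⟩ := (hf.locallyLipschitzOn (s := Metric.closedBall 0 (R + 1))
    ).exists_lipschitzOnWith_of_compact (isCompact_closedBall _ _)
  obtain ⟨M, hM⟩ := hf.continuous.bounded_above_of_compact_support hc
  have hM0 : 0 ≤ M := (norm_nonneg _).trans (hM 0)
  have hz : ∀ x, x ∉ Metric.closedBall (0 : R3) R → f x = 0 := fun x hx =>
    image_eq_zero_of_notMem_tsupport fun h => hx (hR h)
  -- one point in the ball of radius `R` and the other outside the ball of radius `R + 1`
  have key : ∀ x y, x ∈ Metric.closedBall (0 : R3) R → y ∉ Metric.closedBall (0 : R3) (R + 1) →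
      dist (f x) (f y) ≤ (C + M.toNNReal : NNReal) * dist x y := by
    intro x y hx hy
    rw [hz y fun h => hy (Metric.closedBall_subset_closedBall (by linarith) h), dist_zero_right]
    have h1 : 1 ≤ dist x y := by
      simp only [Metric.mem_closedBall, dist_zero_right, not_le] at hx hy
      have := norm_sub_norm_le y x
      rw [dist_comm, dist_eq_norm]
      linarith
    refine (hM x).trans ?_
    push_cast
    rw [Real.coe_toNNReal _ hM0]
    nlinarith [C.2, NNReal.coe_nonneg C, mul_nonneg (NNReal.coe_nonneg C) (zero_le_one.trans h1)]
  refine ⟨C + M.toNNReal, LipschitzWith.of_dist_le_mul fun x y => ?_⟩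
  by_cases hx : x ∈ Metric.closedBall (0 : R3) (R + 1) <;>
    by_cases hy : y ∈ Metric.closedBall (0 : R3) (R + 1)
  · refine (hC.dist_le_mul x hx y hy).trans ?_
    gcongr
    exact_mod_cast le_self_add
  · by_cases hx' : x ∈ Metric.closedBall (0 : R3) R
    · exact key x y hx' hy
    · rw [hz x hx', hz y fun h => hy (Metric.closedBall_subset_closedBall (by linarith) h),
        dist_self]
      positivity
  · by_cases hy' : y ∈ Metric.closedBall (0 : R3) R
    · rw [dist_comm, dist_comm x]
      exact key y x hy' hx
    · rw [hz y hy', hz x fun h => hx (Metric.closedBall_subset_closedBall (by linarith) h),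
        dist_self]
      positivity
  · rw [hz x fun h => hx (Metric.closedBall_subset_closedBall (by linarith) h),
      hz y fun h => hy (Metric.closedBall_subset_closedBall (by linarith) h), dist_self]
    positivity

lemma LocallyLipschitz.mul_complex {f g : R3 → ℂ} (hf : LocallyLipschitz f)
    (hg : LocallyLipschitz g) : LocallyLipschitz fun x => f x * g x := by
  have h : LocallyLipschitz fun p : ℂ × ℂ => p.1 * p.2 :=
    (contDiff_fst.mul contDiff_snd : ContDiff ℝ 1 fun p : ℂ × ℂ => p.1 * p.2).locallyLipschitz
  exact h.comp (hf.prodMk hg)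

/-! ### Mollification -/

/-- A smooth bump function at the origin with outer radius `1 / (n + 1)`. -/
def bump (n : ℕ) : ContDiffBump (0 : R3) where
  rIn := 1 / (2 * (n + 1))
  rOut := 1 / (n + 1)
  rIn_pos := by positivity
  rIn_lt_rOut := by
    apply one_div_lt_one_div_of_lt <;> [positivity; nlinarith [(n.cast_nonneg : (0 : ℝ) ≤ n)]]

/-- The standard mollifier of radius `1 / (n + 1)`. -/
def mollifier (n : ℕ) : R3 → ℝ := (bump n).normed volume

/-- The mollification of a function. -/
def moll (n : ℕ) (g : R3 → ℂ) : R3 → ℂ :=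
  convolution (mollifier n) g (ContinuousLinearMap.lsmul ℝ ℝ) volume

/-- The componentwise mollification of a field. -/
def mollField (n : ℕ) (F : R3 → C3) (x : R3) : C3 := fun i => moll n (fun z => F z i) x

lemma moll_apply (n : ℕ) (g : R3 → ℂ) (x : R3) :
    moll n g x = ∫ t, mollifier n t • g (x - t) := convolution_lsmul

lemma moll_apply' (n : ℕ) (g : R3 → ℂ) (x : R3) :
    moll n g x = ∫ t, mollifier n (x - t) • g t := by
  rw [moll, convolution_eq_swap]
  simp

lemma mollifier_nonneg (n : ℕ) (t : R3) : 0 ≤ mollifier n t := (bump n).nonneg_normed t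

lemma contDiff_mollifier (n : ℕ) : ContDiff ℝ (⊤ : ℕ∞) (mollifier n) := (bump n).contDiff_normed

lemma hasCompactSupport_mollifier (n : ℕ) : HasCompactSupport (mollifier n) :=
  (bump n).hasCompactSupport_normed

lemma integral_mollifier (n : ℕ) : ∫ t, mollifier n t = 1 := (bump n).integral_normed

lemma integrable_mollifier (n : ℕ) : Integrable (mollifier n) := (bump n).integrable_normed

lemma support_mollifier (n : ℕ) : Function.support (mollifier n) = Metric.ball 0 (1 / (n + 1)) :=
  (bump n).support_normed_eq

lemma mollifier_eq_zero {n : ℕ} {t : R3} (h : 1 / (n + 1 : ℝ) ≤ ‖t‖) : mollifier n t = 0 := by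
  by_contra hne
  have : t ∈ Function.support (mollifier n) := hne
  rw [support_mollifier, mem_ball_zero_iff] at this
  linarith

lemma one_div_succ_le_one (n : ℕ) : 1 / (n + 1 : ℝ) ≤ 1 := by
  rw [div_le_one (by positivity)]
  linarith [(n.cast_nonneg : (0 : ℝ) ≤ n)]

lemma tendsto_bump_rOut : Tendsto (fun n => (bump n).rOut) atTop (𝓝 0) :=
  tendsto_one_div_add_atTop_nhds_zero_nat

lemma contDiff_moll (n : ℕ) {g : R3 → ℂ} (hg : LocallyIntegrable g) :
    ContDiff ℝ (⊤ : ℕ∞) (moll n g) :=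
  (hasCompactSupport_mollifier n).contDiff_convolution_left _ (contDiff_mollifier n) hg

lemma integrable_mollifier_smul (n : ℕ) {g : R3 → ℂ} (hg : LocallyIntegrable g) (x : R3) :
    Integrable fun t => mollifier n t • g (x - t) :=
  (hasCompactSupport_mollifier n).convolutionExists_left (ContinuousLinearMap.lsmul ℝ ℝ)
    (contDiff_mollifier n).continuous hg x

/-- The derivative of a mollification falls on the mollifier. -/
lemma pd_moll (n : ℕ) {g : R3 → ℂ} (hg : LocallyIntegrable g) (j : Fin 3) (x : R3) :
    pd j (moll n g) x =
      ∫ t, (fderiv ℝ (mollifier n) (x - t) (EuclideanSpace.single j 1) : ℝ) • g t := by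
  have h := (hasCompactSupport_mollifier n).hasFDerivAt_convolution_left
    (ContinuousLinearMap.lsmul ℝ ℝ) ((contDiff_mollifier n).of_le (by simp)) hg x
  have hc := ((hasCompactSupport_mollifier n).fderiv ℝ).convolutionExists_left
    (ContinuousLinearMap.precompL R3 (ContinuousLinearMap.lsmul ℝ ℝ : ℝ →L[ℝ] ℂ →L[ℝ] ℂ))
    ((contDiff_mollifier n).continuous_fderiv (by simp)) hg x
  rw [pd, moll, h.fderiv, convolution_def, ContinuousLinearMap.integral_apply hc]
  rw [← integral_sub_left_eq_self _ volume x]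
  simp

lemma ae_tendsto_moll {g : R3 → ℂ} (hg : LocallyIntegrable g) :
    ∀ᵐ x, Tendsto (fun n => moll n g x) atTop (𝓝 (g x)) :=
  ContDiffBump.ae_convolution_tendsto_right_of_locallyIntegrable (K := 2) tendsto_bump_rOut
    (Eventually.of_forall fun n => le_of_eq (by simp only [bump]; field_simp)) hg

lemma tendsto_moll_of_continuous {g : R3 → ℂ} (hg : Continuous g) (x : R3) :
    Tendsto (fun n => moll n g x) atTop (𝓝 (g x)) :=
  ContDiffBump.convolution_tendsto_right_of_continuous tendsto_bump_rOut hg x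

lemma lipschitzWith_moll (n : ℕ) {C : NNReal} {g : R3 → ℂ} (hg : LipschitzWith C g) :
    LipschitzWith C (moll n g) := by
  have hl : LocallyIntegrable g := hg.continuous.locallyIntegrable
  refine LipschitzWith.of_dist_le_mul fun x y => ?_
  rw [dist_eq_norm, moll_apply, moll_apply,
    ← integral_sub (integrable_mollifier_smul n hl x) (integrable_mollifier_smul n hl y)]
  have hb : ∀ t, ‖mollifier n t • g (x - t) - mollifier n t • g (y - t)‖
      ≤ mollifier n t * (C * dist x y) := fun t => by
    rw [← smul_sub, norm_smul, Real.norm_of_nonneg (mollifier_nonneg n t)]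
    refine mul_le_mul_of_nonneg_left ?_ (mollifier_nonneg n t)
    have := hg.dist_le_mul (x - t) (y - t)
    simpa [dist_eq_norm] using this
  refine (norm_integral_le_of_norm_le ((integrable_mollifier n).mul_const _)
    (Eventually.of_forall hb)).trans ?_
  rw [integral_mul_const, integral_mollifier, one_mul]

lemma locallyIntegrable_pd {C : NNReal} {g : R3 → ℂ} (hg : LipschitzWith C g) (j : Fin 3) :
    LocallyIntegrable (pd j g) := by
  refine (locallyIntegrable_const (C : ℝ)).mono (measurable_pd j g).aestronglyMeasurable
    (Eventually.of_forall fun x => ?_)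
  simpa using norm_pd_le_of_lipschitz hg j x

/-- The derivative of the mollification of a Lipschitz function is the mollification of its
(almost everywhere defined) derivative. -/
lemma pd_moll_of_lipschitz (n : ℕ) {C : NNReal} {g : R3 → ℂ} (hg : LipschitzWith C g) (j : Fin 3)
    (x : R3) : pd j (moll n g) x = moll n (pd j g) x := by
  have hl : LocallyIntegrable g := hg.continuous.locallyIntegrable
  have hm : Measurable (fderiv ℝ g) := measurable_fderiv ℝ g
  have hb : Integrable fun t => mollifier n t * C := (integrable_mollifier n).mul_const _
  have hd : ∀ᵐ t, DifferentiableAt ℝ g (x - t) := by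
    have h := hg.ae_differentiableAt (μ := volume)
    exact (Measure.measurePreserving_sub_left volume x).quasiMeasurePreserving.ae h
  have hmeas : Measurable fun t => fderiv ℝ g (x - t) := hm.comp (measurable_const.sub measurable_id)
  have h := hasFDerivAt_integral_of_dominated_loc_of_lip (𝕜 := ℝ) (μ := volume)
    (F := fun z t => mollifier n t • g (z - t)) (x₀ := x) (s := Set.univ)
    (F' := fun t => mollifier n t • fderiv ℝ g (x - t)) (bound := fun t => mollifier n t * C)
    univ_mem
    (Eventually.of_forall fun z => (integrable_mollifier_smul n hl z).1)
    (integrable_mollifier_smul n hl x)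
    ((contDiff_mollifier n).continuous.aestronglyMeasurable.smul hmeas.aestronglyMeasurable)
    (Eventually.of_forall fun t => ?_) hb ?_
  · have e : moll n g = fun z => ∫ t, mollifier n t • g (z - t) := funext (moll_apply n g)
    rw [pd, e, h.2.fderiv, ContinuousLinearMap.integral_apply h.1, moll_apply]
    rfl
  · refine (LipschitzWith.of_dist_le_mul fun y z => ?_).lipschitzOnWith
    rw [dist_eq_norm, ← smul_sub, norm_smul, Real.coe_nnabs, abs_mul,
      Real.norm_of_nonneg (mollifier_nonneg n t), abs_of_nonneg (mollifier_nonneg n t),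
      mul_assoc]
    refine mul_le_mul_of_nonneg_left ?_ (mollifier_nonneg n t)
    have := hg.dist_le_mul (y - t) (z - t)
    simpa [dist_eq_norm] using this
  · filter_upwards [hd] with t ht
    have h1 : HasFDerivAt (fun z => z - t) (ContinuousLinearMap.id ℝ R3) x :=
      (hasFDerivAt_id x).sub_const t
    have := (HasFDerivAt.comp x ht.hasFDerivAt h1).const_smul (mollifier n t)
    rw [ContinuousLinearMap.comp_id] at this
    exact this

lemma ae_tendsto_grad_moll {C : NNReal} {g : R3 → ℂ} (hg : LipschitzWith C g) :
    ∀ᵐ x, Tendsto (fun n => grad (moll n g) x) atTop (𝓝 (grad g x)) := by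
  have h : ∀ j, ∀ᵐ x, Tendsto (fun n => moll n (pd j g) x) atTop (𝓝 (pd j g x)) := fun j =>
    ae_tendsto_moll (locallyIntegrable_pd hg j)
  filter_upwards [ae_all_iff.2 h] with x hx
  refine tendsto_pi_nhds.2 fun j => ?_
  simp only [grad, pd_moll_of_lipschitz _ hg]
  exact hx j

lemma tsupport_moll_subset (n : ℕ) (g : R3 → ℂ) :
    tsupport (moll n g) ⊆ Metric.cthickening (1 / (n + 1)) (tsupport g) := by
  refine closure_minimal ?_ Metric.isClosed_cthickening
  refine (support_convolution_subset _).trans ?_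
  rintro _ ⟨t, ht, y, hy, rfl⟩
  rw [support_mollifier, mem_ball_zero_iff] at ht
  refine Metric.mem_cthickening_of_dist_le _ y _ _ (subset_tsupport _ hy) ?_
  simpa [dist_eq_norm] using ht.le

/-! ### Weak curls may be tested with Lipschitz fields -/

/-- For a locally integrable weak curl `G` of `F`, the identity `∫ F · curl φ = ∫ G · φ` holds for
the fields `φ = α ∇β` with Lipschitz functions `α`, `β`, whose curl is `∇α × ∇β`. This is the form
of the weak curl that is invariant under Lipschitz changes of variables. -/
lemma HasWeakCurl.integral_cross_grad {O : Set R3} (hO : IsOpen O) {F G : R3 → C3}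
    (h : HasWeakCurl O F G) {α β : R3 → ℂ} {A B : NNReal} (hα : LipschitzWith A α)
    (hβ : LipschitzWith B β) (hc : HasCompactSupport α) (hs : tsupport α ⊆ O) :
    ∫ x in O, F x ⬝ᵥ crossProduct (grad α x) (grad β x) = ∫ x in O, G x ⬝ᵥ (α x • grad β x) := by
  obtain ⟨hF, hG, hw⟩ := h
  obtain ⟨δ, hδ, hδO⟩ := hc.isCompact.exists_cthickening_subset_open hO hs
  obtain ⟨N, hN⟩ := exists_nat_one_div_lt hδ
  set K := Metric.cthickening δ (tsupport α) with hKdef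
  have hK : IsCompact K := hc.isCompact.cthickening
  have hlα : LocallyIntegrable α := hα.continuous.locallyIntegrable
  have hlβ : LocallyIntegrable β := hβ.continuous.locallyIntegrable
  have hsub : ∀ n, tsupport (moll (n + N) α) ⊆ K := fun n =>
    (tsupport_moll_subset _ _).trans (Metric.cthickening_mono (by
      refine le_trans ?_ hN.le
      apply one_div_le_one_div_of_le
      · positivity
      · push_cast; linarith [(n.cast_nonneg : (0 : ℝ) ≤ n)]) _)
  have hαK : tsupport α ⊆ K := Metric.self_subset_cthickening _
  have z1 : ∀ n, ∀ x ∉ K, moll (n + N) α x = 0 := fun n x hx =>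
    image_eq_zero_of_notMem_tsupport fun h => hx (hsub n h)
  have z2 : ∀ n, ∀ x ∉ K, grad (moll (n + N) α) x = 0 := fun n x hx =>
    funext fun j => pd_eq_zero_of_notMem_tsupport fun h => hx (hsub n h)
  have z1' : ∀ x ∉ K, α x = 0 := fun x hx =>
    image_eq_zero_of_notMem_tsupport fun h => hx (hαK h)
  have z2' : ∀ x ∉ K, grad α x = 0 := fun x hx =>
    funext fun j => pd_eq_zero_of_notMem_tsupport fun h => hx (hαK h)
  -- a uniform bound for the mollifications of `α`
  obtain ⟨M, hM⟩ := hα.continuous.bounded_above_of_compact_support hc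
  have hM0 : 0 ≤ M := (norm_nonneg _).trans (hM 0)
  have hMn : ∀ n x, ‖moll n α x‖ ≤ M := fun n x => by
    rw [moll_apply]
    have := norm_integral_le_of_norm_le ((integrable_mollifier n).mul_const M)
      (Eventually.of_forall fun t => (by
        rw [norm_smul, Real.norm_of_nonneg (mollifier_nonneg n t)]
        exact mul_le_mul_of_nonneg_left (hM _) (mollifier_nonneg n t) :
          ‖mollifier n t • α (x - t)‖ ≤ mollifier n t * M))
    rwa [integral_mul_const, integral_mollifier, one_mul] at this
  have tα := (ae_tendsto_grad_moll hα).mono fun x hx => hx.comp (tendsto_add_atTop_nat N)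
  have tβ := (ae_tendsto_grad_moll hβ).mono fun x hx => hx.comp (tendsto_add_atTop_nat N)
  have gA : ∀ n x, ‖grad (moll n α) x‖ ≤ A := fun n =>
    norm_grad_le_of_lipschitz (lipschitzWith_moll n hα)
  have gB : ∀ n x, ‖grad (moll n β) x‖ ≤ B := fun n =>
    norm_grad_le_of_lipschitz (lipschitzWith_moll n hβ)
  have L1 := tendsto_integral_dot (O := O) (C := 2 * A * B) hF hK hδO
    (g := fun n x => crossProduct (grad (moll (n + N) α) x) (grad (moll (n + N) β) x))
    (g' := fun x => crossProduct (grad α x) (grad β x))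
    (fun n => aestronglyMeasurable_cross (aestronglyMeasurable_grad _ _)
      (aestronglyMeasurable_grad _ _))
    (fun n x => (norm_crossProduct_le _ _).trans (by
      gcongr
      · exact gA _ _
      · exact gB _ _))
    (fun n x hx => by simp [z2 n x hx]) (fun x hx => by simp [z2' x hx]) (by
      filter_upwards [tα, tβ] with x hx hy
      exact tendsto_cross hx hy)
  have L2 := tendsto_integral_dot (O := O) (C := M * B) hG hK hδO
    (g := fun n x => moll (n + N) α x • grad (moll (n + N) β) x)
    (g' := fun x => α x • grad β x)
    (fun n => (contDiff_moll _ hlα).continuous.aestronglyMeasurable.smul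
      (aestronglyMeasurable_grad _ _))
    (fun n x => by
      rw [norm_smul]
      exact mul_le_mul (hMn _ x) (gB _ _) (norm_nonneg _) hM0)
    (fun n x hx => by simp [z1 n x hx]) (fun x hx => by simp [z1' x hx]) (by
      filter_upwards [tβ] with x hy
      exact ((tendsto_moll_of_continuous hα.continuous x).comp (tendsto_add_atTop_nat N)).smul hy)
  refine tendsto_nhds_unique L1 (L2.congr fun n => ?_)
  have h1 := contDiff_moll (n + N) hlα
  have h2 := contDiff_moll (n + N) hlβ
  have hsupp : Function.support (fun x => moll (n + N) α x • grad (moll (n + N) β) x)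
      ⊆ tsupport (moll (n + N) α) := fun x hx => by
    by_contra hx'
    exact hx (by simp [image_eq_zero_of_notMem_tsupport hx'])
  have := hw (fun x => moll (n + N) α x • grad (moll (n + N) β) x)
    (h1.smul (contDiff_pi.2 fun j => contDiff_pd h2))
    (HasCompactSupport.of_support_subset_isCompact hK (hsupp.trans (hsub n)))
    ((closure_minimal hsupp (isClosed_tsupport _)).trans ((hsub n).trans hδO))
  rw [← this]
  simp only [curl_smul_grad h1 h2]

lemma grad_coord (m : Fin 3) (x : R3) : grad (coord m) x = Pi.single m 1 := by
  ext j
  simp [grad, pd_coord, Pi.single_apply, eq_comm]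

lemma lipschitzWith_coord (m : Fin 3) : ∃ C, LipschitzWith C (coord m) :=
  ⟨_, (Complex.ofRealCLM.comp (EuclideanSpace.proj m : R3 →L[ℝ] ℝ)).lipschitz⟩

/-- The weak curl may be tested with Lipschitz fields with compact support. -/
lemma HasWeakCurl.integral_curl {O : Set R3} (hO : IsOpen O) {F G : R3 → C3}
    (h : HasWeakCurl O F G) {φ : R3 → C3} {A : NNReal} (hφ : ∀ i, LipschitzWith A fun x => φ x i)
    (hc : HasCompactSupport φ) (hs : tsupport φ ⊆ O) :
    ∫ x in O, F x ⬝ᵥ curl φ x = ∫ x in O, G x ⬝ᵥ φ x := by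
  have hsm : ∀ m, tsupport (fun x => φ x m) ⊆ tsupport φ := fun m =>
    closure_mono fun x hx hx' => hx (by simp [hx'])
  have hcm : ∀ m, HasCompactSupport fun x => φ x m := fun m =>
    hc.of_isClosed_subset (isClosed_tsupport _) (hsm m)
  have e : ∀ m, ∫ x in O, F x ⬝ᵥ crossProduct (grad (fun z => φ z m) x) (Pi.single m 1)
      = ∫ x in O, G x ⬝ᵥ (φ x m • Pi.single m 1) := fun m => by
    obtain ⟨B, hB⟩ := lipschitzWith_coord m
    have := h.integral_cross_grad hO (hφ m) hB (hcm m) ((hsm m).trans hs)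
    simpa only [grad_coord] using this
  have i1 : ∀ m, Integrable
      (fun x => F x ⬝ᵥ crossProduct (grad (fun z => φ z m) x) (Pi.single m 1)) := fun m =>
    integrable_dot (C := 2 * A * 1) h.1 hc.isCompact hs
      (aestronglyMeasurable_cross (aestronglyMeasurable_grad _ _) aestronglyMeasurable_const)
      (fun x => (norm_crossProduct_le _ _).trans (by
        gcongr
        · exact norm_grad_le_of_lipschitz (hφ m) x
        · simp [Pi.norm_single]))
      (fun x hx => by
        have : grad (fun z => φ z m) x = 0 :=
          funext fun j => pd_eq_zero_of_notMem_tsupport fun h => hx (hsm m h)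
        simp [this])
  have i2 : ∀ m, Integrable (fun x => G x ⬝ᵥ (φ x m • (Pi.single m 1 : C3))) := fun m => by
    obtain ⟨M, hM⟩ := (hφ m).continuous.bounded_above_of_compact_support (hcm m)
    refine integrable_dot (C := M) h.2.1 hc.isCompact hs
      ((hφ m).continuous.aestronglyMeasurable.smul aestronglyMeasurable_const)
      (fun x => by rw [norm_smul]; simpa [Pi.norm_single] using hM x)
      (fun x hx => by
        rw [image_eq_zero_of_notMem_tsupport fun h => hx (hsm m h), zero_smul])
  have s : ∀ x, φ x = ∑ m, φ x m • (Pi.single m 1 : C3) := fun x => by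
    ext i
    simp [Pi.single_apply]
  calc ∫ x in O, F x ⬝ᵥ curl φ x
      = ∫ x in O, ∑ m, F x ⬝ᵥ crossProduct (grad (fun z => φ z m) x) (Pi.single m 1) := by
        simp only [curl_eq_sum φ, dotProduct_sum]
    _ = ∑ m, ∫ x in O, F x ⬝ᵥ crossProduct (grad (fun z => φ z m) x) (Pi.single m 1) :=
        integral_finsetSum _ fun m _ => (i1 m).integrableOn
    _ = ∑ m, ∫ x in O, G x ⬝ᵥ (φ x m • Pi.single m 1) := Finset.sum_congr rfl fun m _ => e m
    _ = ∫ x in O, ∑ m, G x ⬝ᵥ (φ x m • Pi.single m 1) :=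
        (integral_finsetSum _ fun m _ => (i2 m).integrableOn).symm
    _ = ∫ x in O, G x ⬝ᵥ φ x := by
        simp only [← dotProduct_sum, ← s]

/-! ### Mollification of square integrable functions -/

lemma eLpNorm_two_sq {X E : Type*} [MeasurableSpace X] [NormedAddCommGroup E] (f : X → E)
    (ν : Measure X) : eLpNorm f 2 ν ^ (2 : ℝ) = ∫⁻ x, ‖f x‖ₑ ^ (2 : ℝ) ∂ν := by
  have := eLpNorm_nnreal_pow_eq_lintegral (μ := ν) (f := f) (p := 2) (by norm_num)
  simpa using this

/-- The probability measure whose density is the mollifier. -/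
def mollMeasure (n : ℕ) : Measure R3 :=
  volume.withDensity fun t => ((mollifier n t).toNNReal : ENNReal)

lemma measurable_toNNReal_mollifier (n : ℕ) : Measurable fun t => (mollifier n t).toNNReal :=
  (contDiff_mollifier n).continuous.measurable.real_toNNReal

instance (n : ℕ) : IsProbabilityMeasure (mollMeasure n) where
  measure_univ := by
    rw [mollMeasure, withDensity_apply _ MeasurableSet.univ, Measure.restrict_univ]
    have := ofReal_integral_eq_lintegral_ofReal (integrable_mollifier n)
      (Eventually.of_forall (mollifier_nonneg n))
    rw [integral_mollifier, ENNReal.ofReal_one] at this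
    exact this.symm

lemma integral_mollMeasure (n : ℕ) (k : R3 → ℂ) :
    ∫ t, k t ∂mollMeasure n = ∫ t, mollifier n t • k t := by
  rw [mollMeasure, integral_withDensity_eq_integral_smul (measurable_toNNReal_mollifier n)]
  refine integral_congr_ae (Eventually.of_forall fun t => ?_)
  simp only [NNReal.smul_def, Real.coe_toNNReal _ (mollifier_nonneg n t)]

lemma ae_mollMeasure (n : ℕ) : ∀ᵐ t ∂mollMeasure n, ‖t‖ < 1 / (n + 1) := by
  rw [mollMeasure, ae_withDensity_iff
    (measurable_toNNReal_mollifier n).coe_nnreal_ennreal]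
  refine Eventually.of_forall fun t ht => ?_
  by_contra h
  rw [not_lt] at h
  simp [mollifier_eq_zero h] at ht

/-- Averages with respect to the mollifier do not increase the mean square: if all the functions
`k · t` with `t` in the support of the mollifier have a mean square of at most `B`, then so does
their average (Jensen's inequality and Tonelli's theorem). -/
lemma lintegral_mollMeasure_sq_le (n : ℕ) {ν : Measure R3} [SFinite ν] {k : R3 → R3 → ℂ}
    (hk : AEStronglyMeasurable (Function.uncurry k) (ν.prod (mollMeasure n))) {B : ENNReal}
    (hB : ∀ t : R3, ‖t‖ < 1 / (n + 1) → ∫⁻ x, ‖k x t‖ₑ ^ (2 : ℝ) ∂ν ≤ B) :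
    ∫⁻ x, ‖∫ t, k x t ∂mollMeasure n‖ₑ ^ (2 : ℝ) ∂ν ≤ B := by
  calc ∫⁻ x, ‖∫ t, k x t ∂mollMeasure n‖ₑ ^ (2 : ℝ) ∂ν
      ≤ ∫⁻ x, ∫⁻ t, ‖k x t‖ₑ ^ (2 : ℝ) ∂mollMeasure n ∂ν := by
        refine lintegral_mono_ae ?_
        filter_upwards [hk.prodMk_left] with x hx
        rw [← eLpNorm_two_sq]
        refine ENNReal.rpow_le_rpow ?_ (by norm_num)
        refine (enorm_integral_le_lintegral_enorm _).trans ?_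
        rw [← eLpNorm_one_eq_lintegral_enorm]
        exact eLpNorm_le_eLpNorm_of_exponent_le (by norm_num) hx
    _ = ∫⁻ t, ∫⁻ x, ‖k x t‖ₑ ^ (2 : ℝ) ∂ν ∂mollMeasure n :=
        lintegral_lintegral_swap (hk.enorm.pow_const _)
    _ ≤ ∫⁻ _t, B ∂mollMeasure n := lintegral_mono_ae ((ae_mollMeasure n).mono fun t ht => hB t ht)
    _ = B := by simp

lemma aestronglyMeasurable_sub_prod {w : R3 → ℂ} (hw : AEStronglyMeasurable w volume) (n : ℕ)
    (S : Set R3) :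
    AEStronglyMeasurable (Function.uncurry fun x t => w (x - t))
      ((volume.restrict S).prod (mollMeasure n)) := by
  refine (hw.comp_quasiMeasurePreserving
    (quasiMeasurePreserving_sub_of_right_invariant volume (mollMeasure n))).mono_measure ?_
  exact Measure.prod_mono Measure.restrict_le_self le_rfl

/-- Young's inequality for mollifications, localized to balls. -/
lemma lintegral_moll_sq_le (n : ℕ) {w : R3 → ℂ} (hw : AEStronglyMeasurable w volume) (R : ℝ) :
    ∫⁻ x in Metric.ball 0 R, ‖moll n w x‖ₑ ^ (2 : ℝ)
      ≤ ∫⁻ x in Metric.ball 0 (R + 1), ‖w x‖ₑ ^ (2 : ℝ) := by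
  simp only [moll_apply, ← integral_mollMeasure n fun t => w (_ - t)]
  refine lintegral_mollMeasure_sq_le n (aestronglyMeasurable_sub_prod hw n _) fun t ht => ?_
  have ht1 : ‖t‖ < 1 := ht.trans_le (one_div_succ_le_one n)
  rw [← lintegral_indicator Metric.isOpen_ball.measurableSet,
    ← lintegral_indicator Metric.isOpen_ball.measurableSet,
    ← lintegral_sub_right_eq_self (fun x => (Metric.ball (0 : R3) (R + 1)).indicator
      (fun x => ‖w x‖ₑ ^ (2 : ℝ)) x) t]
  refine lintegral_mono fun x => ?_
  by_cases hx : x ∈ Metric.ball (0 : R3) R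
  · have hx' : x - t ∈ Metric.ball (0 : R3) (R + 1) := by
      rw [mem_ball_zero_iff] at hx ⊢
      linarith [norm_sub_le x t]
    simp [hx, hx']
  · simp [hx]

/-- Translations are continuous in the mean square. -/
lemma tendsto_eLpNorm_translate {w : R3 → ℂ} (hw : MemLp w 2 volume) :
    Tendsto (fun t : R3 => eLpNorm (fun x => w (x - t) - w x) 2 volume) (𝓝 0) (𝓝 0) := by
  set W : Lp ℂ 2 (volume : Measure R3) := hw.toLp w
  have : Fact ((2 : ENNReal) ≠ ⊤) := ⟨by norm_num⟩
  have hc : Continuous fun t : R3 => DomAddAct.mk (-t) +ᵥ W :=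
    (DomAddAct.continuous_mk.comp continuous_neg).vadd continuous_const
  have h := (hc.tendsto 0)
  rw [tendsto_iff_edist_tendsto_0] at h
  refine h.congr fun t => ?_
  simp only [W, neg_zero, DomAddAct.mk_zero, zero_vadd, DomAddAct.mk_vadd_toLp,
    Lp.edist_toLp_toLp, vadd_eq_add]
  refine congrArg (fun f => eLpNorm f 2 volume) ?_
  ext x
  simp [sub_eq_neg_add]

lemma tendsto_eLpNorm_moll_sub {w : R3 → ℂ} (hw : MemLp w 2 volume) :
    Tendsto (fun n => eLpNorm (moll n w - w) 2 volume) atTop (𝓝 0) := by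
  have hl : LocallyIntegrable w := hw.locallyIntegrable (by norm_num)
  have hb : ∀ ε > (0 : ENNReal), ∀ᶠ n : ℕ in atTop, eLpNorm (moll n w - w) 2 volume ≤ ε := by
    intro ε hε
    have h1 := (tendsto_eLpNorm_translate hw).eventually (ge_mem_nhds hε)
    obtain ⟨δ, hδ, hball⟩ := Metric.eventually_nhds_iff_ball.1 h1
    obtain ⟨N, hN⟩ := exists_nat_one_div_lt hδ
    filter_upwards [eventually_ge_atTop N] with n hn
    rw [← ENNReal.rpow_le_rpow_iff (z := 2) (by norm_num), eLpNorm_two_sq]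
    have hnδ : 1 / (n + 1 : ℝ) ≤ δ := by
      refine le_trans ?_ hN.le
      apply one_div_le_one_div_of_le <;> [positivity; exact_mod_cast Nat.succ_le_succ hn]
    have e : ∀ x, (moll n w - w) x = ∫ t, (w (x - t) - w x) ∂mollMeasure n := fun x => by
      rw [integral_mollMeasure]
      simp only [smul_sub]
      rw [integral_sub (integrable_mollifier_smul n hl x) ((integrable_mollifier n).smul_const _),
        integral_smul_const, integral_mollifier, one_smul, ← moll_apply]
      rfl
    simp only [e]
    refine lintegral_mollMeasure_sq_le n ?_ fun t ht => ?_
    · have h2 := aestronglyMeasurable_sub_prod hw.1 n Set.univ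
      rw [Measure.restrict_univ] at h2
      exact h2.sub hw.1.comp_fst
    · rw [← eLpNorm_two_sq]
      refine ENNReal.rpow_le_rpow (hball t ?_) (by norm_num)
      rw [mem_ball_zero_iff]
      exact ht.trans_le hnδ
  rw [ENNReal.tendsto_atTop_zero]
  intro ε hε
  exact eventually_atTop.1 (hb ε hε)

/-! ### Square integrable fields -/

/-- Square integrability on bounded sets. -/
def L2Loc {E : Type*} [NormedAddCommGroup E] (f : R3 → E) : Prop :=
  ∀ R : ℝ, MemLp f 2 (volume.restrict (Metric.ball 0 R))

lemma L2Loc.aestronglyMeasurable {E : Type*} [NormedAddCommGroup E] {f : R3 → E}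
    (hf : L2Loc f) : AEStronglyMeasurable f volume := by
  have h : (⋃ n : ℕ, Metric.ball (0 : R3) n) = Set.univ := Metric.iUnion_ball_nat 0
  rw [← Measure.restrict_univ (μ := (volume : Measure R3)), ← h, aestronglyMeasurable_iUnion_iff]
  exact fun n => (hf n).1

lemma MemLp.l2Loc {E : Type*} [NormedAddCommGroup E] {f : R3 → E} (hf : MemLp f 2 volume) :
    L2Loc f := fun _ => hf.restrict _

lemma L2Loc.locallyIntegrable {E : Type*} [NormedAddCommGroup E] {f : R3 → E}
    (hf : L2Loc f) : LocallyIntegrable f := by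
  intro x
  refine ⟨Metric.ball 0 (‖x‖ + 1), Metric.isOpen_ball.mem_nhds (by simp), ?_⟩
  have : IsFiniteMeasure (volume.restrict (Metric.ball (0 : R3) (‖x‖ + 1))) :=
    ⟨by simpa using (Metric.isBounded_ball (x := (0 : R3))).measure_lt_top (μ := volume)⟩
  exact (hf _).integrable (by norm_num)

lemma l2Loc_pi {F : R3 → C3} : L2Loc F ↔ ∀ i, L2Loc fun x => F x i :=
  ⟨fun h i R => memLp_pi_iff.1 (h R) i, fun h R => memLp_pi_iff.2 fun i => h i R⟩

lemma integrable_dot_of_memLp {ν : Measure R3} {F G : R3 → C3} (hF : MemLp F 2 ν)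
    (hG : MemLp G 2 ν) : Integrable (fun x => F x ⬝ᵥ G x) ν := by
  simp only [dotProduct]
  exact integrable_finsetSum _ fun i _ =>
    (memLp_pi_iff.1 hF i).integrable_mul (memLp_pi_iff.1 hG i)

lemma tendsto_integral_mul_moll {h w : R3 → ℂ} {R : ℝ} (hh : MemLp h 2 volume)
    (h0 : ∀ x ∉ Metric.ball (0 : R3) R, h x = 0) (hw : L2Loc w) :
    Tendsto (fun n => ∫ x, h x * moll n w x) atTop (𝓝 (∫ x, h x * w x)) := by
  set w' : R3 → ℂ := (Metric.ball (0 : R3) (R + 1)).indicator w with hw'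
  have hm : MemLp w' 2 volume :=
    (memLp_indicator_iff_restrict Metric.isOpen_ball.measurableSet).2 (hw _)
  have e1 : ∀ n x, h x * moll n w x = h x * moll n w' x := fun n x => by
    by_cases hx : x ∈ Metric.ball (0 : R3) R
    · congr 1
      rw [moll_apply, moll_apply]
      refine integral_congr_ae (Eventually.of_forall fun t => ?_)
      by_cases ht : 1 / (n + 1 : ℝ) ≤ ‖t‖
      · simp [mollifier_eq_zero ht]
      · have : x - t ∈ Metric.ball (0 : R3) (R + 1) := by
          rw [mem_ball_zero_iff] at hx ⊢
          linarith [norm_sub_le x t, one_div_succ_le_one n]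
        simp [hw', this]
    · simp [h0 x hx]
  have e2 : ∀ x, h x * w x = h x * w' x := fun x => by
    by_cases hx : x ∈ Metric.ball (0 : R3) R
    · have : x ∈ Metric.ball (0 : R3) (R + 1) := Metric.ball_subset_ball (by linarith) hx
      simp [hw', this]
    · simp [h0 x hx]
  simp only [e1, e2]
  have hl : LocallyIntegrable w' := hm.locallyIntegrable (by norm_num)
  have ht := tendsto_eLpNorm_moll_sub hm
  have hfin : ∀ᶠ n in atTop, MemLp (moll n w') 2 volume := by
    filter_upwards [ht.eventually (gt_mem_nhds ENNReal.zero_lt_top)] with n hn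
    have h1 : MemLp (moll n w' - w') 2 volume :=
      ⟨(contDiff_moll n hl).continuous.aestronglyMeasurable.sub hm.1, hn⟩
    simpa using h1.add hm
  refine tendsto_integral_of_L1' _ (hh.integrable_mul hm).1 ?_ ?_
  · filter_upwards [hfin] with n hn using hh.integrable_mul hn
  · refine tendsto_of_tendsto_of_tendsto_of_le_of_le tendsto_const_nhds
      (h := fun n => eLpNorm h 2 volume * eLpNorm (moll n w' - w') 2 volume) ?_
      (fun _ => bot_le) (fun n => ?_)
    · simpa using ENNReal.Tendsto.const_mul ht (Or.inr hh.2.ne)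
    · have e3 : ((fun x => h x * moll n w' x) - h * w') = h • (moll n w' - w') := by
        ext x
        simp [mul_sub]
      rw [e3]
      exact eLpNorm_smul_le_mul_eLpNorm
        ((contDiff_moll n hl).continuous.aestronglyMeasurable.sub hm.1) hh.1

lemma tendsto_integral_dot_mollField {h w : R3 → C3} {R : ℝ} (hh : MemLp h 2 volume)
    (h0 : ∀ x ∉ Metric.ball (0 : R3) R, h x = 0) (hw : L2Loc w) :
    Tendsto (fun n => ∫ x, h x ⬝ᵥ mollField n w x) atTop (𝓝 (∫ x, h x ⬝ᵥ w x)) := by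
  have hi : ∀ i, MemLp (fun x => h x i) 2 volume := fun i => memLp_pi_iff.1 hh i
  have hz : ∀ i, ∀ x ∉ Metric.ball (0 : R3) R, h x i = 0 := fun i x hx => by simp [h0 x hx]
  have hint : ∀ (v : R3 → ℂ), L2Loc v → ∀ i, Integrable fun x => h x i * v x := fun v hv i => by
    have hs : Function.support (fun x => h x i * v x) ⊆ Metric.ball (0 : R3) R := fun x hx => by
      by_contra hx'
      exact hx (by simp [hz i x hx'])
    rw [← integrableOn_iff_integrable_of_support_subset hs]
    exact ((hi i).restrict _).integrable_mul (hv R)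
  have hmoll : ∀ n i, L2Loc (moll n fun x => w x i) := fun n i r => by
    have hwi := l2Loc_pi.1 hw i
    refine ⟨(contDiff_moll n hwi.locallyIntegrable).continuous.aestronglyMeasurable, ?_⟩
    rw [← ENNReal.rpow_lt_top_iff_of_pos (y := 2) (by norm_num), eLpNorm_two_sq]
    refine (lintegral_moll_sq_le n hwi.aestronglyMeasurable r).trans_lt ?_
    rw [← eLpNorm_two_sq]
    exact ENNReal.rpow_lt_top_of_nonneg (by norm_num) (hwi (r + 1)).2.ne
  simp only [dotProduct, mollField]
  rw [integral_finsetSum _ fun i _ => hint _ (l2Loc_pi.1 hw i) i]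
  refine (tendsto_finsetSum _ fun i _ =>
    tendsto_integral_mul_moll (hi i) (hz i) (l2Loc_pi.1 hw i)).congr fun n => ?_
  rw [integral_finsetSum _ fun i _ => hint _ (hmoll n i) i]

/-! ### Green's formula for weak curls -/

lemma HasWeakCurl.locallyIntegrable {F G : R3 → C3} (h : HasWeakCurl Set.univ F G) :
    LocallyIntegrable F ∧ LocallyIntegrable G :=
  ⟨locallyIntegrableOn_univ.1 h.1, locallyIntegrableOn_univ.1 h.2.1⟩

lemma locallyIntegrable_comp {F : R3 → C3} (h : LocallyIntegrable F) (i : Fin 3) :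
    LocallyIntegrable fun x => F x i :=
  h.mono (aestronglyMeasurable_comp h.aestronglyMeasurable i)
    (Eventually.of_forall fun x => norm_le_pi_norm (F x) i)

/-- Mollification commutes with the weak curl. -/
lemma curl_mollField (n : ℕ) {F G : R3 → C3} (h : HasWeakCurl Set.univ F G) (x : R3) :
    curl (mollField n F) x = mollField n G x := by
  have hF := fun i => locallyIntegrable_comp h.locallyIntegrable.1 i
  set ρ : R3 → ℂ := fun t => (mollifier n (x - t) : ℂ) with hρ
  have hρs : ContDiff ℝ (⊤ : ℕ∞) ρ :=
    Complex.ofRealCLM.contDiff.comp ((contDiff_mollifier n).comp (contDiff_const.sub contDiff_id))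
  have hρc : HasCompactSupport ρ := by
    have h1 : HasCompactSupport fun t : R3 => mollifier n (x - t) :=
      (hasCompactSupport_mollifier n).comp_homeomorph (Homeomorph.subLeft x)
    exact h1.comp_left (g := fun r : ℝ => (r : ℂ)) Complex.ofReal_zero
  have hpd : ∀ j t, pd j ρ t =
      -((fderiv ℝ (mollifier n) (x - t) (EuclideanSpace.single j 1) : ℝ) : ℂ) := by
    intro j t
    have h1 : HasFDerivAt (fun t : R3 => x - t) (-ContinuousLinearMap.id ℝ R3) t :=
      (hasFDerivAt_id t).const_sub x
    have h2 := ((contDiff_mollifier n).differentiable (by simp) (x - t)).hasFDerivAt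
    have h3 := Complex.ofRealCLM.hasFDerivAt.comp t (h2.comp t h1)
    have h4 : fderiv ℝ ρ t = _ := h3.fderiv
    rw [pd, h4]
    simp
  -- the test field `ρ e`, with `e` a coordinate vector
  have key : ∀ e : C3, ∫ t, F t ⬝ᵥ crossProduct (grad ρ t) e = ∫ t, G t ⬝ᵥ (ρ t • e) := by
    intro e
    have h1 := h.2.2 (fun t => ρ t • e) (hρs.smul contDiff_const) hρc.smul_right (Set.subset_univ _)
    rw [Measure.restrict_univ] at h1
    rw [← h1]
    refine integral_congr_ae (Eventually.of_forall fun t => ?_)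
    have h2 := curl_smul (F := fun _ => e) (hρs.differentiable (by simp) t)
      (fun i => differentiableAt_const _)
    have h3 : curl (fun _ : R3 => e) t = 0 := by
      ext i
      fin_cases i <;> simp [curl, pd_const]
    simp only [h2, h3, smul_zero, zero_add]
  have hpdF : ∀ i j, pd j (fun z => mollField n F z i) x = -∫ t, F t i * pd j ρ t := fun i j => by
    have := pd_moll n (hF i) j x
    simp only [mollField]
    rw [show (fun z => moll n (fun z => F z i) z) = moll n (fun z => F z i) from rfl, this,
      ← integral_neg]
    refine integral_congr_ae (Eventually.of_forall fun t => ?_)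
    simp [hpd, mul_comm]
  have hint : ∀ i j, Integrable fun t => F t i * pd j ρ t := fun i j => by
    have h1 := integrable_dot (C := (⨆ t, ‖pd j ρ t‖)) (K := tsupport ρ)
      (g := fun t => pd j ρ t • (Pi.single i 1 : C3)) h.1 hρc.isCompact (Set.subset_univ _)
      ((measurable_pd j ρ).aestronglyMeasurable.smul aestronglyMeasurable_const) (fun t => by
        rw [norm_smul]
        have hb : BddAbove (Set.range fun t => ‖pd j ρ t‖) := by
          obtain ⟨M, hM⟩ := (contDiff_pd (j := j) hρs).continuous.bounded_above_of_compact_support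
            (hρc.of_isClosed_subset (isClosed_tsupport _) (closure_minimal (fun t ht => by
              by_contra h; exact ht (pd_eq_zero_of_notMem_tsupport h)) (isClosed_tsupport _)))
          exact ⟨M, by rintro _ ⟨t, rfl⟩; exact hM t⟩
        simpa [Pi.norm_single] using le_ciSup hb t)
      (fun t ht => by simp [pd_eq_zero_of_notMem_tsupport ht])
    simpa [mul_comm] using h1
  have hG : ∀ i, mollField n G x i = ∫ t, G t ⬝ᵥ (ρ t • (Pi.single i 1 : C3)) := fun i => by
    simp only [mollField]
    rw [moll_apply']
    refine integral_congr_ae (Eventually.of_forall fun t => ?_)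
    simp [hρ]
  ext i
  rw [hG, ← key]
  simp only [curl, hpdF]
  have e1 : ∀ i j k l, (-∫ t, F t i * pd j ρ t) - (-∫ t, F t k * pd l ρ t)
      = ∫ t, (F t k * pd l ρ t - F t i * pd j ρ t) := fun i j k l => by
    rw [integral_sub (hint _ _) (hint _ _)]
    ring
  simp only [e1]
  fin_cases i <;>
    exact integral_congr_ae (Eventually.of_forall fun t => by
      simp [cross_apply, grad, dotProduct, Fin.sum_univ_three]
      try ring)

lemma contDiff_mollField (n : ℕ) {F : R3 → C3} (h : LocallyIntegrable F) (i : Fin 3) :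
    ContDiff ℝ (⊤ : ℕ∞) fun x => mollField n F x i :=
  contDiff_moll n (locallyIntegrable_comp h i)

/-- The components of the product of a Lipschitz function with compact support and a smooth
field are Lipschitz. -/
lemma exists_lipschitzWith_smul {χ : R3 → ℂ} {A : NNReal} (hχ : LipschitzWith A χ)
    (hc : HasCompactSupport χ) {F : R3 → C3} (hF : ∀ i, ContDiff ℝ 1 fun x => F x i) :
    ∃ B, ∀ i, LipschitzWith B fun x => (χ x • F x) i := by
  have h : ∀ i, ∃ B, LipschitzWith B fun x => χ x * F x i := fun i =>
    exists_lipschitzWith_of_hasCompactSupport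
      (LocallyLipschitz.mul_complex hχ.locallyLipschitz (hF i).locallyLipschitz) hc.mul_right
  choose B hB using h
  exact ⟨∑ i, B i, fun i => (hB i).weaken (Finset.single_le_sum (fun _ _ => zero_le)
    (Finset.mem_univ i))⟩

/-- A bounded function with bounded support times an `L²_loc` field is square integrable. -/
lemma L2Loc.memLp_of_le {F H : R3 → C3} (hF : L2Loc F) (hH : AEStronglyMeasurable H volume)
    {R C : ℝ} (h0 : ∀ x ∉ Metric.ball (0 : R3) R, H x = 0) (hb : ∀ x, ‖H x‖ ≤ C * ‖F x‖) :
    MemLp H 2 volume := by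
  have h1 : MemLp H 2 (volume.restrict (Metric.ball 0 R)) :=
    (hF R).of_le_mul hH.restrict (Eventually.of_forall hb)
  have h2 := (memLp_indicator_iff_restrict (f := H) (p := 2) (μ := volume)
    (Metric.isOpen_ball (x := (0 : R3)) (ε := R)).measurableSet).2 h1
  rwa [Set.indicator_eq_self.2] at h2
  intro x hx
  by_contra h
  exact hx (h0 x h)

lemma exists_ball_of_hasCompactSupport {E : Type*} [Zero E] {f : R3 → E}
    (hc : HasCompactSupport f) : ∃ R : ℝ, ∀ x ∉ Metric.ball (0 : R3) R, x ∉ tsupport f := by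
  obtain ⟨R, hR⟩ := hc.isCompact.isBounded.subset_ball (0 : R3)
  exact ⟨R, fun x hx h => hx (hR h)⟩

/-- Green's formula `∫ χ curl u · v = ∫ u · curl (χ v)` for square integrable fields with square
integrable weak curls and a Lipschitz cut-off function `χ`. It follows from the definition of the
weak curl of `u` when `v` is replaced by its mollifications. -/
lemma integral_weakCurl_dot {u v Cu Cv : R3 → C3} (hu : HasWeakCurl Set.univ u Cu)
    (hv : HasWeakCurl Set.univ v Cv) (lu : L2Loc u) (lCu : L2Loc Cu) (lv : L2Loc v)
    (lCv : L2Loc Cv) {χ : R3 → ℂ} {A : NNReal} (hχ : LipschitzWith A χ)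
    (hc : HasCompactSupport χ) :
    ∫ x, χ x * (Cu x ⬝ᵥ v x) =
      (∫ x, χ x * (u x ⬝ᵥ Cv x)) + ∫ x, u x ⬝ᵥ crossProduct (grad χ x) (v x) := by
  obtain ⟨R, hR⟩ := exists_ball_of_hasCompactSupport hc
  obtain ⟨M, hM⟩ := hχ.continuous.bounded_above_of_compact_support hc
  have hχm : AEStronglyMeasurable χ volume := hχ.continuous.aestronglyMeasurable
  have zχ : ∀ x ∉ Metric.ball (0 : R3) R, χ x = 0 := fun x hx =>
    image_eq_zero_of_notMem_tsupport (hR x hx)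
  have zg : ∀ x ∉ Metric.ball (0 : R3) R, grad χ x = 0 := fun x hx =>
    funext fun j => pd_eq_zero_of_notMem_tsupport (hR x hx)
  have m1 : MemLp (fun x => χ x • Cu x) 2 volume :=
    lCu.memLp_of_le (R := R) (C := M) (hχm.smul lCu.aestronglyMeasurable)
      (fun x hx => by simp [zχ x hx]) fun x => by
        rw [norm_smul]; exact mul_le_mul_of_nonneg_right (hM x) (norm_nonneg _)
  have m2 : MemLp (fun x => χ x • u x) 2 volume :=
    lu.memLp_of_le (R := R) (C := M) (hχm.smul lu.aestronglyMeasurable)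
      (fun x hx => by simp [zχ x hx]) fun x => by
        rw [norm_smul]; exact mul_le_mul_of_nonneg_right (hM x) (norm_nonneg _)
  have m3 : MemLp (fun x => crossProduct (u x) (grad χ x)) 2 volume :=
    lu.memLp_of_le (R := R) (C := 2 * A) (aestronglyMeasurable_cross lu.aestronglyMeasurable
      (aestronglyMeasurable_grad _ _)) (fun x hx => by simp [zg x hx]) fun x => by
        refine (norm_crossProduct_le _ _).trans ?_
        have := mul_le_mul_of_nonneg_left (norm_grad_le_of_lipschitz hχ x) (norm_nonneg (u x))
        linarith
  have t1 := tendsto_integral_dot_mollField (R := R) m1 (fun x hx => by simp [zχ x hx]) lv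
  have t2 := tendsto_integral_dot_mollField (R := R) m2 (fun x hx => by simp [zχ x hx]) lCv
  have t3 := tendsto_integral_dot_mollField (R := R) m3 (fun x hx => by simp [zg x hx]) lv
  have e : ∀ a b c : C3, crossProduct a b ⬝ᵥ c = a ⬝ᵥ crossProduct b c := fun a b c => by
    simp only [cross_apply, dotProduct, Fin.sum_univ_three]
    simp
    ring
  simp only [e] at t3
  simp only [smul_dotProduct, smul_eq_mul] at t1 t2
  refine tendsto_nhds_unique t1 ((t2.add t3).congr fun n => ?_)
  have hvn := fun i => contDiff_mollField n hv.locallyIntegrable.1 i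
  have hvc : Continuous (mollField n v) := continuous_pi fun i => (hvn i).continuous
  have hCvc : Continuous (mollField n Cv) := continuous_pi fun i =>
    (contDiff_mollField n hv.locallyIntegrable.2 i).continuous
  obtain ⟨B, hB⟩ := exists_lipschitzWith_smul hχ hc fun i => (hvn i).of_le (by simp)
  have hcs : HasCompactSupport fun x => χ x • mollField n v x := hc.smul_right
  have h1 := hu.integral_curl isOpen_univ hB hcs (Set.subset_univ _)
  rw [Measure.restrict_univ] at h1
  have h2 : ∫ x, χ x * (Cu x ⬝ᵥ mollField n v x) = ∫ x, Cu x ⬝ᵥ (χ x • mollField n v x) := by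
    simp only [dotProduct_smul, smul_eq_mul]
  -- a continuous field is bounded on the support of `χ`
  have bd : ∀ {G : R3 → C3}, Continuous G → ∃ C, ∀ x ∈ tsupport χ, ‖G x‖ ≤ C := fun hG =>
    hc.isCompact.exists_bound_of_continuousOn hG.continuousOn
  obtain ⟨C₁, hC₁⟩ := bd hCvc
  obtain ⟨C₂, hC₂⟩ := bd hvc
  rw [h2, ← h1, ← integral_add]
  · refine integral_congr_ae ?_
    filter_upwards [hχ.ae_differentiableAt (μ := volume)] with x hx
    rw [curl_smul hx fun i => (hvn i).differentiable (by simp) x,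
      curl_mollField n hv, dotProduct_add, dotProduct_smul, smul_eq_mul]
  · have := integrable_dot (O := Set.univ) (F := u) (C := M * |C₁|) (K := tsupport χ)
      (g := fun x => χ x • mollField n Cv x) hu.1 hc.isCompact (Set.subset_univ _)
      (hχm.smul hCvc.aestronglyMeasurable) (fun x => ?_)
      (fun x hx => by simp [image_eq_zero_of_notMem_tsupport hx])
    · simpa only [dotProduct_smul, smul_eq_mul] using this
    · have hM0 : 0 ≤ M := (norm_nonneg _).trans (hM 0)
      by_cases hx : x ∈ tsupport χ
      · rw [norm_smul]
        exact mul_le_mul (hM x) ((hC₁ x hx).trans (le_abs_self _)) (norm_nonneg _) hM0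
      · rw [image_eq_zero_of_notMem_tsupport hx, zero_smul, norm_zero]
        positivity
  · refine integrable_dot (O := Set.univ) (F := u) (C := 2 * A * |C₂|) (K := tsupport χ)
      hu.1 hc.isCompact (Set.subset_univ _)
      (aestronglyMeasurable_cross (aestronglyMeasurable_grad _ _) hvc.aestronglyMeasurable)
      (fun x => ?_) (fun x hx => ?_)
    · by_cases hx : x ∈ tsupport χ
      · refine (norm_crossProduct_le _ _).trans ?_
        gcongr
        · exact norm_grad_le_of_lipschitz hχ x
        · exact (hC₂ x hx).trans (le_abs_self _)
      · have : grad χ x = 0 := funext fun j => pd_eq_zero_of_notMem_tsupport hx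
        simp only [this, map_zero, LinearMap.zero_apply, norm_zero]
        positivity
    · have : grad χ x = 0 := funext fun j => pd_eq_zero_of_notMem_tsupport hx
      simp [this]

/-! ### Cut-off functions -/

/-- The gradient of a radial function. -/
lemma pd_radial {X : ℝ → ℝ} {x : R3} (hx : x ≠ 0) {d : ℝ} (hX : HasDerivAt X d ‖x‖) (j : Fin 3) :
    pd j (fun z => (X ‖z‖ : ℂ)) x = ((d * (x j / ‖x‖) : ℝ) : ℂ) := by
  have h0 : ‖x‖ ≠ 0 := norm_ne_zero_iff.2 hx
  have h1 : HasFDerivAt (fun z : R3 => ‖z‖ ^ 2) (2 • innerSL ℝ x) x :=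
    (hasStrictFDerivAt_norm_sq x).hasFDerivAt
  have h2 := h1.sqrt (by positivity)
  simp only [Real.sqrt_sq (norm_nonneg _)] at h2
  have h3 := Complex.ofRealCLM.hasFDerivAt.comp x (hX.hasFDerivAt.comp x h2)
  have h4 : fderiv ℝ (fun z : R3 => (X ‖z‖ : ℂ)) x = _ := h3.fderiv
  rw [pd, h4]
  simp [EuclideanSpace.inner_single_right]
  field_simp

lemma lipschitzWith_ofReal {C : NNReal} {f : R3 → ℝ} (hf : LipschitzWith C f) :
    LipschitzWith C fun x => (f x : ℂ) := by
  have := Complex.isometry_ofReal.lipschitz.comp hf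
  rwa [one_mul] at this

/-- The tent function `max (1 - |x| / R) 0`. -/
def tent (R : ℝ) (x : R3) : ℝ := max (1 - ‖x‖ / R) 0

lemma tent_nonneg (R : ℝ) (x : R3) : 0 ≤ tent R x := le_max_right _ _

lemma tent_le_one {R : ℝ} (hR : 0 < R) (x : R3) : tent R x ≤ 1 :=
  max_le (by have : 0 ≤ ‖x‖ / R := by positivity
             linarith) zero_le_one

lemma tent_of_le {R : ℝ} (hR : 0 < R) {x : R3} (h : R ≤ ‖x‖) : tent R x = 0 :=
  max_eq_right (by rw [sub_nonpos, le_div_iff₀ hR]; linarith)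

lemma lipschitzWith_tent {R : ℝ} (hR : 0 < R) : LipschitzWith (R⁻¹).toNNReal (tent R) := by
  refine LipschitzWith.max_const (LipschitzWith.of_dist_le_mul fun x y => ?_) 0
  rw [Real.coe_toNNReal _ (by positivity), Real.dist_eq,
    show (1 - ‖x‖ / R) - (1 - ‖y‖ / R) = R⁻¹ * (‖y‖ - ‖x‖) by field_simp; ring, abs_mul,
    abs_of_pos (inv_pos.2 hR), dist_comm, dist_eq_norm]
  exact mul_le_mul_of_nonneg_left (abs_norm_sub_norm_le _ _) (by positivity)

lemma hasCompactSupport_radial {X : ℝ → ℝ} {R : ℝ} (h : ∀ r, R ≤ r → X r = 0) :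
    HasCompactSupport fun x : R3 => (X ‖x‖ : ℂ) :=
  HasCompactSupport.intro (isCompact_closedBall (0 : R3) R) fun x hx => by
    rw [mem_closedBall_zero_iff, not_le] at hx
    simp [h _ hx.le]

lemma hasCompactSupport_tent {R : ℝ} (hR : 0 < R) :
    HasCompactSupport fun x => (tent R x : ℂ) :=
  hasCompactSupport_radial (X := fun r => max (1 - r / R) 0) fun r hr =>
    max_eq_right (by rw [sub_nonpos, le_div_iff₀ hR]; linarith)

lemma ae_norm_ne (R : ℝ) : ∀ᵐ x : R3, ‖x‖ ≠ R := by
  have h : volume (Metric.sphere (0 : R3) R) = 0 := Measure.addHaar_sphere _ _ _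
  rw [ae_iff]
  convert h using 2
  ext x
  simp

lemma pd_radial_of_lt {X : ℝ → ℝ} {R : ℝ} (h : ∀ r, R ≤ r → X r = 0) {x : R3} (hx : R < ‖x‖)
    (j : Fin 3) : pd j (fun z => (X ‖z‖ : ℂ)) x = 0 := by
  have : (fun z : R3 => (X ‖z‖ : ℂ)) =ᶠ[𝓝 x] fun _ => 0 := by
    filter_upwards [continuous_norm.continuousAt.eventually (lt_mem_nhds hx)] with z hz
    simp [h _ hz.le]
  rw [pd_congr this, pd_const]

lemma ae_grad_tent {R : ℝ} (hR : 0 < R) : ∀ᵐ x : R3, ∀ j, pd j (fun z => (tent R z : ℂ)) x =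
    if ‖x‖ < R then ((-(x j) / (R * ‖x‖) : ℝ) : ℂ) else 0 := by
  filter_upwards [ae_norm_ne 0, ae_norm_ne R] with x h0 hxR j
  set X : ℝ → ℝ := fun r => max (1 - r / R) 0 with hXdef
  have hX : ∀ r, R ≤ r → X r = 0 := fun r hr =>
    max_eq_right (by rw [sub_nonpos, le_div_iff₀ hR]; linarith)
  have e : (fun z => (tent R z : ℂ)) = fun z : R3 => (X ‖z‖ : ℂ) := rfl
  rw [e]
  split_ifs with h
  · have hd : HasDerivAt X (-(1 / R)) ‖x‖ := by
      have h1 : HasDerivAt (fun r : ℝ => 1 - r / R) (-(1 / R)) ‖x‖ :=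
        ((hasDerivAt_id _).div_const R).const_sub 1
      refine h1.congr_of_eventuallyEq ?_
      filter_upwards [gt_mem_nhds h] with r hr
      exact max_eq_left (by rw [sub_nonneg, div_le_one hR]; exact hr.le)
    rw [pd_radial (norm_ne_zero_iff.1 h0) hd]
    congr 1
    field_simp
  · exact pd_radial_of_lt hX (lt_of_le_of_ne (not_lt.1 h) (Ne.symm hxR)) j

lemma tendsto_tent (x : R3) : Tendsto (fun n : ℕ => tent (n + 1) x) atTop (𝓝 1) := by
  have h : Tendsto (fun n : ℕ => 1 - ‖x‖ / ((n : ℝ) + 1)) atTop (𝓝 (1 - 0)) := by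
    have := (tendsto_one_div_add_atTop_nhds_zero_nat (𝕜 := ℝ)).const_mul ‖x‖
    rw [mul_zero] at this
    refine (tendsto_const_nhds.sub this).congr fun n => ?_
    ring
  have h2 := h.max (tendsto_const_nhds (x := (0 : ℝ)))
  simpa [tent] using h2

/-- The weak curl is a symmetric operator on the square integrable fields. -/
lemma integral_weakCurl_dot_eq {u v Cu Cv : R3 → C3} (hu : HasWeakCurl Set.univ u Cu)
    (hv : HasWeakCurl Set.univ v Cv) (lu : MemLp u 2 volume) (lCu : MemLp Cu 2 volume)
    (lv : MemLp v 2 volume) (lCv : MemLp Cv 2 volume) :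
    ∫ x, Cu x ⬝ᵥ v x = ∫ x, u x ⬝ᵥ Cv x := by
  have lim : ∀ {f : R3 → ℂ}, Integrable f →
      Tendsto (fun n : ℕ => ∫ x, (tent (n + 1) x : ℂ) * f x) atTop (𝓝 (∫ x, f x)) := by
    intro f hf
    refine tendsto_integral_of_dominated_convergence (fun x => ‖f x‖) (fun n => ?_) hf.norm
      (fun n => Eventually.of_forall fun x => ?_) (Eventually.of_forall fun x => ?_)
    · exact (lipschitzWith_ofReal (lipschitzWith_tent (by positivity))).continuous.aestronglyMeasurable.mul hf.1
    · rw [norm_mul, Complex.norm_real, Real.norm_of_nonneg (tent_nonneg _ _)]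
      exact mul_le_of_le_one_left (norm_nonneg _) (tent_le_one (by positivity) x)
    · have := (Complex.continuous_ofReal.tendsto _).comp (tendsto_tent x)
      simpa using this.mul_const (f x)
  have i1 := integrable_dot_of_memLp lCu lv
  have i2 := integrable_dot_of_memLp lu lCv
  have iN : Integrable fun x => ‖u x‖ * ‖v x‖ := lu.norm.integrable_mul lv.norm
  -- the boundary term is at most `C / R`
  have lim0 : Tendsto (fun n : ℕ => ∫ x, u x ⬝ᵥ
      crossProduct (grad (fun z => (tent (n + 1) z : ℂ)) x) (v x)) atTop (𝓝 0) := by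
    have hb : ∀ n : ℕ, ‖∫ x, u x ⬝ᵥ crossProduct (grad (fun z => (tent (n + 1) z : ℂ)) x) (v x)‖
        ≤ (6 * ∫ x, ‖u x‖ * ‖v x‖) * (1 / ((n : ℝ) + 1)) := fun n => by
      have hR : (0 : ℝ) < n + 1 := by positivity
      have hle : ∀ x, ‖u x ⬝ᵥ crossProduct (grad (fun z => (tent (n + 1) z : ℂ)) x) (v x)‖
          ≤ 6 * (1 / ((n : ℝ) + 1)) * (‖u x‖ * ‖v x‖) := fun x => ?_
      · refine (norm_integral_le_of_norm_le (iN.const_mul (6 * (1 / ((n : ℝ) + 1))))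
          (Eventually.of_forall hle)).trans_eq ?_
        rw [integral_const_mul]
        ring
      · refine (norm_dotProduct_le _ _).trans ?_
        have h1 := norm_crossProduct_le (grad (fun z => (tent (n + 1) z : ℂ)) x) (v x)
        have h2 := norm_grad_le_of_lipschitz (lipschitzWith_ofReal (lipschitzWith_tent hR)) x
        rw [Real.coe_toNNReal _ (by positivity)] at h2
        have h3 : ‖crossProduct (grad (fun z => (tent (n + 1) z : ℂ)) x) (v x)‖
            ≤ 2 * (1 / ((n : ℝ) + 1)) * ‖v x‖ := h1.trans (by
          rw [one_div]
          gcongr)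
        have h4 := mul_le_mul_of_nonneg_left h3 (by positivity : 0 ≤ 3 * ‖u x‖)
        linarith
    refine squeeze_zero_norm hb ?_
    have := (tendsto_one_div_add_atTop_nhds_zero_nat (𝕜 := ℝ)).const_mul (6 * ∫ x, ‖u x‖ * ‖v x‖)
    rwa [mul_zero] at this
  have key := fun n : ℕ => integral_weakCurl_dot hu hv (MemLp.l2Loc lu) (MemLp.l2Loc lCu)
    (MemLp.l2Loc lv) (MemLp.l2Loc lCv)
    (lipschitzWith_ofReal (lipschitzWith_tent (R := (n : ℝ) + 1) (by positivity)))
    (hasCompactSupport_tent (by positivity))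
  have := (lim i2).add lim0
  rw [add_zero] at this
  exact tendsto_nhds_unique (lim i1) (this.congr fun n => (key n).symm)

lemma curl_star (φ : R3 → C3) (x : R3) : curl (fun z => star (φ z)) x = star (curl φ x) := by
  have h : ∀ i j, pd i (fun z => star (φ z) j) x = star (pd i (fun z => φ z j) x) := fun i j =>
    pd_star (fun z => φ z j) x
  ext i
  fin_cases i
  · exact (congrArg₂ _ (h 1 2) (h 2 1)).trans (star_sub _ _).symm
  · exact (congrArg₂ _ (h 2 0) (h 0 2)).trans (star_sub _ _).symm
  · exact (congrArg₂ _ (h 0 1) (h 1 0)).trans (star_sub _ _).symm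

lemma LocallyIntegrableOn.star_c3 {O : Set R3} {F : R3 → C3} (h : LocallyIntegrableOn F O) :
    LocallyIntegrableOn (fun x => star (F x)) O := fun x hx => by
  obtain ⟨t, ht, hi⟩ := h x hx
  exact ⟨t, ht, Integrable.mono hi (continuous_star.comp_aestronglyMeasurable hi.1)
    (Eventually.of_forall fun x => (norm_star _).le)⟩

/-- The complex conjugate field. -/
lemma HasWeakCurl.star {O : Set R3} {F G : R3 → C3} (h : HasWeakCurl O F G) :
    HasWeakCurl O (fun x => star (F x)) (fun x => star (G x)) := by
  refine ⟨LocallyIntegrableOn.star_c3 h.1, LocallyIntegrableOn.star_c3 h.2.1,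
    fun φ hφ hc hs => ?_⟩
  have hs' : tsupport (fun x => Star.star (φ x)) ⊆ tsupport φ :=
    closure_mono fun x hx hx' => hx (by simp [hx'])
  have h1 := h.2.2 (fun x => Star.star (φ x))
    (contDiff_pi.2 fun i => Complex.conjCLE.contDiff.comp (contDiff_pi.1 hφ i))
    (hc.of_isClosed_subset (isClosed_tsupport _) hs') (hs'.trans hs)
  have e : ∀ a b : C3, Star.star a ⬝ᵥ b = Star.star (a ⬝ᵥ Star.star b) := fun a b => by
    rw [← star_dotProduct_star, star_star]
    exact dotProduct_comm _ _
  have e2 : ∀ (f : R3 → ℂ), ∫ x in O, Star.star (f x) = Star.star (∫ x in O, f x) := fun f =>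
    integral_conj
  simp only [e]
  rw [e2, e2, ← h1]
  simp only [curl_star]

/-! ### Points are removable for square integrable weak curls -/

/-- A Lipschitz cut-off function that vanishes near `P` and is `1` at distance at least
`2 / (n + 1)` of `P`. -/
def cutOff (P : Set R3) (n : ℕ) (x : R3) : ℝ :=
  min (max ((n + 1) * Metric.infDist x P - 1) 0) 1

lemma lipschitzWith_cutOff (P : Set R3) (n : ℕ) : LipschitzWith (n + 1) (cutOff P n) := by
  refine LipschitzWith.min_const (LipschitzWith.max_const
    (LipschitzWith.of_dist_le_mul fun x y => ?_) 0) 1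
  have h := (Metric.lipschitz_infDist_pt P).dist_le_mul x y
  rw [Real.dist_eq] at h ⊢
  rw [show ((n : ℝ) + 1) * Metric.infDist x P - 1 - ((n + 1) * Metric.infDist y P - 1)
    = (n + 1) * (Metric.infDist x P - Metric.infDist y P) by ring, abs_mul,
    abs_of_pos (by positivity : (0 : ℝ) < n + 1)]
  push_cast
  gcongr
  simpa using h

lemma cutOff_mem_Icc (P : Set R3) (n : ℕ) (x : R3) : cutOff P n x ∈ Set.Icc (0 : ℝ) 1 :=
  ⟨le_min (le_max_right _ _) zero_le_one, min_le_right _ _⟩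

lemma norm_cutOff_le (P : Set R3) (n : ℕ) (x : R3) : ‖(cutOff P n x : ℂ)‖ ≤ 1 := by
  rw [Complex.norm_real, Real.norm_of_nonneg (cutOff_mem_Icc P n x).1]
  exact (cutOff_mem_Icc P n x).2

lemma tsupport_cutOff_subset (P : Set R3) (n : ℕ) :
    tsupport (cutOff P n) ⊆ {x | 1 / ((n : ℝ) + 1) ≤ Metric.infDist x P} := by
  refine closure_minimal (fun x hx => ?_)
    (isClosed_le continuous_const (Metric.continuous_infDist_pt P))
  by_contra h
  simp only [Set.mem_ofPred_eq, not_le] at h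
  rw [lt_div_iff₀ (by positivity)] at h
  refine hx ?_
  rw [cutOff, max_eq_right (by linarith), min_eq_left zero_le_one]

lemma cutOff_eq_one {P : Set R3} {n : ℕ} {x : R3} (h : 2 / ((n : ℝ) + 1) ≤ Metric.infDist x P) :
    cutOff P n x = 1 := by
  rw [div_le_iff₀ (by positivity)] at h
  exact min_eq_right (le_max_of_le_left (by linarith))

lemma grad_cutOff_eq_zero {P : Set R3} {n : ℕ} {x : R3}
    (h : 2 / ((n : ℝ) + 1) < Metric.infDist x P) : grad (fun z => (cutOff P n z : ℂ)) x = 0 := by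
  have : (fun z => (cutOff P n z : ℂ)) =ᶠ[𝓝 x] fun _ => 1 := by
    filter_upwards [(Metric.continuous_infDist_pt P).continuousAt.eventually (lt_mem_nhds h)]
      with z hz
    rw [cutOff_eq_one hz.le, Complex.ofReal_one]
  ext j
  simp only [grad, Pi.zero_apply]
  rw [pd_congr this, pd_const]

lemma tendsto_cutOff {P : Set R3} (hP : IsClosed P) (hne : P.Nonempty) {x : R3} (hx : x ∉ P) :
    Tendsto (fun n => cutOff P n x) atTop (𝓝 1) := by
  have h0 : 0 < Metric.infDist x P := (hP.notMem_iff_infDist_pos hne).1 hx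
  obtain ⟨N, hN⟩ := exists_nat_one_div_lt (half_pos h0)
  refine tendsto_const_nhds.congr' ?_
  filter_upwards [eventually_ge_atTop N] with n hn
  refine (cutOff_eq_one ?_).symm
  have : 1 / ((n : ℝ) + 1) ≤ 1 / ((N : ℝ) + 1) := by
    apply one_div_le_one_div_of_le <;> [positivity; exact_mod_cast Nat.succ_le_succ hn]
  have e : 2 / ((n : ℝ) + 1) = 2 * (1 / ((n : ℝ) + 1)) := by ring
  rw [e]
  linarith

/-- The neighbourhood of radius `2 / (n + 1)` of a finite set has volume `O(n⁻³)`. -/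
lemma exists_volume_infDist_le {P : Set R3} (hP : P.Finite) (hne : P.Nonempty) :
    ∃ C : ℝ, 0 ≤ C ∧ ∀ n : ℕ, volume {x | Metric.infDist x P ≤ 2 / ((n : ℝ) + 1)}
      ≤ ENNReal.ofReal (C / ((n : ℝ) + 1) ^ 3) := by
  refine ⟨hP.toFinset.card * (8 * (volume (Metric.ball (0 : R3) 1)).toReal), by positivity,
    fun n => ?_⟩
  have hsub : {x | Metric.infDist x P ≤ 2 / ((n : ℝ) + 1)}
      ⊆ ⋃ p ∈ hP.toFinset, Metric.closedBall p (2 / ((n : ℝ) + 1)) := fun x hx => by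
    obtain ⟨p, hp, he⟩ := hP.isCompact.exists_infDist_eq_dist hne x
    simp only [Set.mem_iUnion]
    exact ⟨p, hP.mem_toFinset.2 hp, by rw [Metric.mem_closedBall, ← he]; exact hx⟩
  refine (measure_mono hsub).trans ((measure_biUnion_finset_le _ _).trans ?_)
  have hb : volume (Metric.ball (0 : R3) 1) ≠ ⊤ := Metric.isBounded_ball.measure_lt_top.ne
  have e : ∀ p : R3, volume (Metric.closedBall p (2 / ((n : ℝ) + 1))) =
      ENNReal.ofReal (8 * (volume (Metric.ball (0 : R3) 1)).toReal / ((n : ℝ) + 1) ^ 3) := by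
    intro p
    rw [Measure.addHaar_closedBall _ _ (by positivity), finrank_euclideanSpace_fin,
      ← ENNReal.ofReal_toReal hb, ← ENNReal.ofReal_mul (by positivity),
      ENNReal.ofReal_toReal hb]
    congr 1
    field_simp
    ring
  simp only [e, Finset.sum_const, nsmul_eq_mul]
  rw [← ENNReal.ofReal_natCast, ← ENNReal.ofReal_mul (by positivity)]
  apply le_of_eq
  congr 1
  ring

/-- Finite sets are removable for square integrable weak curls: a Lipschitz cut-off function `κ`
that vanishes near the points has `∇κ = O(1/δ)` on a set of measure `O(δ³)`, so that
`∫ F · (∇κ × φ) → 0`. -/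
lemma HasWeakCurl.of_compl_finite {P : Set R3} (hP : P.Finite) {F G : R3 → C3}
    (h : HasWeakCurl Pᶜ F G) (lF : L2Loc F) (lG : L2Loc G) : HasWeakCurl Set.univ F G := by
  rcases P.eq_empty_or_nonempty with rfl | hne
  · simpa using h
  refine ⟨locallyIntegrableOn_univ.2 lF.locallyIntegrable,
    locallyIntegrableOn_univ.2 lG.locallyIntegrable, fun φ hφ hc _ => ?_⟩
  have hPc : IsClosed P := hP.isClosed
  have hP0 : volume P = 0 := hP.measure_zero _
  have haeP : ∀ᵐ x : R3, x ∉ P := measure_eq_zero_iff_ae_notMem.1 hP0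
  have hres : (volume : Measure R3).restrict Pᶜ = volume := Measure.restrict_eq_self_of_ae_mem haeP
  rw [Measure.restrict_univ]
  obtain ⟨R, hR⟩ := exists_ball_of_hasCompactSupport hc
  obtain ⟨M, hM⟩ := hφ.continuous.bounded_above_of_compact_support hc
  have hM0 : 0 ≤ M := (norm_nonneg _).trans (hM 0)
  have hφi : ∀ i, ContDiff ℝ (⊤ : ℕ∞) fun x => φ x i := contDiff_pi.1 hφ
  have hκm : ∀ n, AEStronglyMeasurable (fun x => (cutOff P n x : ℂ)) volume := fun n =>
    (lipschitzWith_ofReal (lipschitzWith_cutOff P n)).continuous.aestronglyMeasurable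
  -- the field `κ φ` is an admissible test field in the complement of `P`
  have key : ∀ n, ∫ x, F x ⬝ᵥ ((cutOff P n x : ℂ) • curl φ x
        + crossProduct (grad (fun z => (cutOff P n z : ℂ)) x) (φ x))
      = ∫ x, G x ⬝ᵥ ((cutOff P n x : ℂ) • φ x) := fun n => by
    have hl : ∀ i, ∃ B, LipschitzWith B fun x => (cutOff P n x : ℂ) * φ x i := fun i =>
      exists_lipschitzWith_of_hasCompactSupport (LocallyLipschitz.mul_complex
        (lipschitzWith_ofReal (lipschitzWith_cutOff P n)).locallyLipschitz
        ((hφi i).of_le (by simp)).locallyLipschitz)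
        (hc.of_isClosed_subset (isClosed_tsupport _) (closure_mono fun x hx hx' => hx (by
          simp [hx'])))
    choose B hB using hl
    have hs1 : tsupport (fun x => (cutOff P n x : ℂ) • φ x) ⊆ tsupport φ :=
      closure_mono fun x hx hx' => hx (by simp [hx'])
    have hs2 : tsupport (fun x => (cutOff P n x : ℂ) • φ x) ⊆ Pᶜ := by
      refine (closure_mono fun x hx => ?_ :
        _ ⊆ tsupport (cutOff P n)).trans ((tsupport_cutOff_subset P n).trans fun x hx hxP => ?_)
      · intro hx'
        exact hx (by simp [hx'])
      · simp only [Set.mem_ofPred_eq, Metric.infDist_zero_of_mem hxP] at hx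
        exact absurd hx (not_le.2 (by positivity))
    have h1 := h.integral_curl hPc.isOpen_compl (φ := fun x => (cutOff P n x : ℂ) • φ x)
      (A := ∑ i, B i)
      (fun i => (hB i).weaken (Finset.single_le_sum (fun _ _ => zero_le) (Finset.mem_univ i)))
      (hc.of_isClosed_subset (isClosed_tsupport _) hs1) hs2
    rw [hres] at h1
    rw [← h1]
    refine integral_congr_ae ?_
    filter_upwards [(lipschitzWith_ofReal (lipschitzWith_cutOff P n)).ae_differentiableAt
      (μ := volume)] with x hx
    rw [curl_smul hx fun i => (hφi i).differentiable (by simp) x]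
  have hcurlb : ∃ C, ∀ x, ‖curl φ x‖ ≤ C := by
    have hl : ∀ i, ∃ B, LipschitzWith B fun x => φ x i := fun i =>
      exists_lipschitzWith_of_hasCompactSupport ((hφi i).of_le (by simp)).locallyLipschitz
        (hc.of_isClosed_subset (isClosed_tsupport _) (closure_mono fun x hx hx' => hx (by
          simp [hx'])))
    choose B hB using hl
    exact ⟨_, norm_curl_le_of_lipschitz (C := ∑ i, B i) fun i => (hB i).weaken
      (Finset.single_le_sum (fun _ _ => zero_le) (Finset.mem_univ i))⟩
  obtain ⟨C, hC⟩ := hcurlb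
  have zφ : ∀ x ∉ tsupport φ, φ x = 0 := fun x hx => image_eq_zero_of_notMem_tsupport hx
  have hsub : ∀ j, tsupport (fun z => φ z j) ⊆ tsupport φ := fun j =>
    closure_mono fun x hx hx' => hx (by simp [hx'])
  have zc : ∀ x ∉ tsupport φ, curl φ x = 0 := fun x hx => by
    have : ∀ i j, pd i (fun z => φ z j) x = 0 := fun i j =>
      pd_eq_zero_of_notMem_tsupport fun h => hx (hsub j h)
    ext i
    fin_cases i <;> simp [curl, this]
  have hκ : ∀ᵐ x : R3, Tendsto (fun n => (cutOff P n x : ℂ)) atTop (𝓝 1) := by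
    filter_upwards [haeP] with x hx
    have := (Complex.continuous_ofReal.tendsto _).comp (tendsto_cutOff hPc hne hx)
    rwa [Complex.ofReal_one] at this
  have T1 := tendsto_integral_dot (O := Set.univ) (C := C) (K := tsupport φ)
    (g := fun n x => (cutOff P n x : ℂ) • curl φ x) (g' := curl φ)
    (locallyIntegrableOn_univ.2 lF.locallyIntegrable) hc.isCompact (Set.subset_univ _)
    (fun n => (hκm n).smul (aestronglyMeasurable_curl _ _))
    (fun n x => by
      rw [norm_smul]
      exact (mul_le_of_le_one_left (norm_nonneg _) (norm_cutOff_le P n x)).trans (hC x))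
    (fun n x hx => by simp [zc x hx]) zc (hκ.mono fun x hx => by simpa using hx.smul_const (curl φ x))
  have T2 := tendsto_integral_dot (O := Set.univ) (C := M) (K := tsupport φ)
    (g := fun n x => (cutOff P n x : ℂ) • φ x) (g' := φ)
    (locallyIntegrableOn_univ.2 lG.locallyIntegrable) hc.isCompact (Set.subset_univ _)
    (fun n => (hκm n).smul hφ.continuous.aestronglyMeasurable)
    (fun n x => by
      rw [norm_smul]
      exact (mul_le_of_le_one_left (norm_nonneg _) (norm_cutOff_le P n x)).trans (hM x))
    (fun n x hx => by simp [zφ x hx]) zφ (hκ.mono fun x hx => by simpa using hx.smul_const (φ x))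
  simp only [Measure.restrict_univ] at T1 T2
  have iF2 : IntegrableOn (fun x => ‖F x‖ ^ 2) (Metric.ball (0 : R3) R) := by
    have := (lF R).integrable_norm_pow (by norm_num)
    simpa [IntegrableOn] using this
  set S : ℕ → Set R3 := fun n => {x | Metric.infDist x P ≤ 2 / ((n : ℝ) + 1)} with hS
  have hSm : ∀ n, MeasurableSet (S n) := fun n =>
    (isClosed_le (Metric.continuous_infDist_pt P) continuous_const).measurableSet
  obtain ⟨V, hV0, hV⟩ := exists_volume_infDist_le hP hne
  -- `n ‖F‖ ≤ (‖F‖² + n²) / 2` on the small set on which `∇κ` does not vanish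
  have T3 : Tendsto (fun n : ℕ => ∫ x, F x ⬝ᵥ
      crossProduct (grad (fun z => (cutOff P n z : ℂ)) x) (φ x)) atTop (𝓝 0) := by
    set b : ℕ → R3 → ℝ := fun n x => (S n).indicator
      (fun x => (Metric.ball (0 : R3) R).indicator (fun x => ‖F x‖ ^ 2) x) x with hb
    have ib0 : Integrable (fun x => (Metric.ball (0 : R3) R).indicator (fun x => ‖F x‖ ^ 2) x) :=
      (integrable_indicator_iff Metric.isOpen_ball.measurableSet).2 iF2
    have hb1 : Tendsto (fun n => ∫ x, b n x) atTop (𝓝 0) := by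
      rw [← integral_zero R3 ℝ (μ := volume)]
      refine tendsto_integral_of_dominated_convergence _
        (fun n => (ib0.indicator (hSm n)).1) ib0 (fun n => Eventually.of_forall fun x => ?_) ?_
      · rw [Real.norm_of_nonneg (Set.indicator_nonneg (fun x _ => Set.indicator_nonneg
          (fun x _ => by positivity) _) _)]
        exact Set.indicator_le_self' (fun x _ => Set.indicator_nonneg
          (fun x _ => by positivity) _) _
      · filter_upwards [haeP] with x hx
        have h0 : 0 < Metric.infDist x P := (hPc.notMem_iff_infDist_pos hne).1 hx
        obtain ⟨N, hN⟩ := exists_nat_one_div_lt (half_pos h0)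
        refine tendsto_const_nhds.congr' ?_
        filter_upwards [eventually_ge_atTop N] with n hn
        have : 1 / ((n : ℝ) + 1) ≤ 1 / ((N : ℝ) + 1) := by
          apply one_div_le_one_div_of_le <;> [positivity; exact_mod_cast Nat.succ_le_succ hn]
        have e : 2 / ((n : ℝ) + 1) = 2 * (1 / ((n : ℝ) + 1)) := by ring
        have hxS : x ∉ S n := by
          simp only [hS, Set.mem_ofPred_eq, not_le, e]
          linarith
        simp [hb, hxS]
    have hb2 : Tendsto (fun n : ℕ => V * (1 / ((n : ℝ) + 1))) atTop (𝓝 0) := by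
      have := (tendsto_one_div_add_atTop_nhds_zero_nat (𝕜 := ℝ)).const_mul V
      rwa [mul_zero] at this
    have hb3 := ((hb1.add hb2).const_mul (3 * M))
    rw [add_zero, mul_zero] at hb3
    refine squeeze_zero_norm (fun n => ?_) hb3
    have hSfin : volume (S n) < ⊤ := (hV n).trans_lt ENNReal.ofReal_lt_top
    have ic : Integrable ((S n).indicator fun _ : R3 => ((n : ℝ) + 1) ^ 2) :=
      (integrable_indicator_iff (hSm n)).2 (integrableOn_const hSfin.ne)
    have hpt : ∀ x, ‖F x ⬝ᵥ crossProduct (grad (fun z => (cutOff P n z : ℂ)) x) (φ x)‖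
        ≤ (3 * M) * (b n x + (S n).indicator (fun _ => ((n : ℝ) + 1) ^ 2) x) := fun x => by
      by_cases hxS : x ∈ S n
      · by_cases hxR : x ∈ Metric.ball (0 : R3) R
        · have h1 := norm_dotProduct_le (F x)
            (crossProduct (grad (fun z => (cutOff P n z : ℂ)) x) (φ x))
          have h2 := norm_crossProduct_le (grad (fun z => (cutOff P n z : ℂ)) x) (φ x)
          have h3 := norm_grad_le_of_lipschitz (lipschitzWith_ofReal (lipschitzWith_cutOff P n)) x
          push_cast at h3
          have h4 : ‖crossProduct (grad (fun z => (cutOff P n z : ℂ)) x) (φ x)‖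
              ≤ 2 * ((n : ℝ) + 1) * M := h2.trans (by
            have := hM x
            gcongr)
          simp only [hb, hxS, hxR, Set.indicator_of_mem]
          have h5 := mul_le_mul_of_nonneg_left h4 (by positivity : 0 ≤ 3 * ‖F x‖)
          nlinarith [mul_nonneg hM0 (sq_nonneg (‖F x‖ - ((n : ℝ) + 1)))]
        · have : φ x = 0 := zφ x (hR x hxR)
          simp only [this, map_zero, dotProduct_zero, norm_zero]
          exact mul_nonneg (by positivity) (add_nonneg (Set.indicator_nonneg (fun x _ =>
            Set.indicator_nonneg (fun x _ => by positivity) _) _)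
            (Set.indicator_nonneg (fun x _ => by positivity) _))
      · rw [grad_cutOff_eq_zero (not_le.1 hxS)]
        simp [hb, hxS]
    refine (norm_integral_le_of_norm_le
      (((ib0.indicator (hSm n)).add ic).const_mul (3 * M)) (Eventually.of_forall hpt)).trans ?_
    rw [integral_const_mul, integral_add' (ib0.indicator (hSm n)) ic]
    refine mul_le_mul_of_nonneg_left (add_le_add le_rfl ?_) (by positivity)
    rw [integral_indicator (hSm n), setIntegral_const, smul_eq_mul]
    have h6 : volume.real (S n) ≤ V / ((n : ℝ) + 1) ^ 3 :=
      ENNReal.toReal_le_of_le_ofReal (by positivity) (hV n)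
    refine (mul_le_mul_of_nonneg_right h6 (by positivity)).trans_eq ?_
    field_simp
  have T4 := T1.add T3
  rw [add_zero] at T4
  refine tendsto_nhds_unique T4 (T2.congr fun n => ?_)
  rw [← key n, ← integral_add]
  · simp only [dotProduct_add]
  · exact integrable_dot (O := Set.univ) (C := C) (K := tsupport φ)
      (locallyIntegrableOn_univ.2 lF.locallyIntegrable) hc.isCompact (Set.subset_univ _)
      ((hκm n).smul (aestronglyMeasurable_curl _ _))
      (fun x => by
        rw [norm_smul]
        exact (mul_le_of_le_one_left (norm_nonneg _) (norm_cutOff_le P n x)).trans (hC x))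
      (fun x hx => by simp [zc x hx])
  · refine integrable_dot (O := Set.univ) (C := 2 * (n + 1) * M) (K := tsupport φ)
      (locallyIntegrableOn_univ.2 lF.locallyIntegrable) hc.isCompact (Set.subset_univ _)
      (aestronglyMeasurable_cross (aestronglyMeasurable_grad _ _)
        hφ.continuous.aestronglyMeasurable)
      (fun x => ?_)
      (fun x hx => by simp [zφ x hx])
    refine (norm_crossProduct_le _ _).trans ?_
    have h3 := norm_grad_le_of_lipschitz (lipschitzWith_ofReal (lipschitzWith_cutOff P n)) x
    push_cast at h3
    have := hM x
    gcongr

/-! ### Energy forms -/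

/-- The energy form `ε p₁ · conj q₁ + μ p₂ · conj q₂` of a medium at a point. -/
def energyForm (ε μ : Matrix (Fin 3) (Fin 3) ℂ) (p q : C3 × C3) : ℂ :=
  (ε *ᵥ p.1) ⬝ᵥ star q.1 + (μ *ᵥ p.2) ⬝ᵥ star q.2

lemma mulVec_dotProduct_star {M : Matrix (Fin 3) (Fin 3) ℂ} (hM : M.IsHermitian) (a b : C3) :
    (M *ᵥ a) ⬝ᵥ star b = a ⬝ᵥ star (M *ᵥ b) := by
  rw [star_mulVec, hM.eq, dotProduct_comm a, ← dotProduct_mulVec, dotProduct_comm]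

lemma star_energyForm {ε μ : Matrix (Fin 3) (Fin 3) ℂ} (hε : ε.IsHermitian) (hμ : μ.IsHermitian)
    (p q : C3 × C3) : star (energyForm ε μ p q) = energyForm ε μ q p := by
  rw [energyForm, energyForm, star_add, mulVec_dotProduct_star hε p.1,
    mulVec_dotProduct_star hμ p.2, ← star_dotProduct_star, ← star_dotProduct_star, star_star,
    star_star, dotProduct_comm]

lemma norm_mulVec_le (M : Matrix (Fin 3) (Fin 3) ℂ) : ∃ C : ℝ, 0 ≤ C ∧ ∀ a : C3,
    ‖M *ᵥ a‖ ≤ C * ‖a‖ :=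
  ⟨_, norm_nonneg _, fun a => (M.mulVecLin.toContinuousLinearMap).le_opNorm a⟩

lemma norm_energyForm_le (ε μ : Matrix (Fin 3) (Fin 3) ℂ) : ∃ C : ℝ, 0 ≤ C ∧
    ∀ p q : C3 × C3, ‖energyForm ε μ p q‖ ≤ C * (‖p‖ * ‖q‖) := by
  obtain ⟨C₁, h₁, hC₁⟩ := norm_mulVec_le ε
  obtain ⟨C₂, h₂, hC₂⟩ := norm_mulVec_le μ
  refine ⟨3 * C₁ + 3 * C₂, by positivity, fun p q => (norm_add_le _ _).trans ?_⟩
  have a1 : ‖(ε *ᵥ p.1) ⬝ᵥ star q.1‖ ≤ 3 * (C₁ * ‖p‖) * ‖q‖ := by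
    refine (norm_dotProduct_le _ _).trans ?_
    rw [norm_star]
    have := hC₁ p.1
    gcongr
    · exact this.trans (by gcongr; exact norm_fst_le p)
    · exact norm_fst_le q
  have a2 : ‖(μ *ᵥ p.2) ⬝ᵥ star q.2‖ ≤ 3 * (C₂ * ‖p‖) * ‖q‖ := by
    refine (norm_dotProduct_le _ _).trans ?_
    rw [norm_star]
    have := hC₂ p.2
    gcongr
    · exact this.trans (by gcongr; exact norm_snd_le p)
    · exact norm_snd_le q
  linarith

lemma continuous_energyForm_self (ε μ : Matrix (Fin 3) (Fin 3) ℂ) :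
    Continuous fun p : C3 × C3 => energyForm ε μ p p := by
  unfold energyForm
  fun_prop

lemma mulVec_dotProduct_star_pos {M : Matrix (Fin 3) (Fin 3) ℂ} (hM : M.PosDef) {a : C3}
    (ha : a ≠ 0) : 0 < ((M *ᵥ a) ⬝ᵥ star a).re := by
  have := hM.dotProduct_mulVec_pos ha
  rw [dotProduct_comm] at this
  exact (Complex.pos_iff.1 this).1

lemma energyForm_smul_smul (ε μ : Matrix (Fin 3) (Fin 3) ℂ) (t : ℝ) (p : C3 × C3) :
    energyForm ε μ ((t : ℂ) • p) ((t : ℂ) • p) = ((t ^ 2 : ℝ) : ℂ) * energyForm ε μ p p := by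
  have : star (t : ℂ) = t := Complex.conj_ofReal t
  simp only [energyForm, Prod.smul_fst, Prod.smul_snd, mulVec_smul, star_smul,
    smul_dotProduct, dotProduct_smul, smul_eq_mul, this]
  push_cast
  ring

/-- The energy form of positive definite matrices is coercive. -/
lemma exists_energyForm_ge {ε μ : Matrix (Fin 3) (Fin 3) ℂ} (hε : ε.PosDef) (hμ : μ.PosDef) :
    ∃ c : ℝ, 0 < c ∧ ∀ p : C3 × C3, c * ‖p‖ ^ 2 ≤ (energyForm ε μ p p).re := by
  have hpos : ∀ p : C3 × C3, p ≠ 0 → 0 < (energyForm ε μ p p).re := fun p hp => by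
    have n1 : 0 ≤ ((ε *ᵥ p.1) ⬝ᵥ star p.1).re := by
      by_cases h : p.1 = 0
      · simp [h]
      · exact (mulVec_dotProduct_star_pos hε h).le
    have n2 : 0 ≤ ((μ *ᵥ p.2) ⬝ᵥ star p.2).re := by
      by_cases h : p.2 = 0
      · simp [h]
      · exact (mulVec_dotProduct_star_pos hμ h).le
    rw [energyForm, Complex.add_re]
    by_cases h : p.1 = 0
    · have h2 : p.2 ≠ 0 := fun h2 => hp (Prod.ext h h2)
      linarith [mulVec_dotProduct_star_pos hμ h2]
    · linarith [mulVec_dotProduct_star_pos hε h]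
  have hcont : Continuous fun p : C3 × C3 => (energyForm ε μ p p).re :=
    Complex.continuous_re.comp (continuous_energyForm_self ε μ)
  have hne : (Metric.sphere (0 : C3 × C3) 1).Nonempty := by
    refine ⟨(Pi.single 0 1, 0), ?_⟩
    rw [mem_sphere_zero_iff_norm, Prod.norm_def, Pi.norm_single]
    simp
  obtain ⟨q, hq, hmin⟩ := (isCompact_sphere (0 : C3 × C3) 1).exists_isMinOn hne hcont.continuousOn
  have hq0 : q ≠ 0 := by
    rintro rfl
    rw [mem_sphere_zero_iff_norm, norm_zero] at hq
    exact zero_ne_one hq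
  refine ⟨(energyForm ε μ q q).re, hpos q hq0, fun p => ?_⟩
  by_cases hp : p = 0
  · simp [hp, energyForm]
  · have hn : ‖p‖ ≠ 0 := norm_ne_zero_iff.2 hp
    have hm : ((‖p‖⁻¹ : ℝ) : ℂ) • p ∈ Metric.sphere (0 : C3 × C3) 1 := by
      rw [mem_sphere_zero_iff_norm, norm_smul, Complex.norm_real, norm_inv, norm_norm,
        inv_mul_cancel₀ hn]
    have h1 := isMinOn_iff.1 hmin _ hm
    rw [energyForm_smul_smul, Complex.re_ofReal_mul, inv_pow, le_inv_mul_iff₀ (by positivity)] at h1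
    linarith

/-! ### Square integrable electromagnetic fields -/

lemma memLp_fst {ν : Measure R3} {u : EMField} (h : MemLp u 2 ν) :
    MemLp (fun x => (u x).1) 2 ν :=
  h.of_le (continuous_fst.comp_aestronglyMeasurable h.1)
    (Eventually.of_forall fun x => norm_fst_le (u x))

lemma memLp_snd {ν : Measure R3} {u : EMField} (h : MemLp u 2 ν) :
    MemLp (fun x => (u x).2) 2 ν :=
  h.of_le (continuous_snd.comp_aestronglyMeasurable h.1)
    (Eventually.of_forall fun x => norm_snd_le (u x))

lemma memLp_mulVec {ν : Measure R3} (M : Matrix (Fin 3) (Fin 3) ℂ) {F : R3 → C3}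
    (h : MemLp F 2 ν) : MemLp (fun x => M *ᵥ F x) 2 ν :=
  (M.mulVecLin.toContinuousLinearMap).comp_memLp' h

lemma memLp_smul {ν : Measure R3} {F : R3 → C3} (c : ℂ) (h : MemLp F 2 ν) :
    MemLp (fun x => c • F x) 2 ν := h.const_smul c

lemma memLp_star {ν : Measure R3} {F : R3 → C3} (h : MemLp F 2 ν) :
    MemLp (fun x => star (F x)) 2 ν :=
  h.of_le (continuous_star.comp_aestronglyMeasurable h.1)
    (Eventually.of_forall fun _ => (norm_star _).le)

lemma integrable_energyForm {ν : Measure R3} (ε μ : Matrix (Fin 3) (Fin 3) ℂ) {u v : EMField}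
    (hu : MemLp u 2 ν) (hv : MemLp v 2 ν) :
    Integrable (fun x => energyForm ε μ (u x) (v x)) ν :=
  (integrable_dot_of_memLp (memLp_mulVec ε (memLp_fst hu)) (memLp_star (memLp_fst hv))).add
    (integrable_dot_of_memLp (memLp_mulVec μ (memLp_snd hu)) (memLp_star (memLp_snd hv)))

/-- A measurable field with integrable energy density is square integrable. -/
lemma memLp_of_integrable_energyForm {ν : Measure R3} {ε μ : Matrix (Fin 3) (Fin 3) ℂ}
    (hε : ε.PosDef) (hμ : μ.PosDef) {u : EMField} (hm : AEStronglyMeasurable u ν)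
    (h : Integrable (fun x => energyForm ε μ (u x) (u x)) ν) : MemLp u 2 ν := by
  obtain ⟨c, hc, hle⟩ := exists_energyForm_ge hε hμ
  rw [memLp_two_iff_integrable_sq_norm hm]
  refine (h.re.const_mul c⁻¹).mono' ((hm.norm.pow 2)) (Eventually.of_forall fun x => ?_)
  rw [Real.norm_of_nonneg (by positivity)]
  have := hle (u x)
  rw [RCLike.re_eq_complex_re, le_inv_mul_iff₀ hc]
  exact this

/-! ### The weak Maxwell operator -/

lemma continuous_curl {φ : R3 → C3} (hφ : ContDiff ℝ (⊤ : ℕ∞) φ) : Continuous (curl φ) := by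
  have hp : ∀ i j, Continuous (pd i fun z => φ z j) := fun i j =>
    (contDiff_pd (contDiff_pi.1 hφ j)).continuous
  refine continuous_pi fun i => ?_
  fin_cases i
  · exact (hp 1 2).sub (hp 2 1)
  · exact (hp 2 0).sub (hp 0 2)
  · exact (hp 0 1).sub (hp 1 0)

lemma tsupport_curl_subset (φ : R3 → C3) : tsupport (curl φ) ⊆ tsupport φ := by
  refine closure_minimal (fun x hx => ?_) (isClosed_tsupport _)
  by_contra hx'
  have hz : ∀ i j, pd i (fun z => φ z j) x = 0 := fun i j =>
    pd_eq_zero_of_notMem_tsupport fun h => hx'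
      (closure_mono (fun z (hx : φ z j ≠ 0) (hx' : φ z = 0) => hx (by simp [hx'])) h)
  refine hx ?_
  ext i
  fin_cases i <;> simp [curl, hz]

lemma HasWeakCurl.add {O : Set R3} {F G F' G' : R3 → C3} (h : HasWeakCurl O F G)
    (h' : HasWeakCurl O F' G') :
    HasWeakCurl O (fun x => F x + F' x) (fun x => G x + G' x) := by
  refine ⟨h.1.add h'.1, h.2.1.add h'.2.1, fun φ hφ hc hs => ?_⟩
  have hint : ∀ {H ψ : R3 → C3}, LocallyIntegrableOn H O → Continuous ψ → tsupport ψ ⊆ tsupport φ →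
      IntegrableOn (fun x => H x ⬝ᵥ ψ x) O := by
    intro H ψ hH hψ hsub
    have hcψ : HasCompactSupport ψ := hc.of_isClosed_subset (isClosed_tsupport _) hsub
    obtain ⟨M, hM⟩ := hψ.bounded_above_of_compact_support hcψ
    exact (integrable_dot hH hcψ.isCompact (hsub.trans hs) hψ.aestronglyMeasurable hM
      fun x hx => image_eq_zero_of_notMem_tsupport hx).integrableOn
  have hcc := continuous_curl hφ
  have hsc := tsupport_curl_subset φ
  simp only [add_dotProduct]
  rw [integral_add (hint h.1 hcc hsc) (hint h'.1 hcc hsc),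
    integral_add (hint h.2.1 hφ.continuous le_rfl) (hint h'.2.1 hφ.continuous le_rfl),
    h.2.2 φ hφ hc hs, h'.2.2 φ hφ hc hs]

lemma HasWeakCurl.smul {O : Set R3} {F G : R3 → C3} (h : HasWeakCurl O F G) (c : ℂ) :
    HasWeakCurl O (fun x => c • F x) (fun x => c • G x) := by
  refine ⟨h.1.smul c, h.2.1.smul c, fun φ hφ hc hs => ?_⟩
  simp only [smul_dotProduct, smul_eq_mul]
  rw [integral_const_mul, integral_const_mul, h.2.2 φ hφ hc hs]

/-- `w = i (ε⁻¹ curl H, -μ⁻¹ curl E)` for `u = (E, H)`, in the sense of distributions in `O`,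
written without inverses as `curl E = i μ w₂`, `curl H = -i ε w₁`. -/
def WeakMaxwell (O : Set R3) (ε μ : R3 → Matrix (Fin 3) (Fin 3) ℂ) (u w : EMField) : Prop :=
  HasWeakCurl O (fun x => (u x).1) (fun x => Complex.I • (μ x *ᵥ (w x).2)) ∧
    HasWeakCurl O (fun x => (u x).2) (fun x => (-Complex.I) • (ε x *ᵥ (w x).1))

lemma WeakMaxwell.add {O : Set R3} {ε μ : R3 → Matrix (Fin 3) (Fin 3) ℂ} {u w u' w' : EMField}
    (h : WeakMaxwell O ε μ u w) (h' : WeakMaxwell O ε μ u' w') :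
    WeakMaxwell O ε μ (u + u') (w + w') := by
  constructor
  · simpa only [Pi.add_apply, Prod.fst_add, Prod.snd_add, mulVec_add, smul_add] using h.1.add h'.1
  · simpa only [Pi.add_apply, Prod.fst_add, Prod.snd_add, mulVec_add, smul_add] using h.2.add h'.2

lemma WeakMaxwell.smul {O : Set R3} {ε μ : R3 → Matrix (Fin 3) (Fin 3) ℂ} {u w : EMField}
    (h : WeakMaxwell O ε μ u w) (c : ℂ) : WeakMaxwell O ε μ (c • u) (c • w) := by
  constructor
  · simpa only [Pi.smul_apply, Prod.smul_fst, Prod.smul_snd, mulVec_smul, smul_comm _ Complex.I]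
      using h.1.smul c
  · simpa only [Pi.smul_apply, Prod.smul_fst, Prod.smul_snd, mulVec_smul, smul_comm _ (-Complex.I)]
      using h.2.smul c

lemma WeakMaxwell.sub {O : Set R3} {ε μ : R3 → Matrix (Fin 3) (Fin 3) ℂ} {u w u' w' : EMField}
    (h : WeakMaxwell O ε μ u w) (h' : WeakMaxwell O ε μ u' w') :
    WeakMaxwell O ε μ (u - u') (w - w') := by
  have := h.add (h'.smul (-1))
  simpa only [neg_smul, one_smul, ← sub_eq_add_neg] using this

/-- The Maxwell operator of a homogeneous background is symmetric for the energy scalar product. -/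
lemma WeakMaxwell.integral_energyForm {ε μ : Matrix (Fin 3) (Fin 3) ℂ} (hε : ε.IsHermitian)
    (hμ : μ.IsHermitian) {u w u' w' : EMField}
    (h : WeakMaxwell Set.univ (fun _ => ε) (fun _ => μ) u w)
    (h' : WeakMaxwell Set.univ (fun _ => ε) (fun _ => μ) u' w')
    (lu : MemLp u 2 volume) (lw : MemLp w 2 volume) (lu' : MemLp u' 2 volume)
    (lw' : MemLp w' 2 volume) :
    ∫ x, energyForm ε μ (w x) (u' x) = ∫ x, energyForm ε μ (u x) (w' x) := by
  have l1 := memLp_mulVec ε (memLp_fst lw)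
  have l2 := memLp_mulVec μ (memLp_snd lw)
  have l1' := memLp_mulVec ε (memLp_fst lw')
  have l2' := memLp_mulVec μ (memLp_snd lw')
  have A := integral_weakCurl_dot_eq h.2 h'.1.star (memLp_snd lu) (memLp_smul _ l1)
    (memLp_star (memLp_fst lu')) (memLp_star (memLp_smul _ l2'))
  have B := integral_weakCurl_dot_eq h.1 h'.2.star (memLp_fst lu) (memLp_smul _ l2)
    (memLp_star (memLp_snd lu')) (memLp_star (memLp_smul _ l1'))
  have e1 : ∀ x, energyForm ε μ (u x) (w' x)
      = (u x).1 ⬝ᵥ star (ε *ᵥ (w' x).1) + (u x).2 ⬝ᵥ star (μ *ᵥ (w' x).2) := fun x => by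
    rw [energyForm, mulVec_dotProduct_star hε, mulVec_dotProduct_star hμ]
  simp only [e1]
  simp only [energyForm]
  simp only [smul_dotProduct, star_smul, dotProduct_smul, smul_eq_mul, integral_const_mul] at A B
  have sI : star (-Complex.I) = Complex.I := by simp
  have sI' : star Complex.I = -Complex.I := by simp
  rw [sI'] at A
  rw [sI] at B
  rw [integral_add (integrable_dot_of_memLp l1 (memLp_star (memLp_fst lu')))
      (integrable_dot_of_memLp l2 (memLp_star (memLp_snd lu'))),
    integral_add (integrable_dot_of_memLp (memLp_fst lu) (memLp_star l1'))
      (integrable_dot_of_memLp (memLp_snd lu) (memLp_star l2'))]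
  have A' := mul_left_cancel₀ (neg_ne_zero.2 Complex.I_ne_zero) A
  have B' := mul_left_cancel₀ Complex.I_ne_zero B
  rw [A', B', add_comm]

/-- Convergence of electromagnetic fields in the mean square on bounded sets. -/
def TendstoL2Loc (un : ℕ → EMField) (u : EMField) : Prop :=
  ∀ R : ℝ, Tendsto (fun n => eLpNorm (un n - u) 2 (volume.restrict (Metric.ball (0 : R3) R)))
    atTop (𝓝 0)

lemma tendsto_integral_dot_of_L2Loc {F : ℕ → R3 → C3} {F' : R3 → C3} (hF : ∀ n, L2Loc (F n))
    (hF' : L2Loc F') (hlim : ∀ R : ℝ,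
      Tendsto (fun n => eLpNorm (F n - F') 2 (volume.restrict (Metric.ball (0 : R3) R)))
        atTop (𝓝 0)) {φ : R3 → C3} (hφ : Continuous φ) (hc : HasCompactSupport φ) :
    Tendsto (fun n => ∫ x, F n x ⬝ᵥ φ x) atTop (𝓝 (∫ x, F' x ⬝ᵥ φ x)) := by
  obtain ⟨R, hR⟩ := exists_ball_of_hasCompactSupport hc
  obtain ⟨M, hM⟩ := hφ.bounded_above_of_compact_support hc
  have hfin : IsFiniteMeasure (volume.restrict (Metric.ball (0 : R3) R)) :=
    ⟨by simpa using (Metric.isBounded_ball (x := (0 : R3))).measure_lt_top (μ := volume)⟩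
  have hφL : MemLp φ 2 (volume.restrict (Metric.ball (0 : R3) R)) :=
    MemLp.of_bound hφ.aestronglyMeasurable M (Eventually.of_forall hM)
  have e : ∀ H : R3 → C3, ∫ x, H x ⬝ᵥ φ x = ∫ x in Metric.ball (0 : R3) R, H x ⬝ᵥ φ x := fun H =>
    (setIntegral_eq_integral_of_forall_compl_eq_zero fun x hx => by
      simp [image_eq_zero_of_notMem_tsupport (hR x hx)]).symm
  simp only [e]
  refine tendsto_integral_of_L1' _ (integrable_dot_of_memLp (hF' R) hφL).1
    (Eventually.of_forall fun n => integrable_dot_of_memLp (hF n R) hφL) ?_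
  refine tendsto_of_tendsto_of_tendsto_of_le_of_le tendsto_const_nhds
    (h := fun n => ENNReal.ofReal (3 * M) *
      (eLpNorm (F n - F') 2 (volume.restrict (Metric.ball (0 : R3) R)) *
        (volume.restrict (Metric.ball (0 : R3) R)) Set.univ ^ (1 / (1 : ENNReal).toReal
          - 1 / (2 : ENNReal).toReal))) ?_ (fun _ => bot_le) (fun n => ?_)
  · have h1 : (volume.restrict (Metric.ball (0 : R3) R)) Set.univ ^ (1 / (1 : ENNReal).toReal
        - 1 / (2 : ENNReal).toReal) ≠ ⊤ :=
      ENNReal.rpow_ne_top_of_nonneg (by norm_num) (measure_ne_top _ _)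
    have h2 := ENNReal.Tendsto.mul_const (hlim R) (Or.inr h1)
    have h3 := ENNReal.Tendsto.const_mul h2 (Or.inr (ENNReal.ofReal_ne_top (r := 3 * M)))
    simpa using h3
  · refine (eLpNorm_le_mul_eLpNorm_of_ae_le_mul (g := F n - F') (c := 3 * M)
      (Eventually.of_forall fun x => ?_) 1).trans ?_
    · simp only [Pi.sub_apply, ← sub_dotProduct]
      refine (norm_dotProduct_le _ _).trans ?_
      have := mul_le_mul_of_nonneg_left (hM x) (norm_nonneg (F n x - F' x))
      linarith
    · refine mul_le_mul' le_rfl ?_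
      exact eLpNorm_le_eLpNorm_mul_rpow_measure_univ (by norm_num) ((hF n R).1.sub (hF' R).1)

lemma L2Loc.fst {u : EMField} (h : L2Loc u) : L2Loc fun x => (u x).1 := fun R => memLp_fst (h R)

lemma L2Loc.snd {u : EMField} (h : L2Loc u) : L2Loc fun x => (u x).2 := fun R => memLp_snd (h R)

lemma L2Loc.mulVec {F : R3 → C3} (M : Matrix (Fin 3) (Fin 3) ℂ) (h : L2Loc F) :
    L2Loc fun x => M *ᵥ F x := fun R => memLp_mulVec M (h R)

lemma L2Loc.smul {F : R3 → C3} (c : ℂ) (h : L2Loc F) : L2Loc fun x => c • F x :=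
  fun R => (h R).const_smul c

/-- The weak Maxwell operator of a homogeneous background is closed under convergence in the mean
square on bounded sets. -/
lemma WeakMaxwell.of_tendsto {ε μ : Matrix (Fin 3) (Fin 3) ℂ} {un wn : ℕ → EMField}
    {u w : EMField} (h : ∀ n, WeakMaxwell Set.univ (fun _ => ε) (fun _ => μ) (un n) (wn n))
    (lun : ∀ n, L2Loc (un n)) (lwn : ∀ n, L2Loc (wn n)) (lu : L2Loc u) (lw : L2Loc w)
    (hu : TendstoL2Loc un u) (hw : TendstoL2Loc wn w) :
    WeakMaxwell Set.univ (fun _ => ε) (fun _ => μ) u w := by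
  have lim : ∀ {un : ℕ → EMField} {u : EMField}, TendstoL2Loc un u → ∀ (f : C3 × C3 → C3) (C : ℝ),
      (∀ a b, ‖f a - f b‖ ≤ C * ‖a - b‖) → ∀ R : ℝ,
      Tendsto (fun n => eLpNorm ((fun x => f (un n x)) - fun x => f (u x)) 2
        (volume.restrict (Metric.ball (0 : R3) R))) atTop (𝓝 0) := by
    intro un u hu f C hf R
    have h2 := ENNReal.Tendsto.const_mul (hu R) (Or.inr (ENNReal.ofReal_ne_top (r := C)))
    rw [mul_zero] at h2
    refine tendsto_of_tendsto_of_tendsto_of_le_of_le tendsto_const_nhds h2 (fun _ => bot_le)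
      (fun n => ?_)
    exact eLpNorm_le_mul_eLpNorm_of_ae_le_mul (Eventually.of_forall fun x => hf _ _) 2
  -- a field `F n` with weak curl `G n` such that both converge
  have close : ∀ {F G : ℕ → R3 → C3} {F' G' : R3 → C3}, (∀ n, HasWeakCurl Set.univ (F n) (G n)) →
      (∀ n, L2Loc (F n)) → (∀ n, L2Loc (G n)) → L2Loc F' → L2Loc G' →
      (∀ R : ℝ, Tendsto (fun n => eLpNorm (F n - F') 2 (volume.restrict (Metric.ball (0 : R3) R)))
        atTop (𝓝 0)) →
      (∀ R : ℝ, Tendsto (fun n => eLpNorm (G n - G') 2 (volume.restrict (Metric.ball (0 : R3) R)))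
        atTop (𝓝 0)) → HasWeakCurl Set.univ F' G' := by
    intro F G F' G' hFG lF lG lF' lG' hF hG
    refine ⟨locallyIntegrableOn_univ.2 lF'.locallyIntegrable,
      locallyIntegrableOn_univ.2 lG'.locallyIntegrable, fun φ hφ hc hs => ?_⟩
    have t1 := tendsto_integral_dot_of_L2Loc lF lF' hF (continuous_curl hφ)
      (hc.of_isClosed_subset (isClosed_tsupport _) (tsupport_curl_subset φ))
    have t2 := tendsto_integral_dot_of_L2Loc lG lG' hG hφ.continuous hc
    rw [Measure.restrict_univ]
    refine tendsto_nhds_unique t1 (t2.congr fun n => ?_)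
    have := (hFG n).2.2 φ hφ hc hs
    rw [Measure.restrict_univ] at this
    exact this.symm
  obtain ⟨C₁, -, hC₁⟩ := norm_mulVec_le ε
  obtain ⟨C₂, -, hC₂⟩ := norm_mulVec_le μ
  constructor
  · refine close (fun n => (h n).1) (fun n => (lun n).fst) (fun n => ((lwn n).snd.mulVec μ).smul _)
      lu.fst ((lw.snd.mulVec μ).smul _) (lim hu (fun p => p.1) 1 fun a b => ?_)
      (lim hw (fun p => Complex.I • (μ *ᵥ p.2)) |C₂| fun a b => ?_)
    · rw [one_mul]
      exact norm_fst_le (a - b)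
    · rw [← smul_sub, norm_smul, Complex.norm_I, one_mul, ← mulVec_sub]
      refine (hC₂ _).trans ?_
      gcongr
      · exact le_abs_self _
      · exact norm_snd_le (a - b)
  · refine close (fun n => (h n).2) (fun n => (lun n).snd) (fun n => ((lwn n).fst.mulVec ε).smul _)
      lu.snd ((lw.fst.mulVec ε).smul _) (lim hu (fun p => p.2) 1 fun a b => ?_)
      (lim hw (fun p => (-Complex.I) • (ε *ᵥ p.1)) |C₁| fun a b => ?_)
    · rw [one_mul]
      exact norm_snd_le (a - b)
    · rw [← smul_sub, norm_smul, norm_neg, Complex.norm_I, one_mul, ← mulVec_sub]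
      refine (hC₁ _).trans ?_
      gcongr
      · exact le_abs_self _
      · exact norm_fst_le (a - b)

/-! ### Outgoing solutions in the whole space are square integrable -/

lemma memLp_two_of_forall_ball {d : EMField} (hm : AEStronglyMeasurable d volume) {K : ENNReal}
    (hK : K ≠ ⊤) (h : ∀ n : ℕ, eLpNorm d 2 (volume.restrict (Metric.ball (0 : R3) n)) ≤ K) :
    MemLp d 2 volume := by
  refine ⟨hm, ?_⟩
  rw [← ENNReal.rpow_lt_top_iff_of_pos (y := 2) (by norm_num), eLpNorm_two_sq,
    ← Measure.restrict_univ (μ := (volume : Measure R3)), ← Metric.iUnion_ball_nat (0 : R3),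
    setLIntegral_iUnion_of_directed]
  · refine (iSup_le (a := K ^ (2 : ℝ)) fun n => ?_).trans_lt
      (ENNReal.rpow_lt_top_of_nonneg (by norm_num) hK)
    rw [← eLpNorm_two_sq]
    exact ENNReal.rpow_le_rpow (h n) (by norm_num)
  · exact Monotone.directed_le fun m n hmn => Metric.ball_subset_ball (by exact_mod_cast hmn)

lemma energyForm_sub_self (ε μ : Matrix (Fin 3) (Fin 3) ℂ) (p q : C3 × C3) :
    energyForm ε μ (p - q) (p - q) = energyForm ε μ p p - (energyForm ε μ q p + energyForm ε μ p q)
      + energyForm ε μ q q := by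
  simp only [energyForm, Prod.fst_sub, Prod.snd_sub, mulVec_sub, star_sub, sub_dotProduct,
    dotProduct_sub]
  ring

/-- The resolvent estimate `‖η (A₀ - ω - iη)⁻¹‖ ≤ 1` in the energy norm. -/
lemma integral_energyForm_le_of_resolvent {ε μ : Matrix (Fin 3) (Fin 3) ℂ} (hε : ε.PosDef)
    (hμ : μ.PosDef) {ω η : ℝ} (hη : η ≠ 0) {s p : EMField} (ls : MemLp s 2 volume)
    (lp : MemLp p 2 volume)
    (h : WeakMaxwell Set.univ (fun _ => ε) (fun _ => μ) s
      ((ω + Complex.I * η : ℂ) • s - (Complex.I * η : ℂ) • p)) :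
    (∫ x, energyForm ε μ (s x) (s x)).re ≤ (∫ x, energyForm ε μ (p x) (p x)).re := by
  have lw : MemLp ((ω + Complex.I * η : ℂ) • s - (Complex.I * η : ℂ) • p) 2 volume :=
    (ls.const_smul _).sub (lp.const_smul _)
  have iss := integrable_energyForm ε μ ls ls
  have ips := integrable_energyForm ε μ lp ls
  have isp := integrable_energyForm ε μ ls lp
  have ipp := integrable_energyForm ε μ lp lp
  have key := h.integral_energyForm hε.1 hμ.1 h ls lw ls lw
  have e1 : ∀ x, energyForm ε μ (((ω + Complex.I * η : ℂ) • s - (Complex.I * η : ℂ) • p) x) (s x)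
      = (ω + Complex.I * η) * energyForm ε μ (s x) (s x)
        - (Complex.I * η) * energyForm ε μ (p x) (s x) := fun x => by
    simp only [energyForm, Pi.sub_apply, Pi.smul_apply, Prod.fst_sub, Prod.snd_sub, Prod.smul_fst,
      Prod.smul_snd, mulVec_sub, mulVec_smul, sub_dotProduct, smul_dotProduct, smul_eq_mul]
    ring
  have e2 : ∀ x, energyForm ε μ (s x) (((ω + Complex.I * η : ℂ) • s - (Complex.I * η : ℂ) • p) x)
      = (ω - Complex.I * η) * energyForm ε μ (s x) (s x)
        + (Complex.I * η) * energyForm ε μ (s x) (p x) := fun x => by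
    have c1 : star (ω + Complex.I * η : ℂ) = ω - Complex.I * η := by simp; ring
    have c2 : star (Complex.I * η : ℂ) = -(Complex.I * η) := by simp
    simp only [energyForm, Pi.sub_apply, Pi.smul_apply, Prod.fst_sub, Prod.snd_sub, Prod.smul_fst,
      Prod.smul_snd, star_sub, star_smul, c1, c2, dotProduct_sub, dotProduct_smul, smul_eq_mul]
    ring
  simp only [e1, e2] at key
  rw [integral_sub (iss.const_mul _) (ips.const_mul _),
    integral_add (iss.const_mul _) (isp.const_mul _), integral_const_mul, integral_const_mul,
    integral_const_mul, integral_const_mul] at key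
  set X := ∫ x, energyForm ε μ (s x) (s x)
  set Y := ∫ x, energyForm ε μ (p x) (s x)
  set Z := ∫ x, energyForm ε μ (s x) (p x)
  have hI : (Complex.I * η : ℂ) ≠ 0 := mul_ne_zero Complex.I_ne_zero (by exact_mod_cast hη)
  have hXYZ : Y + Z = 2 * X := by
    apply mul_left_cancel₀ hI
    linear_combination -key
  have hpos : 0 ≤ (∫ x, energyForm ε μ ((s - p) x) ((s - p) x)).re := by
    obtain ⟨c, hc, hle⟩ := exists_energyForm_ge hε hμ
    have i1 := integrable_energyForm ε μ (ls.sub lp) (ls.sub lp)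
    have := integral_re i1
    simp only [RCLike.re_eq_complex_re] at this
    rw [← this]
    exact integral_nonneg fun x => (by positivity : 0 ≤ c * ‖(s - p) x‖ ^ 2).trans (hle _)
  simp only [Pi.sub_apply, energyForm_sub_self] at hpos
  have i4 : Integrable fun x => energyForm ε μ (p x) (s x) + energyForm ε μ (s x) (p x) :=
    ips.add isp
  have i3 : Integrable fun x => energyForm ε μ (s x) (s x) -
      (energyForm ε μ (p x) (s x) + energyForm ε μ (s x) (p x)) := iss.sub i4
  rw [integral_add i3 ipp, integral_sub iss i4, integral_add ips isp, hXYZ] at hpos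
  simp only [Complex.add_re, Complex.sub_re, Complex.mul_re] at hpos
  norm_num at hpos
  linarith

/-- An outgoing solution of the homogeneous equations in the whole space is square integrable. If
`d = u₀ + p` with `u₀ = lim (A₀ - (ω + iη))⁻¹ f` and with `p` of compact support, then
`(A₀ - ω) p = -f`, and therefore `s = (A₀ - (ω + iη))⁻¹ f + p` is `-iη (A₀ - (ω + iη))⁻¹ p`. Its
energy is at most that of `p`, and it converges to `d` as `η ↓ 0`. -/
lemma memLp_two_of_isOutgoing {ε μ : Matrix (Fin 3) (Fin 3) ℂ} (hε : ε.PosDef) (hμ : μ.PosDef)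
    {ω : ℝ} {d u : EMField} (ld : L2Loc d)
    (hd : WeakMaxwell Set.univ (fun _ => ε) (fun _ => μ) d ((ω : ℂ) • d))
    (ho : IsOutgoing ε μ ω u) {R : ℝ} (hR : ∀ᵐ x, R < ‖x‖ → d x = u x) : MemLp d 2 volume := by
  obtain ⟨f, u₀, v, lf, -, hum, hv, hlim, R₁, hR₁⟩ := ho
  set η : ℕ → ℝ := fun n => 1 / ((n : ℝ) + 1) with hηdef
  have hη : ∀ n, 0 < η n := fun n => by positivity
  set vn : ℕ → EMField := fun n => v (η n)
  set z : ℕ → ℂ := fun n => ω + Complex.I * η n with hz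
  have hη0 : Tendsto η atTop (𝓝[>] 0) :=
    tendsto_nhdsWithin_iff.2 ⟨tendsto_one_div_add_atTop_nhds_zero_nat, Eventually.of_forall hη⟩
  have lvn : ∀ n, MemLp (vn n) 2 volume := fun n => (hv (η n) (hη n)).1
  have hvn : ∀ n, WeakMaxwell Set.univ (fun _ => ε) (fun _ => μ) (vn n) (z n • vn n + f) :=
    fun n => ⟨(hv (η n) (hη n)).2.2, (hv (η n) (hη n)).2.1⟩
  have hlimn : TendstoL2Loc vn u₀ := fun r => (hlim _ Metric.isBounded_ball).comp hη0
  have lu₀ : L2Loc u₀ := fun r => by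
    obtain ⟨n, hn⟩ := ((hlimn r).eventually (gt_mem_nhds ENNReal.zero_lt_top)).exists
    have h1 : MemLp (vn n - u₀) 2 (volume.restrict (Metric.ball (0 : R3) r)) :=
      ⟨((lvn n).1.sub hum).restrict, hn⟩
    simpa using ((lvn n).restrict (Metric.ball (0 : R3) r)).sub h1
  have lf' : L2Loc f := MemLp.l2Loc lf
  have lwn : ∀ n, L2Loc (z n • vn n + f) := fun n =>
    MemLp.l2Loc (((lvn n).const_smul _).add lf)
  have lw : L2Loc ((ω : ℂ) • u₀ + f) := fun r => ((lu₀ r).const_smul _).add (lf' r)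
  have hzlim : Tendsto z atTop (𝓝 ω) := by
    have h1 : Tendsto (fun n => ((η n : ℝ) : ℂ)) atTop (𝓝 ((0 : ℝ) : ℂ)) :=
      (Complex.continuous_ofReal.tendsto _).comp (tendsto_nhds_of_tendsto_nhdsWithin hη0)
    have h2 := (h1.const_mul Complex.I).const_add (ω : ℂ)
    simpa using h2
  have hwlim : TendstoL2Loc (fun n => z n • vn n + f) ((ω : ℂ) • u₀ + f) := fun r => by
    have h1 : Tendsto (fun n => ‖z n‖ₑ *
        eLpNorm (vn n - u₀) 2 (volume.restrict (Metric.ball (0 : R3) r))) atTop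
        (𝓝 (‖(ω : ℂ)‖ₑ * 0)) :=
      ENNReal.Tendsto.mul (hzlim.enorm) (Or.inr (by simp)) (hlimn r) (Or.inr (by simp))
    have h2 : Tendsto (fun n => ‖z n - ω‖ₑ *
        eLpNorm u₀ 2 (volume.restrict (Metric.ball (0 : R3) r))) atTop
        (𝓝 (0 * eLpNorm u₀ 2 (volume.restrict (Metric.ball (0 : R3) r)))) := by
      refine ENNReal.Tendsto.mul_const ?_ (Or.inr (lu₀ r).2.ne)
      have := (hzlim.sub_const (ω : ℂ)).enorm
      simpa using this
    have h3 := h1.add h2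
    rw [mul_zero, zero_mul, add_zero] at h3
    refine tendsto_of_tendsto_of_tendsto_of_le_of_le tendsto_const_nhds h3 (fun _ => bot_le)
      (fun n => ?_)
    have e : z n • vn n + f - ((ω : ℂ) • u₀ + f) = z n • (vn n - u₀) + (z n - ω) • u₀ := by module
    rw [e]
    refine (eLpNorm_add_le ((((lvn n).1.sub hum).const_smul _).restrict)
      ((hum.const_smul _).restrict) (by norm_num)).trans ?_
    rw [eLpNorm_const_smul, eLpNorm_const_smul]
  have hu₀ := WeakMaxwell.of_tendsto hvn (fun n => MemLp.l2Loc (lvn n)) lwn lu₀ lw hlimn hwlim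
  -- the difference `p = d - u₀` has compact support
  set p : EMField := d - u₀ with hp
  have lpl : L2Loc p := fun r => (ld r).sub (lu₀ r)
  have lp : MemLp p 2 volume := by
    have h1 := (memLp_indicator_iff_restrict (f := p) (p := 2) (μ := volume)
      (Metric.isOpen_ball (x := (0 : R3)) (ε := max R R₁ + 1)).measurableSet).2 (lpl _)
    refine (memLp_congr_ae ?_).2 h1
    filter_upwards [hR, hR₁] with x h1 h2
    by_cases hx : x ∈ Metric.ball (0 : R3) (max R R₁ + 1)
    · rw [Set.indicator_of_mem hx]
    · rw [mem_ball_zero_iff, not_lt] at hx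
      have hx1 : R < ‖x‖ := by linarith [le_max_left R R₁]
      have hx2 : R₁ < ‖x‖ := by linarith [le_max_right R R₁]
      rw [Set.indicator_of_notMem (by simpa using hx), hp, Pi.sub_apply, h1 hx1, h2 hx2, sub_self]
  set s : ℕ → EMField := fun n => vn n + p
  have ls : ∀ n, MemLp (s n) 2 volume := fun n => (lvn n).add lp
  have hs : ∀ n, WeakMaxwell Set.univ (fun _ => ε) (fun _ => μ) (s n)
      ((ω + Complex.I * η n : ℂ) • s n - (Complex.I * η n : ℂ) • p) := fun n => by
    have h1 := (hvn n).add (hd.sub hu₀)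
    have e : z n • vn n + f + ((ω : ℂ) • d - ((ω : ℂ) • u₀ + f))
        = (ω + Complex.I * η n : ℂ) • s n - (Complex.I * η n : ℂ) • p := by
      simp only [hz, s, hp]
      module
    rwa [e] at h1
  obtain ⟨c, hc, hle⟩ := exists_energyForm_ge hε hμ
  set P := (∫ x, energyForm ε μ (p x) (p x)).re
  have hb : ∀ n, eLpNorm (s n) 2 volume ≤ (ENNReal.ofReal (c⁻¹ * P)) ^ (1 / 2 : ℝ) := fun n => by
    have h1 := integral_energyForm_le_of_resolvent hε hμ (hη n).ne' (ls n) lp (hs n)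
    have i1 := integrable_energyForm ε μ (ls n) (ls n)
    have i2 : Integrable fun x => ‖s n x‖ ^ 2 := (ls n).integrable_norm_pow (by norm_num)
    have h2 : c * ∫ x, ‖s n x‖ ^ 2 ≤ P := by
      refine le_trans ?_ h1
      have := integral_re i1
      simp only [RCLike.re_eq_complex_re] at this
      rw [← this, ← integral_const_mul]
      exact integral_mono (i2.const_mul c) i1.re fun x => hle _
    rw [one_div, ENNReal.le_rpow_inv_iff (by norm_num), eLpNorm_two_sq]
    have e : ∀ x, ‖s n x‖ₑ ^ (2 : ℝ) = ENNReal.ofReal (‖s n x‖ ^ 2) := fun x => by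
      rw [← ofReal_norm, ENNReal.ofReal_rpow_of_nonneg (norm_nonneg _) (by norm_num)]
      norm_cast
    simp only [e]
    rw [← ofReal_integral_eq_lintegral_ofReal i2 (Eventually.of_forall fun x => by positivity)]
    exact ENNReal.ofReal_le_ofReal (by rwa [le_inv_mul_iff₀ hc])
  refine memLp_two_of_forall_ball ld.aestronglyMeasurable
    (K := (ENNReal.ofReal (c⁻¹ * P)) ^ (1 / 2 : ℝ))
    (ENNReal.rpow_ne_top_of_nonneg (by norm_num) ENNReal.ofReal_ne_top) fun r => ?_
  have h1 : Tendsto (fun n => (ENNReal.ofReal (c⁻¹ * P)) ^ (1 / 2 : ℝ) +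
      eLpNorm (vn n - u₀) 2 (volume.restrict (Metric.ball (0 : R3) r))) atTop
      (𝓝 ((ENNReal.ofReal (c⁻¹ * P)) ^ (1 / 2 : ℝ) + 0)) :=
    tendsto_const_nhds.add (hlimn r)
  rw [add_zero] at h1
  refine ge_of_tendsto' h1 fun n => ?_
  have e : d = s n - (vn n - u₀) := by
    simp only [s, hp]
    abel
  calc eLpNorm d 2 (volume.restrict (Metric.ball (0 : R3) r))
      = eLpNorm (s n - (vn n - u₀)) 2 (volume.restrict (Metric.ball (0 : R3) r)) := by rw [← e]
    _ ≤ eLpNorm (s n) 2 (volume.restrict (Metric.ball (0 : R3) r))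
        + eLpNorm (vn n - u₀) 2 (volume.restrict (Metric.ball (0 : R3) r)) :=
        eLpNorm_sub_le (ls n).1.restrict ((lvn n).1.sub hum).restrict (by norm_num)
    _ ≤ _ := by
        gcongr
        exact (eLpNorm_mono_measure _ Measure.restrict_le_self).trans (hb n)

/-! ### The stress tensor -/

/-- The position vector, with complex components. -/
def pos (x : R3) : C3 := fun j => (x j : ℂ)

lemma integral_pd_eq_zero {g : R3 → ℂ} {C : NNReal} (hg : LipschitzWith C g)
    (hc : HasCompactSupport g) (j : Fin 3) : ∫ x, pd j g x = 0 := by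
  have hR : ∀ L : ℂ →L[ℝ] ℝ, ∫ x, L (pd j g x) = 0 := fun L => by
    have hL : LipschitzWith (‖L‖₊ * C) fun x => L (g x) := L.lipschitz.comp hg
    have h := LipschitzWith.integral_lineDeriv_mul_eq (μ := (volume : Measure R3))
      (LipschitzWith.const (1 : ℝ)) hL (hc.comp_left (g := L) (map_zero L))
      (-EuclideanSpace.single j 1)
    have h0 : ∀ x v, lineDeriv ℝ (fun _ : R3 => (1 : ℝ)) x v = 0 := fun x v => by simp [lineDeriv]
    simp only [neg_neg, mul_one, h0, zero_mul, integral_zero] at h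
    rw [h]
    refine integral_congr_ae ?_
    filter_upwards [hg.ae_differentiableAt (μ := volume)] with x hx
    have h2 := (L.hasFDerivAt.comp x hx.hasFDerivAt).hasLineDerivAt (EuclideanSpace.single j 1)
    exact h2.lineDeriv.symm
  have hi : Integrable (pd j g) := by
    have h1 : HasCompactSupport (pd j g) := hc.of_isClosed_subset (isClosed_tsupport _)
      (closure_minimal (fun t ht => by
        by_contra h; exact ht (pd_eq_zero_of_notMem_tsupport h)) (isClosed_tsupport _))
    refine ((locallyIntegrable_pd hg j).integrableOn_isCompact h1.isCompact).integrable_of_forall_notMem_eq_zero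
      fun x hx => image_eq_zero_of_notMem_tsupport hx
  apply Complex.ext
  · exact ((Complex.reCLM.integral_comp_comm hi).symm).trans (hR Complex.reCLM)
  · exact ((Complex.imCLM.integral_comp_comm hi).symm).trans (hR Complex.imCLM)

/-- The stress tensor of the field `F` in a medium `M`, applied to the position vector. -/
def stress (M : Matrix (Fin 3) (Fin 3) ℂ) (F : R3 → C3) (j : Fin 3) (x : R3) : ℂ :=
  (M *ᵥ F x) j * (pos x ⬝ᵥ star (F x)) - 1 / 2 * (coord j x * ((M *ᵥ F x) ⬝ᵥ star (F x)))

lemma contDiff_pos : ContDiff ℝ (⊤ : ℕ∞) pos := contDiff_pi.2 fun i => contDiff_coord i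

lemma contDiff_dot {F G : R3 → C3} (hF : ∀ i, ContDiff ℝ (⊤ : ℕ∞) fun x => F x i)
    (hG : ∀ i, ContDiff ℝ (⊤ : ℕ∞) fun x => G x i) : ContDiff ℝ (⊤ : ℕ∞) fun x => F x ⬝ᵥ G x :=
  ContDiff.sum fun i _ => (hF i).mul (hG i)

lemma contDiff_mulVec (M : Matrix (Fin 3) (Fin 3) ℂ) {F : R3 → C3}
    (hF : ∀ i, ContDiff ℝ (⊤ : ℕ∞) fun x => F x i) (i : Fin 3) :
    ContDiff ℝ (⊤ : ℕ∞) fun x => (M *ᵥ F x) i :=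
  contDiff_dot (F := fun _ => M i) (fun _ => contDiff_const) hF

lemma contDiff_star {F : R3 → C3} (hF : ∀ i, ContDiff ℝ (⊤ : ℕ∞) fun x => F x i) (i : Fin 3) :
    ContDiff ℝ (⊤ : ℕ∞) fun x => (star (F x)) i := Complex.conjCLE.contDiff.comp (hF i)

lemma contDiff_stress (M : Matrix (Fin 3) (Fin 3) ℂ) {F : R3 → C3}
    (hF : ∀ i, ContDiff ℝ (⊤ : ℕ∞) fun x => F x i) (j : Fin 3) :
    ContDiff ℝ (⊤ : ℕ∞) (stress M F j) :=
  ((contDiff_mulVec M hF j).mul (contDiff_dot (fun i => contDiff_coord i) (contDiff_star hF))).sub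
    (contDiff_const.mul ((contDiff_coord j).mul
      (contDiff_dot (contDiff_mulVec M hF) (contDiff_star hF))))

lemma pd_dot {F G : R3 → C3} {x : R3} {j : Fin 3} (hF : ∀ i, DifferentiableAt ℝ (fun x => F x i) x)
    (hG : ∀ i, DifferentiableAt ℝ (fun x => G x i) x) :
    pd j (fun x => F x ⬝ᵥ G x) x =
      (fun i => pd j (fun z => F z i) x) ⬝ᵥ G x + F x ⬝ᵥ fun i => pd j (fun z => G z i) x := by
  simp only [dotProduct, Fin.sum_univ_three]
  have h := fun i => (hF i).fun_mul (hG i)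
  rw [pd_add ((h 0).fun_add (h 1)) (h 2), pd_add (h 0) (h 1), pd_mul (hF 0) (hG 0), pd_mul (hF 1) (hG 1),
    pd_mul (hF 2) (hG 2)]
  ring

lemma pd_mulVec (M : Matrix (Fin 3) (Fin 3) ℂ) {F : R3 → C3} {x : R3} {j : Fin 3}
    (hF : ∀ i, DifferentiableAt ℝ (fun x => F x i) x) (i : Fin 3) :
    pd j (fun x => (M *ᵥ F x) i) x = (M *ᵥ fun i => pd j (fun z => F z i) x) i := by
  have h := pd_dot (F := fun _ => M i) (j := j) (fun _ => differentiableAt_const _) hF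
  simp only [pd_const] at h
  refine h.trans ?_
  simp [mulVec, dotProduct]

/-- The divergence of the stress tensor applied to the position vector. -/
lemma re_div_stress {M : Matrix (Fin 3) (Fin 3) ℂ} (hM : M.IsHermitian) {F : R3 → C3}
    (hF : ∀ i, ContDiff ℝ (⊤ : ℕ∞) fun x => F x i) {x : R3}
    (hdiv : ∑ j, pd j (fun z => (M *ᵥ F z) j) x = 0) :
    (∑ j, pd j (stress M F j) x).re = -(1 / 2) * ((M *ᵥ F x) ⬝ᵥ star (F x)).re +
      (crossProduct (M *ᵥ F x) (pos x) ⬝ᵥ star (curl F x)).re := by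
  have dF := fun i => (hF i).differentiable (by simp) x
  have dM := fun i => (contDiff_mulVec M hF i).differentiable (by simp) x
  have dS := fun i => (contDiff_star hF i).differentiable (by simp) x
  have dc := fun i => (contDiff_coord i (n := (⊤ : ℕ∞))).differentiable (by simp) x
  have d1 := (contDiff_dot (F := pos) (fun i => contDiff_coord i) (contDiff_star hF)).differentiable
    (by simp) x
  have d2 := (contDiff_dot (contDiff_mulVec M hF) (contDiff_star hF)).differentiable (by simp) x
  set A : Fin 3 → C3 := fun j i => pd j (fun z => F z i) x with hA
  have hst : ∀ j, (fun i => pd j (fun z => (star (F z)) i) x) = star (A j) := fun j =>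
    funext fun i => pd_star _ _
  have hpos : ∀ j, (fun i => pd j (fun z => pos z i) x) = Pi.single j 1 := fun j => by
    funext i
    refine (pd_coord i j x).trans ?_
    simp [Pi.single_apply]
  have e : ∀ j, pd j (stress M F j) x = pd j (fun z => (M *ᵥ F z) j) x * (pos x ⬝ᵥ star (F x))
      + (M *ᵥ F x) j * (star (F x) j + pos x ⬝ᵥ star (A j))
      - 1 / 2 * ((M *ᵥ F x) ⬝ᵥ star (F x)
        + coord j x * ((M *ᵥ A j) ⬝ᵥ star (F x) + (M *ᵥ F x) ⬝ᵥ star (A j))) := fun j => by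
    have h1 := pd_mul (j := j) (dM j) d1
    have h2 := pd_mul (j := j) (dc j) d2
    have h3 : pd j (fun x => pos x ⬝ᵥ star (F x)) x = star (F x) j + pos x ⬝ᵥ star (A j) := by
      rw [pd_dot (F := pos) dc dS, hpos, hst]
      simp
    have h4 : pd j (fun x => (M *ᵥ F x) ⬝ᵥ star (F x)) x
        = (M *ᵥ A j) ⬝ᵥ star (F x) + (M *ᵥ F x) ⬝ᵥ star (A j) := by
      rw [pd_dot dM dS, hst]
      congr 2
      funext i
      exact pd_mulVec M dF i
    have h5 : stress M F j = fun x => (M *ᵥ F x) j * (pos x ⬝ᵥ star (F x))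
      + (-(1 / 2)) * (coord j x * ((M *ᵥ F x) ⬝ᵥ star (F x))) := by
      funext x
      rw [stress]
      ring
    rw [h5, pd_add ((dM j).fun_mul d1) (((dc j).fun_mul d2).const_mul _),
      pd_const_mul _ ((dc j).fun_mul d2),
      h1, h2, h3, h4, pd_coord]
    simp
    ring
  have hre : ∀ j, (coord j x * ((M *ᵥ A j) ⬝ᵥ star (F x) + (M *ᵥ F x) ⬝ᵥ star (A j))).re
      = 2 * (coord j x * ((M *ᵥ F x) ⬝ᵥ star (A j))).re := fun j => by
    have h1 : star ((M *ᵥ A j) ⬝ᵥ star (F x)) = (M *ᵥ F x) ⬝ᵥ star (A j) := by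
      rw [mulVec_dotProduct_star hM, ← star_dotProduct_star, star_star, dotProduct_comm]
    have h2 : ((M *ᵥ A j) ⬝ᵥ star (F x)).re = ((M *ᵥ F x) ⬝ᵥ star (A j)).re := by
      rw [← h1]
      exact (Complex.conj_re _).symm
    rw [coord, Complex.re_ofReal_mul, Complex.add_re, h2, Complex.re_ofReal_mul]
    ring
  have key : (M *ᵥ F x) ⬝ᵥ star (F x) + ∑ j, (M *ᵥ F x) j * (pos x ⬝ᵥ star (A j))
      - ∑ j, coord j x * ((M *ᵥ F x) ⬝ᵥ star (A j))
      = (M *ᵥ F x) ⬝ᵥ star (F x) + crossProduct (M *ᵥ F x) (pos x) ⬝ᵥ star (curl F x) := by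
    generalize M *ᵥ F x = D
    simp only [Fin.sum_univ_three, dotProduct, cross_apply, curl, hA, Pi.star_apply, pos, coord]
    simp
    ring
  have hsum : ∑ j, pd j (stress M F j) x = (M *ᵥ F x) ⬝ᵥ star (F x)
      + ∑ j, (M *ᵥ F x) j * (pos x ⬝ᵥ star (A j)) - 3 / 2 * ((M *ᵥ F x) ⬝ᵥ star (F x))
      - 1 / 2 * ∑ j, coord j x * ((M *ᵥ A j) ⬝ᵥ star (F x) + (M *ᵥ F x) ⬝ᵥ star (A j)) := by
    have h1 : (M *ᵥ F x) ⬝ᵥ star (F x) = ∑ j, (M *ᵥ F x) j * star (F x) j := rfl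
    simp only [e, Finset.sum_sub_distrib, Finset.sum_add_distrib, ← Finset.sum_mul, hdiv, mul_add,
      ← Finset.mul_sum, ← h1, Finset.sum_const, Finset.card_univ, Fintype.card_fin]
    simp
    ring
  have h3 : (1 / 2 * ∑ j, coord j x * ((M *ᵥ A j) ⬝ᵥ star (F x) + (M *ᵥ F x) ⬝ᵥ star (A j))).re
      = (∑ j, coord j x * ((M *ᵥ F x) ⬝ᵥ star (A j))).re := by
    have : (1 / 2 : ℂ) = ((1 / 2 : ℝ) : ℂ) := by norm_num
    rw [this, Complex.re_ofReal_mul, Complex.re_sum, Complex.re_sum, Finset.mul_sum]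
    refine Finset.sum_congr rfl fun j _ => ?_
    rw [hre j]
    ring
  have key' := congrArg Complex.re key
  have h4 : (3 / 2 * ((M *ᵥ F x) ⬝ᵥ star (F x))).re = 3 / 2 * ((M *ᵥ F x) ⬝ᵥ star (F x)).re := by
    have : (3 / 2 : ℂ) = ((3 / 2 : ℝ) : ℂ) := by norm_num
    rw [this, Complex.re_ofReal_mul]
  rw [hsum]
  simp only [Complex.add_re, Complex.sub_re] at key' ⊢
  rw [h3, h4]
  linarith

/-- The divergence theorem for the stress tensor applied to the position vector, for a smooth
solution of the time-harmonic Maxwell equations and a radial cut-off function `χ` with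
`∇χ = g x`. -/
lemma integral_energyForm_radial {ε μ : Matrix (Fin 3) (Fin 3) ℂ} (hε : ε.IsHermitian)
    (hμ : μ.IsHermitian) {ω : ℝ} (hω : ω ≠ 0) {E H : R3 → C3}
    (hE : ∀ i, ContDiff ℝ (⊤ : ℕ∞) fun x => E x i) (hH : ∀ i, ContDiff ℝ (⊤ : ℕ∞) fun x => H x i)
    (cE : ∀ x, curl E x = (Complex.I * ω) • (μ *ᵥ H x))
    (cH : ∀ x, curl H x = (-(Complex.I * ω)) • (ε *ᵥ E x)) {χ g : R3 → ℝ} {C : NNReal}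
    (hχ : LipschitzWith C χ) (hc : HasCompactSupport χ)
    (hg : ∀ᵐ x, ∀ j, pd j (fun z => (χ z : ℂ)) x = ((g x * x j : ℝ) : ℂ)) :
    1 / 2 * ∫ x, χ x * (energyForm ε μ (E x, H x) (E x, H x)).re =
      ∫ x, g x * (((ε *ᵥ E x) ⬝ᵥ pos x * (pos x ⬝ᵥ star (E x))
        + (μ *ᵥ H x) ⬝ᵥ pos x * (pos x ⬝ᵥ star (H x))).re
        - 1 / 2 * ‖x‖ ^ 2 * (energyForm ε μ (E x, H x) (E x, H x)).re) := by
  have hI : Complex.I * ω ≠ 0 := mul_ne_zero Complex.I_ne_zero (by exact_mod_cast hω)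
  have div_curl : ∀ {F : R3 → C3}, (∀ i, ContDiff ℝ (⊤ : ℕ∞) fun x => F x i) → ∀ x,
      ∑ j, pd j (fun z => curl F z j) x = 0 := by
    intro F hF x
    have hp : ∀ i j, DifferentiableAt ℝ (pd i fun z => F z j) x := fun i j =>
      (contDiff_pd (hF j)).differentiable (by simp) x
    have e : ∀ i j k l, pd i (fun z => pd j (fun z => F z k) z - pd k (fun z => F z l) z) x
        = pd i (pd j fun z => F z k) x - pd i (pd k fun z => F z l) x := fun i j k l => by
      change fderiv ℝ (fun z => pd j (fun z => F z k) z - pd k (fun z => F z l) z) x _ = _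
      rw [fderiv_fun_sub (hp j k) (hp k l)]
      rfl
    simp only [Fin.sum_univ_three]
    change pd 0 (fun z => pd 1 (fun z => F z 2) z - pd 2 (fun z => F z 1) z) x
      + pd 1 (fun z => pd 2 (fun z => F z 0) z - pd 0 (fun z => F z 2) z) x
      + pd 2 (fun z => pd 0 (fun z => F z 1) z - pd 1 (fun z => F z 0) z) x = 0
    rw [e, e, e, pd_pd_comm (hF 2) (i := 0) (j := 1), pd_pd_comm (hF 1) (i := 2) (j := 0),
      pd_pd_comm (hF 0) (i := 2) (j := 1)]
    ring
  have divE : ∀ x, ∑ j, pd j (fun z => (ε *ᵥ E z) j) x = 0 := fun x => by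
    have h1 := div_curl hH x
    have e : ∀ j, pd j (fun z => curl H z j) x
        = (-(Complex.I * ω)) * pd j (fun z => (ε *ᵥ E z) j) x := fun j => by
      simp only [cH, Pi.smul_apply, smul_eq_mul]
      exact pd_const_mul _ ((contDiff_mulVec ε hE j).differentiable (by simp) x)
    simp only [e, ← Finset.mul_sum] at h1
    exact (mul_eq_zero.1 h1).resolve_left (neg_ne_zero.2 hI)
  have divH : ∀ x, ∑ j, pd j (fun z => (μ *ᵥ H z) j) x = 0 := fun x => by
    have h1 := div_curl hE x
    have e : ∀ j, pd j (fun z => curl E z j) x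
        = (Complex.I * ω) * pd j (fun z => (μ *ᵥ H z) j) x := fun j => by
      simp only [cE, Pi.smul_apply, smul_eq_mul]
      exact pd_const_mul _ ((contDiff_mulVec μ hH j).differentiable (by simp) x)
    simp only [e, ← Finset.mul_sum] at h1
    exact (mul_eq_zero.1 h1).resolve_left hI
  set V : Fin 3 → R3 → ℂ := fun j x => stress ε E j x + stress μ H j x with hV
  have hVs : ∀ j, ContDiff ℝ (⊤ : ℕ∞) (V j) := fun j =>
    (contDiff_stress ε hE j).add (contDiff_stress μ hH j)
  -- the terms with the time derivatives are purely imaginary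
  have divV : ∀ x, (∑ j, pd j (V j) x).re
      = -(1 / 2) * (energyForm ε μ (E x, H x) (E x, H x)).re := fun x => by
    have e : ∀ j, pd j (V j) x = pd j (stress ε E j) x + pd j (stress μ H j) x := fun j =>
      pd_add ((contDiff_stress ε hE j).differentiable (by simp) x)
        ((contDiff_stress μ hH j).differentiable (by simp) x)
    simp only [e, Finset.sum_add_distrib]
    rw [Complex.add_re, re_div_stress hε hE (divE x), re_div_stress hμ hH (divH x), cE, cH,
      energyForm, Complex.add_re]
    have h0 : (crossProduct (ε *ᵥ E x) (pos x) ⬝ᵥ star ((Complex.I * ω) • (μ *ᵥ H x))).re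
        + (crossProduct (μ *ᵥ H x) (pos x) ⬝ᵥ star ((-(Complex.I * ω)) • (ε *ᵥ E x))).re = 0 := by
      generalize ε *ᵥ E x = D
      generalize μ *ᵥ H x = B
      simp [cross_apply, dotProduct, Fin.sum_univ_three, pos]
      ring
    linarith
  have hχ' : LipschitzWith C fun x => (χ x : ℂ) := lipschitzWith_ofReal hχ
  have hc' : HasCompactSupport fun x => (χ x : ℂ) :=
    hc.comp_left (g := fun r : ℝ => (r : ℂ)) Complex.ofReal_zero
  have hV0 : ∀ j, ∫ x, (χ x * pd j (V j) x + V j x * pd j (fun z => (χ z : ℂ)) x) = 0 := fun j => by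
    obtain ⟨B, hB⟩ := exists_lipschitzWith_of_hasCompactSupport
      (LocallyLipschitz.mul_complex hχ'.locallyLipschitz ((hVs j).of_le (by simp)).locallyLipschitz)
      (hc'.mul_right (f' := V j))
    rw [← integral_pd_eq_zero hB hc'.mul_right j]
    refine integral_congr_ae ?_
    filter_upwards [hχ'.ae_differentiableAt (μ := volume)] with x hx
    exact (pd_mul hx ((hVs j).differentiable (by simp) x)).symm
  have i1 : ∀ j, Integrable fun x => (χ x : ℂ) * pd j (V j) x := fun j =>
    (hχ'.continuous.mul (contDiff_pd (hVs j)).continuous).integrable_of_hasCompactSupport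
      hc'.mul_right
  have i2 : ∀ j, Integrable fun x => V j x * pd j (fun z => (χ z : ℂ)) x := fun j => by
    have h1 : IntegrableOn (fun x => V j x * pd j (fun z => (χ z : ℂ)) x)
        (tsupport fun z => (χ z : ℂ)) :=
      ((locallyIntegrable_pd hχ' j).integrableOn_isCompact hc'.isCompact).continuousOn_mul
        (hVs j).continuous.continuousOn hc'.isCompact
    exact h1.integrable_of_forall_notMem_eq_zero fun x hx => by
      rw [pd_eq_zero_of_notMem_tsupport hx, mul_zero]
  have i3 : Integrable fun x => ∑ j, (χ x : ℂ) * pd j (V j) x := integrable_finsetSum _ fun j _ => i1 j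
  have i4 : Integrable fun x => ∑ j, V j x * pd j (fun z => (χ z : ℂ)) x :=
    integrable_finsetSum _ fun j _ => i2 j
  have tot : (∫ x, ∑ j, (χ x : ℂ) * pd j (V j) x)
      + ∫ x, ∑ j, V j x * pd j (fun z => (χ z : ℂ)) x = 0 := by
    rw [integral_finsetSum _ fun j _ => i1 j, integral_finsetSum _ fun j _ => i2 j,
      ← Finset.sum_add_distrib]
    refine Finset.sum_eq_zero fun j _ => ?_
    rw [← integral_add (i1 j) (i2 j), hV0]
  have tot' := congrArg Complex.re tot
  have r3 := integral_re i3
  have r4 := integral_re i4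
  simp only [RCLike.re_eq_complex_re] at r3 r4
  rw [Complex.add_re, ← r3, ← r4, Complex.zero_re] at tot'
  have e3 : ∫ x, (∑ j, (χ x : ℂ) * pd j (V j) x).re
      = -(1 / 2 * ∫ x, χ x * (energyForm ε μ (E x, H x) (E x, H x)).re) := by
    rw [← integral_const_mul, ← integral_neg]
    refine integral_congr_ae (Eventually.of_forall fun x => ?_)
    simp only
    rw [← Finset.mul_sum, Complex.re_ofReal_mul, divV]
    ring
  have e4 : ∫ x, (∑ j, V j x * pd j (fun z => (χ z : ℂ)) x).re
      = ∫ x, g x * (((ε *ᵥ E x) ⬝ᵥ pos x * (pos x ⬝ᵥ star (E x))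
        + (μ *ᵥ H x) ⬝ᵥ pos x * (pos x ⬝ᵥ star (H x))).re
        - 1 / 2 * ‖x‖ ^ 2 * (energyForm ε μ (E x, H x) (E x, H x)).re) := by
    refine integral_congr_ae ?_
    filter_upwards [hg] with x hx
    have h1 : ∑ j, V j x * pd j (fun z => (χ z : ℂ)) x = (g x : ℂ) *
        ((ε *ᵥ E x) ⬝ᵥ pos x * (pos x ⬝ᵥ star (E x))
        + (μ *ᵥ H x) ⬝ᵥ pos x * (pos x ⬝ᵥ star (H x))
        - ((1 / 2 * ‖x‖ ^ 2 : ℝ) : ℂ) * energyForm ε μ (E x, H x) (E x, H x)) := by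
      rw [EuclideanSpace.real_norm_sq_eq]
      simp only [hx, hV, stress, energyForm, coord]
      generalize pos x ⬝ᵥ star (E x) = s₁
      generalize pos x ⬝ᵥ star (H x) = s₂
      generalize (ε *ᵥ E x) ⬝ᵥ star (E x) = t₁
      generalize (μ *ᵥ H x) ⬝ᵥ star (H x) = t₂
      simp only [Fin.sum_univ_three, dotProduct, pos]
      push_cast
      ring
    rw [h1, Complex.re_ofReal_mul, Complex.sub_re, Complex.re_ofReal_mul]
  rw [e3, e4] at tot'
  linarith

lemma norm_pos_le (x : R3) : ‖pos x‖ ≤ ‖x‖ := by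
  refine (pi_norm_le_iff_of_nonneg (norm_nonneg _)).2 fun j => ?_
  rw [pos, Complex.norm_real]
  exact PiLp.norm_apply_le x j

lemma norm_stress_radial_le (ε μ : Matrix (Fin 3) (Fin 3) ℂ) : ∃ C : ℝ, 0 ≤ C ∧
    ∀ (x : R3) (p : C3 × C3), |((ε *ᵥ p.1) ⬝ᵥ pos x * (pos x ⬝ᵥ star p.1)
        + (μ *ᵥ p.2) ⬝ᵥ pos x * (pos x ⬝ᵥ star p.2)).re
        - 1 / 2 * ‖x‖ ^ 2 * (energyForm ε μ p p).re| ≤ C * (‖x‖ ^ 2 * ‖p‖ ^ 2) := by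
  obtain ⟨C₁, h₁, hC₁⟩ := norm_mulVec_le ε
  obtain ⟨C₂, h₂, hC₂⟩ := norm_mulVec_le μ
  obtain ⟨C₃, h₃, hC₃⟩ := norm_energyForm_le ε μ
  have q : ∀ (x : R3) (a : C3) (b : C3) (C s : ℝ), 0 ≤ C → ‖b‖ ≤ C * ‖a‖ → ‖a‖ ≤ s →
      ‖b ⬝ᵥ pos x * (pos x ⬝ᵥ star a)‖ ≤ 9 * C * (‖x‖ ^ 2 * s ^ 2) := fun x a b C s h0 hb hs => by
    have hs0 : 0 ≤ s := (norm_nonneg a).trans hs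
    rw [norm_mul]
    have g1 : ‖b ⬝ᵥ pos x‖ ≤ 3 * (C * s) * ‖x‖ := (norm_dotProduct_le _ _).trans (by
      have := norm_pos_le x
      have := hb.trans (mul_le_mul_of_nonneg_left hs h0)
      gcongr)
    have g2 : ‖pos x ⬝ᵥ star a‖ ≤ 3 * ‖x‖ * s := (norm_dotProduct_le _ _).trans (by
      rw [norm_star]
      have := norm_pos_le x
      gcongr)
    refine (mul_le_mul g1 g2 (norm_nonneg _) (by positivity)).trans_eq ?_
    ring
  refine ⟨9 * C₁ + 9 * C₂ + C₃, by positivity, fun x p => ?_⟩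
  have a1 := q x p.1 _ C₁ ‖p‖ h₁ (hC₁ p.1) (norm_fst_le p)
  have a2 := q x p.2 _ C₂ ‖p‖ h₂ (hC₂ p.2) (norm_snd_le p)
  have a3 := (Complex.abs_re_le_norm _).trans (hC₃ p p)
  have a12 := (Complex.abs_re_le_norm _).trans ((norm_add_le _ _).trans (add_le_add a1 a2))
  refine (abs_sub _ _).trans ?_
  rw [abs_mul, abs_of_nonneg (by positivity : (0 : ℝ) ≤ 1 / 2 * ‖x‖ ^ 2)]
  have a4 := mul_le_mul_of_nonneg_left a3 (by positivity : (0 : ℝ) ≤ 1 / 2 * ‖x‖ ^ 2)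
  have a5 : 0 ≤ C₃ * (‖x‖ ^ 2 * ‖p‖ ^ 2) := by positivity
  nlinarith

/-- The time-harmonic Maxwell equations, at a frequency `ω ≠ 0`, have no smooth square integrable
solutions in a homogeneous background. -/
lemma ae_eq_zero_of_memLp_of_smooth {ε μ : Matrix (Fin 3) (Fin 3) ℂ} (hε : ε.PosDef)
    (hμ : μ.PosDef) {ω : ℝ} (hω : ω ≠ 0) {E H : R3 → C3}
    (hE : ∀ i, ContDiff ℝ (⊤ : ℕ∞) fun x => E x i) (hH : ∀ i, ContDiff ℝ (⊤ : ℕ∞) fun x => H x i)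
    (cE : ∀ x, curl E x = (Complex.I * ω) • (μ *ᵥ H x))
    (cH : ∀ x, curl H x = (-(Complex.I * ω)) • (ε *ᵥ E x))
    (hL : MemLp (fun x => (E x, H x)) 2 volume) : ∀ᵐ x, (E x, H x) = 0 := by
  set m : EMField := fun x => (E x, H x) with hm
  obtain ⟨C, hC0, hC⟩ := norm_stress_radial_le ε μ
  obtain ⟨c, hc, hle⟩ := exists_energyForm_ge hε hμ
  have ie : Integrable fun x => (energyForm ε μ (m x) (m x)).re :=
    (integrable_energyForm ε μ hL hL).re
  have i2 : Integrable fun x => ‖m x‖ ^ 2 := hL.integrable_norm_pow (by norm_num)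
  have t1 : Tendsto (fun n : ℕ => ∫ x, tent (n + 1) x * (energyForm ε μ (m x) (m x)).re) atTop
      (𝓝 (∫ x, (energyForm ε μ (m x) (m x)).re)) := by
    refine tendsto_integral_of_dominated_convergence _ (fun n => ?_) ie.norm
      (fun n => Eventually.of_forall fun x => ?_) (Eventually.of_forall fun x => ?_)
    · exact (lipschitzWith_tent (by positivity)).continuous.aestronglyMeasurable.mul ie.1
    · rw [norm_mul, Real.norm_of_nonneg (tent_nonneg _ _)]
      exact mul_le_of_le_one_left (norm_nonneg _) (tent_le_one (by positivity) x)
    · simpa using (tendsto_tent x).mul_const (energyForm ε μ (m x) (m x)).re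
  set r : ℕ → R3 → ℝ := fun n x =>
    (if ‖x‖ < (n : ℝ) + 1 then ‖x‖ / ((n : ℝ) + 1) else 0) * ‖m x‖ ^ 2 with hr
  have t2 : Tendsto (fun n : ℕ => ∫ x, r n x) atTop (𝓝 (∫ _ : R3, (0 : ℝ))) := by
    refine tendsto_integral_of_dominated_convergence _ (fun n => ?_) i2.norm
      (fun n => Eventually.of_forall fun x => ?_) (Eventually.of_forall fun x => ?_)
    · refine (Measurable.ite (measurableSet_lt measurable_norm measurable_const)
        (measurable_norm.div_const _) measurable_const).aestronglyMeasurable.mul i2.1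
    · have hn : (0 : ℝ) < n + 1 := by positivity
      rw [hr, norm_mul]
      refine mul_le_of_le_one_left (norm_nonneg _) ?_
      split_ifs with h
      · rw [Real.norm_of_nonneg (by positivity), div_le_one hn]
        exact h.le
      · simp
    · have h1 : Tendsto (fun n : ℕ => (‖x‖ * ‖m x‖ ^ 2) * (1 / ((n : ℝ) + 1))) atTop (𝓝 0) := by
        simpa using tendsto_one_div_add_atTop_nhds_zero_nat.const_mul (‖x‖ * ‖m x‖ ^ 2)
      refine squeeze_zero (fun n => ?_) (fun n => ?_) h1
      · simp only [hr]
        split_ifs <;> positivity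
      · simp only [hr]
        have : 0 ≤ (‖x‖ * ‖m x‖ ^ 2) * (1 / ((n : ℝ) + 1)) := by positivity
        split_ifs
        · exact le_of_eq (by ring)
        · simpa using this
  have hb : ∀ n : ℕ, 1 / 2 * ∫ x, tent (n + 1) x * (energyForm ε μ (m x) (m x)).re
      ≤ C * ∫ x, r n x := fun n => by
    have hn : (0 : ℝ) < n + 1 := by positivity
    rw [integral_energyForm_radial hε.1 hμ.1 hω hE hH cE cH
      (g := fun x => if ‖x‖ < (n : ℝ) + 1 then -(1 / (((n : ℝ) + 1) * ‖x‖)) else 0)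
      (lipschitzWith_tent hn)
      (hasCompactSupport_tent (R := (n : ℝ) + 1) hn |>.comp_left (g := Complex.re) rfl) ?_]
    · have ir : Integrable (r n) := by
        refine i2.mono' ?_ (Eventually.of_forall fun x => ?_)
        · refine (Measurable.ite (measurableSet_lt measurable_norm measurable_const)
            (measurable_norm.div_const _) measurable_const).aestronglyMeasurable.mul i2.1
        · rw [hr, norm_mul, Real.norm_of_nonneg (by positivity : 0 ≤ ‖m x‖ ^ 2)]
          refine mul_le_of_le_one_left (by positivity) ?_
          split_ifs with h
          · rw [Real.norm_of_nonneg (by positivity), div_le_one hn]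
            exact h.le
          · simp
      rw [← integral_const_mul]
      refine (Real.le_norm_self _).trans (norm_integral_le_of_norm_le (ir.const_mul C)
        (Eventually.of_forall fun x => ?_))
      rw [norm_mul]
      have h1 := mul_le_mul_of_nonneg_left (hC x (m x)) (norm_nonneg
        (if ‖x‖ < (n : ℝ) + 1 then -(1 / (((n : ℝ) + 1) * ‖x‖)) else 0))
      refine h1.trans_eq ?_
      simp only [hr]
      split_ifs
      · rw [norm_neg, Real.norm_of_nonneg (by positivity)]
        by_cases hx : ‖x‖ = 0
        · simp [hx]
        · field_simp
      · simp
    · filter_upwards [ae_grad_tent hn] with x hx j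
      rw [hx]
      split_ifs
      · congr 1
        ring
      · simp
  have h0 : ∫ x, (energyForm ε μ (m x) (m x)).re ≤ 0 := by
    rw [integral_zero] at t2
    have := le_of_tendsto_of_tendsto' (t1.const_mul (1 / 2)) (t2.const_mul C) hb
    linarith
  have h1 : ∫ x, ‖m x‖ ^ 2 = 0 := by
    refine le_antisymm ?_ (integral_nonneg fun x => by positivity)
    have := (integral_mono (i2.const_mul c) ie fun x => hle (m x)).trans h0
    rw [integral_const_mul] at this
    exact nonpos_of_mul_nonpos_right this hc
  rw [integral_eq_zero_iff_of_nonneg (fun x => by positivity) i2] at h1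
  filter_upwards [h1] with x hx
  exact norm_eq_zero.1 (pow_eq_zero_iff two_ne_zero |>.1 hx)

/-- The radial function which is `1 / a - 1 / R` for `|x| ≤ a`, `1 / |x| - 1 / R` for
`a ≤ |x| ≤ R` and vanishes for `|x| ≥ R`. -/
def coulomb (a R : ℝ) (x : R3) : ℝ := max ((max ‖x‖ a)⁻¹ - R⁻¹) 0

lemma lipschitzWith_coulomb {a R : ℝ} (ha : 0 < a) :
    LipschitzWith ((a ^ 2)⁻¹).toNNReal (coulomb a R) := by
  refine LipschitzWith.max_const (LipschitzWith.of_dist_le_mul fun x y => ?_) 0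
  have hx : a ≤ max ‖x‖ a := le_max_right _ _
  have hy : a ≤ max ‖y‖ a := le_max_right _ _
  have hxy : |max ‖y‖ a - max ‖x‖ a| ≤ dist x y := by
    refine (abs_max_sub_max_le_abs _ _ _).trans ?_
    rw [dist_comm, dist_eq_norm]
    exact abs_norm_sub_norm_le y x
  rw [Real.coe_toNNReal _ (by positivity), Real.dist_eq, sub_sub_sub_cancel_right,
    inv_sub_inv (by linarith) (by linarith), abs_div, abs_of_pos (a := _ * _)
      (mul_pos (by linarith) (by linarith)), div_eq_inv_mul]
  gcongr
  nlinarith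

/-- In an isotropic background the mean energy `R⁻¹ ∫_{|x| < R} e` of a smooth solution increases
with `R`. -/
lemma energy_monotone_of_smooth {ε μ : ℝ} (hε : 0 < ε) (hμ : 0 < μ) {ω : ℝ} (hω : ω ≠ 0)
    {E H : R3 → C3}
    (hE : ∀ i, ContDiff ℝ (⊤ : ℕ∞) fun x => E x i) (hH : ∀ i, ContDiff ℝ (⊤ : ℕ∞) fun x => H x i)
    (cE : ∀ x, curl E x = (Complex.I * ω) • (diagonal (fun _ => (μ : ℂ)) *ᵥ H x))
    (cH : ∀ x, curl H x = (-(Complex.I * ω)) • (diagonal (fun _ => (ε : ℂ)) *ᵥ E x))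
    {a R : ℝ} (ha : 0 < a) (haR : a < R) :
    a⁻¹ * ∫ x in Metric.ball (0 : R3) a, (energyForm (diagonal fun _ => (ε : ℂ))
        (diagonal fun _ => (μ : ℂ)) (E x, H x) (E x, H x)).re ≤
      R⁻¹ * ∫ x in Metric.ball (0 : R3) R, (energyForm (diagonal fun _ => (ε : ℂ))
        (diagonal fun _ => (μ : ℂ)) (E x, H x) (E x, H x)).re := by
  have hR : 0 < R := ha.trans haR
  have herm : ∀ t : ℝ, (diagonal fun _ : Fin 3 => (t : ℂ)).IsHermitian := fun t =>
    isHermitian_diagonal_iff.2 fun _ => by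
      rw [isSelfAdjoint_iff]; exact Complex.conj_ofReal t
  set e : R3 → ℝ := fun x => (energyForm (diagonal fun _ => (ε : ℂ))
        (diagonal fun _ => (μ : ℂ)) (E x, H x) (E x, H x)).re with he
  have hec : Continuous e := by
    have h1 : Continuous fun x => (E x, H x) :=
      (continuous_pi fun i => (hE i).continuous).prodMk (continuous_pi fun i => (hH i).continuous)
    exact Complex.continuous_re.comp ((continuous_energyForm_self _ _).comp h1)
  have hei : ∀ r : ℝ, Integrable ((Metric.ball (0 : R3) r).indicator e) := fun r =>
    (integrable_indicator_iff measurableSet_ball).2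
      ((hec.continuousOn.integrableOn_compact (isCompact_closedBall (0 : R3) r)).mono_set
        Metric.ball_subset_closedBall)
  set g : R3 → ℝ := fun x => if a < ‖x‖ ∧ ‖x‖ < R then -(‖x‖ ^ 3)⁻¹ else 0 with hg
  have hχ0 : ∀ r, R ≤ r → max ((max r a)⁻¹ - R⁻¹) 0 = 0 := fun r hr => by
    refine max_eq_right (sub_nonpos.2 (inv_anti₀ hR (hr.trans (le_max_left _ _))))
  have hc : HasCompactSupport (coulomb a R) :=
    HasCompactSupport.intro (isCompact_closedBall (0 : R3) R) fun x hx => by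
      rw [mem_closedBall_zero_iff, not_le] at hx
      exact hχ0 _ hx.le
  have hgχ : ∀ᵐ x, ∀ j, pd j (fun z => (coulomb a R z : ℂ)) x = ((g x * x j : ℝ) : ℂ) := by
    filter_upwards [ae_norm_ne a, ae_norm_ne R, ae_norm_ne 0] with x h1 h2 h0 j
    have e1 : (fun z => (coulomb a R z : ℂ))
      = fun z : R3 => (((fun r => max ((max r a)⁻¹ - R⁻¹) 0) ‖z‖ : ℝ) : ℂ) := rfl
    rw [e1, hg]
    simp only
    split_ifs with h
    · have hd : HasDerivAt (fun r => max ((max r a)⁻¹ - R⁻¹) 0) (-(‖x‖ ^ 2)⁻¹) ‖x‖ := by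
        refine ((hasDerivAt_inv h0).sub_const R⁻¹).congr_of_eventuallyEq ?_
        filter_upwards [lt_mem_nhds h.1, gt_mem_nhds h.2] with r hr1 hr2
        rw [max_eq_left hr1.le]
        exact max_eq_left (sub_nonneg.2 (inv_anti₀ (ha.trans hr1) hr2.le))
      rw [pd_radial (norm_ne_zero_iff.1 h0) hd]
      congr 1
      field_simp
    · rw [zero_mul, Complex.ofReal_zero]
      rcases lt_or_gt_of_ne h1 with h1 | h1
      · have : (fun z : R3 => (((fun r => max ((max r a)⁻¹ - R⁻¹) 0) ‖z‖ : ℝ) : ℂ))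
            =ᶠ[𝓝 x] fun _ => ((max (a⁻¹ - R⁻¹) 0 : ℝ) : ℂ) := by
          filter_upwards [continuous_norm.continuousAt.eventually (gt_mem_nhds h1)] with z hz
          simp only [max_eq_right hz.le]
        rw [pd_congr this, pd_const]
      · have h3 : R < ‖x‖ := lt_of_le_of_ne (not_lt.1 fun h4 => h ⟨h1, h4⟩) (Ne.symm h2)
        exact pd_radial_of_lt hχ0 h3 j
  have key := integral_energyForm_radial (herm ε) (herm μ) hω hE hH cE cH
    (lipschitzWith_coulomb (R := R) ha) hc hgχ
  have hQ : ∀ x, 0 ≤ (((diagonal fun _ => (ε : ℂ)) *ᵥ E x) ⬝ᵥ pos x * (pos x ⬝ᵥ star (E x))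
        + ((diagonal fun _ => (μ : ℂ)) *ᵥ H x) ⬝ᵥ pos x * (pos x ⬝ᵥ star (H x))).re := fun x => by
    have h1 : ∀ (t : ℝ) (F : C3), ((diagonal fun _ => (t : ℂ)) *ᵥ F) ⬝ᵥ pos x * (pos x ⬝ᵥ star F)
        = ((t * ‖F ⬝ᵥ pos x‖ ^ 2 : ℝ) : ℂ) := fun t F => by
      have h2 : (diagonal fun _ : Fin 3 => (t : ℂ)) *ᵥ F = (t : ℂ) • F := by
        ext i
        rw [mulVec_diagonal]
        rfl
      have h3 : pos x ⬝ᵥ star F = star (F ⬝ᵥ pos x) := by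
        rw [← star_dotProduct_star]
        have : star (pos x) = pos x := funext fun j => Complex.conj_ofReal _
        rw [this]
      rw [h2, h3, smul_dotProduct, smul_eq_mul, mul_assoc]
      push_cast
      congr 1
      exact Complex.mul_conj' _
    rw [h1, h1, ← Complex.ofReal_add, Complex.ofReal_re]
    positivity
  have hgi : ∀ f : R3 → ℝ, Continuous f → Integrable fun x => g x * f x := fun f hf => by
    have hgm : Measurable g := Measurable.ite ((measurableSet_lt measurable_const
      measurable_norm).inter (measurableSet_lt measurable_norm measurable_const))
      (measurable_norm.pow_const 3).inv.neg measurable_const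
    have h1 : IntegrableOn (fun x => g x * f x) (Metric.closedBall 0 R) := by
      refine (hf.continuousOn.integrableOn_compact (isCompact_closedBall (0 : R3) R)).bdd_mul
        (c := (a ^ 3)⁻¹) hgm.aestronglyMeasurable (Eventually.of_forall fun x => ?_)
      simp only [hg]
      split_ifs with h
      · rw [norm_neg, norm_inv, norm_pow, norm_norm]
        have := h.1.le
        gcongr
      · rw [norm_zero]
        positivity
    refine h1.integrable_of_forall_notMem_eq_zero fun x hx => ?_
    rw [mem_closedBall_zero_iff, not_le] at hx
    simp only [hg]
    rw [if_neg fun h => absurd h.2 hx.not_gt, zero_mul]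
  have hQc : Continuous fun x => (((diagonal fun _ => (ε : ℂ)) *ᵥ E x) ⬝ᵥ pos x * (pos x ⬝ᵥ star (E x))
        + ((diagonal fun _ => (μ : ℂ)) *ᵥ H x) ⬝ᵥ pos x * (pos x ⬝ᵥ star (H x))).re := by
    have h1 : Continuous E := continuous_pi fun i => (hE i).continuous
    have h2 : Continuous H := continuous_pi fun i => (hH i).continuous
    have h3 : Continuous pos := contDiff_pos.continuous
    fun_prop
  have hne : Continuous fun x : R3 => 1 / 2 * ‖x‖ ^ 2 * e x := by fun_prop
  have i1 := hgi _ (hQc.sub hne)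
  have i2 := hgi _ hne
  have i3 : Integrable fun x => coulomb a R x * e x :=
    ((lipschitzWith_coulomb ha).continuous.mul hec).integrable_of_hasCompactSupport hc.mul_right
  have h1 : 1 / 2 * ∫ x, coulomb a R x * e x ≤ -∫ x, g x * (1 / 2 * ‖x‖ ^ 2 * e x) := by
    rw [key, ← integral_neg]
    refine integral_mono i1 i2.neg fun x => ?_
    have h2 : g x ≤ 0 := by
      simp only [hg]
      split_ifs
      · exact neg_nonpos.2 (by positivity)
      · exact le_rfl
    have := mul_nonpos_of_nonpos_of_nonneg h2 (hQ x)
    simp only [mul_sub]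
    linarith
  have h2 : ∫ x, (a⁻¹ * (Metric.ball (0 : R3) a).indicator e x
      - R⁻¹ * (Metric.ball (0 : R3) R).indicator e x)
      = 2 * (1 / 2 * ∫ x, coulomb a R x * e x) + 2 * ∫ x, g x * (1 / 2 * ‖x‖ ^ 2 * e x) := by
    rw [← integral_const_mul, ← integral_const_mul, ← integral_const_mul,
      ← integral_add ((i3.const_mul _).const_mul _) (i2.const_mul _)]
    refine integral_congr_ae ?_
    filter_upwards [ae_norm_ne a, ae_norm_ne R] with x hxa hxR
    simp only [Set.indicator, mem_ball_zero_iff, hg, coulomb]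
    rcases lt_or_gt_of_ne hxa with h | h
    · have h3 : ‖x‖ < R := h.trans haR
      have h4 : R⁻¹ ≤ a⁻¹ := inv_anti₀ ha haR.le
      rw [if_pos h, if_pos h3, if_neg fun h5 => h5.1.not_gt h, max_eq_right h.le,
        max_eq_left (sub_nonneg.2 h4)]
      ring
    · rw [if_neg h.not_gt, max_eq_left h.le]
      rcases lt_or_gt_of_ne hxR with h3 | h3
      · rw [if_pos h3, if_pos ⟨h, h3⟩, max_eq_left (sub_nonneg.2 (inv_anti₀ (ha.trans h) h3.le))]
        have := (ha.trans h).ne'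
        field_simp
        ring
      · rw [if_neg h3.not_gt, if_neg fun h5 => h5.2.not_gt h3,
          max_eq_right (sub_nonpos.2 (inv_anti₀ hR h3.le))]
        ring
  rw [integral_sub ((hei a).const_mul _) ((hei R).const_mul _), integral_const_mul,
    integral_const_mul, integral_indicator measurableSet_ball,
    integral_indicator measurableSet_ball] at h2
  linarith

/-! ### Uniqueness in the background -/

lemma mollField_smul_mulVec (n : ℕ) {F : R3 → C3} (hF : LocallyIntegrable F) (c : ℂ)
    (M : Matrix (Fin 3) (Fin 3) ℂ) (x : R3) :
    mollField n (fun z => c • (M *ᵥ F z)) x = c • (M *ᵥ mollField n F x) := by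
  ext i
  have hi := fun k => integrable_mollifier_smul n (locallyIntegrable_comp hF k) x
  have h1 : ∀ k, moll n (fun z => F z k) x = ∫ t, mollifier n t • F (x - t) k := fun k =>
    moll_apply n _ x
  simp only [mollField, Pi.smul_apply, mulVec, dotProduct, smul_eq_mul, h1]
  rw [moll_apply]
  simp only [← integral_const_mul]
  rw [← integral_finsetSum _ fun k _ => (hi k).const_mul _, ← integral_const_mul]
  refine integral_congr_ae (Eventually.of_forall fun t => ?_)
  simp only [Complex.real_smul, Finset.mul_sum]
  exact Finset.sum_congr rfl fun k _ => by ring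

/-- The mollification of an electromagnetic field. -/
def mollEM (n : ℕ) (u : EMField) (x : R3) : C3 × C3 :=
  (mollField n (fun z => (u z).1) x, mollField n (fun z => (u z).2) x)

lemma norm_sq_le_sum_sq (a : C3) : ‖a‖ ^ 2 ≤ ∑ i, ‖a i‖ ^ 2 := by
  by_cases ha : a = 0
  · simp [ha]
  rw [← Real.le_sqrt' (norm_pos_iff.2 ha)]
  refine (pi_norm_le_iff_of_nonneg (Real.sqrt_nonneg _)).2 fun i => Real.le_sqrt_of_sq_le ?_
  exact Finset.single_le_sum (f := fun i => ‖a i‖ ^ 2) (fun i _ => by positivity)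
    (Finset.mem_univ i)

lemma norm_sq_le_sum (p : C3 × C3) : ‖p‖ ^ 2 ≤ ∑ i, ‖p.1 i‖ ^ 2 + ∑ i, ‖p.2 i‖ ^ 2 := by
  rcases max_choice ‖p.1‖ ‖p.2‖ with h1 | h1
  · rw [Prod.norm_def, h1]
    have : 0 ≤ ∑ i, ‖p.2 i‖ ^ 2 := Finset.sum_nonneg fun i _ => by positivity
    linarith [norm_sq_le_sum_sq p.1]
  · rw [Prod.norm_def, h1]
    have : 0 ≤ ∑ i, ‖p.1 i‖ ^ 2 := Finset.sum_nonneg fun i _ => by positivity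
    linarith [norm_sq_le_sum_sq p.2]

lemma L2Loc.integrableOn_sq {E : Type*} [NormedAddCommGroup E] {f : R3 → E} (hf : L2Loc f)
    (R : ℝ) : IntegrableOn (fun x => ‖f x‖ ^ 2) (Metric.ball 0 R) :=
  (hf R).integrable_norm_pow (by norm_num)

lemma l2Loc_of_continuous {E : Type*} [NormedAddCommGroup E] {f : R3 → E} (hf : Continuous f) : L2Loc f := fun R => by
  obtain ⟨C, hC⟩ := (isCompact_closedBall (0 : R3) R).exists_bound_of_continuousOn hf.continuousOn
  have hfin : IsFiniteMeasure (volume.restrict (Metric.ball (0 : R3) R)) :=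
    ⟨by simpa using (Metric.isBounded_ball (x := (0 : R3))).measure_lt_top (μ := volume)⟩
  refine MemLp.of_bound hf.aestronglyMeasurable.restrict C ?_
  filter_upwards [ae_restrict_mem measurableSet_ball] with x hx
  exact hC x (Metric.ball_subset_closedBall hx)

lemma integral_mollField_sq_le (n : ℕ) {w : R3 → ℂ} (hw : L2Loc w) (R : ℝ) :
    ∫ x in Metric.ball 0 R, ‖moll n w x‖ ^ 2 ≤ ∫ x in Metric.ball 0 (R + 1), ‖w x‖ ^ 2 := by
  have e : ∀ z : ℂ, ENNReal.ofReal (‖z‖ ^ 2) = ‖z‖ₑ ^ (2 : ℝ) := fun z => by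
    rw [← ofReal_norm, ENNReal.ofReal_rpow_of_nonneg (norm_nonneg _) (by norm_num)]
    norm_cast
  rw [← ENNReal.ofReal_le_ofReal_iff (integral_nonneg fun x => by positivity),
    ofReal_integral_eq_lintegral_ofReal
      ((l2Loc_of_continuous (contDiff_moll n hw.locallyIntegrable).continuous).integrableOn_sq R)
      (Eventually.of_forall fun x => by positivity),
    ofReal_integral_eq_lintegral_ofReal (hw.integrableOn_sq (R + 1))
      (Eventually.of_forall fun x => by positivity)]
  simp only [e]
  exact lintegral_moll_sq_le n hw.aestronglyMeasurable R

lemma continuous_mollEM (n : ℕ) {u : EMField} (hu : L2Loc u) : Continuous (mollEM n u) :=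
  (continuous_pi fun i => (contDiff_mollField n hu.fst.locallyIntegrable i).continuous).prodMk
    (continuous_pi fun i => (contDiff_mollField n hu.snd.locallyIntegrable i).continuous)

lemma integral_mollEM_sq_le (n : ℕ) {u : EMField} (hu : L2Loc u) (R : ℝ) :
    ∫ x in Metric.ball 0 R, ‖mollEM n u x‖ ^ 2 ≤ 6 * ∫ x in Metric.ball 0 (R + 1), ‖u x‖ ^ 2 := by
  have l1 := l2Loc_pi.1 hu.fst
  have l2 := l2Loc_pi.1 hu.snd
  have c1 : ∀ i, L2Loc fun x => mollField n (fun z => (u z).1) x i := fun i =>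
    l2Loc_of_continuous (contDiff_mollField n hu.fst.locallyIntegrable i).continuous
  have c2 : ∀ i, L2Loc fun x => mollField n (fun z => (u z).2) x i := fun i =>
    l2Loc_of_continuous (contDiff_mollField n hu.snd.locallyIntegrable i).continuous
  have i1 : IntegrableOn (fun x => ∑ i, ‖mollField n (fun z => (u z).1) x i‖ ^ 2)
      (Metric.ball 0 R) := integrable_finsetSum _ fun i _ => (c1 i).integrableOn_sq R
  have i2 : IntegrableOn (fun x => ∑ i, ‖mollField n (fun z => (u z).2) x i‖ ^ 2)
      (Metric.ball 0 R) := integrable_finsetSum _ fun i _ => (c2 i).integrableOn_sq R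
  have b : ∀ {w : R3 → ℂ}, L2Loc w → (∀ x, ‖w x‖ ≤ ‖u x‖) →
      ∫ x in Metric.ball 0 R, ‖moll n w x‖ ^ 2 ≤ ∫ x in Metric.ball 0 (R + 1), ‖u x‖ ^ 2 :=
    fun hw hle => (integral_mollField_sq_le n hw R).trans
      (setIntegral_mono (hw.integrableOn_sq _) (hu.integrableOn_sq _) fun x =>
        pow_le_pow_left₀ (norm_nonneg _) (hle x) 2)
  refine (setIntegral_mono ((l2Loc_of_continuous (continuous_mollEM n hu)).integrableOn_sq R)
    (i1.add i2) fun x => norm_sq_le_sum _).trans ?_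
  simp only [Pi.add_apply]
  rw [integral_add i1 i2, integral_finsetSum _ fun i _ => (c1 i).integrableOn_sq R,
    integral_finsetSum _ fun i _ => (c2 i).integrableOn_sq R, Fin.sum_univ_three, Fin.sum_univ_three]
  have g1 : ∀ i, ∫ x in Metric.ball 0 R, ‖mollField n (fun z => (u z).1) x i‖ ^ 2
      ≤ ∫ x in Metric.ball 0 (R + 1), ‖u x‖ ^ 2 := fun i =>
    b (l1 i) fun x => (norm_le_pi_norm _ i).trans (norm_fst_le (u x))
  have g2 : ∀ i, ∫ x in Metric.ball 0 R, ‖mollField n (fun z => (u z).2) x i‖ ^ 2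
      ≤ ∫ x in Metric.ball 0 (R + 1), ‖u x‖ ^ 2 := fun i =>
    b (l2 i) fun x => (norm_le_pi_norm _ i).trans (norm_snd_le (u x))
  linarith [g1 0, g1 1, g1 2, g2 0, g2 1, g2 2]

/-- A field vanishes if its mollifications do. -/
lemma ae_eq_zero_of_mollEM {u : EMField} (hu : L2Loc u) (h : ∀ n, ∀ᵐ x, mollEM n u x = 0) :
    ∀ᵐ x, u x = 0 := by
  have t1 := fun i => ae_tendsto_moll (l2Loc_pi.1 hu.fst i).locallyIntegrable
  have t2 := fun i => ae_tendsto_moll (l2Loc_pi.1 hu.snd i).locallyIntegrable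
  filter_upwards [ae_all_iff.2 t1, ae_all_iff.2 t2, ae_all_iff.2 h] with x h1 h2 h0
  have z1 : ∀ n i, moll n (fun z => (u z).1 i) x = 0 := fun n i =>
    congrFun (congrArg Prod.fst (h0 n)) i
  have z2 : ∀ n i, moll n (fun z => (u z).2 i) x = 0 := fun n i =>
    congrFun (congrArg Prod.snd (h0 n)) i
  refine Prod.ext (funext fun i => ?_) (funext fun i => ?_)
  · exact tendsto_nhds_unique (h1 i) (tendsto_const_nhds.congr fun n => (z1 n i).symm)
  · exact tendsto_nhds_unique (h2 i) (tendsto_const_nhds.congr fun n => (z2 n i).symm)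

/-- The mollification of a time-harmonic solution is a smooth solution. -/
lemma WeakMaxwell.curl_mollEM {ε μ : Matrix (Fin 3) (Fin 3) ℂ} {ω : ℝ} {d : EMField}
    (ld : L2Loc d) (hd : WeakMaxwell Set.univ (fun _ => ε) (fun _ => μ) d ((ω : ℂ) • d)) (n : ℕ) :
    (∀ x, curl (mollField n fun z => (d z).1) x =
      (Complex.I * ω) • (μ *ᵥ mollField n (fun z => (d z).2) x)) ∧
    ∀ x, curl (mollField n fun z => (d z).2) x =
      (-(Complex.I * ω)) • (ε *ᵥ mollField n (fun z => (d z).1) x) := by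
  constructor <;> intro x
  · rw [curl_mollField n hd.1, ← mollField_smul_mulVec n ld.snd.locallyIntegrable]
    simp only [Pi.smul_apply, Prod.smul_snd, mulVec_smul, smul_smul]
  · rw [curl_mollField n hd.2, ← mollField_smul_mulVec n ld.fst.locallyIntegrable]
    simp only [Pi.smul_apply, Prod.smul_fst, mulVec_smul, smul_smul, neg_mul]

/-- A homogeneous background has no eigenfunctions at nonzero frequencies. -/
lemma ae_eq_zero_of_memLp {ε μ : Matrix (Fin 3) (Fin 3) ℂ} (hε : ε.PosDef) (hμ : μ.PosDef)
    {ω : ℝ} (hω : ω ≠ 0) {d : EMField} (ld : MemLp d 2 volume)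
    (hd : WeakMaxwell Set.univ (fun _ => ε) (fun _ => μ) d ((ω : ℂ) • d)) : ∀ᵐ x, d x = 0 := by
  have ll := MemLp.l2Loc ld
  refine ae_eq_zero_of_mollEM ll fun n => ?_
  have hc := hd.curl_mollEM ll n
  refine ae_eq_zero_of_memLp_of_smooth hε hμ hω
    (contDiff_mollField n ll.fst.locallyIntegrable) (contDiff_mollField n ll.snd.locallyIntegrable)
    hc.1 hc.2 ?_
  have i2 : Integrable fun x => ‖d x‖ ^ 2 := ld.integrable_norm_pow (by norm_num)
  have lm := l2Loc_of_continuous (continuous_mollEM n ll)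
  refine memLp_two_of_forall_ball (d := mollEM n d) (continuous_mollEM n ll).aestronglyMeasurable
    (K := ENNReal.ofReal (6 * ∫ x, ‖d x‖ ^ 2) ^ (1 / 2 : ℝ))
    (ENNReal.rpow_ne_top_of_nonneg (by norm_num) ENNReal.ofReal_ne_top) fun r => ?_
  rw [one_div, ENNReal.le_rpow_inv_iff (by norm_num), eLpNorm_two_sq]
  have e : ∀ z : C3 × C3, ‖z‖ₑ ^ (2 : ℝ) = ENNReal.ofReal (‖z‖ ^ 2) := fun z => by
    rw [← ofReal_norm, ENNReal.ofReal_rpow_of_nonneg (norm_nonneg _) (by norm_num)]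
    norm_cast
  simp only [e]
  rw [← ofReal_integral_eq_lintegral_ofReal (lm.integrableOn_sq r)
    (Eventually.of_forall fun x => by positivity)]
  refine ENNReal.ofReal_le_ofReal ((integral_mollEM_sq_le n ll r).trans ?_)
  exact mul_le_mul_of_nonneg_left
    (setIntegral_le_integral i2 (Eventually.of_forall fun x => by positivity)) (by norm_num)

lemma posDef_diagonal {t : ℝ} (ht : 0 < t) : (diagonal fun _ : Fin 3 => (t : ℂ)).PosDef :=
  PosDef.diagonal fun _ => by exact_mod_cast ht

/-- A solution in an isotropic background vanishes if its mean energy tends to zero. -/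
lemma ae_eq_zero_of_tendsto {ε μ : ℝ} (hε : 0 < ε) (hμ : 0 < μ) {ω : ℝ} (hω : ω ≠ 0)
    {d : EMField} (ld : L2Loc d)
    (hd : WeakMaxwell Set.univ (fun _ => diagonal fun _ => (ε : ℂ))
      (fun _ => diagonal fun _ => (μ : ℂ)) d ((ω : ℂ) • d))
    (hlim : Tendsto (fun R : ℝ => R⁻¹ * ∫ x in Metric.ball 0 R, ‖d x‖ ^ 2) atTop (𝓝 0)) :
    ∀ᵐ x, d x = 0 := by
  refine ae_eq_zero_of_mollEM ld fun n => ?_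
  have hc := hd.curl_mollEM ld n
  set M₁ := diagonal fun _ : Fin 3 => (ε : ℂ) with hM₁
  set M₂ := diagonal fun _ : Fin 3 => (μ : ℂ) with hM₂
  obtain ⟨C, hC0, hC⟩ := norm_energyForm_le M₁ M₂
  obtain ⟨c, hc0, hle⟩ := exists_energyForm_ge (posDef_diagonal hε) (posDef_diagonal hμ)
  have hmc := continuous_mollEM n ld
  have lm := l2Loc_of_continuous hmc
  have hei : ∀ r : ℝ, IntegrableOn (fun x => (energyForm M₁ M₂ (mollEM n d x) (mollEM n d x)).re)
      (Metric.ball (0 : R3) r) := fun r => (integrable_energyForm M₁ M₂ (lm r) (lm r)).re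
  have hball : ∀ a : ℝ, 0 < a → ∫ x in Metric.ball (0 : R3) a, ‖mollEM n d x‖ ^ 2 = 0 := by
    intro a ha
    have t1 : Tendsto (fun R : ℝ => (6 * C) * ((R⁻¹ * (R + 1)) *
        ((R + 1)⁻¹ * ∫ x in Metric.ball 0 (R + 1), ‖d x‖ ^ 2))) atTop (𝓝 ((6 * C) * ((1 + 0) * 0))) := by
      refine (Tendsto.mul ?_ (hlim.comp (tendsto_atTop_add_const_right _ _ tendsto_id))).const_mul _
      refine (tendsto_const_nhds.add tendsto_inv_atTop_zero).congr' ?_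
      filter_upwards [eventually_gt_atTop 0] with R hR
      field_simp
    have h1 : a⁻¹ * ∫ x in Metric.ball (0 : R3) a,
        (energyForm M₁ M₂ (mollEM n d x) (mollEM n d x)).re ≤ (6 * C) * ((1 + 0) * 0) := by
      refine ge_of_tendsto t1 ?_
      filter_upwards [eventually_gt_atTop a] with R hR
      have hR0 : 0 < R := ha.trans hR
      refine (energy_monotone_of_smooth hε hμ hω (contDiff_mollField n ld.fst.locallyIntegrable)
        (contDiff_mollField n ld.snd.locallyIntegrable) hc.1 hc.2 ha hR).trans ?_
      have h2 : ∫ x in Metric.ball (0 : R3) R, (energyForm M₁ M₂ (mollEM n d x) (mollEM n d x)).re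
          ≤ C * (6 * ∫ x in Metric.ball 0 (R + 1), ‖d x‖ ^ 2) := by
        refine (setIntegral_mono (hei R) ((lm.integrableOn_sq R).const_mul C) fun x => ?_).trans ?_
        · refine (Complex.re_le_norm _).trans ((hC _ _).trans_eq ?_)
          ring
        · rw [integral_const_mul]
          exact mul_le_mul_of_nonneg_left (integral_mollEM_sq_le n ld R) hC0
      refine (mul_le_mul_of_nonneg_left h2 (by positivity)).trans_eq ?_
      have : R + 1 ≠ 0 := by positivity
      field_simp
    have h3 : ∫ x in Metric.ball (0 : R3) a,
        (energyForm M₁ M₂ (mollEM n d x) (mollEM n d x)).re ≤ 0 := by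
      rw [mul_zero, mul_zero] at h1
      exact nonpos_of_mul_nonpos_right h1 (by positivity)
    refine le_antisymm ?_ (integral_nonneg fun x => by positivity)
    have h4 := (setIntegral_mono ((lm.integrableOn_sq a).const_mul c) (hei a)
      fun x => hle (mollEM n d x)).trans h3
    rw [integral_const_mul] at h4
    exact nonpos_of_mul_nonpos_right h4 hc0
  have hz : ∀ k : ℕ, ∀ᵐ x, x ∈ Metric.ball (0 : R3) (k + 1) → mollEM n d x = 0 := fun k => by
    have h1 := hball (k + 1) (by positivity)
    rw [integral_eq_zero_iff_of_nonneg (fun x => by positivity) (lm.integrableOn_sq _)] at h1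
    rw [← ae_restrict_iff' measurableSet_ball]
    filter_upwards [h1] with x hx
    exact norm_eq_zero.1 (pow_eq_zero_iff two_ne_zero |>.1 hx)
  filter_upwards [ae_all_iff.2 hz] with x hx
  obtain ⟨k, hk⟩ := exists_nat_gt ‖x‖
  exact hx k (by rw [mem_ball_zero_iff]; linarith)

/-! ### The Silver–Müller radiation condition -/

lemma integrable_inv_sq_ball (R : ℝ) :
    IntegrableOn (fun x : R3 => (‖x‖ ^ 2)⁻¹) (Metric.ball 0 R) := by
  rw [← integrable_indicator_iff measurableSet_ball]
  have e : (Metric.ball (0 : R3) R).indicator (fun x : R3 => (‖x‖ ^ 2)⁻¹)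
      = fun x => (Set.Iio R).indicator (fun r : ℝ => (r ^ 2)⁻¹) ‖x‖ := by
    ext x
    simp [Set.indicator]
  rw [e, integrable_fun_norm_addHaar volume]
  have h1 : IntegrableOn ((Set.Iio R).indicator fun _ : ℝ => (1 : ℝ)) (Set.Ioi 0) := by
    rw [IntegrableOn, integrable_indicator_iff measurableSet_Iio, IntegrableOn,
      Measure.restrict_restrict measurableSet_Iio, Set.inter_comm, Set.Ioi_inter_Iio]
    exact integrableOn_const (by simp)
  refine h1.congr_fun (fun r hr => ?_) measurableSet_Ioi
  have hr0 : r ≠ 0 := ne_of_gt hr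
  simp only [finrank_euclideanSpace, Fintype.card_fin, smul_eq_mul, Set.indicator]
  split_ifs
  · field_simp
  · simp

lemma exists_integral_inv_sq_le : ∃ K : ℝ, 0 ≤ K ∧ ∀ R : ℝ, 0 < R →
    ∫ x in Metric.ball (0 : R3) R, (‖x‖ ^ 2)⁻¹ ≤ K * R := by
  refine ⟨∫ x in Metric.ball (0 : R3) 1, (‖x‖ ^ 2)⁻¹, integral_nonneg fun x => by positivity,
    fun R hR => le_of_eq ?_⟩
  have h := Measure.setIntegral_comp_smul_of_pos (volume : Measure R3)
    (fun x : R3 => (‖x‖ ^ 2)⁻¹) (Metric.ball 0 1) hR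
  rw [smul_unitBall hR.ne', Real.norm_of_nonneg hR.le] at h
  simp only [norm_smul, finrank_euclideanSpace, Fintype.card_fin, smul_eq_mul, mul_pow, mul_inv,
    integral_const_mul, Real.norm_of_nonneg hR.le] at h
  generalize (∫ x in Metric.ball (0 : R3) 1, (‖x‖ ^ 2)⁻¹) = I₁ at h ⊢
  generalize (∫ x in Metric.ball (0 : R3) R, (‖x‖ ^ 2)⁻¹) = I₂ at h ⊢
  field_simp at h
  linarith

lemma star_dot_self (a : C3) : a ⬝ᵥ star a = (((a ⬝ᵥ star a).re : ℝ) : ℂ) ∧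
    ‖a‖ ^ 2 ≤ (a ⬝ᵥ star a).re ∧ (a ⬝ᵥ star a).re ≤ 3 * ‖a‖ ^ 2 := by
  have h : a ⬝ᵥ star a = ((∑ i, ‖a i‖ ^ 2 : ℝ) : ℂ) := by
    push_cast
    exact Finset.sum_congr rfl fun i _ => Complex.mul_conj' _
  have h' : (a ⬝ᵥ star a).re = ∑ i, ‖a i‖ ^ 2 := by rw [h, Complex.ofReal_re]
  refine ⟨by rw [h', h], h' ▸ norm_sq_le_sum_sq a, ?_⟩
  have h2 : ∀ i, ‖a i‖ ^ 2 ≤ ‖a‖ ^ 2 := fun i =>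
    pow_le_pow_left₀ (norm_nonneg _) (norm_le_pi_norm a i) 2
  rw [h', Fin.sum_univ_three]
  linarith [h2 0, h2 1, h2 2]

/-- The mean energy of a solution satisfying the Silver–Müller radiation condition tends to
zero. The real part of Green's formula controls `E`, its imaginary part controls `H`. -/
lemma tendsto_energy_of_silverMuller {ε μ : ℝ} (hε : 0 < ε) (hμ : 0 < μ) {ω : ℝ} (hω : ω ≠ 0)
    {d u : EMField} (ld : L2Loc d)
    (hd : WeakMaxwell Set.univ (fun _ => diagonal fun _ => (ε : ℂ))
      (fun _ => diagonal fun _ => (μ : ℂ)) d ((ω : ℂ) • d))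
    (hu : SilverMuller ε μ u) {R₀ : ℝ} (hR₀ : ∀ᵐ x, R₀ < ‖x‖ → d x = u x) :
    Tendsto (fun R : ℝ => R⁻¹ * ∫ x in Metric.ball 0 R, ‖d x‖ ^ 2) atTop (𝓝 0) := by
  obtain ⟨K₀, hK₀, hint⟩ := exists_integral_inv_sq_le
  set E : R3 → C3 := fun x => (d x).1 with hE
  set H : R3 → C3 := fun x => (d x).2 with hH
  set NE : R3 → ℝ := fun x => (E x ⬝ᵥ star (E x)).re with hNE
  set NH : R3 → ℝ := fun x => (H x ⬝ᵥ star (H x)).re with hNH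
  set f : R3 → ℂ := fun x => ((‖x‖⁻¹ : ℝ) : ℂ) * (E x ⬝ᵥ star (crossProduct (H x) (pos x))) with hf
  have diag : ∀ (t : ℝ) (a : C3), (diagonal fun _ : Fin 3 => (t : ℂ)) *ᵥ a = (t : ℂ) • a :=
    fun t a => by
      ext i
      rw [mulVec_diagonal]
      rfl
  have hd1 : HasWeakCurl Set.univ E fun x => (Complex.I * ω * μ) • H x := by
    have := hd.1
    simp only [Pi.smul_apply, Prod.smul_snd, diag, smul_smul] at this
    rwa [show Complex.I * ((μ : ℂ) * ω) = Complex.I * ω * μ by ring] at this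
  have hd2 : HasWeakCurl Set.univ H fun x => (-(Complex.I * ω * ε)) • E x := by
    have := hd.2
    simp only [Pi.smul_apply, Prod.smul_fst, diag, smul_smul] at this
    rwa [show -Complex.I * ((ε : ℂ) * ω) = -(Complex.I * ω * ε) by ring] at this
  have lE : L2Loc E := ld.fst
  have lH : L2Loc H := ld.snd
  have iN : ∀ {F : R3 → C3}, L2Loc F → ∀ R,
      IntegrableOn (fun x => (F x ⬝ᵥ star (F x)).re) (Metric.ball 0 R) := fun hF R =>
    (integrable_dot_of_memLp (hF R) (memLp_star (hF R))).re
  have iNE : ∀ R, IntegrableOn NE (Metric.ball 0 R) := iN lE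
  have iNH : ∀ R, IntegrableOn NH (Metric.ball 0 R) := iN lH
  have jf : ∀ R, IntegrableOn f (Metric.ball 0 R) := fun R => by
    have hm : AEStronglyMeasurable f volume := by
      refine (Complex.measurable_ofReal.comp measurable_norm.inv).aestronglyMeasurable.mul
        (aestronglyMeasurable_dot lE.aestronglyMeasurable
          (continuous_star.comp_aestronglyMeasurable (aestronglyMeasurable_cross
            lH.aestronglyMeasurable contDiff_pos.continuous.aestronglyMeasurable)))
    refine ((lE R).norm.integrable_mul (lH R).norm |>.const_mul 6).mono' hm.restrict
      (Eventually.of_forall fun x => ?_)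
    simp only [hf, norm_mul, Complex.norm_real, norm_inv, norm_norm, Pi.mul_apply]
    have h1 := norm_dotProduct_le (E x) (star (crossProduct (H x) (pos x)))
    rw [norm_star] at h1
    have h2 : ‖crossProduct (H x) (pos x)‖ ≤ 2 * ‖H x‖ * ‖x‖ :=
      (norm_crossProduct_le _ _).trans (by have := norm_pos_le x; gcongr)
    by_cases hx : ‖x‖ = 0
    · rw [hx, _root_.inv_zero, zero_mul]
      positivity
    · calc ‖x‖⁻¹ * ‖E x ⬝ᵥ star (crossProduct (H x) (pos x))‖
          ≤ ‖x‖⁻¹ * (3 * ‖E x‖ * (2 * ‖H x‖ * ‖x‖)) := by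
            gcongr
            exact h1.trans (by gcongr)
        _ = 6 * (‖E x‖ * ‖H x‖) := by
            field_simp
            ring
  have it : ∀ {N : R3 → ℝ}, (∀ R, IntegrableOn N (Metric.ball 0 R)) → ∀ R, 0 < R →
      Integrable fun x => tent R x * N x := @fun N hN R hR => by
    have h : IntegrableOn (fun x => tent R x * N x) (Metric.ball 0 R) := by
      refine (hN R).bdd_mul (c := 1) (lipschitzWith_tent hR).continuous.aestronglyMeasurable
        (Eventually.of_forall fun x => ?_)
      rw [Real.norm_of_nonneg (tent_nonneg _ _)]
      exact tent_le_one hR x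
    refine h.integrable_of_forall_notMem_eq_zero fun x hx => ?_
    rw [mem_ball_zero_iff, not_lt] at hx
    rw [tent_of_le hR hx, zero_mul]
  have green : ∀ R, 0 < R → (Complex.I * ω) * ((∫ x, tent R x * (μ * NH x - ε * NE x) : ℝ) : ℂ)
      = ((R⁻¹ : ℝ) : ℂ) * ∫ x in Metric.ball 0 R, f x := fun R hR => by
    have h1 := integral_weakCurl_dot hd1 hd2.star lE (lH.smul _) (fun r => memLp_star (lH r))
      (fun r => memLp_star ((lE.smul _) r)) (lipschitzWith_ofReal (lipschitzWith_tent hR))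
      (hasCompactSupport_tent hR)
    have e1 : ∫ x, (tent R x : ℂ) * ((Complex.I * ω * μ) • H x ⬝ᵥ star (H x))
        = (Complex.I * ω) * ((∫ x, tent R x * (μ * NH x) : ℝ) : ℂ) := by
      rw [← integral_complex_ofReal, ← integral_const_mul]
      refine integral_congr_ae (Eventually.of_forall fun x => ?_)
      simp only [smul_dotProduct, smul_eq_mul]
      rw [(star_dot_self (H x)).1]
      push_cast
      ring
    have e2 : ∫ x, (tent R x : ℂ) * (E x ⬝ᵥ star ((-(Complex.I * ω * ε)) • E x))
        = (Complex.I * ω) * ((∫ x, tent R x * (ε * NE x) : ℝ) : ℂ) := by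
      rw [← integral_complex_ofReal, ← integral_const_mul]
      refine integral_congr_ae (Eventually.of_forall fun x => ?_)
      have h2 : star (-(Complex.I * ω * ε)) = Complex.I * ω * ε := by simp
      simp only [star_smul, h2, dotProduct_smul, smul_eq_mul]
      rw [(star_dot_self (E x)).1]
      push_cast
      ring
    have e3 : ∫ x, E x ⬝ᵥ crossProduct (grad (fun z => (tent R z : ℂ)) x) (star (H x))
        = ((R⁻¹ : ℝ) : ℂ) * ∫ x in Metric.ball 0 R, f x := by
      rw [← integral_indicator measurableSet_ball, ← integral_const_mul]
      refine integral_congr_ae ?_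
      filter_upwards [ae_grad_tent hR] with x hx
      by_cases hxR : ‖x‖ < R
      · have h2 : grad (fun z => (tent R z : ℂ)) x = (-((R⁻¹ * ‖x‖⁻¹ : ℝ) : ℂ)) • pos x := by
          funext j
          refine (hx j).trans ?_
          rw [if_pos hxR]
          simp only [Pi.smul_apply, pos, smul_eq_mul]
          push_cast
          ring
        have h3 : star (crossProduct (H x) (pos x)) = -crossProduct (pos x) (star (H x)) := by
          rw [cross_anticomm]
          ext i
          fin_cases i <;> simp [cross_apply, pos]
        rw [h2, Set.indicator_of_mem (mem_ball_zero_iff.2 hxR), hf]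
        simp only [h3, map_smul, LinearMap.smul_apply, dotProduct_smul, dotProduct_neg, smul_eq_mul]
        push_cast
        ring
      · have h2 : grad (fun z => (tent R z : ℂ)) x = 0 := funext fun j => by
          exact (hx j).trans (if_neg hxR)
        rw [h2, Set.indicator_of_notMem (by simpa using hxR)]
        simp
    rw [e1, e2, e3] at h1
    have e4 : ∫ x, tent R x * (μ * NH x - ε * NE x)
        = (∫ x, tent R x * (μ * NH x)) - ∫ x, tent R x * (ε * NE x) := by
      rw [← integral_sub (it (fun r => (iNH r).const_mul μ) R hR)
        (it (fun r => (iNE r).const_mul ε) R hR)]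
      simp only [mul_sub]
    rw [e4, Complex.ofReal_sub, mul_sub, h1]
    ring
  have greenRe : ∀ R, 0 < R → ∫ x in Metric.ball 0 R, (f x).re = 0 := fun R hR => by
    have h1 := congrArg Complex.re (green R hR)
    rw [Complex.re_ofReal_mul] at h1
    have h2 := integral_re (jf R)
    simp only [RCLike.re_eq_complex_re] at h2
    rw [h2]
    have h3 : ((Complex.I * ω) * ((∫ x, tent R x * (μ * NH x - ε * NE x) : ℝ) : ℂ)).re = 0 := by
      rw [mul_assoc, ← Complex.ofReal_mul]
      simp
    rw [h3] at h1
    exact (mul_eq_zero.1 h1.symm).resolve_left (inv_ne_zero hR.ne')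
  have greenIm : ∀ R, 0 < R → |∫ x, tent R x * (μ * NH x - ε * NE x)|
      ≤ |ω|⁻¹ * R⁻¹ * ∫ x in Metric.ball 0 R, ‖f x‖ := fun R hR => by
    have h1 := congrArg norm (green R hR)
    simp only [norm_mul, Complex.norm_I, Complex.norm_real, one_mul, Real.norm_eq_abs,
      abs_of_pos (inv_pos.2 hR)] at h1
    have h2 : R⁻¹ * ‖∫ x in Metric.ball 0 R, f x‖ ≤ R⁻¹ * ∫ x in Metric.ball 0 R, ‖f x‖ :=
      mul_le_mul_of_nonneg_left (norm_integral_le_integral_norm _) (by positivity)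
    rw [← h1] at h2
    rw [mul_assoc, inv_mul_eq_div, le_div_iff₀ (abs_pos.2 hω)]
    linarith
  set κ : ℝ := Real.sqrt (ε / μ) with hκ
  have hκ0 : 0 < κ := Real.sqrt_pos.2 (by positivity)
  set K₁ : ℝ := 9 / (2 * κ * μ) with hK₁
  -- the radiation condition
  have hrad : ∀ δ > 0, ∃ R₁ > 0, ∀ᵐ x, R₁ < ‖x‖ →
      ‖f x - (κ : ℂ) * NE x‖ ≤ κ / 2 * NE x + K₁ * δ ^ 2 * (‖x‖ ^ 2)⁻¹ := fun δ hδ => by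
    have h1 := hu.eventually (Metric.ball_mem_nhds (0 : C3) hδ)
    obtain ⟨t₁, ht₁, t₂, ht₂, hst⟩ := Filter.mem_inf_iff.1 h1
    obtain ⟨r, hr⟩ := Metric.closedBall_compl_subset_of_mem_cocompact ht₁ (0 : R3)
    refine ⟨max (max r R₀) 1, lt_max_of_lt_right one_pos, ?_⟩
    filter_upwards [hR₀, ht₂] with x hx0 hx2 hx
    have hxr : r < ‖x‖ := (le_max_left _ _).trans_lt ((le_max_left _ _).trans_lt hx)
    have hxR : R₀ < ‖x‖ := (le_max_right _ _).trans_lt ((le_max_left _ _).trans_lt hx)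
    have hx1 : 0 < ‖x‖ := one_pos.trans ((le_max_right _ _).trans_lt hx)
    have hmem : x ∈ t₁ ∩ t₂ := ⟨hr (by simpa using hxr), hx2⟩
    rw [← hst] at hmem
    have hsδ : ‖(Real.sqrt μ : ℂ) • crossProduct (H x) (pos x)
        - ((Real.sqrt ε * ‖x‖ : ℝ) : ℂ) • E x‖ < δ := by
      have h3 := mem_ball_zero_iff.1 hmem
      rwa [← hx0 hxR] at h3
    set s := (Real.sqrt μ : ℂ) • crossProduct (H x) (pos x)
        - ((Real.sqrt ε * ‖x‖ : ℝ) : ℂ) • E x with hs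
    have hsμ : 0 < Real.sqrt μ := Real.sqrt_pos.2 hμ
    have e1 : f x - (κ : ℂ) * NE x = (((Real.sqrt μ)⁻¹ * ‖x‖⁻¹ : ℝ) : ℂ) * (E x ⬝ᵥ star s) := by
      have c1 : star (Real.sqrt μ : ℂ) = Real.sqrt μ := Complex.conj_ofReal _
      have c2 : star (((Real.sqrt ε * ‖x‖ : ℝ) : ℂ)) = ((Real.sqrt ε * ‖x‖ : ℝ) : ℂ) :=
        Complex.conj_ofReal _
      simp only [hs, star_sub, star_smul, dotProduct_sub, dotProduct_smul, c1, c2, smul_eq_mul]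
      rw [(star_dot_self (E x)).1, hκ, Real.sqrt_div hε.le]
      simp only [hf, hNE]
      have n1 : (Real.sqrt μ : ℂ) ≠ 0 := by exact_mod_cast hsμ.ne'
      have n2 : (‖x‖ : ℂ) ≠ 0 := by exact_mod_cast hx1.ne'
      push_cast
      field_simp
    rw [e1, norm_mul, Complex.norm_real, Real.norm_of_nonneg (by positivity)]
    have h2 : ‖E x ⬝ᵥ star s‖ ≤ 3 * ‖E x‖ * δ := by
      refine (norm_dotProduct_le _ _).trans ?_
      rw [norm_star]
      gcongr
    have h3 : ‖E x‖ ^ 2 ≤ NE x := (star_dot_self (E x)).2.1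
    have h4 : ((Real.sqrt μ)⁻¹ * ‖x‖⁻¹) * ‖E x ⬝ᵥ star s‖
        ≤ ‖E x‖ * (3 * δ * (Real.sqrt μ)⁻¹ * ‖x‖⁻¹) := by
      refine (mul_le_mul_of_nonneg_left h2 (by positivity)).trans_eq ?_
      ring
    have h5 : (3 * δ * (Real.sqrt μ)⁻¹ * ‖x‖⁻¹) ^ 2 = 2 * κ * (K₁ * δ ^ 2 * (‖x‖ ^ 2)⁻¹) := by
      have : Real.sqrt μ ^ 2 = μ := Real.sq_sqrt hμ.le
      rw [hK₁]
      field_simp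
      rw [this]
      ring
    generalize (3 * δ * (Real.sqrt μ)⁻¹ * ‖x‖⁻¹) = q at h4 h5
    generalize (K₁ * δ ^ 2 * (‖x‖ ^ 2)⁻¹) = w at h5 ⊢
    have h6 : ‖E x‖ * q ≤ κ / 2 * ‖E x‖ ^ 2 + w := by
      have h7 := sq_nonneg (κ * ‖E x‖ - q)
      have h8 : 0 ≤ 2 * κ * (κ / 2 * ‖E x‖ ^ 2 + w - ‖E x‖ * q) := by nlinarith
      have := nonneg_of_mul_nonneg_right h8 (by positivity)
      linarith
    have h9 := mul_le_mul_of_nonneg_left h3 (by positivity : 0 ≤ κ / 2)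
    linarith
  have nNE : ∀ x, 0 ≤ NE x := fun x => (by positivity : 0 ≤ ‖E x‖ ^ 2).trans
    (star_dot_self (E x)).2.1
  have nNH : ∀ x, 0 ≤ NH x := fun x => (by positivity : 0 ≤ ‖H x‖ ^ 2).trans
    (star_dot_self (H x)).2.1
  -- the region where the radiation condition gives no information contributes a constant
  have inner : ∀ r : ℝ, ∃ G : R3 → ℝ, Integrable G ∧ (∀ x, 0 ≤ G x) ∧
      ∀ x, ‖x‖ ≤ r → ‖f x‖ + κ / 2 * NE x ≤ G x := fun r => by
    refine ⟨(Metric.ball 0 (r + 1)).indicator fun x => ‖f x‖ + κ / 2 * NE x,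
      (integrable_indicator_iff measurableSet_ball).2 ((jf _).norm.add ((iNE _).const_mul _)),
      fun x => Set.indicator_nonneg (fun x _ => ?_) x, fun x hx => ?_⟩
    · have := nNE x
      positivity
    · rw [Set.indicator_of_mem (by rw [mem_ball_zero_iff]; linarith)]
  have limE : Tendsto (fun R : ℝ => R⁻¹ * ∫ x in Metric.ball 0 R, NE x) atTop (𝓝 0) := by
    have hb : ∀ δ > 0, ∃ C₁, ∀ R > 0, R⁻¹ * ∫ x in Metric.ball 0 R, NE x
        ≤ 2 / κ * K₁ * K₀ * δ ^ 2 + C₁ * R⁻¹ := fun δ hδ => by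
      obtain ⟨R₁, hR₁, hf₁⟩ := hrad δ hδ
      obtain ⟨G, iG, hG0, hG⟩ := inner R₁
      refine ⟨2 / κ * ∫ x, G x, fun R hR => ?_⟩
      have h1 : ∫ x in Metric.ball 0 R, κ / 2 * NE x ≤ ∫ x in Metric.ball 0 R,
          ((f x).re + K₁ * δ ^ 2 * (‖x‖ ^ 2)⁻¹ + G x) := by
        refine setIntegral_mono_ae ((iNE R).const_mul _)
          (((jf R).re.add ((integrable_inv_sq_ball R).const_mul _)).add iG.integrableOn) ?_
        filter_upwards [hf₁] with x hx
        rcases le_or_gt ‖x‖ R₁ with h | h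
        · have h2 := hG x h
          have h3 := (abs_le.1 (Complex.abs_re_le_norm (f x))).1
          have h4 : 0 ≤ K₁ * δ ^ 2 * (‖x‖ ^ 2)⁻¹ := by positivity
          linarith
        · have h2 := (abs_le.1 ((Complex.abs_re_le_norm _).trans (hx h))).1
          rw [Complex.sub_re, ← Complex.ofReal_mul, Complex.ofReal_re] at h2
          linarith [hG0 x]
      have h2 : ∫ x in Metric.ball 0 R, ((f x).re + K₁ * δ ^ 2 * (‖x‖ ^ 2)⁻¹ + G x)
          = (∫ x in Metric.ball 0 R, (f x).re) + K₁ * δ ^ 2 * (∫ x in Metric.ball (0 : R3) R, (‖x‖ ^ 2)⁻¹)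
            + ∫ x in Metric.ball 0 R, G x := by
        have i1 : IntegrableOn (fun x => (f x).re + K₁ * δ ^ 2 * (‖x‖ ^ 2)⁻¹) (Metric.ball 0 R) :=
          (jf R).re.add ((integrable_inv_sq_ball R).const_mul _)
        have i0 : IntegrableOn (fun x => (f x).re) (Metric.ball 0 R) := (jf R).re
        rw [integral_add i1 iG.integrableOn, integral_add i0
          ((integrable_inv_sq_ball R).const_mul _), integral_const_mul]
      rw [h2, greenRe R hR, integral_const_mul] at h1
      have h3 := setIntegral_le_integral (s := Metric.ball 0 R) iG (Eventually.of_forall hG0)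
      have h4 := mul_le_mul_of_nonneg_left (hint R hR) (by positivity : 0 ≤ K₁ * δ ^ 2)
      have h5 : κ / 2 * ∫ x in Metric.ball 0 R, NE x ≤ K₁ * δ ^ 2 * (K₀ * R) + ∫ x, G x := by
        linarith
      have h6 := mul_le_mul_of_nonneg_left h5 (by positivity : 0 ≤ 2 / κ * R⁻¹)
      calc R⁻¹ * ∫ x in Metric.ball 0 R, NE x
          = 2 / κ * R⁻¹ * (κ / 2 * ∫ x in Metric.ball 0 R, NE x) := by field_simp
        _ ≤ _ := h6
        _ = _ := by field_simp
    rw [Metric.tendsto_atTop]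
    intro η hη
    set A := 2 / κ * K₁ * K₀ with hA
    have hA0 : 0 ≤ A := by positivity
    obtain ⟨C₁, hC₁⟩ := hb (Real.sqrt (η / (2 * (A + 1)))) (Real.sqrt_pos.2 (by positivity))
    rw [Real.sq_sqrt (by positivity)] at hC₁
    have h1 : A * (η / (2 * (A + 1))) < η / 2 := by
      rw [mul_div_assoc', div_lt_div_iff₀ (by positivity) (by positivity)]
      nlinarith
    have h2 : Tendsto (fun R : ℝ => C₁ * R⁻¹) atTop (𝓝 0) := by
      simpa using tendsto_inv_atTop_zero.const_mul C₁
    obtain ⟨R₂, hR₂⟩ := eventually_atTop.1 ((h2.eventually (gt_mem_nhds (half_pos hη))).and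
      (eventually_gt_atTop 0))
    refine ⟨R₂, fun R hR => ?_⟩
    have h3 := hR₂ R hR
    have h4 := hC₁ R h3.2
    have h5 : 0 ≤ R⁻¹ * ∫ x in Metric.ball 0 R, NE x :=
      mul_nonneg (inv_nonneg.2 h3.2.le) (integral_nonneg nNE)
    rw [Real.dist_eq, sub_zero, abs_of_nonneg h5]
    linarith [h3.1]
  have limH : Tendsto (fun R : ℝ => R⁻¹ * ∫ x in Metric.ball 0 R, NH x) atTop (𝓝 0) := by
    obtain ⟨R₁, hR₁, hf₁⟩ := hrad 1 one_pos
    obtain ⟨G, iG, hG0, hG⟩ := inner R₁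
    set Y : ℝ → ℝ := fun R => R⁻¹ * ∫ x in Metric.ball 0 R, NE x with hY
    have t2 : Tendsto (fun R : ℝ => 2 * R) atTop atTop :=
      tendsto_id.const_mul_atTop (by norm_num)
    have tY : Tendsto (fun R : ℝ => Y (2 * R)) atTop (𝓝 0) := limE.comp t2
    have ti : Tendsto (fun R : ℝ => (2 * R)⁻¹) atTop (𝓝 0) := tendsto_inv_atTop_zero.comp t2
    have t3 : Tendsto (fun R : ℝ => 2 / μ * (2 * ε * Y (2 * R) + |ω|⁻¹ * R⁻¹ *
        (3 * κ / 2 * Y (2 * R) + K₁ * K₀ + (∫ x, G x) * (2 * R)⁻¹))) atTop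
        (𝓝 (2 / μ * (2 * ε * 0 + |ω|⁻¹ * 0 * (3 * κ / 2 * 0 + K₁ * K₀ + (∫ x, G x) * 0)))) :=
      ((tY.const_mul _).add ((tendsto_inv_atTop_zero.const_mul _).mul
        (((tY.const_mul _).add_const _).add (ti.const_mul _)))).const_mul _
    simp only [mul_zero, zero_mul, add_zero] at t3
    refine squeeze_zero' ?_ ?_ t3
    · filter_upwards [eventually_gt_atTop 0] with R hR
      exact mul_nonneg (by positivity) (integral_nonneg nNH)
    filter_upwards [eventually_gt_atTop 0] with R hR
    have hR2 : 0 < 2 * R := by positivity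
    have h1 : ∫ x in Metric.ball 0 (2 * R), ‖f x‖ ≤ ∫ x in Metric.ball 0 (2 * R),
        (3 * κ / 2 * NE x + K₁ * (‖x‖ ^ 2)⁻¹ + G x) := by
      refine setIntegral_mono_ae (jf _).norm
        ((((iNE _).const_mul _).add ((integrable_inv_sq_ball _).const_mul _)).add iG.integrableOn) ?_
      filter_upwards [hf₁] with x hx
      have h4 : 0 ≤ K₁ * (‖x‖ ^ 2)⁻¹ := by positivity
      have h5 := mul_nonneg hκ0.le (nNE x)
      rcases le_or_gt ‖x‖ R₁ with h | h
      · have h2 := hG x h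
        linarith
      · have h2 := norm_le_norm_add_norm_sub' (f x) ((κ : ℂ) * NE x)
        have h3 : ‖(κ : ℂ) * NE x‖ = κ * NE x := by
          rw [← Complex.ofReal_mul, Complex.norm_real, Real.norm_of_nonneg h5]
        have h6 := hx h
        rw [one_pow, mul_one] at h6
        linarith [hG0 x]
    have h2 : ∫ x in Metric.ball 0 (2 * R), (3 * κ / 2 * NE x + K₁ * (‖x‖ ^ 2)⁻¹ + G x)
        = 3 * κ / 2 * (∫ x in Metric.ball 0 (2 * R), NE x)
          + K₁ * (∫ x in Metric.ball (0 : R3) (2 * R), (‖x‖ ^ 2)⁻¹)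
          + ∫ x in Metric.ball 0 (2 * R), G x := by
      have i1 : IntegrableOn (fun x => 3 * κ / 2 * NE x + K₁ * (‖x‖ ^ 2)⁻¹)
          (Metric.ball 0 (2 * R)) :=
        ((iNE _).const_mul _).add ((integrable_inv_sq_ball _).const_mul _)
      rw [integral_add i1 iG.integrableOn, integral_add ((iNE _).const_mul _)
        ((integrable_inv_sq_ball _).const_mul _), integral_const_mul, integral_const_mul]
    have h3 := setIntegral_le_integral (s := Metric.ball 0 (2 * R)) iG (Eventually.of_forall hG0)
    have hK₁0 : 0 ≤ K₁ := by positivity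
    have h4 := mul_le_mul_of_nonneg_left (hint _ hR2) hK₁0
    have h5 : ∫ x in Metric.ball 0 (2 * R), ‖f x‖
        ≤ 3 * κ / 2 * (∫ x in Metric.ball 0 (2 * R), NE x) + K₁ * (K₀ * (2 * R)) + ∫ x, G x := by
      linarith
    have iH := it iNH _ hR2
    have iE := it iNE _ hR2
    have h6 : ∫ x, tent (2 * R) x * (μ * NH x - ε * NE x)
        = μ * (∫ x, tent (2 * R) x * NH x) - ε * ∫ x, tent (2 * R) x * NE x := by
      rw [← integral_const_mul, ← integral_const_mul, ← integral_sub (iH.const_mul _)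
        (iE.const_mul _)]
      exact integral_congr_ae (Eventually.of_forall fun x => by ring)
    have h7 := (le_abs_self _).trans (greenIm _ hR2)
    rw [h6] at h7
    have h8 : ∫ x, tent (2 * R) x * NE x ≤ ∫ x in Metric.ball 0 (2 * R), NE x := by
      rw [← integral_indicator measurableSet_ball]
      refine integral_mono iE ((integrable_indicator_iff measurableSet_ball).2 (iNE _)) fun x => ?_
      by_cases hx : ‖x‖ < 2 * R
      · rw [Set.indicator_of_mem (mem_ball_zero_iff.2 hx)]
        exact mul_le_of_le_one_left (nNE x) (tent_le_one hR2 x)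
      · rw [Set.indicator_of_notMem (by simpa using hx), tent_of_le hR2 (not_lt.1 hx), zero_mul]
    have h9 : ∫ x in Metric.ball 0 R, NH x ≤ 2 * ∫ x, tent (2 * R) x * NH x := by
      rw [← integral_indicator measurableSet_ball, ← integral_const_mul]
      refine integral_mono ((integrable_indicator_iff measurableSet_ball).2 (iNH _))
        (iH.const_mul _) fun x => ?_
      by_cases hx : ‖x‖ < R
      · rw [Set.indicator_of_mem (mem_ball_zero_iff.2 hx)]
        have h10 : 1 / 2 ≤ tent (2 * R) x := by
          refine le_max_of_le_left ?_
          have : ‖x‖ / (2 * R) ≤ 1 / 2 := by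
            rw [div_le_div_iff₀ hR2 (by norm_num)]
            linarith
          linarith
        nlinarith [nNH x]
      · rw [Set.indicator_of_notMem (by simpa using hx)]
        have := mul_nonneg (tent_nonneg (2 * R) x) (nNH x)
        positivity
    have h10 : ∫ x in Metric.ball 0 (2 * R), NE x = 2 * R * Y (2 * R) := by
      simp only [hY]
      field_simp
    rw [h10] at h5 h8
    have h11 := mul_le_mul_of_nonneg_left h5 (by positivity : 0 ≤ |ω|⁻¹ * (2 * R)⁻¹)
    have h12 := mul_le_mul_of_nonneg_left h8 hε.le
    have h13 : μ * ∫ x in Metric.ball 0 R, NH x ≤ 2 * (ε * (2 * R * Y (2 * R)) +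
        |ω|⁻¹ * (2 * R)⁻¹ * (3 * κ / 2 * (2 * R * Y (2 * R)) + K₁ * (K₀ * (2 * R)) + ∫ x, G x)) := by
      have := mul_le_mul_of_nonneg_left h9 hμ.le
      linarith
    have h14 := mul_le_mul_of_nonneg_left h13 (by positivity : 0 ≤ μ⁻¹ * R⁻¹)
    calc R⁻¹ * ∫ x in Metric.ball 0 R, NH x
        = μ⁻¹ * R⁻¹ * (μ * ∫ x in Metric.ball 0 R, NH x) := by field_simp
      _ ≤ _ := h14
      _ = _ := by
        have := abs_pos.2 hω
        field_simp
  have h0 := limE.add limH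
  rw [add_zero] at h0
  refine squeeze_zero' ?_ ?_ h0
  · filter_upwards [eventually_gt_atTop 0] with R hR
    exact mul_nonneg (by positivity) (integral_nonneg fun x => by positivity)
  · filter_upwards [eventually_gt_atTop 0] with R hR
    rw [← mul_add, ← integral_add (iNE R) (iNH R)]
    refine mul_le_mul_of_nonneg_left (setIntegral_mono (ld.integrableOn_sq R)
      ((iNE R).add (iNH R)) fun x => ?_) (by positivity)
    have h1 := (star_dot_self (d x).1).2.1
    have h2 := (star_dot_self (d x).2).2.1
    simp only [hNE, hNH, hE, hH]
    rcases max_choice ‖(d x).1‖ ‖(d x).2‖ with h3 | h3 <;> rw [Prod.norm_def, h3] <;>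
      nlinarith [sq_nonneg ‖(d x).1‖, sq_nonneg ‖(d x).2‖]

/-- Uniqueness of the solution of the homogeneous equations in an isotropic background that
satisfies the Silver–Müller radiation condition. -/
lemma ae_eq_zero_of_silverMuller {ε μ : ℝ} (hε : 0 < ε) (hμ : 0 < μ) {ω : ℝ} (hω : ω ≠ 0)
    {d u : EMField} (ld : L2Loc d)
    (hd : WeakMaxwell Set.univ (fun _ => diagonal fun _ => (ε : ℂ))
      (fun _ => diagonal fun _ => (μ : ℂ)) d ((ω : ℂ) • d))
    (hu : SilverMuller ε μ u) {R₀ : ℝ} (hR₀ : ∀ᵐ x, R₀ < ‖x‖ → d x = u x) : ∀ᵐ x, d x = 0 :=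
  ae_eq_zero_of_tendsto hε hμ hω ld hd (tendsto_energy_of_silverMuller hε hμ hω ld hd hu hR₀)

/-! ### Changes of variables -/

/-- The Jacobian matrix of a map, as a complex matrix. -/
def jacobian (Φ : R3 → R3) (y : R3) : Matrix (Fin 3) (Fin 3) ℂ :=
  Matrix.of fun l m => ((fderiv ℝ Φ y (EuclideanSpace.single m 1) l : ℝ) : ℂ)

lemma det_jacobian (Φ : R3 → R3) (y : R3) :
    (jacobian Φ y).det = ((fderiv ℝ Φ y).det : ℂ) := by
  have h1 : jacobian Φ y = (LinearMap.toMatrix (EuclideanSpace.basisFun (Fin 3) ℝ).toBasis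
      (EuclideanSpace.basisFun (Fin 3) ℝ).toBasis (fderiv ℝ Φ y : R3 →ₗ[ℝ] R3)).map
        (algebraMap ℝ ℂ) := by
    ext l m
    simp [jacobian, LinearMap.toMatrix_apply]
  rw [h1, ← RingHom.mapMatrix_apply, ← RingHom.map_det, LinearMap.det_toMatrix]
  rfl

lemma norm_jacobian_le (Φ : R3 → R3) (y : R3) (l m : Fin 3) :
    ‖jacobian Φ y l m‖ ≤ ‖fderiv ℝ Φ y‖ := by
  rw [jacobian, Matrix.of_apply, Complex.norm_real]
  refine (PiLp.norm_apply_le _ l).trans (((fderiv ℝ Φ y).le_opNorm _).trans ?_)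
  simp

lemma star_jacobian_mulVec (Φ : R3 → R3) (y : R3) (a : C3) :
    star ((jacobian Φ y)ᵀ *ᵥ a) = (jacobian Φ y)ᵀ *ᵥ star a := by
  ext i
  simp [mulVec, dotProduct, jacobian]

/-- The chain rule for gradients. -/
lemma grad_comp {Φ : R3 → R3} {α : R3 → ℂ} {y : R3} (hα : DifferentiableAt ℝ α (Φ y))
    (hΦ : DifferentiableAt ℝ Φ y) :
    grad (fun z => α (Φ z)) y = (jacobian Φ y)ᵀ *ᵥ grad α (Φ y) := by
  ext m
  have h1 := (hα.hasFDerivAt.comp y hΦ.hasFDerivAt).fderiv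
  have h2 : pd m (fun z => α (Φ z)) y
      = fderiv ℝ α (Φ y) (fderiv ℝ Φ y (EuclideanSpace.single m 1)) := by
    rw [pd]
    exact DFunLike.congr_fun h1 _
  have h3 : ∀ v : R3, v = ∑ l, v l • EuclideanSpace.single l (1 : ℝ) := fun v => by
    ext i
    simp [Finset.sum_apply, Pi.single_apply]
  rw [grad, h2]
  conv_lhs => rw [h3 (fderiv ℝ Φ y (EuclideanSpace.single m 1))]
  rw [map_sum]
  change _ = ∑ l, (jacobian Φ y)ᵀ m l * grad α (Φ y) l
  refine Finset.sum_congr rfl fun l _ => ?_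
  rw [map_smul, Complex.real_smul]
  rfl

lemma jacobian_mul_jacobian {Φ Ψ : R3 → R3} {y : R3} (hΦ : DifferentiableAt ℝ Φ y)
    (hΨ : DifferentiableAt ℝ Ψ (Φ y)) (h : ∀ᶠ z in 𝓝 y, Ψ (Φ z) = z) :
    jacobian Ψ (Φ y) * jacobian Φ y = 1 := by
  have h1 : HasFDerivAt (fun z => Ψ (Φ z)) (ContinuousLinearMap.id ℝ R3) y :=
    (hasFDerivAt_id y).congr_of_eventuallyEq h
  have h2 := h1.unique (hΨ.hasFDerivAt.comp y hΦ.hasFDerivAt)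
  have h3 : ∀ v : R3, v = ∑ l, v l • EuclideanSpace.single l (1 : ℝ) := fun v => by
    ext i
    simp [Finset.sum_apply, Pi.single_apply]
  ext i m
  have h4 := congrArg (fun v : R3 => v i) (DFunLike.congr_fun h2 (EuclideanSpace.single m 1))
  simp only [ContinuousLinearMap.id_apply, ContinuousLinearMap.comp_apply] at h4
  rw [h3 (fderiv ℝ Φ y (EuclideanSpace.single m 1)), map_sum] at h4
  have h5 := congrArg (fun r : ℝ => (r : ℂ)) h4
  rw [Matrix.mul_apply]
  simp only [jacobian, Matrix.of_apply]
  have h6 : ((EuclideanSpace.single m (1 : ℝ) : R3) i : ℂ) = (1 : Matrix (Fin 3) (Fin 3) ℂ) i m := by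
    rw [Matrix.one_apply]
    by_cases him : i = m <;> simp [him]
  rw [← h6, h5]
  simp only [WithLp.ofLp_sum, Finset.sum_apply, map_smul, PiLp.smul_apply, smul_eq_mul]
  push_cast
  exact Finset.sum_congr rfl fun l _ => mul_comm _ _

lemma measurable_jacobian (Φ : R3 → R3) (l m : Fin 3) : Measurable fun y => jacobian Φ y l m :=
  Complex.measurable_ofReal.comp ((EuclideanSpace.proj l : R3 →L[ℝ] ℝ).measurable.comp
    (measurable_fderiv_apply_const ℝ Φ (EuclideanSpace.single m 1)))

lemma norm_mulVec_le_of_le {M : Matrix (Fin 3) (Fin 3) ℂ} {C : ℝ} (hM : ∀ i j, ‖M i j‖ ≤ C)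
    (a : C3) : ‖M *ᵥ a‖ ≤ 3 * C * ‖a‖ := by
  have hC : 0 ≤ C := (norm_nonneg _).trans (hM 0 0)
  refine (pi_norm_le_iff_of_nonneg (by positivity)).2 fun i => ?_
  rw [mulVec, dotProduct]
  refine (norm_sum_le _ _).trans ?_
  have : ∀ j, ‖M i j * a j‖ ≤ C * ‖a‖ := fun j => by
    rw [norm_mul]
    exact mul_le_mul (hM i j) (norm_le_pi_norm a j) (norm_nonneg _) hC
  rw [Fin.sum_univ_three]
  linarith [this 0, this 1, this 2]

lemma norm_det_le {M : Matrix (Fin 3) (Fin 3) ℂ} {C : ℝ} (hM : ∀ i j, ‖M i j‖ ≤ C) :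
    ‖M.det‖ ≤ 6 * C ^ 3 := by
  have h : ‖M.det‖ ≤ (Fintype.card (Fin 3)).factorial • C ^ Fintype.card (Fin 3) :=
    Matrix.det_le (A := M) (abv := NormedField.toAbsoluteValue ℂ) hM
  simpa [Nat.factorial] using h

lemma aestronglyMeasurable_mulVec {ν : Measure R3} {M : R3 → Matrix (Fin 3) (Fin 3) ℂ}
    (hM : ∀ i j, AEStronglyMeasurable (fun x => M x i j) ν) {F : R3 → C3}
    (hF : AEStronglyMeasurable F ν) : AEStronglyMeasurable (fun x => M x *ᵥ F x) ν := by
  refine aestronglyMeasurable_c3 fun i => ?_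
  simp only [mulVec, dotProduct, Fin.sum_univ_three]
  have hFc := aestronglyMeasurable_comp hF
  exact (((hM i 0).mul (hFc 0)).add ((hM i 1).mul (hFc 1))).add ((hM i 2).mul (hFc 2))

lemma mulVec_cross_transpose (M : Matrix (Fin 3) (Fin 3) ℂ) (a b : C3) :
    M *ᵥ crossProduct (Mᵀ *ᵥ a) (Mᵀ *ᵥ b) = M.det • crossProduct a b := by
  ext i
  fin_cases i <;>
  · simp [mulVec, dotProduct, Fin.sum_univ_three, cross_apply, det_fin_three]
    ring

/-- `Φ : O₀ → O` and `Ψ : O → O₀` are inverse to each other and locally Lipschitz, and outside the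
relatively closed null sets `O₀ \ U₀` and `O \ U`, which they map to each other, they are
differentiable with positive Jacobian determinant. -/
structure IsChange (Φ Ψ : R3 → R3) (O₀ O U₀ U : Set R3) : Prop where
  isOpen_source : IsOpen O₀
  isOpen_target : IsOpen O
  isOpen_source' : IsOpen U₀
  isOpen_target' : IsOpen U
  source_subset : U₀ ⊆ O₀
  target_subset : U ⊆ O
  source_null : volume (O₀ \ U₀) = 0
  target_null : volume (O \ U) = 0
  map_mem : ∀ y ∈ O₀, Φ y ∈ O
  inv_mem : ∀ x ∈ O, Ψ x ∈ O₀
  map_mem' : ∀ y ∈ U₀, Φ y ∈ U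
  inv_mem' : ∀ x ∈ U, Ψ x ∈ U₀
  left_inv : ∀ y ∈ O₀, Ψ (Φ y) = y
  right_inv : ∀ x ∈ O, Φ (Ψ x) = x
  measurable_map : Measurable Φ
  measurable_inv : Measurable Ψ
  lipschitz_map : ∀ y ∈ O₀, ∃ C, ∃ t ∈ 𝓝 y, LipschitzOnWith C Φ t
  lipschitz_inv : ∀ x ∈ O, ∃ C, ∃ t ∈ 𝓝 x, LipschitzOnWith C Ψ t
  differentiable_map : ∀ y ∈ U₀, DifferentiableAt ℝ Φ y
  differentiable_inv : ∀ x ∈ U, DifferentiableAt ℝ Ψ x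
  det_pos : ∀ y ∈ U₀, 0 < (fderiv ℝ Φ y).det

namespace IsChange

variable {Φ Ψ : R3 → R3} {O₀ O U₀ U : Set R3}

lemma jacobian_inv_mul (h : IsChange Φ Ψ O₀ O U₀ U) {y : R3} (hy : y ∈ U₀) : jacobian Ψ (Φ y) * jacobian Φ y = 1 :=
  jacobian_mul_jacobian (h.differentiable_map y hy) (h.differentiable_inv _ (h.map_mem' y hy))
    ((h.isOpen_source.eventually_mem (h.source_subset hy)).mono h.left_inv)

lemma jacobian_mul_inv (h : IsChange Φ Ψ O₀ O U₀ U) {y : R3} (hy : y ∈ U₀) : jacobian Φ y * jacobian Ψ (Φ y) = 1 :=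
  mul_eq_one_comm.1 (h.jacobian_inv_mul hy)

lemma det_inv_pos (h : IsChange Φ Ψ O₀ O U₀ U) {x : R3} (hx : x ∈ U) : 0 < (fderiv ℝ Ψ x).det := by
  have h1 := h.jacobian_inv_mul (h.inv_mem' x hx)
  rw [h.right_inv x (h.target_subset hx)] at h1
  have h2 := congrArg Matrix.det h1
  rw [det_mul, det_one, det_jacobian, det_jacobian] at h2
  have h3 : (fderiv ℝ Ψ x).det * (fderiv ℝ Φ (Ψ x)).det = 1 := by exact_mod_cast h2
  exact pos_of_mul_pos_left (h3 ▸ one_pos) (h.det_pos _ (h.inv_mem' x hx)).le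

/-- The inverse change of variables. -/
lemma symm (h : IsChange Φ Ψ O₀ O U₀ U) : IsChange Ψ Φ O O₀ U U₀ where
  isOpen_source := h.isOpen_target
  isOpen_target := h.isOpen_source
  isOpen_source' := h.isOpen_target'
  isOpen_target' := h.isOpen_source'
  source_subset := h.target_subset
  target_subset := h.source_subset
  source_null := h.target_null
  target_null := h.source_null
  map_mem := h.inv_mem
  inv_mem := h.map_mem
  map_mem' := h.inv_mem'
  inv_mem' := h.map_mem'
  left_inv := h.right_inv
  right_inv := h.left_inv
  measurable_map := h.measurable_inv
  measurable_inv := h.measurable_map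
  lipschitz_map := h.lipschitz_inv
  lipschitz_inv := h.lipschitz_map
  differentiable_map := h.differentiable_inv
  differentiable_inv := h.differentiable_map
  det_pos := fun _ hx => h.det_inv_pos hx

lemma restrict_source (h : IsChange Φ Ψ O₀ O U₀ U) : volume.restrict O₀ = volume.restrict U₀ :=
  (Measure.restrict_congr_set (ae_eq_set.2
    ⟨h.source_null, by rw [Set.sdiff_eq_empty.2 h.source_subset, measure_empty]⟩))

lemma restrict_target (h : IsChange Φ Ψ O₀ O U₀ U) : volume.restrict O = volume.restrict U := h.symm.restrict_source

lemma image_source (h : IsChange Φ Ψ O₀ O U₀ U) : Φ '' U₀ = U :=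
  Set.Subset.antisymm (Set.image_subset_iff.2 h.map_mem') fun x hx =>
    ⟨Ψ x, h.inv_mem' x hx, h.right_inv x (h.target_subset hx)⟩

lemma injOn (h : IsChange Φ Ψ O₀ O U₀ U) : Set.InjOn Φ U₀ := fun y hy z hz hyz => by
  rw [← h.left_inv y (h.source_subset hy), hyz, h.left_inv z (h.source_subset hz)]

lemma quasiMeasurePreserving (h : IsChange Φ Ψ O₀ O U₀ U) :
    Measure.QuasiMeasurePreserving Φ (volume.restrict O₀) (volume.restrict O) := by
  refine ⟨h.measurable_map, Measure.AbsolutelyContinuous.mk fun N hN h0 => ?_⟩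
  rw [Measure.map_apply h.measurable_map hN, h.restrict_source,
    Measure.restrict_apply (h.measurable_map hN)]
  rw [h.restrict_target, Measure.restrict_apply hN] at h0
  refine measure_mono_null (t := Ψ '' (N ∩ U)) ?_ ?_
  · rintro y ⟨hyN, hy⟩
    exact ⟨Φ y, ⟨hyN, h.map_mem' y hy⟩, h.left_inv y (h.source_subset hy)⟩
  · exact addHaar_image_eq_zero_of_differentiableOn_of_addHaar_eq_zero volume
      (fun x hx => (h.differentiable_inv x hx.2).differentiableWithinAt) h0

lemma ae_source (h : IsChange Φ Ψ O₀ O U₀ U) : ∀ᵐ y ∂volume.restrict O₀, y ∈ U₀ := by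
  rw [h.restrict_source]
  exact ae_restrict_mem h.isOpen_source'.measurableSet

/-- The change of variables formula. -/
lemma integral_eq (h : IsChange Φ Ψ O₀ O U₀ U) {E : Type*} [NormedAddCommGroup E] [NormedSpace ℝ E] (f : R3 → E) :
    ∫ x in O, f x = ∫ y in O₀, (fderiv ℝ Φ y).det • f (Φ y) := by
  rw [h.restrict_target, h.restrict_source, ← h.image_source,
    integral_image_eq_integral_abs_det_fderiv_smul volume h.isOpen_source'.measurableSet
      (fun y hy => (h.differentiable_map y hy).hasFDerivAt.hasFDerivWithinAt) h.injOn]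
  refine setIntegral_congr_fun h.isOpen_source'.measurableSet fun y hy => ?_
  rw [abs_of_pos (h.det_pos y hy)]

lemma integrableOn_image (h : IsChange Φ Ψ O₀ O U₀ U) {E : Type*} [NormedAddCommGroup E]
    [NormedSpace ℝ E] (f : R3 → E) {V : Set R3} (hV : MeasurableSet V) (hVU : V ⊆ U₀) :
    IntegrableOn f (Φ '' V) ↔ IntegrableOn (fun y => (fderiv ℝ Φ y).det • f (Φ y)) V := by
  rw [integrableOn_image_iff_integrableOn_abs_det_fderiv_smul volume hV
    (fun y hy => (h.differentiable_map y (hVU hy)).hasFDerivAt.hasFDerivWithinAt)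
    (h.injOn.mono hVU)]
  exact integrableOn_congr_fun (fun y hy => by rw [abs_of_pos (h.det_pos y (hVU hy))]) hV

lemma integrableOn_iff (h : IsChange Φ Ψ O₀ O U₀ U) {E : Type*} [NormedAddCommGroup E]
    [NormedSpace ℝ E] (f : R3 → E) :
    IntegrableOn f O ↔ IntegrableOn (fun y => (fderiv ℝ Φ y).det • f (Φ y)) O₀ := by
  rw [IntegrableOn, IntegrableOn, h.restrict_target, h.restrict_source, ← h.image_source]
  exact h.integrableOn_image f h.isOpen_source'.measurableSet le_rfl

lemma continuousAt (h : IsChange Φ Ψ O₀ O U₀ U) {y : R3} (hy : y ∈ O₀) : ContinuousAt Φ y := by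
  obtain ⟨C, t, ht, hL⟩ := h.lipschitz_map y hy
  exact hL.continuousOn.continuousAt ht

lemma exists_norm_fderiv_le (h : IsChange Φ Ψ O₀ O U₀ U) {y : R3} (hy : y ∈ O₀) :
    ∃ C : ℝ, 0 ≤ C ∧ ∀ᶠ z in 𝓝 y, ‖fderiv ℝ Φ z‖ ≤ C := by
  obtain ⟨C, t, ht, hL⟩ := h.lipschitz_map y hy
  refine ⟨C, C.2, ?_⟩
  filter_upwards [eventually_mem_nhds_iff.2 ht] with z hz
  exact norm_fderiv_le_of_lipschitzOn ℝ hz hL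

lemma aestronglyMeasurable_comp (h : IsChange Φ Ψ O₀ O U₀ U) {E : Type*} [TopologicalSpace E]
    {F : R3 → E} (hF : AEStronglyMeasurable F (volume.restrict O)) :
    AEStronglyMeasurable (fun y => F (Φ y)) (volume.restrict O₀) :=
  hF.comp_quasiMeasurePreserving h.quasiMeasurePreserving

/-- Densities `H` that are dominated by a locally integrable field are mapped to locally
integrable densities. -/
lemma locallyIntegrableOn_det_smul (h : IsChange Φ Ψ O₀ O U₀ U) {F H : R3 → C3}
    (hF : LocallyIntegrableOn F O) (hm : AEStronglyMeasurable H (volume.restrict O))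
    (hb : ∀ x ∈ O, ∃ C : ℝ, ∀ᶠ z in 𝓝 x, z ∈ U → ‖H z‖ ≤ C * ‖F z‖) :
    LocallyIntegrableOn (fun y => (fderiv ℝ Φ y).det • H (Φ y)) O₀ := by
  intro y hy
  obtain ⟨C, hC⟩ := hb _ (h.map_mem y hy)
  obtain ⟨t, ht, hFt⟩ := hF _ (h.map_mem y hy)
  rw [h.isOpen_target.nhdsWithin_eq (h.map_mem y hy)] at ht
  obtain ⟨V, hVs, hVo, hyV⟩ := _root_.mem_nhds_iff.1 (inter_mem (inter_mem ht hC)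
    (h.isOpen_target.mem_nhds (h.map_mem y hy)))
  obtain ⟨W, hWs, hWo, hyW⟩ := _root_.mem_nhds_iff.1 (inter_mem
    ((h.continuousAt hy).preimage_mem_nhds (hVo.mem_nhds hyV)) (h.isOpen_source.mem_nhds hy))
  refine ⟨W, mem_nhdsWithin_of_mem_nhds (hWo.mem_nhds hyW), ?_⟩
  have hWO : W ⊆ O₀ := fun z hz => (hWs hz).2
  have hW0 : W \ (W ∩ U₀) ⊆ O₀ \ U₀ := fun z hz => ⟨hWO hz.1, fun h2 => hz.2 ⟨hz.1, h2⟩⟩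
  have e : (volume.restrict W : Measure R3) = volume.restrict (W ∩ U₀) :=
    Measure.restrict_congr_set (ae_eq_set.2 ⟨measure_mono_null hW0 h.source_null, by
      rw [Set.sdiff_eq_empty.2 Set.inter_subset_left, measure_empty]⟩)
  have hmeas := (hWo.inter h.isOpen_source').measurableSet
  rw [IntegrableOn, e]
  refine (h.integrableOn_image H hmeas Set.inter_subset_right).1 ?_
  have hsub : Φ '' (W ∩ U₀) ⊆ V ∩ U := by
    rintro _ ⟨z, hz, rfl⟩
    exact ⟨(hWs hz.1).1, h.map_mem' z hz.2⟩
  have hVO : V ∩ U ⊆ O := fun z hz => h.target_subset hz.2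
  have h1 : IntegrableOn F (V ∩ U) := hFt.mono_set fun z hz => (hVs hz.1).1.1
  refine IntegrableOn.mono_set ?_ hsub
  refine Integrable.mono' (h1.norm.const_mul C) (hm.mono_measure (Measure.restrict_mono hVO le_rfl)) ?_
  filter_upwards [ae_restrict_mem (hVo.inter h.isOpen_target').measurableSet] with z hz
  exact (hVs hz.1).1.2 hz.2

/-- The function `α ∘ Ψ`, extended by zero. -/
def push (Ψ : R3 → R3) (O : Set R3) (α : R3 → ℂ) : R3 → ℂ :=
  O.indicator fun x => α (Ψ x)

lemma push_apply (h : IsChange Φ Ψ O₀ O U₀ U) (α : R3 → ℂ) {y : R3} (hy : y ∈ O₀) :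
    push Ψ O α (Φ y) = α y := by
  rw [push, Set.indicator_of_mem (h.map_mem y hy), h.left_inv y hy]

lemma tsupport_push (h : IsChange Φ Ψ O₀ O U₀ U) {α : R3 → ℂ} (hc : HasCompactSupport α)
    (hs : tsupport α ⊆ O₀) : IsCompact (Φ '' tsupport α) ∧ Φ '' tsupport α ⊆ O ∧
      tsupport (push Ψ O α) ⊆ Φ '' tsupport α := by
  have h1 : IsCompact (Φ '' tsupport α) :=
    hc.isCompact.image_of_continuousOn fun y hy => (h.continuousAt (hs hy)).continuousWithinAt
  refine ⟨h1, Set.image_subset_iff.2 fun y hy => h.map_mem y (hs hy),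
    closure_minimal (fun x hx => ?_) h1.isClosed⟩
  have hxO : x ∈ O := by
    by_contra hxO
    exact hx (Set.indicator_of_notMem hxO _)
  have hx' : push Ψ O α x ≠ 0 := hx
  rw [push, Set.indicator_of_mem hxO] at hx'
  exact ⟨Ψ x, subset_tsupport _ hx', h.right_inv x hxO⟩

lemma exists_lipschitzWith_push (h : IsChange Φ Ψ O₀ O U₀ U) {α : R3 → ℂ}
    (hα : LocallyLipschitz α) (hc : HasCompactSupport α) (hs : tsupport α ⊆ O₀) :
    ∃ C, LipschitzWith C (push Ψ O α) := by
  obtain ⟨hK, hKO, hsub⟩ := h.tsupport_push hc hs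
  refine exists_lipschitzWith_of_hasCompactSupport (fun x => ?_)
    (hK.of_isClosed_subset (isClosed_tsupport _) hsub)
  by_cases hx : x ∈ O
  · obtain ⟨C, t, ht, hL⟩ := h.lipschitz_inv x hx
    obtain ⟨D, s, hsx, hD⟩ := hα (Ψ x)
    refine ⟨D * C, t ∩ Ψ ⁻¹' s ∩ O, inter_mem (inter_mem ht
      ((h.symm.continuousAt hx).preimage_mem_nhds hsx)) (h.isOpen_target.mem_nhds hx), ?_⟩
    have h1 := hD.comp (hL.mono (fun z hz => hz.1.1 : t ∩ Ψ ⁻¹' s ∩ O ⊆ t)) fun z hz => hz.1.2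
    intro a ha b hb
    rw [push, Set.indicator_of_mem ha.2, Set.indicator_of_mem hb.2]
    exact h1 ha hb
  · refine ⟨0, (Φ '' tsupport α)ᶜ, hK.isClosed.isOpen_compl.mem_nhds fun h1 => hx (hKO h1), ?_⟩
    have hz : ∀ a ∈ (Φ '' tsupport α)ᶜ, push Ψ O α a = 0 := fun a ha =>
      image_eq_zero_of_notMem_tsupport fun h1 => ha (hsub h1)
    intro a ha b hb
    rw [hz a ha, hz b hb]
    simp

lemma grad_push (h : IsChange Φ Ψ O₀ O U₀ U) {α : R3 → ℂ} {y : R3} (hy : y ∈ U₀)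
    (hα : DifferentiableAt ℝ α y) :
    grad α y = (jacobian Φ y)ᵀ *ᵥ grad (push Ψ O α) (Φ y) := by
  have hyO := h.source_subset hy
  have h1 : DifferentiableAt ℝ (push Ψ O α) (Φ y) := by
    have h2 : DifferentiableAt ℝ (fun x => α (Ψ x)) (Φ y) := by
      refine DifferentiableAt.comp (g := α) (Φ y) ?_ (h.differentiable_inv _ (h.map_mem' y hy))
      rwa [h.left_inv y hyO]
    refine h2.congr_of_eventuallyEq ?_
    filter_upwards [h.isOpen_target.mem_nhds (h.map_mem y hyO)] with x hx
    rw [push, Set.indicator_of_mem hx]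
  rw [← grad_comp h1 (h.differentiable_map y hy)]
  funext m
  refine pd_congr ?_
  filter_upwards [h.isOpen_source.mem_nhds hyO] with z hz
  rw [h.push_apply α hz]

/-- The weak curl of the transformed covariant field `Jᵀ F` is the contravariant density
`det J J⁻¹ G`, where `J` is the Jacobian matrix. -/
lemma integral_cross_grad (h : IsChange Φ Ψ O₀ O U₀ U) {F G : R3 → C3} (hFG : HasWeakCurl O F G)
    {α β : R3 → ℂ} (hα : ContDiff ℝ (⊤ : ℕ∞) α) (hβ : ContDiff ℝ (⊤ : ℕ∞) β)
    (cα : HasCompactSupport α) (cβ : HasCompactSupport β) (sα : tsupport α ⊆ O₀)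
    (sβ : tsupport β ⊆ O₀) :
    ∫ y in O₀, ((jacobian Φ y)ᵀ *ᵥ F (Φ y)) ⬝ᵥ crossProduct (grad α y) (grad β y)
      = ∫ y in O₀, ((jacobian Φ y).det • (jacobian Ψ (Φ y) *ᵥ G (Φ y))) ⬝ᵥ (α y • grad β y) := by
  obtain ⟨A, hA⟩ := h.exists_lipschitzWith_push (hα.of_le (by simp : (1 : WithTop ℕ∞) ≤ _)).locallyLipschitz cα sα
  obtain ⟨B, hB⟩ := h.exists_lipschitzWith_push (hβ.of_le (by simp : (1 : WithTop ℕ∞) ≤ _)).locallyLipschitz cβ sβ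
  obtain ⟨hK, hKO, hsub⟩ := h.tsupport_push cα sα
  have key := hFG.integral_cross_grad h.isOpen_target hA hB
    (hK.of_isClosed_subset (isClosed_tsupport _) hsub) (hsub.trans hKO)
  rw [h.integral_eq, h.integral_eq] at key
  have e1 : ∫ y in O₀, ((jacobian Φ y)ᵀ *ᵥ F (Φ y)) ⬝ᵥ crossProduct (grad α y) (grad β y)
      = ∫ y in O₀, (fderiv ℝ Φ y).det • (F (Φ y) ⬝ᵥ crossProduct (grad (push Ψ O α) (Φ y))
        (grad (push Ψ O β) (Φ y))) := by
    refine integral_congr_ae ?_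
    filter_upwards [h.ae_source] with y hy
    rw [h.grad_push hy (hα.differentiable (by simp) y), h.grad_push hy (hβ.differentiable (by simp) y),
      mulVec_transpose, ← dotProduct_mulVec, mulVec_cross_transpose, det_jacobian, dotProduct_smul,
      Complex.real_smul, smul_eq_mul]
  have e2 : ∫ y in O₀, ((jacobian Φ y).det • (jacobian Ψ (Φ y) *ᵥ G (Φ y))) ⬝ᵥ (α y • grad β y)
      = ∫ y in O₀, (fderiv ℝ Φ y).det • (G (Φ y) ⬝ᵥ (push Ψ O α (Φ y) • grad (push Ψ O β) (Φ y))) := by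
    refine integral_congr_ae ?_
    filter_upwards [h.ae_source] with y hy
    rw [h.push_apply α (h.source_subset hy), h.grad_push hy (hβ.differentiable (by simp) y),
      det_jacobian, smul_dotProduct, dotProduct_smul, dotProduct_smul, dotProduct_comm,
      mulVec_transpose, ← dotProduct_mulVec, mulVec_mulVec, h.jacobian_mul_inv hy, one_mulVec,
      Complex.real_smul, dotProduct_comm, smul_eq_mul]
  rw [e1, e2, key]

lemma locallyIntegrableOn_pull (h : IsChange Φ Ψ O₀ O U₀ U) {F : R3 → C3}
    (hF : LocallyIntegrableOn F O) :
    LocallyIntegrableOn (fun y => (jacobian Φ y)ᵀ *ᵥ F (Φ y)) O₀ := by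
  have h1 := h.locallyIntegrableOn_det_smul (F := F)
    (H := fun x => (jacobian Ψ x).det • ((jacobian Φ (Ψ x))ᵀ *ᵥ F x)) hF ?_ ?_
  · intro y hy
    obtain ⟨t, ht, hi⟩ := h1 y hy
    refine ⟨t ∩ O₀, inter_mem ht self_mem_nhdsWithin, ?_⟩
    refine (hi.mono_set Set.inter_subset_left).congr ?_
    have h2 : ∀ᵐ z ∂volume.restrict (t ∩ O₀), z ∈ U₀ :=
      ae_mono (Measure.restrict_mono Set.inter_subset_right le_rfl) h.ae_source
    filter_upwards [h2] with z hz
    have h3 := congrArg Matrix.det (h.jacobian_mul_inv hz)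
    rw [det_mul, det_one, det_jacobian Φ] at h3
    rw [h.left_inv z (h.source_subset hz), ← Complex.coe_smul, smul_smul, h3, one_smul]
  · have hd : Measurable fun x => (jacobian Ψ x).det := by
      simp only [det_fin_three]
      have := measurable_jacobian Ψ
      fun_prop
    refine hd.aestronglyMeasurable.smul (aestronglyMeasurable_mulVec (fun i j => ?_)
      hF.aestronglyMeasurable)
    exact ((measurable_jacobian Φ j i).comp h.measurable_inv).aestronglyMeasurable
  · intro x hx
    obtain ⟨C₁, h₁, hC₁⟩ := h.symm.exists_norm_fderiv_le hx
    obtain ⟨C₂, h₂, hC₂⟩ := h.exists_norm_fderiv_le (h.inv_mem x hx)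
    refine ⟨6 * C₁ ^ 3 * (3 * C₂), ?_⟩
    filter_upwards [hC₁, (h.symm.continuousAt hx).eventually hC₂] with z hz1 hz2 _
    rw [norm_smul, mul_assoc]
    refine mul_le_mul (norm_det_le fun i j => (norm_jacobian_le _ _ _ _).trans hz1)
      (norm_mulVec_le_of_le (M := (jacobian Φ (Ψ z))ᵀ)
        (fun i j => (norm_jacobian_le _ _ _ _).trans hz2) _) (norm_nonneg _)
      (by positivity)

lemma locallyIntegrableOn_pull_density (h : IsChange Φ Ψ O₀ O U₀ U) {G : R3 → C3}
    (hG : LocallyIntegrableOn G O) :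
    LocallyIntegrableOn (fun y => (jacobian Φ y).det • (jacobian Ψ (Φ y) *ᵥ G (Φ y))) O₀ := by
  have h1 := h.locallyIntegrableOn_det_smul (F := G) (H := fun x => jacobian Ψ x *ᵥ G x) hG
    (aestronglyMeasurable_mulVec (fun i j => (measurable_jacobian Ψ i j).aestronglyMeasurable)
      hG.aestronglyMeasurable) fun x hx => ?_
  · simp only [det_jacobian Φ, Complex.coe_smul]
    exact h1
  · obtain ⟨C₁, h₁, hC₁⟩ := h.symm.exists_norm_fderiv_le hx
    exact ⟨3 * C₁, hC₁.mono fun z hz _ =>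
      norm_mulVec_le_of_le (M := jacobian Ψ z) (fun i j => (norm_jacobian_le _ _ _ _).trans hz) _⟩

/-- Weak curls under a change of variables: `F` is transformed as a covariant field, its curl as a
contravariant density. -/
lemma hasWeakCurl (h : IsChange Φ Ψ O₀ O U₀ U) {F G : R3 → C3} (hFG : HasWeakCurl O F G) :
    HasWeakCurl O₀ (fun y => (jacobian Φ y)ᵀ *ᵥ F (Φ y))
      (fun y => (jacobian Φ y).det • (jacobian Ψ (Φ y) *ᵥ G (Φ y))) := by
  have lF := h.locallyIntegrableOn_pull hFG.1
  have lG := h.locallyIntegrableOn_pull_density hFG.2.1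
  refine ⟨lF, lG, fun φ hφ hc hs => ?_⟩
  -- the coordinate functions, cut off outside a neighbourhood of the support of `φ`
  obtain ⟨K, hK, hKi, hKO⟩ := exists_compact_between hc.isCompact h.isOpen_source hs
  obtain ⟨χ, hχ1, hχ0, -⟩ := exists_contMDiffMap_one_nhds_of_subset_interior
    (modelWithCornersSelf ℝ R3) (n := (⊤ : ℕ∞)) (isClosed_tsupport φ) hKi
  have hχs : ContDiff ℝ (⊤ : ℕ∞) χ := χ.contMDiff.contDiff
  set β : Fin 3 → R3 → ℂ := fun m x => (χ x : ℂ) * coord m x with hβ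
  have hβs : ∀ m, ContDiff ℝ (⊤ : ℕ∞) (β m) := fun m =>
    (Complex.ofRealCLM.contDiff.comp hχs).mul (contDiff_coord m)
  have sβ : ∀ m, tsupport (β m) ⊆ K := fun m =>
    closure_minimal (fun x hx => by
      by_contra hxK
      exact hx (by simp [hβ, hχ0 x hxK])) hK.isClosed
  have gβ : ∀ m, ∀ x ∈ tsupport φ, grad (β m) x = Pi.single m 1 := fun m x hx => by
    rw [← grad_coord]
    funext j
    refine pd_congr ?_
    filter_upwards [hχ1.filter_mono (nhds_le_nhdsSet hx)] with z hz
    simp [hβ, hz]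
  have hφm : ∀ m, ContDiff ℝ (⊤ : ℕ∞) fun x => φ x m := fun m => contDiff_pi.1 hφ m
  have sφ : ∀ m, tsupport (fun x => φ x m) ⊆ tsupport φ := fun m =>
    closure_mono fun z (hz : φ z m ≠ 0) (hz' : φ z = 0) => hz (by simp [hz'])
  have cφ : ∀ m, HasCompactSupport fun x => φ x m := fun m =>
    hc.of_isClosed_subset (isClosed_tsupport _) (sφ m)
  have key := fun m => h.integral_cross_grad hFG (hφm m) (hβs m) (cφ m)
    (hK.of_isClosed_subset (isClosed_tsupport _) (sβ m)) ((sφ m).trans hs) ((sβ m).trans hKO)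
  have zφ : ∀ m, ∀ x ∉ tsupport φ, grad (fun x => φ x m) x = 0 := fun m x hx =>
    funext fun j => pd_eq_zero_of_notMem_tsupport fun h2 => hx (sφ m h2)
  have e1 : ∀ m x, crossProduct (grad (fun x => φ x m) x) (grad (β m) x)
      = crossProduct (grad (fun x => φ x m) x) (Pi.single m 1) := fun m x => by
    by_cases hx : x ∈ tsupport φ
    · rw [gβ m x hx]
    · rw [zφ m x hx]
      simp
  have e2 : ∀ m x, φ x m • grad (β m) x = φ x m • (Pi.single m 1 : C3) := fun m x => by
    by_cases hx : x ∈ tsupport φ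
    · rw [gβ m x hx]
    · simp [image_eq_zero_of_notMem_tsupport hx]
  simp only [e1, e2] at key
  have bdd : ∀ {ψ : R3 → C3}, Continuous ψ → tsupport ψ ⊆ tsupport φ → ∀ {H : R3 → C3},
      LocallyIntegrableOn H O₀ → IntegrableOn (fun x => H x ⬝ᵥ ψ x) O₀ := by
    intro ψ hψ hsub H hH
    have hcψ : HasCompactSupport ψ := hc.of_isClosed_subset (isClosed_tsupport _) hsub
    obtain ⟨M, hM⟩ := hψ.bounded_above_of_compact_support hcψ
    exact (integrable_dot hH hcψ.isCompact (hsub.trans hs) hψ.aestronglyMeasurable hM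
      fun x hx => image_eq_zero_of_notMem_tsupport hx).integrableOn
  have i1 : ∀ m, IntegrableOn (fun y => ((jacobian Φ y)ᵀ *ᵥ F (Φ y)) ⬝ᵥ
      crossProduct (grad (fun x => φ x m) y) (Pi.single m 1)) O₀ := fun m => by
    refine bdd ?_ (closure_minimal (fun x hx => ?_) (isClosed_tsupport _)) lF
    · have : Continuous (grad fun x => φ x m) :=
        continuous_pi fun j => (contDiff_pd (hφm m)).continuous
      have hj := fun j => (continuous_apply j).comp this
      simp only [cross_apply]
      refine continuous_pi fun i => ?_
      fin_cases i
      · exact ((hj 1).mul continuous_const).sub ((hj 2).mul continuous_const)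
      · exact ((hj 2).mul continuous_const).sub ((hj 0).mul continuous_const)
      · exact ((hj 0).mul continuous_const).sub ((hj 1).mul continuous_const)
    · by_contra h2
      exact hx (by simp [zφ m x h2])
  have i2 : ∀ m, IntegrableOn (fun y => ((jacobian Φ y).det • (jacobian Ψ (Φ y) *ᵥ G (Φ y))) ⬝ᵥ
      (φ y m • (Pi.single m 1 : C3))) O₀ := fun m => by
    refine bdd ?_ (closure_minimal (fun x hx => ?_) (isClosed_tsupport _)) lG
    · have := (hφm m).continuous
      fun_prop
    · by_contra h2
      exact hx (by simp [image_eq_zero_of_notMem_tsupport h2])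
  have e3 : ∀ x, φ x = ∑ m, φ x m • (Pi.single m 1 : C3) := fun x => by
    ext i
    simp [Finset.sum_apply, Pi.single_apply]
  calc ∫ y in O₀, ((jacobian Φ y)ᵀ *ᵥ F (Φ y)) ⬝ᵥ curl φ y
      = ∑ m, ∫ y in O₀, ((jacobian Φ y)ᵀ *ᵥ F (Φ y)) ⬝ᵥ
          crossProduct (grad (fun x => φ x m) y) (Pi.single m 1) := by
        rw [← integral_finsetSum _ fun m _ => i1 m]
        simp only [curl_eq_sum, dotProduct_sum]
    _ = ∑ m, ∫ y in O₀, ((jacobian Φ y).det • (jacobian Ψ (Φ y) *ᵥ G (Φ y))) ⬝ᵥ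
          (φ y m • (Pi.single m 1 : C3)) := Finset.sum_congr rfl fun m _ => key m
    _ = _ := by
        rw [← integral_finsetSum _ fun m _ => i2 m]
        refine integral_congr_ae (Eventually.of_forall fun x => ?_)
        simp only [← dotProduct_sum, ← e3]

end IsChange

/-! ### Radial profiles -/

/-- `k` is an increasing Lipschitz function that maps `p` to `q` and is the identity for `r ≥ b`, and
that has a positive derivative for `r > p` except possibly at `r = b`. -/
structure IsProfile (p q b : ℝ) (k : ℝ → ℝ) : Prop where
  nonneg_left : 0 ≤ p
  nonneg_value : 0 ≤ q
  left_lt : p < b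
  lipschitz : ∃ C, LipschitzWith C k
  strictMono : StrictMono k
  map_left : k p = q
  map_of_le : ∀ r, b ≤ r → k r = r
  hasDerivAt : ∀ r, p < r → r ≠ b → ∃ d, 0 < d ∧ HasDerivAt k d r

/-- The cloaking function `g`, extended from `[0, b]` to the whole line with slope one. -/
def profile (b : ℝ) (g : ℝ → ℝ) (r : ℝ) : ℝ := g (max 0 (min b r)) + (r - max 0 (min b r))

lemma profile_of_mem {b r : ℝ} (g : ℝ → ℝ) (h : r ∈ Set.Icc 0 b) : profile b g r = g r := by
  rw [profile, min_eq_right h.2, max_eq_right h.1]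
  ring

lemma profile_of_le {a b r : ℝ} {g : ℝ → ℝ} (hg : IsCloakingFunction a b g) (hb : 0 ≤ b)
    (h : b ≤ r) : profile b g r = r := by
  rw [profile, min_eq_left h, max_eq_right hb, hg.map_right]
  ring

lemma IsCloakingFunction.hasDerivAt {a b r : ℝ} {g : ℝ → ℝ} (hg : IsCloakingFunction a b g)
    (h : r ∈ Set.Ioo 0 b) : HasDerivAt g (derivWithin g (Set.Icc 0 b) r) r :=
  ((hg.contDiffOn.differentiableOn (by simp)) r (Set.Ioo_subset_Icc_self h)).hasDerivWithinAt.hasDerivAt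
    (Icc_mem_nhds h.1 h.2)

lemma exists_slope_bounds {a b : ℝ} {g : ℝ → ℝ} (hg : IsCloakingFunction a b g) (hb : 0 < b) :
    ∃ m M : ℝ, 0 < m ∧ 0 ≤ M ∧ ∀ x y, x ≤ y → m * (y - x) ≤ profile b g y - profile b g x ∧
      profile b g y - profile b g x ≤ M * (y - x) := by
  have hc : ContinuousOn (derivWithin g (Set.Icc 0 b)) (Set.Icc 0 b) :=
    hg.contDiffOn.continuousOn_derivWithin (uniqueDiffOn_Icc hb) (by norm_num)
  have hne : (Set.Icc 0 b).Nonempty := Set.nonempty_Icc.2 hb.le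
  obtain ⟨s, hs, hmin⟩ := isCompact_Icc.exists_isMinOn hne hc
  obtain ⟨t, ht, hmax⟩ := isCompact_Icc.exists_isMaxOn hne hc
  set m := min 1 (derivWithin g (Set.Icc 0 b) s)
  set M := max 1 (derivWithin g (Set.Icc 0 b) t)
  have hm : ∀ ρ ∈ Set.Icc 0 b, m ≤ derivWithin g (Set.Icc 0 b) ρ := fun ρ hρ =>
    (min_le_right _ _).trans (hmin hρ)
  have hM : ∀ ρ ∈ Set.Icc 0 b, derivWithin g (Set.Icc 0 b) ρ ≤ M := fun ρ hρ =>
    (hmax hρ : _ ≤ derivWithin g (Set.Icc 0 b) t).trans (le_max_right _ _)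
  have key : ∀ u ∈ Set.Icc 0 b, ∀ v ∈ Set.Icc 0 b, u ≤ v →
      m * (v - u) ≤ g v - g u ∧ g v - g u ≤ M * (v - u) := by
    intro u hu v hv huv
    rcases huv.eq_or_lt with rfl | huv
    · simp
    obtain ⟨ρ, hρ, h⟩ := exists_hasDerivAt_eq_slope g (derivWithin g (Set.Icc 0 b)) huv
      (hg.contDiffOn.continuousOn.mono (Set.Icc_subset_Icc hu.1 hv.2))
      fun ρ hρ => hg.hasDerivAt ⟨hu.1.trans_lt hρ.1, hρ.2.trans_le hv.2⟩
    have hρ' : ρ ∈ Set.Icc 0 b := ⟨hu.1.trans hρ.1.le, hρ.2.le.trans hv.2⟩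
    have h1 := hm ρ hρ'
    have h2 := hM ρ hρ'
    rw [h] at h1 h2
    exact ⟨(le_div_iff₀ (sub_pos.2 huv)).1 h1, (div_le_iff₀ (sub_pos.2 huv)).1 h2⟩
  refine ⟨m, M, lt_min one_pos (hg.deriv_pos s hs), zero_le_one.trans (le_max_left _ _), ?_⟩
  intro x y hxy
  set u := max 0 (min b x) with hu
  set v := max 0 (min b y) with hv
  have hu' : u ∈ Set.Icc 0 b := ⟨le_max_left _ _, max_le hb.le (min_le_left _ _)⟩
  have hv' : v ∈ Set.Icc 0 b := ⟨le_max_left _ _, max_le hb.le (min_le_left _ _)⟩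
  have huv : u ≤ v := max_le_max le_rfl (min_le_min le_rfl hxy)
  have huv' : v - u ≤ y - x := by
    rw [hu, hv]
    rcases max_cases 0 (min b x) with h1 | h1 <;> rcases max_cases 0 (min b y) with h2 | h2 <;>
      rcases min_cases b x with h3 | h3 <;> rcases min_cases b y with h4 | h4 <;> linarith
  obtain ⟨h1, h2⟩ := key u hu' v hv' huv
  have hm1 : m ≤ 1 := min_le_left _ _
  have hM1 : 1 ≤ M := le_max_left _ _
  have e : profile b g y - profile b g x = (g v - g u) + ((y - x) - (v - u)) := by
    rw [profile, profile, ← hu, ← hv]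
    ring
  rw [e]
  constructor <;> nlinarith

lemma isProfile_profile {a b : ℝ} {g : ℝ → ℝ} (hg : IsCloakingFunction a b g) (ha : 0 ≤ a)
    (hb : 0 < b) : IsProfile 0 a b (profile b g) := by
  obtain ⟨m, M, hm, hM, h⟩ := exists_slope_bounds hg hb
  have hmono : StrictMono (profile b g) := fun x y hxy => by
    nlinarith [(h x y hxy.le).1, mul_pos hm (sub_pos.2 hxy)]
  refine ⟨le_rfl, ha, hb, ⟨⟨M, hM⟩, LipschitzWith.of_dist_le_mul fun x y => ?_⟩, hmono, ?_,
    fun r hr => profile_of_le hg hb.le hr, fun r hr hrb => ?_⟩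
  · rw [Real.dist_eq, Real.dist_eq]
    change _ ≤ M * _
    rcases le_total x y with hxy | hxy
    · rw [abs_sub_comm, abs_sub_comm x, abs_of_nonneg (sub_nonneg.2 hxy),
        abs_of_nonneg (sub_nonneg.2 (hmono.monotone hxy))]
      exact (h x y hxy).2
    · rw [abs_of_nonneg (sub_nonneg.2 hxy), abs_of_nonneg (sub_nonneg.2 (hmono.monotone hxy))]
      exact (h y x hxy).2
  · rw [profile_of_mem g ⟨le_rfl, hb.le⟩, hg.map_zero]
  · rcases hrb.lt_or_gt with hlt | hgt
    · refine ⟨_, hg.deriv_pos r ⟨hr.le, hlt.le⟩, (hg.hasDerivAt ⟨hr, hlt⟩).congr_of_eventuallyEq ?_⟩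
      filter_upwards [Icc_mem_nhds hr hlt] with s hs using profile_of_mem g hs
    · refine ⟨1, one_pos, (hasDerivAt_id r).congr_of_eventuallyEq ?_⟩
      filter_upwards [lt_mem_nhds hgt] with s hs using profile_of_le hg hb.le hs.le

/-- The inverse of the extended cloaking function is a profile, too. -/
lemma exists_inverse_profile {a b : ℝ} {g : ℝ → ℝ} (hg : IsCloakingFunction a b g) (ha : 0 ≤ a)
    (hb : 0 < b) : ∃ k, IsProfile a 0 b k ∧ (∀ r, k (profile b g r) = r) ∧
      ∀ r, profile b g (k r) = r := by
  have hp := isProfile_profile hg ha hb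
  obtain ⟨m, M, hm, hM, h⟩ := exists_slope_bounds hg hb
  obtain ⟨C, hC⟩ := hp.lipschitz
  have hsurj : Function.Surjective (profile b g) := by
    refine hC.continuous.surjective ?_ ?_
    · refine tendsto_atTop_mono' _ ?_ tendsto_id
      filter_upwards [eventually_ge_atTop b] with r hr using (hp.map_of_le r hr).ge
    · refine tendsto_atBot_mono' _ (f₁ := fun r => r + a) ?_ (tendsto_atBot_add_const_right _ _ tendsto_id)
      filter_upwards [eventually_le_atBot 0] with r hr
      rw [profile, min_eq_right (hr.trans hb.le), max_eq_left hr, hg.map_zero]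
      linarith
  set k := Function.surjInv hsurj
  have hr : ∀ r, profile b g (k r) = r := Function.surjInv_eq hsurj
  have hl : ∀ r, k (profile b g r) = r := fun r => hp.strictMono.injective (hr _)
  have hanti : AntilipschitzWith ⟨m⁻¹, (inv_pos.2 hm).le⟩ (profile b g) :=
    AntilipschitzWith.of_le_mul_dist fun x y => by
      change _ ≤ m⁻¹ * _
      rw [inv_mul_eq_div, le_div_iff₀ hm, Real.dist_eq, Real.dist_eq, mul_comm]
      rcases le_total x y with hxy | hxy
      · rw [abs_sub_comm, abs_sub_comm (profile b g x), abs_of_nonneg (sub_nonneg.2 hxy)]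
        exact (h x y hxy).1.trans (le_abs_self _)
      · rw [abs_of_nonneg (sub_nonneg.2 hxy)]
        exact (h y x hxy).1.trans (le_abs_self _)
  have hkl : LipschitzWith _ k := hanti.to_rightInverse hr
  have hab : a < b := by
    have := hp.strictMono hb
    rwa [hp.map_left, hp.map_of_le b le_rfl] at this
  have hmono : StrictMono k := fun x y hxy => hp.strictMono.lt_iff_lt.1 (by rwa [hr, hr])
  have hka : k a = 0 := by rw [← hp.map_left, hl]
  have hkb : ∀ r, b ≤ r → k r = r := fun r hbr => by
    conv_lhs => rw [← hp.map_of_le r hbr, hl]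
  refine ⟨k, ⟨ha, le_rfl, hab, ⟨_, hkl⟩, hmono, hka, hkb, fun r har hrb => ?_⟩, hl, hr⟩
  have h0 : 0 < k r := hka ▸ hmono har
  have h1 : k r ≠ b := fun h2 => hrb (hmono.injective (h2.trans (hkb b le_rfl).symm))
  obtain ⟨d, hd, hd'⟩ := hp.hasDerivAt _ h0 h1
  exact ⟨d⁻¹, inv_pos.2 hd, HasDerivAt.of_local_left_inverse hkl.continuous.continuousAt hd' hd.ne'
    (Eventually.of_forall hr)⟩

/-! ### Radial maps -/

/-- `f` is Lipschitz near `x`. -/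
def LipschitzNear {X Y : Type*} [PseudoEMetricSpace X] [PseudoEMetricSpace Y] (f : X → Y) (x : X) : Prop :=
  ∃ C, ∃ t ∈ 𝓝 x, LipschitzOnWith C f t

lemma LipschitzWith.lipschitzNear {X Y : Type*} [PseudoEMetricSpace X] [PseudoEMetricSpace Y] {f : X → Y} {C : NNReal}
    (h : LipschitzWith C f) (x : X) : LipschitzNear f x :=
  ⟨C, Set.univ, univ_mem, h.lipschitzOnWith⟩

lemma LipschitzNear.add {f g : R3 → R3} {x : R3} (hf : LipschitzNear f x) (hg : LipschitzNear g x) :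
    LipschitzNear (fun z => f z + g z) x := by
  obtain ⟨C, t, ht, hC⟩ := hf
  obtain ⟨D, s, hs, hD⟩ := hg
  refine ⟨C + D, t ∩ s, inter_mem ht hs, LipschitzOnWith.of_dist_le_mul fun y hy z hz => ?_⟩
  have h1 := hC.dist_le_mul y hy.1 z hz.1
  have h2 := hD.dist_le_mul y hy.2 z hz.2
  have h3 := dist_add_add_le (f y) (g y) (f z) (g z)
  push_cast
  linarith

lemma LipschitzNear.smul {f : R3 → ℝ} {g : R3 → R3} {x : R3} (hf : LipschitzNear f x)
    (hg : LipschitzNear g x) : LipschitzNear (fun z => f z • g z) x := by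
  obtain ⟨C, t, ht, hC⟩ := hf
  obtain ⟨D, s, hs, hD⟩ := hg
  have cf := (hC.continuousOn.continuousAt ht).norm.eventually (gt_mem_nhds (lt_add_one ‖f x‖))
  have cg := (hD.continuousOn.continuousAt hs).norm.eventually (gt_mem_nhds (lt_add_one ‖g x‖))
  refine ⟨C * (‖g x‖₊ + 1) + (‖f x‖₊ + 1) * D, _, inter_mem (inter_mem ht hs) (inter_mem cf cg),
    LipschitzOnWith.of_dist_le_mul fun y hy z hz => ?_⟩
  have h1 := hC.dist_le_mul y hy.1.1 z hz.1.1
  have h2 := hD.dist_le_mul y hy.1.2 z hz.1.2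
  have h3 : ‖f z‖ < ‖f x‖ + 1 := hz.2.1
  have h4 : ‖g y‖ < ‖g x‖ + 1 := hy.2.2
  rw [dist_eq_norm] at h1 h2 ⊢
  have e : f y • g y - f z • g z = (f y - f z) • g y + f z • (g y - g z) := by
    rw [sub_smul, smul_sub]
    abel
  rw [e]
  refine (norm_add_le _ _).trans ?_
  rw [norm_smul, norm_smul]
  push_cast
  have h5 := mul_le_mul h1 h4.le (norm_nonneg _) (by positivity)
  have h6 := mul_le_mul h3.le h2 (norm_nonneg _) (by positivity)
  linarith

lemma ContDiffAt.lipschitzNear {E F : Type*} [NormedAddCommGroup E] [NormedSpace ℝ E]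
    [NormedAddCommGroup F] [NormedSpace ℝ F] {f : E → F} {x : E} (h : ContDiffAt ℝ 1 f x) :
    LipschitzNear f x :=
  h.exists_lipschitzOnWith

variable {N : ℕ}

/-- The map that moves the points at the distance `r` from `c j` radially to the distance `k j r`.
It is written as one sum over `j`, which serves its purpose if `k j r = r` holds for
`r ≥ b j`, where the balls of radius `b j` about the centres `c j` are disjoint. -/
def radialMap (c : Fin N → R3) (k : Fin N → ℝ → ℝ) (y : R3) : R3 :=
  y + ∑ j, (k j ‖y - c j‖ - ‖y - c j‖) • ‖y - c j‖⁻¹ • (y - c j)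

/-- Profiles `k j` that map `p j` to `q j`, for disjoint balls of radius `b j` about `c j`. -/
structure IsRadial (c : Fin N → R3) (p q b : Fin N → ℝ) (k : Fin N → ℝ → ℝ) : Prop where
  profile : ∀ j, IsProfile (p j) (q j) (b j) (k j)
  disjoint : ∀ j l, j ≠ l → Disjoint (Metric.closedBall (c j) (b j)) (Metric.closedBall (c l) (b l))

/-- The points at a distance larger than `p j` from `c j` for all `j`. -/
def outside (c : Fin N → R3) (p : Fin N → ℝ) : Set R3 := {y | ∀ j, p j < ‖y - c j‖}

/-- The points of `outside c p` that are not on the spheres of radius `b j`. -/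
def outside' (c : Fin N → R3) (p b : Fin N → ℝ) : Set R3 :=
  {y | ∀ j, p j < ‖y - c j‖ ∧ ‖y - c j‖ ≠ b j}

lemma isOpen_outside (c : Fin N → R3) (p : Fin N → ℝ) : IsOpen (outside c p) := by
  rw [outside, Set.ofPred_forall]
  exact isOpen_iInter_of_finite fun j => isOpen_lt continuous_const (by fun_prop)

lemma isOpen_outside' (c : Fin N → R3) (p b : Fin N → ℝ) : IsOpen (outside' c p b) := by
  rw [outside', Set.ofPred_forall]
  refine isOpen_iInter_of_finite fun j => ?_
  have hn : Continuous fun y : R3 => ‖y - c j‖ := by fun_prop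
  exact (isOpen_lt continuous_const hn).inter (isOpen_ne_fun hn continuous_const)

lemma outside'_subset (c : Fin N → R3) (p b : Fin N → ℝ) : outside' c p b ⊆ outside c p :=
  fun _ hy j => (hy j).1

lemma volume_outside_diff (c : Fin N → R3) (p b : Fin N → ℝ) :
    volume (outside c p \ outside' c p b) = 0 := by
  refine measure_mono_null (t := ⋃ j, Metric.sphere (c j) (b j)) (fun y hy => ?_)
    (measure_iUnion_null fun j => Measure.addHaar_sphere volume (c j) (b j))
  by_contra h
  refine hy.2 fun j => ⟨hy.1 j, fun h1 => h (Set.mem_iUnion.2 ⟨j, ?_⟩)⟩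
  rwa [mem_sphere_iff_norm]

namespace IsRadial

variable {c : Fin N → R3} {p q b : Fin N → ℝ} {k k' : Fin N → ℝ → ℝ}

lemma lt_of_mem (h : IsRadial c p q b k) {j l : Fin N} (hjl : l ≠ j) {y : R3} (hy : ‖y - c j‖ ≤ b j) :
    b l < ‖y - c l‖ := by
  by_contra h1
  exact Set.disjoint_left.1 (h.disjoint l j hjl) (mem_closedBall_iff_norm.2 (not_lt.1 h1))
    (mem_closedBall_iff_norm.2 hy)

lemma radialMap_of_mem (h : IsRadial c p q b k) {j : Fin N} {y : R3} (hy : ‖y - c j‖ ≤ b j)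
    (h0 : y ≠ c j) : radialMap c k y = c j + (k j ‖y - c j‖ / ‖y - c j‖) • (y - c j) := by
  have h0' : ‖y - c j‖ ≠ 0 := norm_ne_zero_iff.2 (sub_ne_zero.2 h0)
  rw [radialMap, Finset.sum_eq_single j]
  · rw [sub_smul, smul_smul, smul_smul, mul_inv_cancel₀ h0', one_smul, div_eq_mul_inv]
    abel
  · intro l _ hl
    rw [(h.profile l).map_of_le _ (h.lt_of_mem hl hy).le, sub_self, zero_smul]
  · simp

lemma radialMap_of_le (h : IsRadial c p q b k) {y : R3} (hy : ∀ j, b j ≤ ‖y - c j‖) :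
    radialMap c k y = y := by
  rw [radialMap, Finset.sum_eq_zero, add_zero]
  intro j _
  rw [(h.profile j).map_of_le _ (hy j), sub_self, zero_smul]

lemma ne_center (h : IsRadial c p q b k) {y : R3} (hy : y ∈ outside c p) (j : Fin N) : y ≠ c j := by
  rintro rfl
  have := hy j
  rw [sub_self, norm_zero] at this
  exact absurd (h.profile j).nonneg_left (not_le.2 this)

lemma lt_map (h : IsRadial c p q b k) {j : Fin N} {r : ℝ} (hr : p j < r) : q j < k j r := by
  rw [← (h.profile j).map_left]
  exact (h.profile j).strictMono hr

lemma map_le (h : IsRadial c p q b k) {j : Fin N} {r : ℝ} (hr : r ≤ b j) : k j r ≤ b j := by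
  rw [← (h.profile j).map_of_le (b j) le_rfl]
  exact (h.profile j).strictMono.monotone hr

lemma norm_radialMap_sub (h : IsRadial c p q b k) {j : Fin N} {y : R3} (hy : ‖y - c j‖ ≤ b j)
    (hp : y ∈ outside c p) : ‖radialMap c k y - c j‖ = k j ‖y - c j‖ := by
  have h0 : 0 < ‖y - c j‖ := norm_pos_iff.2 (sub_ne_zero.2 (h.ne_center hp j))
  rw [h.radialMap_of_mem hy (h.ne_center hp j), add_sub_cancel_left, norm_smul, norm_div, norm_norm,
    div_mul_cancel₀ _ h0.ne', Real.norm_of_nonneg]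
  exact ((h.profile j).nonneg_value.trans (h.lt_map (hp j)).le)

lemma map_mem (h : IsRadial c p q b k) (hq : ∀ j, q j < b j) {y : R3} (hp : y ∈ outside c p) :
    radialMap c k y ∈ outside c q := by
  intro l
  by_cases hy : ∃ j, ‖y - c j‖ ≤ b j
  · obtain ⟨j, hy⟩ := hy
    have h1 := h.norm_radialMap_sub hy hp
    rcases eq_or_ne l j with rfl | hl
    · rw [h1]
      exact h.lt_map (hp l)
    · exact (hq l).trans (h.lt_of_mem hl (h1.trans_le (h.map_le hy)))
  · push Not at hy
    rw [h.radialMap_of_le fun j => (hy j).le]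
    exact (hq l).trans (hy l)

lemma map_mem' (h : IsRadial c p q b k) (hq : ∀ j, q j < b j) {y : R3} (hp : y ∈ outside' c p b) :
    radialMap c k y ∈ outside' c q b := by
  have hp' := outside'_subset c p b hp
  refine fun l => ⟨h.map_mem hq hp' l, ?_⟩
  by_cases hy : ∃ j, ‖y - c j‖ ≤ b j
  · obtain ⟨j, hy⟩ := hy
    have h1 := h.norm_radialMap_sub hy hp'
    rcases eq_or_ne l j with rfl | hl
    · rw [h1]
      intro h2
      refine (hp l).2 ((h.profile l).strictMono.injective ?_)
      rw [h2, (h.profile l).map_of_le _ le_rfl]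
    · exact (h.lt_of_mem hl (h1.trans_le (h.map_le hy))).ne'
  · push Not at hy
    rw [h.radialMap_of_le fun j => (hy j).le]
    exact (hy l).ne'

lemma left_inv (h : IsRadial c p q b k) (h' : IsRadial c q p b k')
    (hk : ∀ j r, p j < r → k' j (k j r) = r) {y : R3} (hp : y ∈ outside c p) :
    radialMap c k' (radialMap c k y) = y := by
  have hq : ∀ j, q j < b j := fun j => (h'.profile j).left_lt
  by_cases hy : ∃ j, ‖y - c j‖ ≤ b j
  · obtain ⟨j, hy⟩ := hy
    have h1 := h.norm_radialMap_sub hy hp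
    have h0 : ‖y - c j‖ ≠ 0 := norm_ne_zero_iff.2 (sub_ne_zero.2 (h.ne_center hp j))
    have h3 : 0 < k j ‖y - c j‖ := (h.profile j).nonneg_value.trans_lt (h.lt_map (hp j))
    rw [h'.radialMap_of_mem (h1.trans_le (h.map_le hy)) (h'.ne_center (h.map_mem hq hp) j), h1,
      hk j _ (hp j), h.radialMap_of_mem hy (h.ne_center hp j), add_sub_cancel_left, smul_smul,
      div_mul_div_comm, mul_comm, div_self (mul_ne_zero h3.ne' h0), one_smul, add_sub_cancel]
  · push Not at hy
    rw [h.radialMap_of_le fun j => (hy j).le, h'.radialMap_of_le fun j => (hy j).le]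

lemma lipschitzNear (h : IsRadial c p q b k) {y : R3} (hp : y ∈ outside c p) :
    LipschitzNear (radialMap c k) y := by
  have h1 : ∀ j, LipschitzNear (fun z => (k j ‖z - c j‖ - ‖z - c j‖) • ‖z - c j‖⁻¹ • (z - c j)) y := by
    intro j
    obtain ⟨C, hC⟩ := (h.profile j).lipschitz
    have hn : LipschitzWith 1 fun z : R3 => ‖z - c j‖ :=
      LipschitzWith.of_le_add fun x y => by
        rw [dist_eq_norm]
        linarith [norm_sub_norm_le (x - c j) (y - c j), sub_sub_sub_cancel_right x y (c j) ▸ norm_sub_norm_le (x - c j) (y - c j)]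
    have h2 : LipschitzNear (fun z : R3 => k j ‖z - c j‖ - ‖z - c j‖) y :=
      LipschitzWith.lipschitzNear ((hC.comp hn).sub hn) y
    have h0 : y - c j ≠ 0 := sub_ne_zero.2 (h.ne_center hp j)
    have h3 : LipschitzNear (fun z : R3 => ‖z - c j‖⁻¹ • (z - c j)) y := by
      refine ContDiffAt.lipschitzNear ?_
      have h4 : ContDiffAt ℝ 1 (fun z : R3 => z - c j) y := by fun_prop
      exact ((h4.norm ℝ h0).inv (norm_ne_zero_iff.2 h0)).smul h4
    exact h2.smul h3
  have h2 : ∀ s : Finset (Fin N), LipschitzNear (fun z : R3 => z +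
      ∑ j ∈ s, (k j ‖z - c j‖ - ‖z - c j‖) • ‖z - c j‖⁻¹ • (z - c j)) y := by
    intro s
    induction s using Finset.induction_on with
    | empty =>
      simp only [Finset.sum_empty, add_zero]
      exact LipschitzWith.lipschitzNear LipschitzWith.id y
    | insert j s hj ih =>
      simp only [Finset.sum_insert hj]
      simpa only [add_left_comm] using (h1 j).add ih
  exact h2 Finset.univ

lemma measurable (h : IsRadial c p q b k) : Measurable (radialMap c k) := by
  refine measurable_id.add (Finset.measurable_sum _ fun j _ => ?_)
  obtain ⟨C, hC⟩ := (h.profile j).lipschitz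
  have hn : Measurable fun z : R3 => ‖z - c j‖ := by fun_prop
  have h1 := hC.continuous.measurable.comp hn
  exact (h1.sub hn).smul (hn.inv.smul (by fun_prop))

/-- The derivative of a radial map inside the ball of radius `b j` about `c j`. -/
lemma hasFDerivAt_of_lt (h : IsRadial c p q b k) {j : Fin N} {y : R3} (hy : ‖y - c j‖ < b j)
    (h0 : y ≠ c j) {d : ℝ} (hd : HasDerivAt (k j) d ‖y - c j‖) :
    HasFDerivAt (radialMap c k) ((k j ‖y - c j‖ / ‖y - c j‖) • ContinuousLinearMap.id ℝ R3 +
      (((d - k j ‖y - c j‖ / ‖y - c j‖) / ‖y - c j‖ ^ 2) • innerSL ℝ (y - c j)).smulRight (y - c j)) y := by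
  have h0' : ‖y - c j‖ ≠ 0 := norm_ne_zero_iff.2 (sub_ne_zero.2 h0)
  have h1 : HasFDerivAt (fun z : R3 => ‖z - c j‖ ^ 2) (2 • innerSL ℝ (y - c j)) y := by
    have := ((hasFDerivAt_id y).sub_const (c j)).norm_sq
    simpa using this
  have h2 := h1.sqrt (by positivity)
  simp only [Real.sqrt_sq (norm_nonneg _)] at h2
  have h3 : HasDerivAt (fun r => k j r / r) ((d * ‖y - c j‖ - k j ‖y - c j‖ * 1) / ‖y - c j‖ ^ 2)
      ‖y - c j‖ := hd.div (hasDerivAt_id _) h0'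
  have h4 := (h3.comp_hasFDerivAt y h2).smul ((hasFDerivAt_id y).sub_const (c j))
  have h5 := h4.const_add (c j)
  refine (h5.congr_of_eventuallyEq ?_).congr_fderiv ?_
  · have h6 : ∀ᶠ z in 𝓝 y, ‖z - c j‖ < b j :=
      (show Continuous fun z : R3 => ‖z - c j‖ by fun_prop).continuousAt.eventually (gt_mem_nhds hy)
    filter_upwards [h6, eventually_ne_nhds h0] with z hz hz0
    exact h.radialMap_of_mem hz.le hz0
  · ext1 v
    simp only [_root_.add_apply, _root_.smul_apply,
      ContinuousLinearMap.smulRight_apply, ContinuousLinearMap.id_apply, Function.comp_apply, id]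
    congr 2
    simp only [innerSL_apply_apply, smul_eq_mul, nsmul_eq_mul, Nat.cast_ofNat]
    field_simp

lemma eventually_eq_of_lt (h : IsRadial c p q b k) {y : R3} (hy : ∀ j, b j < ‖y - c j‖) :
    ∀ᶠ z in 𝓝 y, radialMap c k z = z := by
  filter_upwards [(isOpen_outside c b).mem_nhds hy] with z hz
  exact h.radialMap_of_le fun j => (hz j).le

lemma hasFDerivAt_of_forall_lt (h : IsRadial c p q b k) {y : R3} (hy : ∀ j, b j < ‖y - c j‖) :
    HasFDerivAt (radialMap c k) (ContinuousLinearMap.id ℝ R3) y :=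
  (hasFDerivAt_id y).congr_of_eventuallyEq (h.eventually_eq_of_lt hy)

lemma exists_lt_or_forall_lt {y : R3} (hy : y ∈ outside' c p b) :
    (∃ j, ‖y - c j‖ < b j) ∨ ∀ j, b j < ‖y - c j‖ := by
  by_cases h : ∃ j, ‖y - c j‖ < b j
  · exact Or.inl h
  · push Not at h
    exact Or.inr fun j => lt_of_le_of_ne (h j) (hy j).2.symm

lemma differentiableAt (h : IsRadial c p q b k) {y : R3} (hy : y ∈ outside' c p b) :
    DifferentiableAt ℝ (radialMap c k) y := by
  rcases exists_lt_or_forall_lt hy with ⟨j, hj⟩ | h1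
  · obtain ⟨d, -, hd⟩ := (h.profile j).hasDerivAt _ (hy j).1 (hy j).2
    exact (h.hasFDerivAt_of_lt hj (h.ne_center (outside'_subset c p b hy) j) hd).differentiableAt
  · exact (h.hasFDerivAt_of_forall_lt h1).differentiableAt

lemma det_pos (h : IsRadial c p q b k) {y : R3} (hy : y ∈ outside' c p b) :
    0 < (fderiv ℝ (radialMap c k) y).det := by
  rcases exists_lt_or_forall_lt hy with ⟨j, hj⟩ | h1
  · obtain ⟨d, hd0, hd⟩ := (h.profile j).hasDerivAt _ (hy j).1 (hy j).2
    have hc := h.ne_center (outside'_subset c p b hy) j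
    have h2 := (h.hasFDerivAt_of_lt hj hc hd).fderiv
    set x := y - c j with hx
    set r := ‖x‖ with hr
    have hr0 : r ≠ 0 := norm_ne_zero_iff.2 (sub_ne_zero.2 hc)
    have hk : 0 < k j r := (h.profile j).nonneg_value.trans_lt (h.lt_map (hy j).1)
    have hr2 : x 0 ^ 2 + x 1 ^ 2 + x 2 ^ 2 = r ^ 2 := by
      rw [hr, EuclideanSpace.real_norm_sq_eq, Fin.sum_univ_three]
    set β := (d - k j r / r) / r ^ 2 with hβ
    have e : ∀ l m, jacobian (radialMap c k) y l m
        = ((k j r / r * (if l = m then 1 else 0) + β * x m * x l : ℝ) : ℂ) := fun l m => by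
      rw [jacobian, Matrix.of_apply, h2]
      congr 1
      by_cases hlm : l = m
      · simp [hlm, EuclideanSpace.inner_single_right]
      · simp [hlm, EuclideanSpace.inner_single_right]
    have h3 : (fderiv ℝ (radialMap c k) y).det = (k j r / r) ^ 2 * d := by
      have h4 := det_jacobian (radialMap c k) y
      rw [det_fin_three] at h4
      simp only [e] at h4
      have h5 : (k j r / r) ^ 2 * (k j r / r + β * (x 0 ^ 2 + x 1 ^ 2 + x 2 ^ 2))
          = (fderiv ℝ (radialMap c k) y).det := by
        rw [← Complex.ofReal_inj, ← h4]
        simp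
        ring
      rw [← h5, hr2, hβ]
      field_simp
      ring
    rw [h3]
    positivity
  · rw [(h.hasFDerivAt_of_forall_lt h1).fderiv]
    simp [ContinuousLinearMap.det]

/-- A radial map expands lengths at most by the order of `1 / r` near a centre. -/
lemma exists_norm_fderiv_le (h : IsRadial c p q b k) : ∃ C : ℝ, 0 ≤ C ∧ ∀ y ∈ outside' c p b,
    ‖fderiv ℝ (radialMap c k) y‖ ≤ C * (1 + ∑ j, ‖y - c j‖⁻¹) := by
  choose C hC using fun j => (h.profile j).lipschitz
  refine ⟨∑ j, (3 * C j + 2 * |k j 0|) + 1, by positivity, fun y hy => ?_⟩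
  have hs : 0 ≤ ∑ j, ‖y - c j‖⁻¹ := by positivity
  have hS : ∀ j, 3 * C j + 2 * |k j 0| ≤ ∑ j, (3 * C j + 2 * |k j 0| : ℝ) := fun j =>
    Finset.single_le_sum (f := fun j => (3 * C j + 2 * |k j 0| : ℝ)) (fun j _ => by positivity)
      (Finset.mem_univ j)
  have hS0 : 0 ≤ ∑ j, (3 * C j + 2 * |k j 0| : ℝ) := by positivity
  rcases exists_lt_or_forall_lt hy with ⟨j, hj⟩ | h1
  · obtain ⟨d, hd0, hd⟩ := (h.profile j).hasDerivAt _ (hy j).1 (hy j).2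
    have hc := h.ne_center (outside'_subset c p b hy) j
    have hdC : |d| ≤ C j := by
      have := norm_deriv_le_of_lipschitz (hC j) (x₀ := ‖y - c j‖)
      rwa [hd.deriv] at this
    rw [(h.hasFDerivAt_of_lt hj hc hd).fderiv]
    set x := y - c j with hx
    set r := ‖x‖ with hr
    have hr0 : 0 < r := norm_pos_iff.2 (sub_ne_zero.2 hc)
    have hk : |k j r / r| ≤ C j + |k j 0| * r⁻¹ := by
      have h2 := (hC j).dist_le_mul r 0
      rw [Real.dist_eq, Real.dist_eq, sub_zero, abs_of_pos hr0] at h2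
      have h3 : |k j r| ≤ C j * r + |k j 0| := by
        have := abs_sub_abs_le_abs_sub (k j r) (k j 0)
        linarith
      rw [abs_div, abs_of_pos hr0, div_le_iff₀ hr0, add_mul, mul_assoc, inv_mul_cancel₀ hr0.ne', mul_one]
      exact h3
    have hr1 : r⁻¹ ≤ ∑ l, ‖y - c l‖⁻¹ :=
      Finset.single_le_sum (f := fun l => ‖y - c l‖⁻¹) (fun l _ => by positivity) (Finset.mem_univ j)
    have h5 : ‖(k j r / r) • ContinuousLinearMap.id ℝ R3
        + (((d - k j r / r) / r ^ 2) • innerSL ℝ x).smulRight x‖ ≤ |k j r / r| + |d - k j r / r| := by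
      refine (norm_add_le _ _).trans (add_le_add ?_ ?_)
      · rw [norm_smul, Real.norm_eq_abs]
        exact mul_le_of_le_one_right (abs_nonneg _) ContinuousLinearMap.norm_id_le
      · rw [ContinuousLinearMap.norm_smulRight_apply, norm_smul, innerSL_apply_norm, Real.norm_eq_abs,
          abs_div, abs_of_pos (pow_pos hr0 2), ← hr]
        exact le_of_eq (by field_simp)
    have h6 := abs_sub d (k j r / r)
    have h7 : |k j 0| * r⁻¹ ≤ |k j 0| * ∑ l, ‖y - c l‖⁻¹ :=
      mul_le_mul_of_nonneg_left hr1 (abs_nonneg _)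
    have h8 := mul_le_mul_of_nonneg_right (hS j) hs
    have h9 : 0 ≤ C j * ∑ l, ‖y - c l‖⁻¹ := mul_nonneg (C j).2 hs
    have h10 := hS j
    have h11 := abs_nonneg (k j 0)
    nlinarith
  · rw [(h.hasFDerivAt_of_forall_lt h1).fderiv]
    refine ContinuousLinearMap.norm_id_le.trans ?_
    nlinarith [mul_nonneg hS0 hs]

lemma isChange (h : IsRadial c p q b k) (h' : IsRadial c q p b k')
    (hk : ∀ j r, p j < r → k' j (k j r) = r) (hk' : ∀ j r, q j < r → k j (k' j r) = r) :
    IsChange (radialMap c k) (radialMap c k') (outside c p) (outside c q) (outside' c p b)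
      (outside' c q b) where
  isOpen_source := isOpen_outside c p
  isOpen_target := isOpen_outside c q
  isOpen_source' := isOpen_outside' c p b
  isOpen_target' := isOpen_outside' c q b
  source_subset := outside'_subset c p b
  target_subset := outside'_subset c q b
  source_null := volume_outside_diff c p b
  target_null := volume_outside_diff c q b
  map_mem := fun _ => h.map_mem fun j => (h'.profile j).left_lt
  inv_mem := fun _ => h'.map_mem fun j => (h.profile j).left_lt
  map_mem' := fun _ => h.map_mem' fun j => (h'.profile j).left_lt
  inv_mem' := fun _ => h'.map_mem' fun j => (h.profile j).left_lt
  left_inv := fun _ => h.left_inv h' hk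
  right_inv := fun _ => h'.left_inv h hk'
  measurable_map := h.measurable
  measurable_inv := h'.measurable
  lipschitz_map := fun _ => h.lipschitzNear
  lipschitz_inv := fun _ => h'.lipschitzNear
  differentiable_map := fun _ => h.differentiableAt
  differentiable_inv := fun _ => h'.differentiableAt
  det_pos := fun _ => h.det_pos

end IsRadial

/-! ### Weak curls of differentiable fields -/

lemma LocallyIntegrableOn.congr_ae {O : Set R3} {F F' : R3 → C3}
    (h : LocallyIntegrableOn F O) (e : F =ᵐ[volume.restrict O] F') : LocallyIntegrableOn F' O := by
  intro x hx
  obtain ⟨t, ht, hi⟩ := h x hx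
  refine ⟨t ∩ O, inter_mem ht self_mem_nhdsWithin, (hi.mono_set Set.inter_subset_left).congr ?_⟩
  exact ae_mono (Measure.restrict_mono Set.inter_subset_right le_rfl) e

lemma HasWeakCurl.congr {O : Set R3} {F G F' G' : R3 → C3}
    (h : HasWeakCurl O F G) (eF : F =ᵐ[volume.restrict O] F') (eG : G =ᵐ[volume.restrict O] G') :
    HasWeakCurl O F' G' := by
  refine ⟨LocallyIntegrableOn.congr_ae h.1 eF, LocallyIntegrableOn.congr_ae h.2.1 eG,
    fun φ hφ hc hs => ?_⟩
  have e1 : ∫ x in O, F' x ⬝ᵥ curl φ x = ∫ x in O, F x ⬝ᵥ curl φ x :=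
    integral_congr_ae (eF.mono fun x hx => by simp only [hx])
  have e2 : ∫ x in O, G' x ⬝ᵥ φ x = ∫ x in O, G x ⬝ᵥ φ x :=
    integral_congr_ae (eG.mono fun x hx => by simp only [hx])
  rw [e1, e2, h.2.2 φ hφ hc hs]

lemma continuous_pd_of_contDiff {f : R3 → ℂ} (hf : ContDiff ℝ 1 f) (j : Fin 3) :
    Continuous (pd j f) :=
  (hf.continuous_fderiv (by simp)).clm_apply continuous_const

lemma continuous_grad_of_contDiff {f : R3 → ℂ} (hf : ContDiff ℝ 1 f) : Continuous (grad f) :=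
  continuous_pi fun j => continuous_pd_of_contDiff hf j

lemma continuous_curl_of_contDiff {F : R3 → C3} (hF : ContDiff ℝ 1 F) : Continuous (curl F) := by
  have hp : ∀ i j, Continuous (pd i fun z => F z j) := fun i j =>
    continuous_pd_of_contDiff (contDiff_pi.1 hF j) i
  refine continuous_pi fun i => ?_
  fin_cases i <;> exact (hp _ _).sub (hp _ _)

lemma exists_lipschitzWith_of_contDiff {f : R3 → ℂ} (hf : ContDiff ℝ 1 f)
    (hc : HasCompactSupport f) : ∃ C, LipschitzWith C f :=
  exists_lipschitzWith_of_hasCompactSupport hf.locallyLipschitz hc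

/-- The classical curl is a weak curl; the divergence of `φ × F` integrates to zero. -/
lemma hasWeakCurl_of_contDiff {O : Set R3} {F : R3 → C3} (hF : ContDiff ℝ 1 F) :
    HasWeakCurl O F (curl F) := by
  have hcF := continuous_curl_of_contDiff hF
  refine ⟨hF.continuous.locallyIntegrable.locallyIntegrableOn _,
    hcF.locallyIntegrable.locallyIntegrableOn _, fun φ hφ hc hs => ?_⟩
  have hF1 := fun i => contDiff_pi.1 hF i
  have hφ1 : ContDiff ℝ 1 φ := hφ.of_le (by simp)
  have hφi := fun i => contDiff_pi.1 hφ1 i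
  have e0 : ∀ {f : R3 → ℂ}, (∀ x ∉ tsupport φ, f x = 0) → ∫ x in O, f x = ∫ x, f x := fun hf =>
    setIntegral_eq_integral_of_forall_compl_eq_zero fun x hx => hf x fun h => hx (hs h)
  have z1 : ∀ x ∉ tsupport φ, curl φ x = 0 := fun x hx =>
    image_eq_zero_of_notMem_tsupport fun h => hx (tsupport_curl_subset φ h)
  have z2 : ∀ x ∉ tsupport φ, φ x = 0 := fun x hx => image_eq_zero_of_notMem_tsupport hx
  rw [e0 fun x hx => by rw [z1 x hx, dotProduct_zero], e0 fun x hx => by rw [z2 x hx, dotProduct_zero],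
    ← sub_eq_zero]
  have i1 : Integrable fun x => F x ⬝ᵥ curl φ x := by
    have : Continuous fun x => F x ⬝ᵥ curl φ x := hF.continuous.dotProduct (continuous_curl hφ)
    refine this.integrable_of_hasCompactSupport (hc.of_isClosed_subset (isClosed_tsupport _)
      (closure_minimal (fun x hx => ?_) (isClosed_tsupport _)))
    by_contra h
    exact hx (by simp [z1 x h])
  have i2 : Integrable fun x => curl F x ⬝ᵥ φ x := by
    have : Continuous fun x => curl F x ⬝ᵥ φ x := hcF.dotProduct hφ.continuous
    refine this.integrable_of_hasCompactSupport (hc.of_isClosed_subset (isClosed_tsupport _)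
      (closure_minimal (fun x hx => ?_) (isClosed_tsupport _)))
    by_contra h
    exact hx (by simp [z2 x h])
  rw [← integral_sub i1 i2]
  have hp : ∀ i j, ContDiff ℝ 1 (fun x => φ x i * F x j) := fun i j => (hφi i).mul (hF1 j)
  have cp : ∀ i j, HasCompactSupport fun x => φ x i * F x j := fun i j =>
    hc.of_isClosed_subset (isClosed_tsupport _) (closure_minimal (fun x hx => by
      by_contra h
      exact hx (by simp [z2 x h])) (isClosed_tsupport _))
  have I : ∀ m i j, ∫ x, pd m (fun x => φ x i * F x j) x = 0 := fun m i j => by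
    obtain ⟨C, hC⟩ := exists_lipschitzWith_of_contDiff (hp i j) (cp i j)
    exact integral_pd_eq_zero hC (cp i j) m
  have J : ∀ m i j, Integrable (pd m (fun x => φ x i * F x j)) := fun m i j =>
    (continuous_pd_of_contDiff (hp i j) m).integrable_of_hasCompactSupport
      ((cp i j).of_isClosed_subset (isClosed_tsupport _) (closure_minimal (fun x hx => by
        by_contra h
        exact hx (pd_eq_zero_of_notMem_tsupport h)) (isClosed_tsupport _)))
  have e : ∀ x, F x ⬝ᵥ curl φ x - curl F x ⬝ᵥ φ x
      = ((pd 0 (fun x => φ x 1 * F x 2) x - pd 0 (fun x => φ x 2 * F x 1) x)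
        + (pd 1 (fun x => φ x 2 * F x 0) x - pd 1 (fun x => φ x 0 * F x 2) x))
        + (pd 2 (fun x => φ x 0 * F x 1) x - pd 2 (fun x => φ x 1 * F x 0) x) := by
    intro x
    have e1 : ∀ m i j, pd m (fun z => φ z i * F z j) x
        = φ x i * pd m (fun z => F z j) x + F x j * pd m (fun z => φ z i) x := fun m i j =>
      pd_mul ((hφi i).differentiable (by simp) x) ((hF1 j).differentiable (by simp) x)
    simp only [e1, dotProduct, Fin.sum_univ_three, curl, cons_val_zero, cons_val_one, cons_val]
    ring
  simp only [e]
  have d : ∀ m i j i' j', Integrable (fun x => pd m (fun x => φ x i * F x j) x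
      - pd m (fun x => φ x i' * F x j') x) := fun m i j i' j' => (J m i j).sub (J m i' j')
  have k : ∀ m i j i' j', ∫ x, (pd m (fun x => φ x i * F x j) x
      - pd m (fun x => φ x i' * F x j') x) = 0 := fun m i j i' j' => by
    rw [integral_sub (J m i j) (J m i' j'), I, I, sub_zero]
  have d2 : Integrable fun x => (pd 0 (fun x => φ x 1 * F x 2) x - pd 0 (fun x => φ x 2 * F x 1) x)
      + (pd 1 (fun x => φ x 2 * F x 0) x - pd 1 (fun x => φ x 0 * F x 2) x) :=
    (d _ _ _ _ _).add (d _ _ _ _ _)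
  rw [integral_add d2 (d _ _ _ _ _), integral_add (d _ _ _ _ _) (d _ _ _ _ _), k, k, k, add_zero,
    add_zero]

/-- The product rule for the weak curl, with a continuously differentiable factor. -/
lemma HasWeakCurl.contDiff_smul {O : Set R3} (hO : IsOpen O) {F G : R3 → C3}
    (h : HasWeakCurl O F G) {χ : R3 → ℂ} (hχ : ContDiff ℝ 1 χ) :
    HasWeakCurl O (fun x => χ x • F x) (fun x => χ x • G x + crossProduct (grad χ x) (F x)) := by
  have hg := continuous_grad_of_contDiff hχ
  have bd : ∀ {H : R3 → C3} {b : R3 → ℝ} {T : R3 → C3}, LocallyIntegrableOn H O → Continuous b →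
      AEStronglyMeasurable T (volume.restrict O) → (∀ x, ‖T x‖ ≤ b x * ‖H x‖) →
      LocallyIntegrableOn T O := by
    intro H b T hH hb hT hle x hx
    obtain ⟨t, ht, hi⟩ := hH x hx
    have h1 : {z | b z < b x + 1} ∈ 𝓝 x := hb.continuousAt.eventually (gt_mem_nhds (lt_add_one _))
    refine ⟨t ∩ O ∩ {z | b z < b x + 1}, inter_mem (inter_mem ht self_mem_nhdsWithin)
      (mem_nhdsWithin_of_mem_nhds h1), ?_⟩
    have hi' : IntegrableOn H (t ∩ O ∩ {z | b z < b x + 1}) :=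
      hi.mono_set fun z hz => hz.1.1
    refine Integrable.mono' (hi'.norm.const_mul (b x + 1))
      (hT.mono_measure (Measure.restrict_mono (fun z hz => hz.1.2) le_rfl)) ?_
    obtain ⟨s, hs, hsm, hae⟩ : ∃ s, t ∩ O ∩ {z | b z < b x + 1} ⊆ s ∧ MeasurableSet s ∧
        ∀ z ∈ s, b z < b x + 1 := ⟨{z | b z < b x + 1}, Set.inter_subset_right,
      measurableSet_lt hb.measurable measurable_const, fun z hz => hz⟩
    have := ae_mono (Measure.restrict_mono hs le_rfl) (ae_restrict_mem (μ := (volume : Measure R3)) hsm)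
    filter_upwards [this] with z hz
    exact (hle z).trans (mul_le_mul_of_nonneg_right (hae z hz).le (norm_nonneg _))
  have mF := h.1.aestronglyMeasurable
  have mG := h.2.1.aestronglyMeasurable
  have mχ : AEStronglyMeasurable χ (volume.restrict O) := hχ.continuous.aestronglyMeasurable
  have l1 : LocallyIntegrableOn (fun x => χ x • F x) O :=
    bd h.1 hχ.continuous.norm (mχ.smul mF) fun x => (norm_smul _ _).le
  have l2 : LocallyIntegrableOn (fun x => χ x • G x) O :=
    bd h.2.1 hχ.continuous.norm (mχ.smul mG) fun x => (norm_smul _ _).le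
  have l3 : LocallyIntegrableOn (fun x => crossProduct (grad χ x) (F x)) O :=
    bd h.1 (hg.norm.const_mul 2) (aestronglyMeasurable_cross hg.aestronglyMeasurable mF)
      fun x => norm_crossProduct_le _ _
  refine ⟨l1, l2.add l3, fun φ hφ hc hs => ?_⟩
  have hφ1 : ContDiff ℝ 1 φ := hφ.of_le (by simp)
  have hψ : ∀ i, ContDiff ℝ 1 fun x => χ x * φ x i := fun i => hχ.mul (contDiff_pi.1 hφ1 i)
  have sψ : tsupport (fun x => χ x • φ x) ⊆ tsupport φ :=
    closure_mono fun x hx hx' => hx (by simp [hx'])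
  have cψ : HasCompactSupport fun x => χ x • φ x := hc.of_isClosed_subset (isClosed_tsupport _) sψ
  have hL : ∀ i, ∃ C, LipschitzWith C fun x => χ x * φ x i := fun i =>
    exists_lipschitzWith_of_contDiff (hψ i) (hc.of_isClosed_subset (isClosed_tsupport _)
      (closure_mono fun x hx hx' => hx (by simp [hx'])))
  choose C hC using hL
  have key := h.integral_curl hO (φ := fun x => χ x • φ x) (A := ∑ i, C i)
    (fun i => (hC i).weaken (Finset.single_le_sum (f := C) (fun _ _ => zero_le) (Finset.mem_univ i)))
    cψ (sψ.trans hs)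
  have e1 : ∀ x, curl (fun x => χ x • φ x) x = χ x • curl φ x + crossProduct (grad χ x) (φ x) :=
    fun x => curl_smul (hχ.differentiable (by simp) x)
      fun i => (contDiff_pi.1 hφ1 i).differentiable (by simp) x
  have int : ∀ {H ψ : R3 → C3}, LocallyIntegrableOn H O → Continuous ψ →
      (∀ x ∉ tsupport φ, ψ x = 0) → IntegrableOn (fun x => H x ⬝ᵥ ψ x) O := by
    intro H ψ hH hψ h0
    obtain ⟨M, hM⟩ := hψ.bounded_above_of_compact_support
      (hc.of_isClosed_subset (isClosed_tsupport _) (closure_minimal (fun x hx => by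
        by_contra h
        exact hx (h0 x h)) (isClosed_tsupport _)) : HasCompactSupport ψ)
    exact (integrable_dot hH hc.isCompact hs hψ.aestronglyMeasurable hM h0).integrableOn
  have z1 : ∀ x ∉ tsupport φ, curl φ x = 0 := fun x hx =>
    image_eq_zero_of_notMem_tsupport fun h => hx (tsupport_curl_subset φ h)
  have z2 : ∀ x ∉ tsupport φ, φ x = 0 := fun x hx => image_eq_zero_of_notMem_tsupport hx
  have c3 : Continuous fun x => crossProduct (grad χ x) (φ x) := by
    have h1 := fun j => (continuous_apply j).comp hg
    have h2 := fun j => (continuous_apply j).comp hφ.continuous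
    simp only [cross_apply]
    refine continuous_pi fun i => ?_
    fin_cases i
    · exact ((h1 1).mul (h2 2)).sub ((h1 2).mul (h2 1))
    · exact ((h1 2).mul (h2 0)).sub ((h1 0).mul (h2 2))
    · exact ((h1 0).mul (h2 1)).sub ((h1 1).mul (h2 0))
  have i1 : IntegrableOn (fun x => F x ⬝ᵥ crossProduct (grad χ x) (φ x)) O :=
    int h.1 c3 fun x hx => by simp [z2 x hx]
  have i2 : IntegrableOn (fun x => F x ⬝ᵥ (χ x • curl φ x)) O :=
    int h.1 (hχ.continuous.smul (continuous_curl hφ)) fun x hx => by simp [z1 x hx]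
  simp only [e1, dotProduct_add] at key
  rw [integral_add i2 i1] at key
  have e2 : ∀ x, (χ x • G x + crossProduct (grad χ x) (F x)) ⬝ᵥ φ x
      = G x ⬝ᵥ (χ x • φ x) - F x ⬝ᵥ crossProduct (grad χ x) (φ x) := fun x => by
    simp only [dotProduct, Fin.sum_univ_three, Pi.add_apply, Pi.smul_apply, smul_eq_mul, cross_apply,
      cons_val_zero, cons_val_one, cons_val]
    ring
  simp only [e2]
  have i3 : IntegrableOn (fun x => G x ⬝ᵥ (χ x • φ x)) O :=
    int h.2.1 (hχ.continuous.smul hφ.continuous) fun x hx => by simp [z2 x hx]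
  rw [integral_sub i3 i1, ← key, add_sub_cancel_right]
  refine integral_congr_ae (Eventually.of_forall fun x => ?_)
  simp only [smul_dotProduct, dotProduct_smul]

/-- A weak curl is divergence free. -/
lemma HasWeakCurl.isWeakDivFree {O : Set R3} {F G : R3 → C3} (h : HasWeakCurl O F G) :
    IsWeakDivFree O G := by
  refine ⟨h.2.1, fun ψ hψ hc hs => ?_⟩
  have sψ : tsupport (grad ψ) ⊆ tsupport ψ := closure_minimal (fun x hx => by
    by_contra h
    exact hx (funext fun j => pd_eq_zero_of_notMem_tsupport h)) (isClosed_tsupport _)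
  have e : ∀ x, curl (grad ψ) x = 0 := fun x => by
    ext i
    have c := fun i j => pd_pd_comm (i := i) (j := j) hψ x
    fin_cases i
    · exact sub_eq_zero.2 (c 1 2)
    · exact sub_eq_zero.2 (c 2 0)
    · exact sub_eq_zero.2 (c 0 1)
  rw [← h.2.2 (grad ψ) (contDiff_pi.2 fun j => contDiff_pd hψ)
    (hc.of_isClosed_subset (isClosed_tsupport _) sψ) (sψ.trans hs)]
  simp [e]

/-! ### Transformation of electromagnetic fields -/

/-- The pull-back `(Jᵀ E ∘ Φ, Jᵀ H ∘ Φ)` of a covariant electromagnetic field by `Φ`, where `J` is the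
Jacobian matrix of `Φ`. -/
def pull (Φ : R3 → R3) (u : EMField) : EMField := fun y =>
  ((jacobian Φ y)ᵀ *ᵥ (u (Φ y)).1, (jacobian Φ y)ᵀ *ᵥ (u (Φ y)).2)

namespace IsChange

variable {Φ Ψ : R3 → R3} {O₀ O U₀ U : Set R3}

lemma pull_pull (h : IsChange Φ Ψ O₀ O U₀ U) (v : EMField) {y : R3} (hy : y ∈ U₀) :
    pull Φ (pull Ψ v) y = v y := by
  have e : (jacobian Φ y)ᵀ * (jacobian Ψ (Φ y))ᵀ = 1 := by
    rw [← transpose_mul, h.jacobian_inv_mul hy, transpose_one]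
  simp only [pull, mulVec_mulVec, e, one_mulVec, h.left_inv y (h.source_subset hy)]

lemma aestronglyMeasurable_pull (h : IsChange Φ Ψ O₀ O U₀ U) {u : EMField}
    (hu : AEStronglyMeasurable u (volume.restrict O)) :
    AEStronglyMeasurable (pull Φ u) (volume.restrict O₀) := by
  have h1 := h.aestronglyMeasurable_comp hu
  have hJ : ∀ i j, AEStronglyMeasurable (fun y => (jacobian Φ y)ᵀ i j) (volume.restrict O₀) :=
    fun i j => (measurable_jacobian Φ j i).aestronglyMeasurable
  exact (aestronglyMeasurable_mulVec hJ (continuous_fst.comp_aestronglyMeasurable h1)).prodMk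
    (aestronglyMeasurable_mulVec hJ (continuous_snd.comp_aestronglyMeasurable h1))

lemma det_ne_zero (h : IsChange Φ Ψ O₀ O U₀ U) {y : R3} (hy : y ∈ U₀) : (jacobian Φ y).det ≠ 0 := by
  rw [det_jacobian]
  exact_mod_cast (h.det_pos y hy).ne'

end IsChange

namespace CloakSystem

variable {N : ℕ} (S : CloakSystem N)

/-- The transformation `S.map` and its inverse `Ψ` as a change of variables from `Ω₀` to `Ω`,
with the growth of the derivatives. -/
structure IsFlattening (Ψ : R3 → R3) (U₀ U : Set R3) : Prop
    extends IsChange S.map Ψ S.Omega0 S.Omega U₀ U where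
  invMap_eq : ∀ x ∈ S.Omega, S.invMap x = Ψ x
  exterior_subset : S.exterior ⊆ U
  inv_eq : ∀ x ∈ S.exterior, Ψ x = x
  norm_fderiv_map_le : ∃ C : ℝ, 0 ≤ C ∧ ∀ y ∈ U₀,
    ‖fderiv ℝ S.map y‖ ≤ C * (1 + ∑ j, ‖y - S.c j‖⁻¹)
  norm_fderiv_inv_le : ∃ C : ℝ, 0 ≤ C ∧ ∀ x ∈ U, ‖fderiv ℝ Ψ x‖ ≤ C
  norm_map_sub_le : ∃ D : ℝ, ∀ y ∈ S.Omega0, ‖S.map y - y‖ ≤ D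

lemma b_pos (j : Fin N) : 0 < S.b j := (S.a_pos j).trans (S.a_lt_b j)

lemma Omega_eq : S.Omega = outside S.c S.a := by
  ext x
  simp [Omega, K, outside, dist_eq_norm]

lemma Omega0_eq : S.Omega0 = outside S.c fun _ => 0 := by
  ext x
  simp [Omega0, outside, sub_eq_zero, eq_comm]

lemma exterior_eq : S.exterior = outside S.c S.b := by
  ext x
  simp [exterior, outside, dist_eq_norm]

lemma map_eq_radialMap : S.map = radialMap S.c fun j => profile (S.b j) (S.g j) := by
  have hr : IsRadial S.c (fun _ => 0) S.a S.b fun j => profile (S.b j) (S.g j) :=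
    ⟨fun j => isProfile_profile (S.cloaking j) (S.a_pos j).le (S.b_pos j), S.disjoint⟩
  funext y
  rw [map]
  split_ifs with h
  · have hj := mem_closedBall_iff_norm.1 h.choose_spec
    set j := h.choose
    by_cases h0 : y = S.c j
    · have hz : ∀ l, (profile (S.b l) (S.g l) ‖y - S.c l‖ - ‖y - S.c l‖) •
          ‖y - S.c l‖⁻¹ • (y - S.c l) = 0 := fun l => by
        rcases eq_or_ne l j with rfl | hl
        · rw [h0, sub_self, smul_zero, smul_zero]
        · rw [(hr.profile l).map_of_le _ (hr.lt_of_mem hl hj).le, sub_self, zero_smul]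
      rw [radialMap, Finset.sum_eq_zero fun l _ => hz l, h0, sub_self, smul_zero]
    · rw [hr.radialMap_of_mem hj h0, profile_of_mem (S.g j) ⟨norm_nonneg _, hj⟩]
  · exact (hr.radialMap_of_le fun j =>
      (not_le.1 fun hj => h ⟨j, mem_closedBall_iff_norm.2 hj⟩).le).symm

lemma exists_isFlattening : ∃ Ψ U₀ U, S.IsFlattening Ψ U₀ U := by
  have hr : IsRadial S.c (fun _ => 0) S.a S.b fun j => profile (S.b j) (S.g j) :=
    ⟨fun j => isProfile_profile (S.cloaking j) (S.a_pos j).le (S.b_pos j), S.disjoint⟩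
  choose k hk hl hri using fun j =>
    exists_inverse_profile (S.cloaking j) (S.a_pos j).le (S.b_pos j)
  have hr' : IsRadial S.c S.a (fun _ => 0) S.b k := ⟨hk, S.disjoint⟩
  have hch := hr.isChange hr' (fun j r _ => hl j r) fun j r _ => hri j r
  rw [← S.map_eq_radialMap, ← S.Omega_eq, ← S.Omega0_eq] at hch
  refine ⟨_, _, _, ⟨hch, fun x hx => ?_, fun x hx j => ?_, fun x hx => ?_, ?_, ?_, ?_⟩⟩
  · have h1 : ∃ y ∈ S.Omega0, S.map y = x := ⟨_, hch.inv_mem x hx, hch.right_inv x hx⟩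
    have h2 := hch.left_inv _ (Function.invFunOn_mem h1)
    rwa [Function.invFunOn_eq h1, eq_comm] at h2
  · rw [S.exterior_eq] at hx
    exact ⟨(S.a_lt_b j).trans (hx j), (hx j).ne'⟩
  · rw [S.exterior_eq] at hx
    exact hr'.radialMap_of_le fun j => (hx j).le
  · rw [S.map_eq_radialMap]
    exact hr.exists_norm_fderiv_le
  · obtain ⟨C, hC, h⟩ := hr'.exists_norm_fderiv_le
    refine ⟨C * (1 + ∑ j, (S.a j)⁻¹), ?_, fun x hx => (h x hx).trans ?_⟩
    · have : ∀ j, 0 < S.a j := S.a_pos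
      have : 0 ≤ ∑ j, (S.a j)⁻¹ := Finset.sum_nonneg fun j _ => (inv_pos.2 (this j)).le
      positivity
    · gcongr with j
      · exact S.a_pos j
      · exact (hx j).1.le
  · refine ⟨∑ j, 2 * S.b j, fun y hy => ?_⟩
    have hb : ∀ j, 0 ≤ 2 * S.b j := fun j => by linarith [S.b_pos j]
    rw [S.Omega0_eq] at hy
    rw [S.map_eq_radialMap]
    by_cases h1 : ∃ j, ‖y - S.c j‖ ≤ S.b j
    · obtain ⟨j, hj⟩ := h1
      have h2 := hr.norm_radialMap_sub hj hy
      have h3 := hr.map_le hj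
      have h4 : S.b j ≥ 0 := (S.b_pos j).le
      have h5 := norm_sub_le (radialMap S.c (fun j => profile (S.b j) (S.g j)) y - S.c j) (y - S.c j)
      rw [sub_sub_sub_cancel_right] at h5
      have h6 : 2 * S.b j ≤ ∑ j, 2 * S.b j :=
        Finset.single_le_sum (f := fun j => 2 * S.b j) (fun j _ => hb j) (Finset.mem_univ j)
      linarith
    · push Not at h1
      rw [hr.radialMap_of_le fun j => (h1 j).le, sub_self, norm_zero]
      exact Finset.sum_nonneg fun j _ => hb j

lemma finite_range_c : (Set.range S.c).Finite := Set.finite_range _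

lemma restrict_Omega0 : (volume.restrict S.Omega0 : Measure R3) = volume :=
  Measure.restrict_eq_self_of_ae_mem (by
    rw [ae_iff]
    refine measure_mono_null (fun y hy => ?_) (S.finite_range_c.measure_zero volume)
    exact not_not.1 hy)

variable {S} {ε₀ μ₀ : Matrix (Fin 3) (Fin 3) ℂ}

lemma conjTranspose_jac (y : R3) : (S.jac y)ᴴ = (S.jac y)ᵀ := by
  ext i j
  simp [jac]

lemma isHermitian_medium {t₀ : Matrix (Fin 3) (Fin 3) ℂ} (ht : t₀.IsHermitian) (x : R3) :
    (S.medium t₀ x).IsHermitian := by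
  have hd : star (S.jac (S.invMap x)).det = (S.jac (S.invMap x)).det := by
    rw [← det_conjTranspose, conjTranspose_jac, det_transpose]
  have hJ : (S.jac (S.invMap x))ᵀᴴ = S.jac (S.invMap x) := by
    ext i j
    simp [jac]
  rw [Matrix.IsHermitian, medium, conjTranspose_smul, conjTranspose_mul, conjTranspose_mul, conjTranspose_jac,
    hJ, ht.eq, star_inv₀, hd, Matrix.mul_assoc]

/-- The energy in `O` is the energy in `Ω` of the field cut off outside `O`. -/
lemma finiteEnergyOn_iff_indicator {W : Set R3} (hW : MeasurableSet W) (hWO : W ⊆ S.Omega)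
    (u : EMField) :
    S.FiniteEnergyOn ε₀ μ₀ W u ↔ S.FiniteEnergyOn ε₀ μ₀ S.Omega (W.indicator u) := by
  have e : (volume.restrict S.Omega : Measure R3).restrict W = volume.restrict W := by
    rw [Measure.restrict_restrict hW, Set.inter_eq_left.2 hWO]
  have e2 : S.energyDensity ε₀ μ₀ (W.indicator u) (W.indicator u)
      = W.indicator (S.energyDensity ε₀ μ₀ u u) := by
    funext x
    by_cases hx : x ∈ W
    · simp [energyDensity, hx]
    · simp [energyDensity, hx]
  rw [FiniteEnergyOn, FiniteEnergyOn, aestronglyMeasurable_indicator_iff hW, e, e2, IntegrableOn,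
    IntegrableOn, integrable_indicator_iff hW, IntegrableOn, e]

namespace IsFlattening

variable {Ψ : R3 → R3} {U₀ U : Set R3}

lemma ae_mem (h : S.IsFlattening Ψ U₀ U) : ∀ᵐ y : R3, y ∈ U₀ := by
  have := h.ae_source
  rwa [S.restrict_Omega0] at this

lemma ae_target (h : S.IsFlattening Ψ U₀ U) : ∀ᵐ x ∂volume.restrict S.Omega, x ∈ U :=
  h.symm.ae_source

lemma medium_eq (h : S.IsFlattening Ψ U₀ U) (t₀ : Matrix (Fin 3) (Fin 3) ℂ) {y : R3} (hy : y ∈ U₀) :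
    S.medium t₀ (S.map y) = (jacobian S.map y).det⁻¹ •
      (jacobian S.map y * t₀ * (jacobian S.map y)ᵀ) := by
  have hy0 := h.source_subset hy
  rw [medium, h.invMap_eq _ (h.map_mem y hy0), h.left_inv y hy0]
  rfl

lemma medium_inv (h : S.IsFlattening Ψ U₀ U) {t₀ : Matrix (Fin 3) (Fin 3) ℂ} (ht : t₀.PosDef)
    {y : R3} (hy : y ∈ U₀) :
    S.medium t₀ (S.map y) * ((jacobian S.map y).det •
      ((jacobian Ψ (S.map y))ᵀ * t₀⁻¹ * jacobian Ψ (S.map y))) = 1 := by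
  have h1 := h.jacobian_mul_inv hy
  have h2 : (jacobian S.map y)ᵀ * (jacobian Ψ (S.map y))ᵀ = 1 := by
    rw [← transpose_mul, h.jacobian_inv_mul hy, transpose_one]
  have h3 : t₀ * t₀⁻¹ = 1 := mul_nonsing_inv _ ((isUnit_iff_isUnit_det _).1 ht.isUnit)
  rw [h.medium_eq t₀ hy, smul_mul_smul_comm, inv_mul_cancel₀ (h.det_ne_zero hy), one_smul]
  calc _ = jacobian S.map y * t₀ * ((jacobian S.map y)ᵀ * (jacobian Ψ (S.map y))ᵀ) * t₀⁻¹
        * jacobian Ψ (S.map y) := by simp only [Matrix.mul_assoc]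
    _ = 1 := by rw [h2, Matrix.mul_one, Matrix.mul_assoc (jacobian S.map y), h3, Matrix.mul_one, h1]

/-- The energy density is transformed to the one of the background. -/
lemma energyDensity_map (h : S.IsFlattening Ψ U₀ U) (u v : EMField) {y : R3} (hy : y ∈ U₀) :
    (fderiv ℝ S.map y).det • S.energyDensity ε₀ μ₀ u v (S.map y)
      = energyForm ε₀ μ₀ (pull S.map u y) (pull S.map v y) := by
  have key : ∀ (t₀ : Matrix (Fin 3) (Fin 3) ℂ) (a b : C3),
      (jacobian S.map y).det * ((S.medium t₀ (S.map y) *ᵥ a) ⬝ᵥ star b)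
        = (t₀ *ᵥ ((jacobian S.map y)ᵀ *ᵥ a)) ⬝ᵥ star ((jacobian S.map y)ᵀ *ᵥ b) := fun t₀ a b => by
    rw [h.medium_eq t₀ hy, smul_mulVec, smul_dotProduct, smul_eq_mul,
      mul_inv_cancel_left₀ (h.det_ne_zero hy), star_jacobian_mulVec, ← mulVec_mulVec, ← mulVec_mulVec,
      dotProduct_mulVec, vecMul_transpose]
  rw [Complex.real_smul, ← det_jacobian, energyDensity, mul_add, key, key]
  rfl

lemma energyInner_eq (h : S.IsFlattening Ψ U₀ U) (u v : EMField) :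
    S.energyInner ε₀ μ₀ u v = ∫ y, energyForm ε₀ μ₀ (pull S.map u y) (pull S.map v y) := by
  rw [energyInner, h.integral_eq, S.restrict_Omega0]
  exact integral_congr_ae (h.ae_mem.mono fun y hy => h.energyDensity_map u v hy)

lemma aestronglyMeasurable_pull_map (h : S.IsFlattening Ψ U₀ U) {u : EMField}
    (hu : AEStronglyMeasurable u (volume.restrict S.Omega)) :
    AEStronglyMeasurable (pull S.map u) volume := by
  have := h.aestronglyMeasurable_pull hu
  rwa [S.restrict_Omega0] at this

lemma aestronglyMeasurable_pull_inv (h : S.IsFlattening Ψ U₀ U) {v : EMField}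
    (hv : AEStronglyMeasurable v volume) :
    AEStronglyMeasurable (pull Ψ v) (volume.restrict S.Omega) :=
  h.symm.aestronglyMeasurable_pull hv.restrict

lemma finiteEnergyOn_iff (h : S.IsFlattening Ψ U₀ U) (hε : ε₀.PosDef) (hμ : μ₀.PosDef)
    {u : EMField} : S.FiniteEnergyOn ε₀ μ₀ S.Omega u ↔
      AEStronglyMeasurable u (volume.restrict S.Omega) ∧ MemLp (pull S.map u) 2 volume := by
  have e : IntegrableOn (S.energyDensity ε₀ μ₀ u u) S.Omega ↔
      Integrable fun y => energyForm ε₀ μ₀ (pull S.map u y) (pull S.map u y) := by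
    rw [h.integrableOn_iff, IntegrableOn, S.restrict_Omega0]
    exact integrable_congr (h.ae_mem.mono fun y hy => h.energyDensity_map u u hy)
  rw [FiniteEnergyOn, e]
  refine and_congr_right fun hu => ⟨fun hi => ?_, fun hm => integrable_energyForm _ _ hm hm⟩
  exact memLp_of_integrable_energyForm hε hμ (h.aestronglyMeasurable_pull_map hu) hi

lemma l2Loc_pull (h : S.IsFlattening Ψ U₀ U) (hε : ε₀.PosDef) (hμ : μ₀.PosDef) {u : EMField}
    (hu : ∀ O : Set R3, O ⊆ S.Omega → Bornology.IsBounded O → S.FiniteEnergyOn ε₀ μ₀ O u) :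
    L2Loc (pull S.map u) := by
  intro R
  obtain ⟨D, hD⟩ := h.norm_map_sub_le
  set W := S.Omega ∩ Metric.closedBall 0 (R + D) with hW
  have hWm : MeasurableSet W := h.isOpen_target.measurableSet.inter measurableSet_closedBall
  have h1 := hu W Set.inter_subset_left (Metric.isBounded_closedBall.subset Set.inter_subset_right)
  rw [finiteEnergyOn_iff_indicator hWm Set.inter_subset_left, h.finiteEnergyOn_iff hε hμ] at h1
  refine (h1.2.restrict (Metric.ball 0 R)).ae_eq ?_
  filter_upwards [ae_restrict_mem measurableSet_ball, ae_restrict_of_ae h.ae_mem] with y hy hyU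
  have hy0 := h.source_subset hyU
  have hm : S.map y ∈ W := by
    refine ⟨h.map_mem y hy0, mem_closedBall_zero_iff.2 ?_⟩
    have h2 := norm_add_le (S.map y - y) y
    rw [sub_add_cancel] at h2
    linarith [hD y hy0, mem_ball_zero_iff.1 hy]
  simp only [pull, Set.indicator_of_mem hm]

lemma finiteEnergyOn_pull (h : S.IsFlattening Ψ U₀ U) (hε : ε₀.PosDef) (hμ : μ₀.PosDef)
    {v : EMField} (hv : L2Loc v) {O : Set R3} (hO : O ⊆ S.Omega) (hb : Bornology.IsBounded O) :
    S.FiniteEnergyOn ε₀ μ₀ O (pull Ψ v) := by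
  obtain ⟨D, hD⟩ := h.norm_map_sub_le
  obtain ⟨r, hr⟩ := hb.subset_closedBall (0 : R3)
  set W := S.Omega ∩ Metric.closedBall 0 r with hW
  have hWm : MeasurableSet W := h.isOpen_target.measurableSet.inter measurableSet_closedBall
  have hOW : O ⊆ W := Set.subset_inter hO hr
  suffices hs : S.FiniteEnergyOn ε₀ μ₀ W (pull Ψ v) from
    ⟨hs.1.mono_measure (Measure.restrict_mono hOW le_rfl), hs.2.mono_set hOW⟩
  have hm := h.aestronglyMeasurable_pull_inv hv.aestronglyMeasurable
  rw [finiteEnergyOn_iff_indicator hWm Set.inter_subset_left, h.finiteEnergyOn_iff hε hμ]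
  refine ⟨hm.indicator hWm, ?_⟩
  set V := S.map ⁻¹' W with hV
  have hVm : MeasurableSet V := h.measurable_map hWm
  have h1 : MemLp (V.indicator v) 2 volume := by
    rw [memLp_indicator_iff_restrict hVm]
    refine (hv (r + D + 1)).mono_measure (Measure.restrict_mono_ae ?_)
    filter_upwards [h.ae_mem] with y hyU hyV
    have h2 := norm_sub_le (S.map y) (S.map y - y)
    rw [sub_sub_cancel] at h2
    refine mem_ball_zero_iff.2 ?_
    linarith [hD y (h.source_subset hyU), mem_closedBall_zero_iff.1 (hyV : S.map y ∈ W).2]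
  refine h1.ae_eq ?_
  filter_upwards [h.ae_mem] with y hy
  by_cases hyV : S.map y ∈ W
  · rw [Set.indicator_of_mem (s := V) hyV, ← h.pull_pull v hy]
    simp only [pull, Set.indicator_of_mem hyV]
  · rw [Set.indicator_of_notMem (s := V) hyV]
    simp [pull, Set.indicator_of_notMem hyV]
    rfl

/-- Almost everywhere, a field in `Ω` is determined by its pull-back. -/
lemma ae_eq_of_pull (h : S.IsFlattening Ψ U₀ U) {u : EMField} {v : EMField}
    (huv : ∀ᵐ y, pull S.map u y = v y) : u =ᵐ[volume.restrict S.Omega] pull Ψ v := by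
  have h1 := h.symm.quasiMeasurePreserving.ae (by rwa [S.restrict_Omega0] : ∀ᵐ y ∂volume.restrict S.Omega0,
    pull S.map u y = v y)
  filter_upwards [h1, h.ae_target] with x hx hxU
  rw [← h.symm.pull_pull u hxU]
  simp only [pull] at hx ⊢
  simp only [← hx]

/-- The curl equations of the cloaked medium become those of the background. -/
lemma hasWeakCurl_pull (h : S.IsFlattening Ψ U₀ U) {t₀ : Matrix (Fin 3) (Fin 3) ℂ} {F G : R3 → C3}
    {z : ℂ} (hFG : HasWeakCurl S.Omega F fun x => z • (S.medium t₀ x *ᵥ G x)) :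
    HasWeakCurl S.Omega0 (fun y => (jacobian S.map y)ᵀ *ᵥ F (S.map y))
      fun y => z • (t₀ *ᵥ ((jacobian S.map y)ᵀ *ᵥ G (S.map y))) := by
  refine (h.hasWeakCurl hFG).congr (EventuallyEq.refl _ _) ?_
  filter_upwards [h.ae_source] with y hy
  rw [h.medium_eq t₀ hy, smul_mulVec, mulVec_smul, mulVec_smul, smul_comm, smul_smul _ _ (_ *ᵥ _),
    mul_inv_cancel₀ (h.det_ne_zero hy), one_smul, mulVec_mulVec, mulVec_mulVec, ← Matrix.mul_assoc,
    ← Matrix.mul_assoc, h.jacobian_inv_mul hy, Matrix.one_mul, ← mulVec_mulVec]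

lemma hasWeakCurl_of_pull (h : S.IsFlattening Ψ U₀ U) {t₀ : Matrix (Fin 3) (Fin 3) ℂ} {F G : R3 → C3}
    {z : ℂ} (hFG : HasWeakCurl S.Omega0 (fun y => (jacobian S.map y)ᵀ *ᵥ F (S.map y))
      fun y => z • (t₀ *ᵥ ((jacobian S.map y)ᵀ *ᵥ G (S.map y)))) :
    HasWeakCurl S.Omega F fun x => z • (S.medium t₀ x *ᵥ G x) := by
  refine (h.symm.hasWeakCurl hFG).congr ?_ ?_
  · filter_upwards [h.ae_target] with x hx
    have hxO := h.target_subset hx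
    have e := h.symm.jacobian_mul_inv hx
    rw [mulVec_mulVec, ← transpose_mul, h.symm.jacobian_inv_mul hx, transpose_one, one_mulVec,
      h.right_inv x hxO]
  · filter_upwards [h.ae_target] with x hx
    have hxO := h.target_subset hx
    have hy := h.inv_mem' x hx
    have e := h.medium_eq t₀ hy
    have e2 : (jacobian Ψ x).det = (jacobian S.map (Ψ x)).det⁻¹ := by
      refine eq_inv_of_mul_eq_one_left ?_
      rw [← det_mul, h.symm.jacobian_mul_inv hx, det_one]
    rw [h.right_inv x hxO] at e ⊢
    rw [e, e2, mulVec_smul, smul_comm, smul_mulVec, mulVec_mulVec, mulVec_mulVec]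

lemma weakMaxwell_pull (h : S.IsFlattening Ψ U₀ U) {u w : EMField}
    (hu : WeakMaxwell S.Omega (S.medium ε₀) (S.medium μ₀) u w) :
    WeakMaxwell S.Omega0 (fun _ => ε₀) (fun _ => μ₀) (pull S.map u) (pull S.map w) :=
  ⟨h.hasWeakCurl_pull hu.1, h.hasWeakCurl_pull hu.2⟩

lemma weakMaxwell_of_pull (h : S.IsFlattening Ψ U₀ U) {u w : EMField}
    (hu : WeakMaxwell S.Omega0 (fun _ => ε₀) (fun _ => μ₀) (pull S.map u) (pull S.map w)) :
    WeakMaxwell S.Omega (S.medium ε₀) (S.medium μ₀) u w :=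
  ⟨h.hasWeakCurl_of_pull hu.1, h.hasWeakCurl_of_pull hu.2⟩

/-- The centres are removable singularities of the pulled back fields. -/
lemma weakMaxwell_pull_univ (h : S.IsFlattening Ψ U₀ U) {u w : EMField}
    (hu : WeakMaxwell S.Omega (S.medium ε₀) (S.medium μ₀) u w) (lu : L2Loc (pull S.map u))
    (lw : L2Loc (pull S.map w)) :
    WeakMaxwell Set.univ (fun _ => ε₀) (fun _ => μ₀) (pull S.map u) (pull S.map w) := by
  have h1 := h.weakMaxwell_pull hu
  exact ⟨h1.1.of_compl_finite S.finite_range_c lu.fst ((lw.snd.mulVec μ₀).smul _),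
    h1.2.of_compl_finite S.finite_range_c lu.snd ((lw.fst.mulVec ε₀).smul _)⟩

end IsFlattening

end CloakSystem

namespace CloakSystem

variable {N : ℕ} {S : CloakSystem N} {ε₀ μ₀ : Matrix (Fin 3) (Fin 3) ℂ}

/-! ### The adjoint of the Maxwell operator -/

lemma star_energyDensity (hε : ε₀.IsHermitian) (hμ : μ₀.IsHermitian) (u v : EMField) (x : R3) :
    star (S.energyDensity ε₀ μ₀ u v x) =
      (S.medium ε₀ x *ᵥ (v x).1) ⬝ᵥ star (u x).1 + (S.medium μ₀ x *ᵥ (v x).2) ⬝ᵥ star (u x).2 :=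
  star_energyForm (isHermitian_medium hε x) (isHermitian_medium hμ x) (u x) (v x)

lemma isFiniteMeasure_restrict_ball (R : ℝ) :
    IsFiniteMeasure (volume.restrict (Metric.ball (0 : R3) R)) :=
  ⟨by simpa using (Metric.isBounded_ball (x := (0 : R3))).measure_lt_top (μ := volume)⟩

lemma memLp_inv_norm_sub (c : R3) (R : ℝ) :
    MemLp (fun y : R3 => ‖y - c‖⁻¹) 2 (volume.restrict (Metric.ball 0 R)) := by
  have hm : Measurable fun y : R3 => ‖y - c‖⁻¹ := by fun_prop
  rw [memLp_two_iff_integrable_sq hm.aestronglyMeasurable]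
  have h2 := (integrable_inv_sq_ball (R + ‖c‖)).integrable_indicator measurableSet_ball
  have h3 := (h2.comp_sub_right c).integrableOn (s := Metric.ball 0 R)
  refine h3.congr ?_
  filter_upwards [ae_restrict_mem measurableSet_ball] with y hy
  rw [Set.indicator_of_mem, inv_pow]
  rw [mem_ball_zero_iff] at hy ⊢
  linarith [norm_sub_le y c]

/-- A field of size `O(1 / r)` near the centres, and with bounded support, is square integrable. -/
lemma memLp_of_le_sum_inv (c : Fin N → R3) {F : EMField}
    (hF : AEStronglyMeasurable F volume) {C R : ℝ}
    (hb : ∀ᵐ y, ‖F y‖ ≤ C * (1 + ∑ j, ‖y - c j‖⁻¹)) (h0 : ∀ᵐ y, R ≤ ‖y‖ → F y = 0) :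
    MemLp F 2 volume := by
  have hfin := isFiniteMeasure_restrict_ball R
  have h2 : MemLp (fun y : R3 => 1 + ∑ j, ‖y - c j‖⁻¹) 2 (volume.restrict (Metric.ball 0 R)) :=
    (memLp_const (1 : ℝ)).add (memLp_finsetSum _ fun j _ => memLp_inv_norm_sub (c j) R)
  have hpos : ∀ y : R3, 0 ≤ 1 + ∑ j, ‖y - c j‖⁻¹ := fun y =>
    add_nonneg zero_le_one (Finset.sum_nonneg fun j _ => inv_nonneg.2 (norm_nonneg _))
  have h3 : MemLp F 2 (volume.restrict (Metric.ball 0 R)) := by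
    refine h2.of_le_mul (c := C) hF.restrict ((ae_restrict_of_ae hb).mono fun y hy => ?_)
    rwa [Real.norm_of_nonneg (hpos y)]
  have h4 := (memLp_indicator_iff_restrict (f := F) (p := 2) (μ := volume)
    (Metric.isOpen_ball (x := (0 : R3)) (ε := R)).measurableSet).2 h3
  refine h4.ae_eq ?_
  filter_upwards [h0] with y hy
  by_cases hyR : y ∈ Metric.ball (0 : R3) R
  · rw [Set.indicator_of_mem hyR]
  · rw [Set.indicator_of_notMem hyR, hy (by simpa using hyR)]

namespace IsFlattening

variable {Ψ : R3 → R3} {U₀ U : Set R3}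

lemma medium_mul_inv (h : S.IsFlattening Ψ U₀ U) {t₀ : Matrix (Fin 3) (Fin 3) ℂ} (ht : t₀.PosDef)
    {x : R3} (hx : x ∈ U) : S.medium t₀ x * (S.medium t₀ x)⁻¹ = 1 := by
  have h1 := h.medium_inv ht (h.inv_mem' x hx)
  rw [h.right_inv x (h.target_subset hx)] at h1
  exact mul_nonsing_inv _ (isUnit_det_of_right_inverse h1)

lemma medium_inv_eq (h : S.IsFlattening Ψ U₀ U) {t₀ : Matrix (Fin 3) (Fin 3) ℂ} (ht : t₀.PosDef)
    {y : R3} (hy : y ∈ U₀) : (S.medium t₀ (S.map y))⁻¹ = (jacobian S.map y).det •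
      ((jacobian Ψ (S.map y))ᵀ * t₀⁻¹ * jacobian Ψ (S.map y)) :=
  inv_eq_right_inv (h.medium_inv ht hy)

lemma medium_mulVec_maxwell (h : S.IsFlattening Ψ U₀ U) (hε : ε₀.PosDef) (hμ : μ₀.PosDef)
    (φ : EMField) {x : R3} (hx : x ∈ U) :
    S.medium ε₀ x *ᵥ (S.maxwell ε₀ μ₀ φ x).1 = Complex.I • curl (fun z => (φ z).2) x ∧
      S.medium μ₀ x *ᵥ (S.maxwell ε₀ μ₀ φ x).2 = -(Complex.I • curl (fun z => (φ z).1) x) := by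
  simp only [maxwell, mulVec_neg, mulVec_smul, mulVec_mulVec, h.medium_mul_inv hε hx,
    h.medium_mul_inv hμ hx, one_mulVec, and_self]

lemma star_energyInner_maxwell (h : S.IsFlattening Ψ U₀ U) (hε : ε₀.PosDef) (hμ : μ₀.PosDef)
    (φ u : EMField) : star (S.energyInner ε₀ μ₀ (S.maxwell ε₀ μ₀ φ) u) =
      ∫ x in S.Omega, ((-Complex.I) * ((u x).1 ⬝ᵥ curl (fun z => star (φ z).2) x)
        + Complex.I * ((u x).2 ⬝ᵥ curl (fun z => star (φ z).1) x)) := by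
  rw [energyInner]
  change (starRingEnd ℂ) _ = _
  rw [← integral_conj]
  refine integral_congr_ae ?_
  filter_upwards [h.ae_target] with x hx
  obtain ⟨h1, h2⟩ := h.medium_mulVec_maxwell hε hμ φ hx
  change star _ = _
  rw [energyDensity, h1, h2, star_add, ← star_dotProduct_star, ← star_dotProduct_star, star_star,
    star_star, star_neg, star_smul, star_smul, ← curl_star, ← curl_star, dotProduct_smul,
    dotProduct_neg, dotProduct_smul]
  simp

lemma star_energyInner (hε : ε₀.PosDef) (hμ : μ₀.PosDef) (φ w : EMField) :
    star (S.energyInner ε₀ μ₀ φ w) =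
      ∫ x in S.Omega, ((S.medium ε₀ x *ᵥ (w x).1) ⬝ᵥ star (φ x).1
        + (S.medium μ₀ x *ᵥ (w x).2) ⬝ᵥ star (φ x).2) := by
  rw [energyInner]
  change (starRingEnd ℂ) _ = _
  rw [← integral_conj]
  exact integral_congr_ae (Eventually.of_forall fun x => star_energyDensity hε.1 hμ.1 φ w x)

/-- Fields of finite energy are locally integrable. -/
lemma locallyIntegrableOn (h : S.IsFlattening Ψ U₀ U) {F : R3 → C3}
    (hF : LocallyIntegrableOn (fun y => (jacobian S.map y)ᵀ *ᵥ F (S.map y)) S.Omega0) :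
    LocallyIntegrableOn F S.Omega := by
  refine LocallyIntegrableOn.congr_ae (h.symm.locallyIntegrableOn_pull hF) ?_
  filter_upwards [h.ae_target] with x hx
  rw [mulVec_mulVec, ← transpose_mul, h.symm.jacobian_inv_mul hx, transpose_one, one_mulVec,
    h.right_inv x (h.target_subset hx)]

lemma locallyIntegrableOn_medium (h : S.IsFlattening Ψ U₀ U) (t₀ : Matrix (Fin 3) (Fin 3) ℂ)
    {F : R3 → C3}
    (hF : LocallyIntegrableOn (fun y => t₀ *ᵥ ((jacobian S.map y)ᵀ *ᵥ F (S.map y))) S.Omega0) :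
    LocallyIntegrableOn (fun x => S.medium t₀ x *ᵥ F x) S.Omega := by
  refine LocallyIntegrableOn.congr_ae (h.symm.locallyIntegrableOn_pull_density hF) ?_
  filter_upwards [h.ae_target] with x hx
  have e := h.medium_eq t₀ (h.inv_mem' x hx)
  have e2 : (jacobian Ψ x).det = (jacobian S.map (Ψ x)).det⁻¹ := by
    refine eq_inv_of_mul_eq_one_left ?_
    rw [← det_mul, h.symm.jacobian_mul_inv hx, det_one]
  rw [h.right_inv x (h.target_subset hx)] at e ⊢
  rw [e, e2, smul_mulVec, mulVec_mulVec, mulVec_mulVec]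

/-- The adjoint of the Maxwell operator on `C¹₀(Ω)` is the weak Maxwell operator. -/
lemma mem_adjointGraph_iff (h : S.IsFlattening Ψ U₀ U) (hε : ε₀.PosDef) (hμ : μ₀.PosDef)
    {u w : EMField} : (u, w) ∈ S.adjointGraph ε₀ μ₀ (S.maxwellGraph ε₀ μ₀) ↔
      S.FiniteEnergyOn ε₀ μ₀ S.Omega u ∧ S.FiniteEnergyOn ε₀ μ₀ S.Omega w ∧
        WeakMaxwell S.Omega (S.medium ε₀) (S.medium μ₀) u w := by
  refine and_congr_right fun hu => and_congr_right fun hw => ?_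
  have lu := MemLp.l2Loc ((h.finiteEnergyOn_iff hε hμ).1 hu).2
  have lw := MemLp.l2Loc ((h.finiteEnergyOn_iff hε hμ).1 hw).2
  have l1 : LocallyIntegrableOn (fun x => (u x).1) S.Omega :=
    h.locallyIntegrableOn (lu.fst.locallyIntegrable.locallyIntegrableOn _)
  have l2 : LocallyIntegrableOn (fun x => (u x).2) S.Omega :=
    h.locallyIntegrableOn (lu.snd.locallyIntegrable.locallyIntegrableOn _)
  have l3 : LocallyIntegrableOn (fun x => S.medium ε₀ x *ᵥ (w x).1) S.Omega :=
    h.locallyIntegrableOn_medium ε₀ ((lw.fst.mulVec ε₀).locallyIntegrable.locallyIntegrableOn _)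
  have l4 : LocallyIntegrableOn (fun x => S.medium μ₀ x *ᵥ (w x).2) S.Omega :=
    h.locallyIntegrableOn_medium μ₀ ((lw.snd.mulVec μ₀).locallyIntegrable.locallyIntegrableOn _)
  constructor
  · intro hA
    have sub : ∀ φ : R3 → C3, tsupport (fun x => star (φ x)) ⊆ tsupport φ := fun φ =>
      closure_mono fun x hx hx' => hx (by simp [hx'])
    have zc : ∀ x, curl (fun _ : R3 => (0 : C3)) x = 0 := fun x => by
      ext i
      fin_cases i <;> simp [curl, pd]
    refine ⟨⟨l1, l4.smul Complex.I, fun φ hφ hc hs => ?_⟩, ⟨l2, l3.smul (-Complex.I), fun φ hφ hc hs => ?_⟩⟩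
    · have hs' : tsupport (fun x => ((0 : C3), star (φ x))) ⊆ tsupport φ :=
        closure_mono fun x hx hx' => hx (by simp [hx'])
      have hq : ((fun x => ((0 : C3), star (φ x))), S.maxwell ε₀ μ₀ fun x => ((0 : C3), star (φ x)))
          ∈ S.maxwellGraph ε₀ μ₀ := by
        refine ⟨contDiff_const.prodMk ?_, hc.of_isClosed_subset (isClosed_tsupport _) hs',
          hs'.trans hs, rfl⟩
        exact contDiff_pi.2 fun i => Complex.conjCLE.contDiff.comp
          ((contDiff_pi.1 hφ i).of_le (by simp))
      have key := congrArg star (hA _ hq)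
      rw [h.star_energyInner_maxwell hε hμ, star_energyInner hε hμ] at key
      simp only [star_star, star_zero, zc, dotProduct_zero, mul_zero, add_zero, zero_add] at key
      rw [integral_const_mul] at key
      simp only [smul_dotProduct, smul_eq_mul]
      rw [integral_const_mul, ← key, ← mul_assoc, mul_neg, Complex.I_mul_I, neg_neg, one_mul]
    · have hs' : tsupport (fun x => (star (φ x), (0 : C3))) ⊆ tsupport φ :=
        closure_mono fun x hx hx' => hx (by simp [hx'])
      have hq : ((fun x => (star (φ x), (0 : C3))), S.maxwell ε₀ μ₀ fun x => (star (φ x), (0 : C3)))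
          ∈ S.maxwellGraph ε₀ μ₀ := by
        refine ⟨ContDiff.prodMk ?_ contDiff_const, hc.of_isClosed_subset (isClosed_tsupport _) hs',
          hs'.trans hs, rfl⟩
        exact contDiff_pi.2 fun i => Complex.conjCLE.contDiff.comp
          ((contDiff_pi.1 hφ i).of_le (by simp))
      have key := congrArg star (hA _ hq)
      rw [h.star_energyInner_maxwell hε hμ, star_energyInner hε hμ] at key
      simp only [star_star, star_zero, zc, dotProduct_zero, mul_zero, add_zero, zero_add] at key
      rw [integral_const_mul] at key
      simp only [smul_dotProduct, smul_eq_mul]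
      rw [integral_const_mul, ← key, ← mul_assoc, neg_mul, Complex.I_mul_I, neg_neg, one_mul]
  · rintro ⟨hE, hH⟩ ⟨φ, ψ⟩ ⟨hφ, hc, hs, hψ⟩
    change ψ = S.maxwell ε₀ μ₀ φ at hψ
    change ContDiff ℝ 1 φ at hφ
    change HasCompactSupport φ at hc
    change tsupport φ ⊆ _ at hs
    subst hψ
    have c1 : ContDiff ℝ 1 fun x => star (φ x).1 := contDiff_pi.2 fun i =>
      Complex.conjCLE.contDiff.comp (contDiff_pi.1 (contDiff_fst.comp hφ) i)
    have c2 : ContDiff ℝ 1 fun x => star (φ x).2 := contDiff_pi.2 fun i =>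
      Complex.conjCLE.contDiff.comp (contDiff_pi.1 (contDiff_snd.comp hφ) i)
    have s1 : tsupport (fun x => star (φ x).1) ⊆ tsupport φ :=
      closure_mono fun x hx hx' => hx (by simp [hx'])
    have s2 : tsupport (fun x => star (φ x).2) ⊆ tsupport φ :=
      closure_mono fun x hx hx' => hx (by simp [hx'])
    have green : ∀ {F G : R3 → C3} {χ : R3 → C3}, HasWeakCurl S.Omega F G → ContDiff ℝ 1 χ →
        tsupport χ ⊆ tsupport φ → ∫ x in S.Omega, F x ⬝ᵥ curl χ x = ∫ x in S.Omega, G x ⬝ᵥ χ x := by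
      intro F G χ hFG hχ sχ
      have hcχ : HasCompactSupport χ := hc.of_isClosed_subset (isClosed_tsupport _) sχ
      choose C hC using fun i => exists_lipschitzWith_of_contDiff (contDiff_pi.1 hχ i)
        (hcχ.of_isClosed_subset (isClosed_tsupport _) (closure_mono fun x hx hx' => hx (by simp [hx'])))
      exact hFG.integral_curl h.isOpen_target (A := ∑ i, C i) (fun i => (hC i).weaken
        (Finset.single_le_sum (f := C) (fun _ _ => zero_le) (Finset.mem_univ i))) hcχ (sχ.trans hs)
    have int : ∀ {H χ : R3 → C3}, LocallyIntegrableOn H S.Omega → Continuous χ →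
        tsupport χ ⊆ tsupport φ → IntegrableOn (fun x => H x ⬝ᵥ χ x) S.Omega := by
      intro H χ hH hχ hsub
      have hcψ : HasCompactSupport χ := hc.of_isClosed_subset (isClosed_tsupport _) hsub
      obtain ⟨M, hM⟩ := hχ.bounded_above_of_compact_support hcψ
      exact (integrable_dot hH hcψ.isCompact (hsub.trans hs) hχ.aestronglyMeasurable hM
        fun x hx => image_eq_zero_of_notMem_tsupport hx).integrableOn
    refine star_injective ?_
    rw [h.star_energyInner_maxwell hε hμ, star_energyInner hε hμ,
      integral_add ((int l1 (continuous_curl_of_contDiff c2)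
        ((tsupport_curl_subset _).trans s2)).const_mul _) ((int l2 (continuous_curl_of_contDiff c1)
        ((tsupport_curl_subset _).trans s1)).const_mul _), integral_const_mul, integral_const_mul,
      green hE c2 s2, green hH c1 s1, integral_add (int l3 c1.continuous s1) (int l4 c2.continuous s2)]
    simp only [smul_dotProduct, smul_eq_mul]
    rw [integral_const_mul, integral_const_mul, ← mul_assoc, ← mul_assoc, neg_mul, mul_neg,
      Complex.I_mul_I, neg_neg, one_mul, one_mul, add_comm]

/-- The graph of the adjoint of the Maxwell operator in terms of the pulled back fields. -/
lemma mem_adjointGraph_iff_pull (h : S.IsFlattening Ψ U₀ U) (hε : ε₀.PosDef) (hμ : μ₀.PosDef)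
    {u w : EMField} : (u, w) ∈ S.adjointGraph ε₀ μ₀ (S.maxwellGraph ε₀ μ₀) ↔
      (AEStronglyMeasurable u (volume.restrict S.Omega) ∧ MemLp (pull S.map u) 2 volume) ∧
      (AEStronglyMeasurable w (volume.restrict S.Omega) ∧ MemLp (pull S.map w) 2 volume) ∧
        WeakMaxwell S.Omega (S.medium ε₀) (S.medium μ₀) u w := by
  rw [h.mem_adjointGraph_iff hε hμ, h.finiteEnergyOn_iff hε hμ, h.finiteEnergyOn_iff hε hμ]

/-- The weak Maxwell operator in `Ω` is symmetric, as its pull-back is. -/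
lemma adjointGraph_subset (h : S.IsFlattening Ψ U₀ U) (hε : ε₀.PosDef) (hμ : μ₀.PosDef) :
    S.adjointGraph ε₀ μ₀ (S.maxwellGraph ε₀ μ₀)
      ⊆ S.adjointGraph ε₀ μ₀ (S.adjointGraph ε₀ μ₀ (S.maxwellGraph ε₀ μ₀)) := by
  rintro ⟨u, w⟩ hp
  refine ⟨hp.1, hp.2.1, ?_⟩
  rintro ⟨u', w'⟩ hp'
  rw [h.mem_adjointGraph_iff_pull hε hμ] at hp hp'
  obtain ⟨⟨-, lu⟩, ⟨-, lw⟩, hW⟩ := hp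
  obtain ⟨⟨-, lu'⟩, ⟨-, lw'⟩, hW'⟩ := hp'
  rw [h.energyInner_eq, h.energyInner_eq]
  exact WeakMaxwell.integral_energyForm hε.1 hμ.1
    (h.weakMaxwell_pull_univ hW' (MemLp.l2Loc lu') (MemLp.l2Loc lw'))
    (h.weakMaxwell_pull_univ hW (MemLp.l2Loc lu) (MemLp.l2Loc lw)) lu' lw' lu lw

end IsFlattening

end CloakSystem

lemma pull_smul (Φ : R3 → R3) (c : ℂ) (u : EMField) : pull Φ (c • u) = c • pull Φ u := by
  funext y
  simp only [pull, Pi.smul_apply, Prod.smul_fst, Prod.smul_snd, mulVec_smul, Prod.smul_mk]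

lemma WeakMaxwell.congr {O : Set R3} {ε μ : R3 → Matrix (Fin 3) (Fin 3) ℂ} {u w u' w' : EMField}
    (h : WeakMaxwell O ε μ u w) (hu : u =ᵐ[volume.restrict O] u') (hw : w =ᵐ[volume.restrict O] w') :
    WeakMaxwell O ε μ u' w' :=
  ⟨h.1.congr (hu.mono fun x hx => by simp only [hx]) (hw.mono fun x hx => by simp only [hx]),
    h.2.congr (hu.mono fun x hx => by simp only [hx]) (hw.mono fun x hx => by simp only [hx])⟩

lemma jacobian_eq_one {f : R3 → R3} {x : R3} (h : ∀ᶠ z in 𝓝 x, f z = z) : jacobian f x = 1 := by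
  have h1 : HasFDerivAt f (ContinuousLinearMap.id ℝ R3) x := (hasFDerivAt_id x).congr_of_eventuallyEq h
  ext l m
  rw [jacobian, Matrix.of_apply, h1.fderiv, Matrix.one_apply]
  by_cases hlm : l = m <;> simp [hlm]

namespace CloakSystem

variable {N : ℕ} {S : CloakSystem N} {ε₀ μ₀ : Matrix (Fin 3) (Fin 3) ℂ}

namespace IsFlattening

variable {Ψ : R3 → R3} {U₀ U : Set R3}

/-! ### The Maxwell operator and its self-adjoint extension -/

lemma pull_medium_inv (h : S.IsFlattening Ψ U₀ U) {t₀ : Matrix (Fin 3) (Fin 3) ℂ} (ht : t₀.PosDef)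
    {y : R3} (hy : y ∈ U₀) (a : C3) :
    (jacobian S.map y)ᵀ *ᵥ ((S.medium t₀ (S.map y))⁻¹ *ᵥ a)
      = t₀⁻¹ *ᵥ ((jacobian S.map y).det • (jacobian Ψ (S.map y) *ᵥ a)) := by
  have h2 : (jacobian S.map y)ᵀ * (jacobian Ψ (S.map y))ᵀ = 1 := by
    rw [← transpose_mul, h.jacobian_inv_mul hy, transpose_one]
  rw [h.medium_inv_eq ht hy, smul_mulVec, mulVec_smul, mulVec_smul, mulVec_mulVec, mulVec_mulVec,
    ← Matrix.mul_assoc, ← Matrix.mul_assoc, h2, Matrix.one_mul]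

lemma det_smul_inv_cross (h : S.IsFlattening Ψ U₀ U) {y : R3} (hy : y ∈ U₀) (a b : C3) :
    (jacobian S.map y).det • (jacobian Ψ (S.map y) *ᵥ crossProduct a b)
      = crossProduct ((jacobian S.map y)ᵀ *ᵥ a) ((jacobian S.map y)ᵀ *ᵥ b) := by
  rw [← mulVec_smul, ← mulVec_cross_transpose, mulVec_mulVec, h.jacobian_inv_mul hy, one_mulVec]

lemma aestronglyMeasurable_medium_inv (h : S.IsFlattening Ψ U₀ U) {t₀ : Matrix (Fin 3) (Fin 3) ℂ}
    (ht : t₀.PosDef) {F : R3 → C3} (hF : AEStronglyMeasurable F (volume.restrict S.Omega)) :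
    AEStronglyMeasurable (fun x => (S.medium t₀ x)⁻¹ *ᵥ F x) (volume.restrict S.Omega) := by
  have hd : Measurable fun y => (jacobian S.map y).det := by
    simp only [det_fin_three]
    have := measurable_jacobian S.map
    fun_prop
  have hK := measurable_jacobian Ψ
  have m1 : AEStronglyMeasurable (fun x => jacobian Ψ x *ᵥ F x) (volume.restrict S.Omega) :=
    aestronglyMeasurable_mulVec (fun i j => (hK i j).aestronglyMeasurable) hF
  have m2 : AEStronglyMeasurable (fun x => t₀⁻¹ *ᵥ (jacobian Ψ x *ᵥ F x))
      (volume.restrict S.Omega) :=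
    aestronglyMeasurable_mulVec (M := fun _ => t₀⁻¹) (fun i j => aestronglyMeasurable_const) m1
  have m3 : AEStronglyMeasurable (fun x => (jacobian Ψ x)ᵀ *ᵥ (t₀⁻¹ *ᵥ (jacobian Ψ x *ᵥ F x)))
      (volume.restrict S.Omega) :=
    aestronglyMeasurable_mulVec (M := fun x => (jacobian Ψ x)ᵀ)
      (fun i j => (hK j i).aestronglyMeasurable) m2
  have m0 : AEStronglyMeasurable (fun x => (jacobian S.map (Ψ x)).det) (volume.restrict S.Omega) :=
    (hd.comp h.measurable_inv).aestronglyMeasurable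
  have h1 := m0.smul m3
  refine h1.congr ?_
  filter_upwards [h.ae_target] with x hx
  have e := h.medium_inv_eq ht (h.inv_mem' x hx)
  rw [h.right_inv x (h.target_subset hx)] at e
  rw [e, smul_mulVec, Pi.smul_apply', mulVec_mulVec, mulVec_mulVec, Matrix.mul_assoc]

lemma exists_bound_jacobian (h : S.IsFlattening Ψ U₀ U) : ∃ C : ℝ, 0 ≤ C ∧ ∀ y ∈ U₀, ∀ a : C3,
    ‖(jacobian S.map y)ᵀ *ᵥ a‖ ≤ C * (1 + ∑ j, ‖y - S.c j‖⁻¹) * ‖a‖ := by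
  obtain ⟨C, hC, hJ⟩ := h.norm_fderiv_map_le
  refine ⟨3 * C, by positivity, fun y hy a => ?_⟩
  rw [mul_assoc 3]
  exact norm_mulVec_le_of_le (M := (jacobian S.map y)ᵀ)
    (fun i j => (norm_jacobian_le _ _ _ _).trans (hJ y hy)) a

lemma one_le_sum (c : Fin N → R3) (y : R3) : 1 ≤ 1 + ∑ j, ‖y - c j‖⁻¹ :=
  le_add_of_nonneg_right (Finset.sum_nonneg fun _ _ => inv_nonneg.2 (norm_nonneg _))

/-- Points far out are mapped to points far out. -/
lemma exists_map_far (h : S.IsFlattening Ψ U₀ U) (r : ℝ) : ∃ R : ℝ, ∀ y ∈ U₀, R ≤ ‖y‖ →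
    r < ‖S.map y‖ := by
  obtain ⟨D, hD⟩ := h.norm_map_sub_le
  refine ⟨r + D + 1, fun y hy hR => ?_⟩
  have h2 := norm_sub_norm_le y (S.map y)
  rw [norm_sub_rev] at h2
  linarith [hD y (h.source_subset hy)]

lemma maxwellGraph_subset (h : S.IsFlattening Ψ U₀ U) (hε : ε₀.PosDef) (hμ : μ₀.PosDef) :
    S.maxwellGraph ε₀ μ₀ ⊆ S.adjointGraph ε₀ μ₀ (S.maxwellGraph ε₀ μ₀) := by
  rintro ⟨φ, ψ⟩ ⟨hφ, hc, hs, hψ⟩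
  change ψ = S.maxwell ε₀ μ₀ φ at hψ
  change ContDiff ℝ 1 φ at hφ
  change HasCompactSupport φ at hc
  change tsupport φ ⊆ _ at hs
  subst hψ
  have c1 : ContDiff ℝ 1 fun x => (φ x).1 := contDiff_fst.comp hφ
  have c2 : ContDiff ℝ 1 fun x => (φ x).2 := contDiff_snd.comp hφ
  have cc1 := continuous_curl_of_contDiff c1
  have cc2 := continuous_curl_of_contDiff c2
  have s1 : tsupport (curl fun x => (φ x).1) ⊆ tsupport φ :=
    (tsupport_curl_subset _).trans (closure_mono fun x hx hx' => hx (by simp [hx']))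
  have s2 : tsupport (curl fun x => (φ x).2) ⊆ tsupport φ :=
    (tsupport_curl_subset _).trans (closure_mono fun x hx hx' => hx (by simp [hx']))
  obtain ⟨M, hM⟩ := hφ.continuous.bounded_above_of_compact_support hc
  obtain ⟨M₁, hM₁⟩ := cc1.bounded_above_of_compact_support
    (hc.of_isClosed_subset (isClosed_tsupport _) s1)
  obtain ⟨M₂, hM₂⟩ := cc2.bounded_above_of_compact_support
    (hc.of_isClosed_subset (isClosed_tsupport _) s2)
  have hM0 : 0 ≤ M := (norm_nonneg _).trans (hM 0)
  obtain ⟨r, hr⟩ := hc.isCompact.isBounded.subset_closedBall (0 : R3)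
  obtain ⟨R, hR⟩ := h.exists_map_far r
  have far : ∀ y ∈ U₀, R ≤ ‖y‖ → S.map y ∉ tsupport φ := fun y hy hyR hm =>
    (mem_closedBall_zero_iff.1 (hr hm)).not_gt (hR y hy hyR)
  have mφ : AEStronglyMeasurable φ (volume.restrict S.Omega) := hφ.continuous.aestronglyMeasurable
  have mm : AEStronglyMeasurable (S.maxwell ε₀ μ₀ φ) (volume.restrict S.Omega) :=
    ((h.aestronglyMeasurable_medium_inv hε cc2.aestronglyMeasurable).const_smul Complex.I).prodMk
      ((h.aestronglyMeasurable_medium_inv hμ cc1.aestronglyMeasurable).const_smul Complex.I).neg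
  obtain ⟨C, hC, hJ⟩ := h.exists_bound_jacobian
  refine (h.mem_adjointGraph_iff_pull hε hμ).2 ⟨⟨mφ, ?_⟩, ⟨mm, ?_⟩, ?_, ?_⟩
  · refine memLp_of_le_sum_inv S.c (h.aestronglyMeasurable_pull_map mφ) (C := C * M) (R := R) ?_ ?_
    · filter_upwards [h.ae_mem] with y hy
      have hpos : 0 ≤ C * (1 + ∑ j, ‖y - S.c j‖⁻¹) :=
        mul_nonneg hC (zero_le_one.trans (one_le_sum S.c y))
      rw [mul_right_comm]
      refine norm_prod_le_iff.2 ⟨(hJ y hy _).trans ?_, (hJ y hy _).trans ?_⟩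
      · exact mul_le_mul_of_nonneg_left ((norm_fst_le _).trans (hM _)) hpos
      · exact mul_le_mul_of_nonneg_left ((norm_snd_le _).trans (hM _)) hpos
    · filter_upwards [h.ae_mem] with y hy hyR
      have := image_eq_zero_of_notMem_tsupport (far y hy hyR)
      simp [pull, this]
  · -- on the compact preimage of the support, the Jacobian matrix is bounded
    have hK : IsCompact (Ψ '' tsupport φ) := hc.isCompact.image_of_continuousOn fun x hx =>
      (h.symm.continuousAt (hs hx)).continuousWithinAt
    have hcont : ContinuousOn (fun y : R3 => 1 + ∑ j, ‖y - S.c j‖⁻¹) (Ψ '' tsupport φ) := by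
      rintro _ ⟨x, hx, rfl⟩
      refine ContinuousAt.continuousWithinAt (continuousAt_const.add (tendsto_finsetSum _ fun j _ => ?_))
      refine ContinuousAt.inv₀ (by fun_prop) (norm_ne_zero_iff.2 (sub_ne_zero.2 fun e => ?_))
      exact h.inv_mem x (hs hx) ⟨j, e.symm⟩
    obtain ⟨B, hB⟩ := hK.exists_bound_of_continuousOn hcont
    obtain ⟨C₁, hC₁, hJ₁⟩ := h.norm_fderiv_map_le
    obtain ⟨C₂, hC₂, hJ₂⟩ := h.norm_fderiv_inv_le
    obtain ⟨E₁, hE₁, hE₁'⟩ := norm_mulVec_le ε₀⁻¹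
    obtain ⟨E₂, hE₂, hE₂'⟩ := norm_mulVec_le μ₀⁻¹
    have key : ∀ y ∈ U₀, ∀ {F : R3 → C3} {M' : ℝ}, (∀ x, ‖F x‖ ≤ M') → tsupport F ⊆ tsupport φ →
        ‖(jacobian S.map y).det • (jacobian Ψ (S.map y) *ᵥ F (S.map y))‖
          ≤ |6 * (C₁ * |B|) ^ 3 * (3 * C₂ * M')| := by
      intro y hy F M' hF sF
      refine le_trans ?_ (le_abs_self _)
      have hM' : 0 ≤ M' := (norm_nonneg _).trans (hF 0)
      by_cases hm : S.map y ∈ tsupport φ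
      · have hyB := hB y ⟨_, hm, h.left_inv y (h.source_subset hy)⟩
        rw [Real.norm_of_nonneg (zero_le_one.trans (one_le_sum S.c y))] at hyB
        have h1 : ‖fderiv ℝ S.map y‖ ≤ C₁ * |B| :=
          (hJ₁ y hy).trans (mul_le_mul_of_nonneg_left (hyB.trans (le_abs_self _)) hC₁)
        rw [norm_smul]
        refine mul_le_mul (norm_det_le fun i j => (norm_jacobian_le _ _ _ _).trans h1) ?_
          (norm_nonneg _) (by positivity)
        refine (norm_mulVec_le_of_le (M := jacobian Ψ (S.map y)) (fun i j =>
          (norm_jacobian_le _ _ _ _).trans (hJ₂ _ (h.map_mem' y hy))) _).trans ?_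
        exact mul_le_mul_of_nonneg_left (hF _) (by positivity)
      · rw [image_eq_zero_of_notMem_tsupport fun h' => hm (sF h'), mulVec_zero, smul_zero, norm_zero]
        positivity
    set Q₁ := |6 * (C₁ * |B|) ^ 3 * (3 * C₂ * M₁)|
    set Q₂ := |6 * (C₁ * |B|) ^ 3 * (3 * C₂ * M₂)|
    have hQ₁ : 0 ≤ Q₁ := abs_nonneg _
    have hQ₂ : 0 ≤ Q₂ := abs_nonneg _
    refine memLp_of_le_sum_inv S.c (h.aestronglyMeasurable_pull_map mm) (C := E₁ * Q₂ + E₂ * Q₁)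
      (R := R) ?_ ?_
    · filter_upwards [h.ae_mem] with y hy
      refine le_trans ?_ (le_mul_of_one_le_right (by positivity) (one_le_sum S.c y))
      have n1 := (hE₁' _).trans (mul_le_mul_of_nonneg_left (key y hy hM₂ s2) hE₁)
      have n2 := (hE₂' _).trans (mul_le_mul_of_nonneg_left (key y hy hM₁ s1) hE₂)
      rw [← h.pull_medium_inv hε hy] at n1
      rw [← h.pull_medium_inv hμ hy] at n2
      have p1 : 0 ≤ E₁ * Q₂ := by positivity
      have p2 : 0 ≤ E₂ * Q₁ := by positivity
      refine norm_prod_le_iff.2 ⟨?_, ?_⟩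
      · simp only [pull, maxwell, mulVec_smul, norm_smul, Complex.norm_I, one_mul]
        linarith
      · simp only [pull, maxwell, mulVec_neg, norm_neg, mulVec_smul, norm_smul, Complex.norm_I, one_mul]
        linarith
    · filter_upwards [h.ae_mem] with y hy hyR
      have e1 := image_eq_zero_of_notMem_tsupport fun h' => far y hy hyR (s1 h')
      have e2 := image_eq_zero_of_notMem_tsupport fun h' => far y hy hyR (s2 h')
      simp only [pull, maxwell, e1, e2, mulVec_zero, smul_zero, neg_zero]
      rfl
  · refine (hasWeakCurl_of_contDiff c1).congr (EventuallyEq.refl _ _) ?_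
    filter_upwards [h.ae_target] with x hx
    rw [(h.medium_mulVec_maxwell hε hμ φ hx).2, smul_neg, smul_smul, Complex.I_mul_I, neg_smul,
      one_smul, neg_neg]
  · refine (hasWeakCurl_of_contDiff c2).congr (EventuallyEq.refl _ _) ?_
    filter_upwards [h.ae_target] with x hx
    rw [(h.medium_mulVec_maxwell hε hμ φ hx).1, smul_smul, neg_mul, Complex.I_mul_I, neg_neg, one_smul]

/-- The adjoint of the Maxwell operator is its only self-adjoint extension. -/
lemma isSelfAdjointExtension (h : S.IsFlattening Ψ U₀ U) (hε : ε₀.PosDef) (hμ : μ₀.PosDef) :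
    S.IsSelfAdjointExtension ε₀ μ₀ (S.adjointGraph ε₀ μ₀ (S.maxwellGraph ε₀ μ₀)) ∧
      ∀ A', S.IsSelfAdjointExtension ε₀ μ₀ A' →
        A' = S.adjointGraph ε₀ μ₀ (S.maxwellGraph ε₀ μ₀) := by
  have anti : ∀ {A B : Set (EMField × EMField)}, A ⊆ B →
      S.adjointGraph ε₀ μ₀ B ⊆ S.adjointGraph ε₀ μ₀ A := fun hAB p hp =>
    ⟨hp.1, hp.2.1, fun q hq => hp.2.2 q (hAB hq)⟩
  have h1 := h.maxwellGraph_subset hε hμ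
  have h2 := h.adjointGraph_subset hε hμ
  have h3 := h2.antisymm (anti h1)
  refine ⟨⟨h1, h3⟩, fun A' hA' => ?_⟩
  have h4 : A' ⊆ S.adjointGraph ε₀ μ₀ (S.maxwellGraph ε₀ μ₀) := by
    rw [hA'.2]
    exact anti hA'.1
  refine h4.antisymm ?_
  rw [h3]
  conv_rhs => rw [hA'.2]
  exact anti h4

/-! ### Solutions of locally finite energy -/

/-- Cutting off a field whose pull-back is bounded leads to the domain of the Maxwell operator. The
gradient of the cut-off function is pulled back to a field of size `O(1 / r)` near the centres,
which is square integrable. -/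
lemma exists_smul_mem (h : S.IsFlattening Ψ U₀ U) (hε : ε₀.PosDef) (hμ : μ₀.PosDef) {u w : EMField}
    (hW : WeakMaxwell S.Omega (S.medium ε₀) (S.medium μ₀) u w)
    (mu : AEStronglyMeasurable u (volume.restrict S.Omega))
    (mw : AEStronglyMeasurable w (volume.restrict S.Omega)) {M : ℝ}
    (bu : ∀ᵐ y, ‖pull S.map u y‖ ≤ M) (bw : ∀ᵐ y, ‖pull S.map w y‖ ≤ M)
    {χ : R3 → ℂ} (hχ : ContDiff ℝ 1 χ) (hc : HasCompactSupport χ) :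
    ∃ w', ((fun x => χ x • u x), w') ∈ S.adjointGraph ε₀ μ₀ (S.maxwellGraph ε₀ μ₀) := by
  have hg := continuous_grad_of_contDiff hχ
  have sg : tsupport (grad χ) ⊆ tsupport χ := closure_minimal (fun x hx => by
    by_contra h
    exact hx (funext fun j => pd_eq_zero_of_notMem_tsupport h)) (isClosed_tsupport _)
  obtain ⟨X, hX⟩ := hχ.continuous.bounded_above_of_compact_support hc
  obtain ⟨Y, hY⟩ := hg.bounded_above_of_compact_support
    (hc.of_isClosed_subset (isClosed_tsupport _) sg)
  have hX0 : 0 ≤ X := (norm_nonneg _).trans (hX 0)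
  have hY0 : 0 ≤ Y := (norm_nonneg _).trans (hY 0)
  obtain ⟨r, hr⟩ := hc.isCompact.isBounded.subset_closedBall (0 : R3)
  obtain ⟨R, hR⟩ := h.exists_map_far r
  have far : ∀ y ∈ U₀, R ≤ ‖y‖ → S.map y ∉ tsupport χ := fun y hy hyR hm =>
    (mem_closedBall_zero_iff.1 (hr hm)).not_gt (hR y hy hyR)
  obtain ⟨C, hC, hJ⟩ := h.exists_bound_jacobian
  obtain ⟨E₁, hE₁, hE₁'⟩ := norm_mulVec_le ε₀⁻¹
  obtain ⟨E₂, hE₂, hE₂'⟩ := norm_mulVec_le μ₀⁻¹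
  set w' : EMField := fun x =>
    (χ x • (w x).1 + Complex.I • ((S.medium ε₀ x)⁻¹ *ᵥ crossProduct (grad χ x) (u x).2),
      χ x • (w x).2 - Complex.I • ((S.medium μ₀ x)⁻¹ *ᵥ crossProduct (grad χ x) (u x).1)) with hw'
  have mχ : AEStronglyMeasurable χ (volume.restrict S.Omega) := hχ.continuous.aestronglyMeasurable
  have mg : AEStronglyMeasurable (grad χ) (volume.restrict S.Omega) := hg.aestronglyMeasurable
  have m1 : AEStronglyMeasurable (fun x => χ x • u x) (volume.restrict S.Omega) := mχ.smul mu
  have m2 : AEStronglyMeasurable w' (volume.restrict S.Omega) :=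
    ((mχ.smul (continuous_fst.comp_aestronglyMeasurable mw)).add
      ((h.aestronglyMeasurable_medium_inv hε (aestronglyMeasurable_cross mg
        (continuous_snd.comp_aestronglyMeasurable mu))).const_smul Complex.I)).prodMk
    ((mχ.smul (continuous_snd.comp_aestronglyMeasurable mw)).sub
      ((h.aestronglyMeasurable_medium_inv hμ (aestronglyMeasurable_cross mg
        (continuous_fst.comp_aestronglyMeasurable mu))).const_smul Complex.I))
  refine ⟨w', (h.mem_adjointGraph_iff_pull hε hμ).2 ⟨⟨m1, ?_⟩, ⟨m2, ?_⟩, ?_, ?_⟩⟩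
  · refine memLp_of_le_sum_inv S.c (h.aestronglyMeasurable_pull_map m1) (C := X * M) (R := R) ?_ ?_
    · filter_upwards [bu] with y hy
      have hM0 : 0 ≤ M := (norm_nonneg _).trans hy
      refine le_trans ?_ (le_mul_of_one_le_right (by positivity) (one_le_sum S.c y))
      have e : pull S.map (fun x => χ x • u x) y = χ (S.map y) • pull S.map u y := by
        simp only [pull, Prod.smul_fst, Prod.smul_snd, mulVec_smul, Prod.smul_mk]
      rw [e, norm_smul]
      exact mul_le_mul (hX _) hy (norm_nonneg _) hX0
    · filter_upwards [h.ae_mem] with y hy hyR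
      have := image_eq_zero_of_notMem_tsupport (far y hy hyR)
      simp only [pull, this, zero_smul, Prod.fst_zero, Prod.snd_zero, mulVec_zero]
      rfl
  · refine memLp_of_le_sum_inv S.c (h.aestronglyMeasurable_pull_map m2)
      (C := X * M + E₁ * (2 * (C * Y) * M) + E₂ * (2 * (C * Y) * M)) (R := R) ?_ ?_
    · filter_upwards [bu, bw, h.ae_mem] with y hyu hyw hy
      have hM0 : 0 ≤ M := (norm_nonneg _).trans hyu
      set σ := 1 + ∑ j, ‖y - S.c j‖⁻¹
      have hσ : 1 ≤ σ := one_le_sum S.c y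
      have hσ0 : 0 ≤ σ := zero_le_one.trans hσ
      have g1 : ‖(jacobian S.map y)ᵀ *ᵥ grad χ (S.map y)‖ ≤ C * σ * Y :=
        (hJ y hy _).trans (mul_le_mul_of_nonneg_left (hY _) (by positivity))
      have k1 : ∀ {F : R3 → C3}, ‖(jacobian S.map y)ᵀ *ᵥ F (S.map y)‖ ≤ M →
          ‖crossProduct ((jacobian S.map y)ᵀ *ᵥ grad χ (S.map y))
            ((jacobian S.map y)ᵀ *ᵥ F (S.map y))‖ ≤ 2 * (C * Y) * M * σ := fun hF => by
        refine (norm_crossProduct_le _ _).trans ?_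
        have := mul_le_mul (mul_le_mul_of_nonneg_left g1 zero_le_two) hF (norm_nonneg _)
          (by positivity)
        refine this.trans (le_of_eq (by ring))
      have u1 : ‖(pull S.map u y).1‖ ≤ M := (norm_fst_le _).trans hyu
      have u2 : ‖(pull S.map u y).2‖ ≤ M := (norm_snd_le _).trans hyu
      have n1 := (hE₁' _).trans (mul_le_mul_of_nonneg_left (k1 (F := fun x => (u x).2) u2) hE₁)
      have n2 := (hE₂' _).trans (mul_le_mul_of_nonneg_left (k1 (F := fun x => (u x).1) u1) hE₂)
      have w1 : ‖χ (S.map y) • (pull S.map w y).1‖ ≤ X * M * σ := by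
        rw [norm_smul]
        exact (mul_le_mul (hX _) ((norm_fst_le _).trans hyw) (norm_nonneg _) hX0).trans
          (le_mul_of_one_le_right (by positivity) hσ)
      have w2 : ‖χ (S.map y) • (pull S.map w y).2‖ ≤ X * M * σ := by
        rw [norm_smul]
        exact (mul_le_mul (hX _) ((norm_snd_le _).trans hyw) (norm_nonneg _) hX0).trans
          (le_mul_of_one_le_right (by positivity) hσ)
      have e1 : (pull S.map w' y).1 = χ (S.map y) • (pull S.map w y).1 + Complex.I • (ε₀⁻¹ *ᵥ
          crossProduct ((jacobian S.map y)ᵀ *ᵥ grad χ (S.map y))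
            ((jacobian S.map y)ᵀ *ᵥ (u (S.map y)).2)) := by
        simp only [pull, hw', mulVec_add, mulVec_smul]
        rw [h.pull_medium_inv hε hy, h.det_smul_inv_cross hy]
      have e2 : (pull S.map w' y).2 = χ (S.map y) • (pull S.map w y).2 - Complex.I • (μ₀⁻¹ *ᵥ
          crossProduct ((jacobian S.map y)ᵀ *ᵥ grad χ (S.map y))
            ((jacobian S.map y)ᵀ *ᵥ (u (S.map y)).1)) := by
        simp only [pull, hw', mulVec_sub, mulVec_smul]
        rw [h.pull_medium_inv hμ hy, h.det_smul_inv_cross hy]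
      have p1 : 0 ≤ E₁ * (2 * (C * Y) * M * σ) := by positivity
      have p2 : 0 ≤ E₂ * (2 * (C * Y) * M * σ) := by positivity
      have e0 : (X * M + E₁ * (2 * (C * Y) * M) + E₂ * (2 * (C * Y) * M)) * σ
          = X * M * σ + E₁ * (2 * (C * Y) * M * σ) + E₂ * (2 * (C * Y) * M * σ) := by ring
      rw [e0]
      refine norm_prod_le_iff.2 ⟨?_, ?_⟩
      · rw [e1]
        refine (norm_add_le _ _).trans ?_
        rw [norm_smul Complex.I, Complex.norm_I, one_mul]
        linarith
      · rw [e2]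
        refine (norm_sub_le _ _).trans ?_
        rw [norm_smul Complex.I, Complex.norm_I, one_mul]
        linarith
    · filter_upwards [h.ae_mem] with y hy hyR
      have e1 := image_eq_zero_of_notMem_tsupport (far y hy hyR)
      have e2 := image_eq_zero_of_notMem_tsupport fun h' => far y hy hyR (sg h')
      simp only [pull, hw', e1, e2, zero_smul, map_zero, LinearMap.zero_apply, mulVec_zero, smul_zero,
        add_zero, sub_zero]
      rfl
  · refine (hW.1.contDiff_smul h.isOpen_target hχ).congr (EventuallyEq.refl _ _) ?_
    filter_upwards [h.ae_target] with x hx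
    simp only [hw', mulVec_sub, mulVec_smul, mulVec_mulVec, h.medium_mul_inv hμ hx, one_mulVec,
      smul_sub, smul_smul, Complex.I_mul_I, neg_smul, one_smul, sub_neg_eq_add, mul_comm Complex.I]
  · refine (hW.2.contDiff_smul h.isOpen_target hχ).congr (EventuallyEq.refl _ _) ?_
    filter_upwards [h.ae_target] with x hx
    simp only [hw', mulVec_add, mulVec_smul, mulVec_mulVec, h.medium_mul_inv hε hx, one_mulVec,
      smul_add, smul_smul, neg_mul, Complex.I_mul_I, neg_neg, one_smul, mul_neg, mul_comm Complex.I]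

end IsFlattening

end CloakSystem

/-! ### Plane waves -/

lemma contDiff_phase (k : R3) :
    ContDiff ℝ 1 fun x : R3 => Complex.exp (Complex.I * (inner ℝ k x : ℝ)) := by
  have h1 : ContDiff ℝ 1 fun x : R3 => inner ℝ k x := (innerSL ℝ k).contDiff
  exact (contDiff_const.mul (Complex.ofRealCLM.contDiff.comp h1)).cexp

lemma grad_phase (k x : R3) : grad (fun x : R3 => Complex.exp (Complex.I * (inner ℝ k x : ℝ))) x
    = (Complex.I * Complex.exp (Complex.I * (inner ℝ k x : ℝ))) • fun j => (k j : ℂ) := by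
  have h1 : HasFDerivAt (fun x : R3 => inner ℝ k x) (innerSL ℝ k) x := (innerSL ℝ k).hasFDerivAt
  have h2 := ((Complex.ofRealCLM.hasFDerivAt.comp x h1).const_mul Complex.I).cexp
  funext j
  have h3 : fderiv ℝ (fun x : R3 => Complex.exp (Complex.I * (inner ℝ k x : ℝ))) x = _ := h2.fderiv
  rw [grad, pd, h3]
  simp [EuclideanSpace.inner_single_right]
  ring

lemma curl_phase_smul (k x : R3) (a : C3) :
    curl (fun x : R3 => Complex.exp (Complex.I * (inner ℝ k x : ℝ)) • a) x
      = (Complex.I * Complex.exp (Complex.I * (inner ℝ k x : ℝ))) •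
        crossProduct (fun j => (k j : ℂ)) a := by
  have h0 : curl (fun _ : R3 => a) x = 0 := by
    ext i
    fin_cases i <;> simp [curl, pd]
  rw [curl_smul (F := fun _ => a) ((contDiff_phase k).differentiable (by simp) x)
    fun i => differentiableAt_const _, h0, smul_zero, zero_add, grad_phase, map_smul,
    LinearMap.smul_apply]

lemma norm_planeWave_le (k : R3) (e h : C3) (x : R3) : ‖planeWave k e h x‖ ≤ ‖(e, h)‖ := by
  have h1 : ‖Complex.exp (Complex.I * (inner ℝ k x : ℝ))‖ = 1 := by
    rw [mul_comm]
    exact Complex.norm_exp_ofReal_mul_I _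
  have h2 : planeWave k e h x = Complex.exp (Complex.I * (inner ℝ k x : ℝ)) • (e, h) := rfl
  rw [h2, norm_smul, h1, one_mul]

lemma continuous_planeWave (k : R3) (e h : C3) : Continuous (planeWave k e h) :=
  ((contDiff_phase k).continuous.smul continuous_const).prodMk
    ((contDiff_phase k).continuous.smul continuous_const)

lemma IsPlaneWave.weakMaxwell {ε₀ μ₀ : Matrix (Fin 3) (Fin 3) ℂ} {ω : ℝ} {k : R3} {e h : C3}
    (hp : IsPlaneWave ε₀ μ₀ ω k e h) (O : Set R3) :
    WeakMaxwell O (fun _ => ε₀) (fun _ => μ₀) (planeWave k e h) ((ω : ℂ) • planeWave k e h) := by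
  constructor
  · have h1 := hasWeakCurl_of_contDiff (O := O) ((contDiff_phase k).smul (contDiff_const (c := e)))
    refine h1.congr (EventuallyEq.refl _ _)
      (Eventually.of_forall fun x => (curl_phase_smul k x e).trans ?_)
    rw [hp.faraday]
    simp only [planeWave, Pi.smul_apply, Prod.smul_snd, mulVec_smul, smul_smul]
    congr 1
    ring
  · have h1 := hasWeakCurl_of_contDiff (O := O) ((contDiff_phase k).smul (contDiff_const (c := h)))
    refine h1.congr (EventuallyEq.refl _ _)
      (Eventually.of_forall fun x => (curl_phase_smul k x h).trans ?_)
    rw [hp.ampere]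
    simp only [planeWave, Pi.smul_apply, Prod.smul_fst, mulVec_smul, smul_smul, ← neg_smul]
    congr 1
    ring

lemma IsWeakDivFree.of_smul {O : Set R3} {F : R3 → C3} {z : ℂ} (hz : z ≠ 0)
    (h : IsWeakDivFree O fun x => z • F x) : IsWeakDivFree O F := by
  have e : F = fun x => z⁻¹ • z • F x := by
    funext x
    rw [smul_smul, inv_mul_cancel₀ hz, one_smul]
  refine ⟨?_, fun ψ hψ hc hs => ?_⟩
  · rw [e]
    exact h.1.smul z⁻¹
  · have h1 := h.2 ψ hψ hc hs
    simp only [smul_dotProduct, smul_eq_mul] at h1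
    rw [integral_const_mul] at h1
    exact (mul_eq_zero.1 h1).resolve_left hz

/-- A field that vanishes far out is outgoing. -/
lemma isOutgoing_of_ae_eq_zero {ε₀ μ₀ : Matrix (Fin 3) (Fin 3) ℂ} {ω R : ℝ} {u : EMField}
    (h : ∀ᵐ x, R < ‖x‖ → u x = 0) : IsOutgoing ε₀ μ₀ ω u := by
  have h0 : HasWeakCurl Set.univ (fun _ => (0 : C3)) fun _ => (0 : C3) :=
    ⟨locallyIntegrableOn_zero, locallyIntegrableOn_zero, fun φ _ _ _ => by simp⟩
  refine ⟨0, 0, fun _ => 0, MemLp.zero, HasCompactSupport.zero, aestronglyMeasurable_zero,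
    fun η _ => ⟨MemLp.zero, ?_, ?_⟩, fun B _ => ?_, R, h⟩
  · simpa using h0
  · simpa using h0
  · simp

namespace CloakSystem

variable {N : ℕ} {S : CloakSystem N} {ε₀ μ₀ : Matrix (Fin 3) (Fin 3) ℂ}

lemma solvesMaxwell_iff {ω : ℝ} (hω : ω ≠ 0) {u : EMField} : S.SolvesMaxwell ε₀ μ₀ ω u ↔
    WeakMaxwell S.Omega (S.medium ε₀) (S.medium μ₀) u ((ω : ℂ) • u) := by
  have hz : Complex.I * ω ≠ 0 := mul_ne_zero Complex.I_ne_zero (by exact_mod_cast hω)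
  have e : WeakMaxwell S.Omega (S.medium ε₀) (S.medium μ₀) u ((ω : ℂ) • u) ↔
      HasWeakCurl S.Omega (fun x => (u x).1)
        (fun x => (Complex.I * ω) • (S.medium μ₀ x *ᵥ (u x).2)) ∧
      HasWeakCurl S.Omega (fun x => (u x).2)
        (fun x => (-(Complex.I * ω)) • (S.medium ε₀ x *ᵥ (u x).1)) := by
    simp only [WeakMaxwell, Pi.smul_apply, Prod.smul_fst, Prod.smul_snd, mulVec_smul, smul_smul,
      neg_mul]
  rw [e]
  exact ⟨fun h => ⟨h.1, h.2.1⟩, fun h => ⟨h.1, h.2, IsWeakDivFree.of_smul hz h.1.isWeakDivFree,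
    IsWeakDivFree.of_smul (neg_ne_zero.2 hz) h.2.isWeakDivFree⟩⟩

variable (S) in
lemma exists_mem_exterior : ∃ R : ℝ, ∀ x : R3, R < ‖x‖ → x ∈ S.exterior := by
  refine ⟨∑ j, (‖S.c j‖ + S.b j), fun x hx => ?_⟩
  rw [S.exterior_eq]
  intro j
  have h1 : ‖S.c j‖ + S.b j ≤ ∑ j, (‖S.c j‖ + S.b j) :=
    Finset.single_le_sum (f := fun j => ‖S.c j‖ + S.b j)
      (fun j _ => add_nonneg (norm_nonneg _) (S.b_pos j).le) (Finset.mem_univ j)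
  linarith [norm_sub_norm_le x (S.c j)]

lemma isOpen_exterior : IsOpen S.exterior := by
  rw [S.exterior_eq]
  exact isOpen_outside _ _

namespace IsFlattening

variable {Ψ : R3 → R3} {U₀ U : Set R3}

lemma map_eq (h : S.IsFlattening Ψ U₀ U) {x : R3} (hx : x ∈ S.exterior) : S.map x = x := by
  have h1 := h.right_inv x (h.target_subset (h.exterior_subset hx))
  rwa [h.inv_eq x hx] at h1

lemma pull_map_eq (h : S.IsFlattening Ψ U₀ U) (u : EMField) {x : R3} (hx : x ∈ S.exterior) :
    pull S.map u x = u x := by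
  have h1 : jacobian S.map x = 1 := jacobian_eq_one (by
    filter_upwards [isOpen_exterior.mem_nhds hx] with z hz using h.map_eq hz)
  simp only [pull, h1, transpose_one, one_mulVec, h.map_eq hx]

lemma pull_inv_eq (h : S.IsFlattening Ψ U₀ U) (u : EMField) {x : R3} (hx : x ∈ S.exterior) :
    pull Ψ u x = u x := by
  have h1 : jacobian Ψ x = 1 := jacobian_eq_one (by
    filter_upwards [isOpen_exterior.mem_nhds hx] with z hz using h.inv_eq z hz)
  simp only [pull, h1, transpose_one, one_mulVec, h.inv_eq x hx]

/-- The pull-back of an incident plane wave by the inverse transformation is a solution. -/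
lemma isLocallyFiniteEnergySolution (h : S.IsFlattening Ψ U₀ U) (hε : ε₀.PosDef) (hμ : μ₀.PosDef)
    {ω : ℝ} {k : R3} {e m : C3} (hp : IsPlaneWave ε₀ μ₀ ω k e m) :
    S.IsLocallyFiniteEnergySolution ε₀ μ₀ (S.adjointGraph ε₀ μ₀ (S.maxwellGraph ε₀ μ₀)) ω
      (pull Ψ (planeWave k e m)) := by
  set v := planeWave k e m with hv
  have ae : ∀ᵐ y, pull S.map (pull Ψ v) y = v y := h.ae_mem.mono fun y hy => h.pull_pull v hy
  have ae' : ∀ᵐ y, pull S.map ((ω : ℂ) • pull Ψ v) y = ((ω : ℂ) • v) y := by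
    filter_upwards [ae] with y hy
    rw [pull_smul, Pi.smul_apply, hy, Pi.smul_apply]
  have hW : WeakMaxwell S.Omega (S.medium ε₀) (S.medium μ₀) (pull Ψ v) ((ω : ℂ) • pull Ψ v) :=
    h.weakMaxwell_of_pull ((hp.weakMaxwell S.Omega0).congr
      (ae_restrict_of_ae (ae.mono fun y hy => hy.symm))
      (ae_restrict_of_ae (ae'.mono fun y hy => hy.symm)))
  have mu := h.aestronglyMeasurable_pull_inv (continuous_planeWave k e m).aestronglyMeasurable
  refine ⟨(solvesMaxwell_iff hp.frequency_ne_zero).2 hW, fun O hO hb => ?_, fun χ hχ hc => ?_⟩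
  · exact h.finiteEnergyOn_pull hε hμ (l2Loc_of_continuous (continuous_planeWave k e m)) hO hb
  · refine h.exists_smul_mem hε hμ hW mu (mu.const_smul (ω : ℂ)) (M := max 1 |ω| * ‖(e, m)‖) ?_ ?_
      hχ hc
    · filter_upwards [ae] with y hy
      rw [hy]
      exact (norm_planeWave_le k e m y).trans
        (le_mul_of_one_le_left (norm_nonneg _) (le_max_left _ _))
    · filter_upwards [ae'] with y hy
      rw [hy, Pi.smul_apply, norm_smul, Complex.norm_real]
      exact mul_le_mul (le_max_right _ _) (norm_planeWave_le k e m y) (norm_nonneg _)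
        (zero_le_one.trans (le_max_left _ _))

/-- The difference of the pull-back of a solution and of the plane wave solves the equations of the
background in the whole space. -/
lemma weakMaxwell_pull_sub (h : S.IsFlattening Ψ U₀ U) (hε : ε₀.PosDef) (hμ : μ₀.PosDef)
    {ω : ℝ} {k : R3} {e m : C3} (hp : IsPlaneWave ε₀ μ₀ ω k e m) {A : Set (EMField × EMField)}
    {u : EMField} (hu : S.IsLocallyFiniteEnergySolution ε₀ μ₀ A ω u) :
    L2Loc (pull S.map u - planeWave k e m) ∧
      WeakMaxwell Set.univ (fun _ => ε₀) (fun _ => μ₀) (pull S.map u - planeWave k e m)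
        ((ω : ℂ) • (pull S.map u - planeWave k e m)) := by
  have l1 := h.l2Loc_pull hε hμ hu.finite_energy
  have l2 : L2Loc (pull S.map ((ω : ℂ) • u)) := by
    rw [pull_smul]
    exact fun R => (l1 R).const_smul _
  have h1 := h.weakMaxwell_pull_univ ((solvesMaxwell_iff hp.frequency_ne_zero).1 hu.solves) l1 l2
  refine ⟨fun R => (l1 R).sub (l2Loc_of_continuous (continuous_planeWave k e m) R), ?_⟩
  rw [smul_sub, ← pull_smul]
  exact h1.sub (hp.weakMaxwell _)

lemma ae_eq_of_ae_eq_zero (h : S.IsFlattening Ψ U₀ U) {u v : EMField}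
    (huv : ∀ᵐ y, (pull S.map u - v) y = 0) : u =ᵐ[volume.restrict S.Omega] pull Ψ v :=
  h.ae_eq_of_pull (huv.mono fun _ hy => sub_eq_zero.1 hy)

end IsFlattening

end CloakSystem

end Cloak

end

theorem theorem3p1 {N : ℕ} (S : Cloak.CloakSystem N) (ε₀ μ₀ : Matrix (Fin 3) (Fin 3) ℂ)
    (hε : ε₀.PosDef) (hμ : μ₀.PosDef) :
    ∃ A : Set (Cloak.EMField × Cloak.EMField),
      (S.IsSelfAdjointExtension ε₀ μ₀ A ∧
        ∀ A' : Set (Cloak.EMField × Cloak.EMField),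
          S.IsSelfAdjointExtension ε₀ μ₀ A' → A' = A) ∧
      ∀ (ω : ℝ) (k : Cloak.R3) (e h : Cloak.C3), Cloak.IsPlaneWave ε₀ μ₀ ω k e h →
        ∃ u : Cloak.EMField,
          S.IsLocallyFiniteEnergySolution ε₀ μ₀ A ω u ∧
          (∀ x ∈ S.exterior, u x = Cloak.planeWave k e h x) ∧
          Cloak.IsOutgoing ε₀ μ₀ ω (u - Cloak.planeWave k e h) ∧
          (∀ u' : Cloak.EMField, S.IsLocallyFiniteEnergySolution ε₀ μ₀ A ω u' →
            Cloak.IsOutgoing ε₀ μ₀ ω (u' - Cloak.planeWave k e h) →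
            u' =ᵐ[volume.restrict S.Omega] u) ∧
          (∀ ε μ : ℝ, 0 < ε → 0 < μ →
            ε₀ = Matrix.diagonal (fun _ => (ε : ℂ)) → μ₀ = Matrix.diagonal (fun _ => (μ : ℂ)) →
            ∀ u' : Cloak.EMField, S.IsLocallyFiniteEnergySolution ε₀ μ₀ A ω u' →
              Cloak.SilverMuller ε μ (u' - Cloak.planeWave k e h) →
              u' =ᵐ[volume.restrict S.Omega] u) := by
  obtain ⟨Ψ, U₀, U, hΨ⟩ := S.exists_isFlattening
  refine ⟨_, hΨ.isSelfAdjointExtension hε hμ, fun ω k e h hp => ?_⟩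
  obtain ⟨R, hR⟩ := S.exists_mem_exterior
  have far : ∀ u' : Cloak.EMField, ∀ᵐ x, R < ‖x‖ →
      (Cloak.pull S.map u' - Cloak.planeWave k e h) x = (u' - Cloak.planeWave k e h) x :=
    fun u' => Eventually.of_forall fun x hx => by
      rw [Pi.sub_apply, Pi.sub_apply, hΨ.pull_map_eq u' (hR x hx)]
  refine ⟨Cloak.pull Ψ (Cloak.planeWave k e h), hΨ.isLocallyFiniteEnergySolution hε hμ hp,
    fun x hx => hΨ.pull_inv_eq _ hx, ?_, fun u' hu' ho => ?_, fun ε μ hε' hμ' eε eμ u' hu' hs => ?_⟩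
  · refine Cloak.isOutgoing_of_ae_eq_zero (R := R) (Eventually.of_forall fun x hx => ?_)
    rw [Pi.sub_apply, hΨ.pull_inv_eq _ (hR x hx), sub_self]
  · obtain ⟨ld, hd⟩ := hΨ.weakMaxwell_pull_sub hε hμ hp hu'
    exact hΨ.ae_eq_of_ae_eq_zero (Cloak.ae_eq_zero_of_memLp hε hμ hp.frequency_ne_zero
      (Cloak.memLp_two_of_isOutgoing hε hμ ld hd ho (far u')) hd)
  · obtain ⟨ld, hd⟩ := hΨ.weakMaxwell_pull_sub hε hμ hp hu'
    rw [eε, eμ] at hd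
    exact hΨ.ae_eq_of_ae_eq_zero (Cloak.ae_eq_zero_of_silverMuller hε' hμ' hp.frequency_ne_zero
      ld hd hs (far u'))
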